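/- **Calculus.** Consider the process calculus CQP with terms $$P ::= \mathbf 0 \mid P\parallel P \mid P+P \mid c?[\tilde x:\tilde T].P \mid c![\tilde e].P \mid \{e\}.P \mid \{s{:}\mathsf{NS},t{:}\mathsf{NS}\mathbin{*{=}}\mathsf{PS}(q)\}.P \mid (\mathsf{qbit}\,x)P \mid (\mathsf{ns}\,x)P \mid (\mathsf{new}\,\tilde c)P,$$ where expressions $e$ are built from values (numbers, qubit names, number state names, variables), measurements $\mathsf{measure}\,\tilde x$, unitary operations $\tilde x\mathbin{*{=}}U$, data operations ($+$, $=$, $\wedge$) and conditionals. A number state is an optical mode with basis $|0\rangle,|1\rangle,|2\rangle,\dots$ A *mixed configuration* $\bigoplus_i g_i(\tilde x:\tilde T;\sigma_i;\omega;\lambda\tilde z\bullet P;\tilde v_i)$ consists of the names $\tilde x$ of the qubits and modes in use, the names $\omega$ among them owned by the process, a term $P$ with abstracted variables $\tilde z$, and components with weights $g_i$ (of sum $1$), pure states $\sigma_i$ of the systems $\tilde x$, and classical values $\tilde v_i$ for $\tilde z$. It is pure if it has one component and $\tilde z$ is empty. A *probabilistic configuration* $\boxplus_j\, p_j t_j$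 is a distribution on mixed configurations, with transitions $\boxplus_j\, p_jt_j \leadsto_{p_j} t_j$. A mixed configuration has the following transitions. * $\xrightarrow{\tau}$: a communication on a common channel between parallel components (possibly of component-dependent classical values and of quantum names); creation of a fresh qubit in the state $|0\rangle$ or of a fresh mode in the vacuum, which is then owned; $\mathsf{PS}(q)$, which replaces an owned qubit by two fresh owned modes by $|0\rangle\mapsto|10\rangle$, $|1\rangle\mapsto|01\rangle$; removal of an evaluated action $\{e\}$; one step of the evaluation of the leftmost unevaluated expression of an output or action prefix. A step applies a unitary, or performs a data operation, or performs a measurement in the standard basis, which splits each component according to the outcomes and multiplies its weight by their probabilities. Modes yield their photon numbers, and a list of qubits yields the number with these binary digits. If the condition of a conditional differs between components, each branch is evaluated in the components which select it. * $\xrightarrow{c?[\tilde v]}$: reception, from the environment, of values of the right types. Received qubits and modes pass from the environment to the process. * $\xrightarrow{c![V,\tilde r]}$: an output. The result is the probabilistic configuration $\boxplus_{w\in V}p_wt_w$, where $V$ is the set of tuples $w$ of numbers sent with positive probability $p_w$, $t_w$ is the normalised mixture of the components which send $w$, and the quantum names $\tilde r$ pass to the environment. Transitions are closed under parallel composition,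 sum, and restriction (when the action is not on a restricted channel). Write $\Rightarrow$ for zero or more $\xrightarrow{\tau}$, and $\rho_E(t)$ for the reduced density matrix of the systems in $\tilde x\setminus\omega$, averaged over the components. An equivalence relation $\mathcal R$ on configurations is a *probabilistic branching bisimulation* if $(t,u)\in\mathcal R$ implies: 1. if $t\xrightarrow{\tau}t'$, then $u\Rightarrow u'$ and ($u'\xrightarrow{\tau}u''$ or $u'=u''$) for some $u',u''$ with $(t,u'),(t',u'')\in\mathcal R$; 2. if $t\xrightarrow{c![V,\tilde r]}\boxplus_{w\in V}p_wt_w$, then $u\Rightarrow u'\xrightarrow{c![V,\tilde r']}\boxplus_{w\in V}p_wu_w$ for some $u',\tilde r',u_w$ with $(t,u')\in\mathcal R$ and, for all $w\in V$, $\rho_E(t_w)=\rho_E(u_w)$ and $(t_w,u_w)\in\mathcal R$; 3. if $t\xrightarrow{c?[\tilde v]}t'$, then $u\Rightarrow u'\xrightarrow{c?[\tilde v]}u''$ for some $u',u''$ with $(t,u'),(t',u'')\in\mathcal R$; 4. if $t$ is probabilistic, then $\mu(t,D)=\mu(u,D)$ for every class $D$ of $\mathcal R$, where $\mu(\boxplus_jp_jt_j,D)=\sum_{t_j\in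 D}p_j$, and for a mixed $u$, $\mu(u,D)$ is $1$ or $0$ as $u\in D$ or not. Processes $P,Q$ are *full probabilistic branching bisimilar*, $P\simeq^cQ$, if for every substitution $\kappa$ (of channels for free channels and of closed values for free variables), all finite lists $\tilde x$ of systems, all $\omega\subseteq\tilde x$ and all pure states $\sigma$ of $\tilde x$, the pure configurations $(\tilde x:\tilde T;\sigma;\omega;P\kappa)$ and $(\tilde x:\tilde T;\sigma;\omega;Q\kappa)$ are related by some probabilistic branching bisimulation. **Unitaries.** With $\cos\theta=\sqrt\eta$ and $\sin\theta=\sqrt{1-\eta}$, the beam splitter of reflectivity $\eta$ is $$B_\eta|m,n\rangle=\tfrac1{\sqrt{m!\,n!}}(a^\dagger\cos\theta+b^\dagger\sin\theta)^m(a^\dagger\sin\theta-b^\dagger\cos\theta)^n|0,0\rangle .$$ On dual rail qubits ($|10\rangle$ is logical $0$, $|01\rangle$ is logical $1$), $\mathsf H$ is the Hadamard gate and $\mathsf{CZ}$ the controlled $Z$ gate, both extended by the identity to the orthogonal complement. $U_{1/9}$ is the real rotation of a qubit with $U_{1/9}|0\rangle=\frac{\sqrt8}3|0\rangle+\frac13|1\rangle$.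 **Model.** Let $$\begin{aligned} \mathit{PolSe}(a,c,d)&=a?[q_0{:}\mathsf{Qbit}].\{s_0{:}\mathsf{NS},s_1{:}\mathsf{NS}\mathbin{*{=}}\mathsf{PS}(q_0)\}.c![s_0].d![s_1].\mathbf 0,\\ \mathit{PolSe}_{CT}&=\mathit{PolSe}(a,c,d)\parallel\mathit{PolSe}(b,e,f),\\ \mathit{BS}(e,f,h,i,\eta)&=e?[s_2{:}\mathsf{NS}].f?[s_3{:}\mathsf{NS}].\{s_2,s_3\mathbin{*{=}}B_\eta\}.h![s_2].i![s_3].\mathbf 0,\\ \mathit{Det}(l,m,u)&=l?[s_0{:}\mathsf{NS}].m?[s_1{:}\mathsf{NS}].u![\mathsf{measure}\,s_0,s_1].\mathbf 0,\\ \mathit{CNOT}&=(\mathsf{new}\,g,h,m,o,i,j,n,p)(\mathsf{ns}\,y,z)\big(\mathit{BS}(e,f,g,h,\tfrac12)\parallel i![y].\mathbf 0\parallel\mathit{BS}(c,i,k,j,\tfrac13)\parallel j?[y{:}\mathsf{NS}].\mathbf 0\\ &\quad\parallel\mathit{BS}(g,d,m,l,\tfrac13)\parallel n![z].\mathbf 0\parallel\mathit{BS}(h,n,o,p,\tfrac13)\parallel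 p?[z{:}\mathsf{NS}].\mathbf 0\parallel\mathit{BS}(m,o,q,r,\tfrac12)\big),\\ \mathit{Counter}&=u?[c_0,c_1{:}\mathsf{Int}].v?[t_0,t_1{:}\mathsf{Int}].out_1![\text{if }K\text{ then }c_1\text{ else }0].\\ &\quad out_2![\text{if }K\text{ then }t_1\text{ else }0].cnt![\text{if }K\text{ then }1\text{ else }0].\mathbf 0,\qquad K:\ c_0+c_1=1\wedge t_0+t_1=1,\\ \mathit{MMT}&=(\mathsf{new}\,u,v)(\mathit{Det}(k,l,u)\parallel\mathit{Det}(q,r,v)\parallel\mathit{Counter}),\\ \mathit{Model}_1&=(\mathsf{new}\,c,d,e,f,g,h,m,l,k,o,q,r,u,v)(\mathit{PolSe}_{CT}\parallel\mathit{CNOT}\parallel\mathit{MMT}). \end{aligned}$$ **Specification.** Let $$\begin{aligned} \mathit{OP}&=(\mathsf{qbit}\,q_2).c?[s_0{:}\mathsf{NS}].d?[s_1{:}\mathsf{NS}].e?[s_2{:}\mathsf{NS}].f?[s_3{:}\mathsf{NS}].\{s_2,s_3\mathbin{*{=}}\mathsf H\}.\{q_2\mathbin{*{=}}U_{1/9}\}.\\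 &\quad\{(s_0,s_1),(s_2,s_3)\mathbin{*{=}}\mathsf{CZ}\}.\{s_2,s_3\mathbin{*{=}}\mathsf H\}.h![s_0].i![s_1].j![s_2].k![s_3].g![\mathsf{measure}\,q_2].\mathbf 0,\\ \mathit{Output}&=h?[s_0{:}\mathsf{NS}].i?[s_1{:}\mathsf{NS}].j?[s_2{:}\mathsf{NS}].k?[s_3{:}\mathsf{NS}].g?[x{:}\mathsf{Bit}].out_1![\text{if }x=1\text{ then }\mathsf{measure}\,s_1\text{ else }0].\\ &\quad out_2![\text{if }x=1\text{ then }\mathsf{measure}\,s_3\text{ else }0].cnt![x].\mathbf 0,\\ \mathit{Specification}_1&=(\mathsf{new}\,c,d,e,f,g,h,i,j,k)(\mathit{PolSe}_{CT}\parallel\mathit{OP}\parallel\mathit{Output}). \end{aligned}$$ **Proposition.** For all public channels $a,b,out_1,cnt,out_2$, $$\mathit{Model}_1(a,b,out_1,cnt,out_2)\ \simeq^c\ \mathit{Specification}_1(a,b,out_1,cnt,out_2).$$ -/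

import Mathlib

/-!  The process calculus CQP (Communicating Quantum Processes) with qubits and optical number
states, its labelled transition semantics on mixed and probabilistic configurations, full
probabilistic branching bisimilarity, and the optical CNOT model with its specification. -/

namespace CQP

/-! ### Quantum names and quantum states -/

/-- Names of quantum systems: countably many qubit names and countably many number state names
(optical modes). -/
inductive QName
  | qb (n : ℕ)
  | ns (n : ℕ)
  deriving DecidableEq

/-- The name is a number state name. -/
def QName.IsNS : QName → Prop
  | .ns _ => True
  | .qb _ => False

/-- The name is a qubit name. -/
def QName.IsQb : QName → Prop
  | .qb _ => True
  | .ns _ => False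

/-- Standard basis states: an occupation number for each mode and a bit for each qubit. Names
outside the finite list of names of a configuration have the value `0`. -/
abbrev Basis := QName →₀ ℕ

/-- (Amplitudes of) pure quantum states. A system whose name is not in use is in the state `0`
(`|0⟩` or the vacuum), so that no factor has to be added when a fresh qubit or mode is created. -/
abbrev State := Basis → ℂ

/-- `ψ` is a (normalised) state of the systems with names in `X`. -/
def IsState (X : Finset QName) (ψ : State) : Prop :=
  HasSum (fun f => ‖ψ f‖ ^ 2) 1 ∧
    ∀ f, ψ f ≠ 0 → f.support ⊆ X ∧ ∀ n, f (.qb n) ≤ 1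

/-! ### Unitary operations -/

/-- The amplitude `⟨k,l| B |m,n⟩` of a non-polarising beam splitter of reflectivity
`η = cos² θ` (with relative phase `0`), which sends
`|m,n⟩` to `(m! n!)^(-1/2) (a† cos θ + b† sin θ)^m (a† sin θ - b† cos θ)^n |0,0⟩`.
The product is homogeneous of degree `m + n`, so that the coefficient of `(a†)^k (b†)^l` is read
off from the polynomial with `b†` set to `1`; and `(a†)^k (b†)^l |0,0⟩ = (k! l!)^(1/2) |k,l⟩`. -/
noncomputable def bsAmp (η : ℝ) (i o : ℕ × ℕ) : ℂ :=
  open Polynomial in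
  if o.1 + o.2 = i.1 + i.2 then
    ((√((o.1.factorial * o.2.factorial : ℕ) : ℝ) / √((i.1.factorial * i.2.factorial : ℕ) : ℝ) *
      ((C √η * X + C √(1 - η)) ^ i.1 * (C √(1 - η) * X - C √η) ^ i.2 : ℝ[X]).coeff o.1 : ℝ) : ℂ)
  else 0

/-- The amplitude `⟨k,l| H |m,n⟩` of the dual rail Hadamard gate, with `|1,0⟩` for the logical `0`
and `|0,1⟩` for the logical `1`; it is the identity on the orthogonal complement of these. -/
noncomputable def hadAmp (i o : ℕ × ℕ) : ℂ :=
  if i.1 + i.2 = 1 then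
    if o.1 + o.2 = 1 then (if i.2 = 1 ∧ o.2 = 1 then -1 else 1) / (√2 : ℝ) else 0
  else if i = o then 1 else 0

/-- The action on the modes `s, t` of the operator with matrix `A` (input first) that preserves
the number of photons. -/
noncomputable def pairAct (A : ℕ × ℕ → ℕ × ℕ → ℂ) (s t : QName) (ψ : State) : State := fun f =>
  ∑ i ∈ Finset.HasAntidiagonal.antidiagonal (f s + f t), A i (f s, f t) * ψ ((f.update s i.1).update t i.2)

/-- The dual rail controlled Z gate with control pair `s₀, s₁` and target pair `s₂, s₃`: a sign
on logical `11`, that is, on `|0,1⟩|0,1⟩`. -/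
noncomputable def czAct (s₀ s₁ s₂ s₃ : QName) (ψ : State) : State := fun f =>
  (if f s₀ = 0 ∧ f s₁ = 1 ∧ f s₂ = 0 ∧ f s₃ = 1 then -1 else 1) * ψ f

/-- The action of a `2 × 2` matrix on a qubit. -/
noncomputable def qubitAct (U : Matrix (Fin 2) (Fin 2) ℂ) (q : QName) (ψ : State) : State :=
  fun f => if h : f q < 2 then ∑ b : Fin 2, U ⟨f q, h⟩ b * ψ (f.update q b.val) else 0

/-- The operator `PS` turning the polarisation qubit `q` into a dual rail qubit on the fresh modes
`s, t`: `|0⟩ ↦ |1,0⟩` and `|1⟩ ↦ |0,1⟩`. The qubit `q` disappears. -/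
noncomputable def psAct (q s t : QName) (ψ : State) : State := fun f =>
  if f q = 0 ∧ f s = 1 ∧ f t = 0 then ψ ((f.update s 0).update t 0)
  else if f q = 0 ∧ f s = 0 ∧ f t = 1 then ψ (((f.update s 0).update t 0).update q 1)
  else 0

/-- Unitary operators of the language: beam splitters, the Hadamard and controlled Z operators on
number states, and the one-qubit unitaries. -/
inductive Gate
  | bs (η : ℝ)
  | had
  | cz
  | qubit (U : Matrix.unitaryGroup (Fin 2) ℂ)

/-- The operator can be applied to the systems `xs`: the number and the types are right, and no
system occurs twice. -/
def Gate.Fits : Gate → List QName → Prop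
  | .bs _, xs => xs.length = 2 ∧ xs.Nodup ∧ ∀ x ∈ xs, x.IsNS
  | .had, xs => xs.length = 2 ∧ xs.Nodup ∧ ∀ x ∈ xs, x.IsNS
  | .cz, xs => xs.length = 4 ∧ xs.Nodup ∧ ∀ x ∈ xs, x.IsNS
  | .qubit _, xs => xs.length = 1 ∧ ∀ x ∈ xs, x.IsQb

/-- The action of an operator on the global state; only used for lists that fit. -/
noncomputable def Gate.act : Gate → List QName → State → State
  | .bs η, [s, t], ψ => pairAct (bsAmp η) s t ψ
  | .had, [s, t], ψ => pairAct hadAmp s t ψ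
  | .cz, [s₀, s₁, s₂, s₃], ψ => czAct s₀ s₁ s₂ s₃ ψ
  | .qubit U, [q], ψ => qubitAct U.1 q ψ
  | _, _, ψ => ψ

/-! ### Measurements -/

/-- The result of measuring the modes `xs` in a basis state: the photon numbers. -/
def obsNS (xs : List QName) (f : Basis) : List ℤ := xs.map fun x => (f x : ℤ)

/-- The result of measuring the qubits `xs` in a basis state: the number with binary digits `xs`. -/
def obsQb (xs : List QName) (f : Basis) : List ℤ :=
  [xs.foldl (fun m x => 2 * m + (f x : ℤ)) 0]

/-- The probability of the outcome `o`. -/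
noncomputable def measProb (obs : Basis → List ℤ) (ψ : State) (o : List ℤ) : ℝ :=
  ∑' f, if obs f = o then ‖ψ f‖ ^ 2 else 0

/-- The normalised state after the outcome `o` (zero if `o` has probability zero). -/
noncomputable def collapse (obs : Basis → List ℤ) (ψ : State) (o : List ℤ) : State := fun f =>
  if obs f = o then ψ f / (√(measProb obs ψ o) : ℝ) else 0

/-! ### Syntax -/

/-- Types of received data. -/
inductive Ty
  | int
  | bit
  | qbit
  | ns

/-- Values. `slot k` is the `k`-th of the variables `z` abstracted in the term `λ z • P` of a
mixed configuration; it stands for a classical value which depends on the component.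
`var` is a variable of the source language. -/
inductive Val
  | int (n : ℤ)
  | slot (k : ℕ)
  | name (x : QName)
  | var (x : ℕ)

/-- The value is a classical one. -/
def Val.isClassical : Val → Bool
  | .int _ => true
  | .slot _ => true
  | _ => false

/-- Values the environment can send: numbers and quantum names. -/
def Val.IsClosed : Val → Prop
  | .int _ => True
  | .name _ => True
  | _ => False

/-- The number denoted by a classical value in the component with the values `v`. -/
def Val.at : Val → List ℤ → ℤ
  | .int n, _ => n
  | .slot k, v => v.getD k 0
  | _, _ => 0

/-- The value may be received at the given type. -/
def Val.HasTy : Val → Ty → Prop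
  | .int _, .int => True
  | .int n, .bit => n = 0 ∨ n = 1
  | .slot _, .int => True
  | .slot _, .bit => True
  | .name x, .qbit => x.IsQb
  | .name x, .ns => x.IsNS
  | _, _ => False

/-- The quantum names among a list of values. -/
def namesOf (vs : List Val) : List QName :=
  vs.filterMap fun
    | .name x => some x
    | _ => none

/-- The tuple of classical values among a list of values, in the component with values `v`. -/
def numbersOf (vs : List Val) (v : List ℤ) : List ℤ :=
  (vs.filter Val.isClassical).map fun a => a.at v

/-- Operations on data. Truth values are the bits `0` and `1`. -/
inductive DataOp
  | add
  | eq
  | and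

def DataOp.eval : DataOp → ℤ → ℤ → ℤ
  | .add, m, n => m + n
  | .eq, m, n => if m = n then 1 else 0
  | .and, m, n => if m ≠ 0 ∧ n ≠ 0 then 1 else 0

/-- Expressions. `vals vs` is a tuple of values (the empty tuple is `unit`), `apply xs U` is
`xs *= U`. -/
inductive Expr
  | vals (vs : List Val)
  | measure (xs : List Val)
  | apply (xs : List Val) (U : Gate)
  | op (o : DataOp) (e e' : Expr)
  | ite (b e e' : Expr)

/-- Channels: public channel names, which are free in a term and subject to substitution, and
private channel names, which are the ones that can be restricted. -/
inductive Chan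
  | pub (n : ℕ)
  | priv (n : ℕ)
  deriving DecidableEq

instance : Coe ℕ Chan := ⟨Chan.priv⟩

/-- Terms of the calculus:
`0`, `P ∥ Q`, `P + Q`, `c?[x:T].P`, `c![e].P`, `{e}.P`, `{s:NS, t:NS *= PS(q)}.P`, `(qbit x)P`,
`(ns x)P` and `(new c)P` (for several channels `c`). -/
inductive Proc
  | nil
  | par (P Q : Proc)
  | sum (P Q : Proc)
  | inp (c : Chan) (xs : List (ℕ × Ty)) (P : Proc)
  | out (c : Chan) (es : List Expr) (P : Proc)
  | act (e : Expr) (P : Proc)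
  | ps (s t : ℕ) (q : Val) (P : Proc)
  | qbit (x : ℕ) (P : Proc)
  | ns (x : ℕ) (P : Proc)
  | new (cs : List ℕ) (P : Proc)

/-! ### Substitution -/

def Val.subst (σ : ℕ → Val) : Val → Val
  | .var x => σ x
  | v => v

def Expr.subst (σ : ℕ → Val) : Expr → Expr
  | .vals vs => .vals (vs.map (Val.subst σ))
  | .measure xs => .measure (xs.map (Val.subst σ))
  | .apply xs U => .apply (xs.map (Val.subst σ)) U
  | .op o e e' => .op o (e.subst σ) (e'.subst σ)
  | .ite b e e' => .ite (b.subst σ) (e.subst σ) (e'.subst σ)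

/-- The substitution `σ` with the variables `xs` left alone. -/
def hide (xs : List ℕ) (σ : ℕ → Val) : ℕ → Val := fun x => if x ∈ xs then .var x else σ x

/-- Substitution of values for the free variables. It is only used for values that are not
variables themselves (apart from `x ↦ x`), so that nothing can be captured. -/
def Proc.subst : Proc → (ℕ → Val) → Proc
  | .nil, _ => .nil
  | .par P Q, σ => .par (P.subst σ) (Q.subst σ)
  | .sum P Q, σ => .sum (P.subst σ) (Q.subst σ)
  | .inp c xs P, σ => .inp c xs (P.subst (hide (xs.map Prod.fst) σ))
  | .out c es P, σ => .out c (es.map (Expr.subst σ)) (P.subst σ)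
  | .act e P, σ => .act (e.subst σ) (P.subst σ)
  | .ps s t q P, σ => .ps s t (q.subst σ) (P.subst (hide [s, t] σ))
  | .qbit x P, σ => .qbit x (P.subst (hide [x] σ))
  | .ns x P, σ => .ns x (P.subst (hide [x] σ))
  | .new cs P, σ => .new cs (P.subst σ)

/-- The substitution of the values `vs` for the variables `xs`. -/
def bind (xs : List ℕ) (vs : List Val) : ℕ → Val := fun x =>
  ((xs.zip vs).lookup x).getD (.var x)

/-- Substitution of public channels for public channels. Restriction only binds private ones, so
that nothing can be captured. -/
def Chan.rename (κ : ℕ → ℕ) : Chan → Chan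
  | .pub n => .pub (κ n)
  | .priv n => .priv n

def Proc.rename (κ : ℕ → ℕ) : Proc → Proc
  | .nil => .nil
  | .par P Q => .par (P.rename κ) (Q.rename κ)
  | .sum P Q => .sum (P.rename κ) (Q.rename κ)
  | .inp c xs P => .inp (c.rename κ) xs (P.rename κ)
  | .out c es P => .out (c.rename κ) es (P.rename κ)
  | .act e P => .act e (P.rename κ)
  | .ps s t q P => .ps s t q (P.rename κ)
  | .qbit x P => .qbit x (P.rename κ)
  | .ns x P => .ns x (P.rename κ)
  | .new cs P => .new cs (P.rename κ)

/-! ### Configurations -/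

/-- All of a mixed configuration `⊕ᵢ gᵢ (x:T; σᵢ; ω; λ z • P; vᵢ)` but the term `P`. The
components differ in the classical values `vᵢ` and are indexed by them: `wt v` is the weight and
`st v` the quantum state of the component with the values `v`, a list of length `width`
(components of weight zero count as absent). The names `x` are those in `own`, which is the list
`ω` of names owned by the process, and those in `env`, the list of names of the environment. -/
structure Store where
  own : Finset QName
  env : List QName
  width : ℕ
  wt : List ℤ → ℝ
  st : List ℤ → State

/-- The configuration has one component only, in the state `ψ`, and no abstracted variables. -/
def Store.pure (own : Finset QName) (env : List QName) (ψ : State) : Store where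
  own := own
  env := env
  width := 0
  wt := fun v => if v = [] then 1 else 0
  st := fun _ => ψ

/-- Each component `v` is replaced by components `v ++ o` with relative weight `(h v o).1` and
state `(h v o).2`, where `o` ranges over lists of length `r`. -/
def Store.branch (S : Store) (r : ℕ) (h : List ℤ → List ℤ → ℝ × State) : Store where
  own := S.own
  env := S.env
  width := S.width + r
  wt := fun w => S.wt (w.take S.width) * (h (w.take S.width) (w.drop S.width)).1
  st := fun w => (h (w.take S.width) (w.drop S.width)).2

/-- Each component `v` gets the additional values `a v`, a list of length `r`. -/
def Store.push (S : Store) (r : ℕ) (a : List ℤ → List ℤ) : Store :=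
  S.branch r fun v o => (if o = a v then 1 else 0, S.st v)

/-- The components which satisfy `G` are measured, with `r` numbers as the result; the others get
`r` numbers `0`. -/
noncomputable def Store.measure (S : Store) (G : List ℤ → Bool) (r : ℕ)
    (obs : Basis → List ℤ) : Store :=
  S.branch r fun v o =>
    if G v then (measProb obs (S.st v) o, collapse obs (S.st v) o)
    else (if o = List.replicate r 0 then 1 else 0, S.st v)

/-- An operator is applied to the components which satisfy `G`. -/
def Store.transform (S : Store) (G : List ℤ → Bool) (U : State → State) : Store :=
  { S with st := fun v => if G v then U (S.st v) else S.st v }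

/-- The next `r` abstracted variables. -/
def Store.newSlots (S : Store) (r : ℕ) : List Val :=
  (List.range r).map fun i => .slot (S.width + i)

/-- The basis state in which the `k`-th name of the list has the value given by the `k`-th
number, and all other names have the value `0`. -/
noncomputable def place (env : List QName) (a : List ℕ) : Basis :=
  (List.zipWith Finsupp.single env a).sum

/-- The reduced density matrix of the environment: entries are indexed by pairs of basis states
of the systems listed in `env`, and all systems not in `env` are traced out. -/
noncomputable def Store.rhoE (S : Store) (a b : List ℕ) : ℂ :=
  if a.length = S.env.length ∧ b.length = S.env.length then
    ∑' v, (S.wt v : ℂ) * ∑' f : Basis,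
      if ∀ x ∈ S.env, f x = 0 then
        S.st v (f + place S.env a) * (starRingEnd ℂ) (S.st v (f + place S.env b))
      else 0
  else 0

/-- Configurations: mixed ones (`mix`; the pure ones are special cases), from which there are
nondeterministic transitions, and probabilistic ones `⊞ⱼ pⱼ tⱼ`, in which `j` ranges over the
tuples of numbers with `pⱼ > 0`. -/
inductive Config
  | mix (S : Store) (P : Proc)
  | prob (p : List ℤ → ℝ) (S : List ℤ → Store) (P : Proc)

/-! ### Transitions -/

/-- Evaluation steps of expressions in a mixed configuration. Only the components that satisfy
`G` take part in measurements and unitary operations: in a conditional whose condition has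
different values in different components, each branch is evaluated in those components that
select it. -/
inductive EStep : (List ℤ → Bool) → Store → Expr → Store → Expr → Prop
  | measureNS {G S} (xs : List QName) : xs ≠ [] → xs.Nodup → (∀ x ∈ xs, x.IsNS) →
      EStep G S (.measure (xs.map .name))
        (S.measure G xs.length (obsNS xs)) (.vals (S.newSlots xs.length))
  | measureQb {G S} (xs : List QName) : xs ≠ [] → xs.Nodup → (∀ x ∈ xs, x.IsQb) →
      EStep G S (.measure (xs.map .name)) (S.measure G 1 (obsQb xs)) (.vals (S.newSlots 1))
  | apply {G S} (xs : List QName) (U : Gate) : U.Fits xs →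
      EStep G S (.apply (xs.map .name) U) (S.transform G (U.act xs)) (.vals [])
  | op {G S} (o : DataOp) (a b : Val) : a.isClassical → b.isClassical →
      EStep G S (.op o (.vals [a]) (.vals [b]))
        (S.push 1 fun v => [o.eval (a.at v) (b.at v)]) (.vals (S.newSlots 1))
  | opLeft {G S S'} (o : DataOp) {e₁ e₁'} (e₂ : Expr) : EStep G S e₁ S' e₁' →
      EStep G S (.op o e₁ e₂) S' (.op o e₁' e₂)
  | opRight {G S S'} (o : DataOp) (vs : List Val) {e₂ e₂'} : EStep G S e₂ S' e₂' →
      EStep G S (.op o (.vals vs) e₂) S' (.op o (.vals vs) e₂')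
  | iteCond {G S S'} {b b'} (e₁ e₂ : Expr) : EStep G S b S' b' →
      EStep G S (.ite b e₁ e₂) S' (.ite b' e₁ e₂)
  | iteThen {G S S'} (b : Val) {e₁ e₁'} (e₂ : Expr) : b.isClassical →
      EStep (fun v => G v && decide (b.at v ≠ 0)) S e₁ S' e₁' →
      EStep G S (.ite (.vals [b]) e₁ e₂) S' (.ite (.vals [b]) e₁' e₂)
  | iteElse {G S S'} (b : Val) (xs : List Val) {e₂ e₂'} : b.isClassical →
      EStep (fun v => G v && decide (b.at v = 0)) S e₂ S' e₂' →
      EStep G S (.ite (.vals [b]) (.vals xs) e₂) S' (.ite (.vals [b]) (.vals xs) e₂')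
  | ite {G S} (b : Val) (xs ys : List Val) : b.isClassical → xs.length = ys.length →
      (∀ x ∈ xs, x.isClassical) → (∀ y ∈ ys, y.isClassical) →
      EStep G S (.ite (.vals [b]) (.vals xs) (.vals ys))
        (S.push xs.length fun v => (if b.at v ≠ 0 then xs else ys).map fun a => a.at v)
        (.vals (S.newSlots xs.length))

/-- `POut P c vs P'`: the term `P` can output the values `vs` on `c` and become `P'`. -/
inductive POut : Proc → Chan → List Val → Proc → Prop
  | out (c : Chan) (vss : List (List Val)) (P : Proc) :
      POut (.out c (vss.map .vals) P) c vss.flatten P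
  | parLeft {P c vs P'} (Q : Proc) : POut P c vs P' → POut (.par P Q) c vs (.par P' Q)
  | parRight {Q c vs Q'} (P : Proc) : POut Q c vs Q' → POut (.par P Q) c vs (.par P Q')
  | sumLeft {P c vs P'} (Q : Proc) : POut P c vs P' → POut (.sum P Q) c vs P'
  | sumRight {Q c vs Q'} (P : Proc) : POut Q c vs Q' → POut (.sum P Q) c vs Q'
  | res {P c vs P'} (cs : List ℕ) : (∀ d ∈ cs, c ≠ .priv d) → POut P c vs P' →
      POut (.new cs P) c vs (.new cs P')

/-- `PIn P c vs P'`: the term `P` can input the values `vs` on `c` and become `P'`. -/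
inductive PIn : Proc → Chan → List Val → Proc → Prop
  | inp (c : Chan) (xs : List (ℕ × Ty)) (vs : List Val) (P : Proc) :
      List.Forall₂ (fun x v => v.HasTy x.2) xs vs →
      PIn (.inp c xs P) c vs (P.subst (bind (xs.map Prod.fst) vs))
  | parLeft {P c vs P'} (Q : Proc) : PIn P c vs P' → PIn (.par P Q) c vs (.par P' Q)
  | parRight {Q c vs Q'} (P : Proc) : PIn Q c vs Q' → PIn (.par P Q) c vs (.par P Q')
  | sumLeft {P c vs P'} (Q : Proc) : PIn P c vs P' → PIn (.sum P Q) c vs P'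
  | sumRight {Q c vs Q'} (P : Proc) : PIn Q c vs Q' → PIn (.sum P Q) c vs Q'
  | res {P c vs P'} (cs : List ℕ) : (∀ d ∈ cs, c ≠ .priv d) → PIn P c vs P' →
      PIn (.new cs P) c vs (.new cs P')

/-- The name `x` is not in use. -/
def Store.Fresh (S : Store) (x : QName) : Prop := x ∉ S.own ∧ x ∉ S.env

/-- Internal transitions of mixed configurations. -/
inductive Tau : Store → Proc → Store → Proc → Prop
  | comLeft {S P Q c vs P' Q'} : POut P c vs P' → PIn Q c vs Q' →
      Tau S (.par P Q) S (.par P' Q')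
  | comRight {S P Q c vs P' Q'} : PIn P c vs P' → POut Q c vs Q' →
      Tau S (.par P Q) S (.par P' Q')
  | parLeft {S P S' P'} (Q : Proc) : Tau S P S' P' → Tau S (.par P Q) S' (.par P' Q)
  | parRight {S Q S' Q'} (P : Proc) : Tau S Q S' Q' → Tau S (.par P Q) S' (.par P Q')
  | sumLeft {S P S' P'} (Q : Proc) : Tau S P S' P' → Tau S (.sum P Q) S' P'
  | sumRight {S Q S' Q'} (P : Proc) : Tau S Q S' Q' → Tau S (.sum P Q) S' Q'
  | res {S P S' P'} (cs : List ℕ) : Tau S P S' P' → Tau S (.new cs P) S' (.new cs P')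
  | qbit {S : Store} (n x : ℕ) (P : Proc) : S.Fresh (.qb n) →
      Tau S (.qbit x P) { S with own := insert (.qb n) S.own }
        (P.subst (bind [x] [.name (.qb n)]))
  | ns {S : Store} (n x : ℕ) (P : Proc) : S.Fresh (.ns n) →
      Tau S (.ns x P) { S with own := insert (.ns n) S.own }
        (P.subst (bind [x] [.name (.ns n)]))
  | act {S} (vs : List Val) (P : Proc) : Tau S (.act (.vals vs) P) S P
  | ps {S : Store} (q m n s t : ℕ) (P : Proc) : .qb q ∈ S.own → S.Fresh (.ns m) →
      S.Fresh (.ns n) → m ≠ n →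
      Tau S (.ps s t (.name (.qb q)) P)
        { S with
          own := insert (.ns m) (insert (.ns n) (S.own.erase (.qb q)))
          st := fun v => psAct (.qb q) (.ns m) (.ns n) (S.st v) }
        (P.subst (bind [s, t] [.name (.ns m), .name (.ns n)]))
  | exprAct {S e S' e'} (P : Proc) : EStep (fun _ => true) S e S' e' →
      Tau S (.act e P) S' (.act e' P)
  | exprOut {S e S' e'} (c : Chan) (vss : List (List Val)) (es : List Expr) (P : Proc) :
      EStep (fun _ => true) S e S' e' →
      Tau S (.out c (vss.map .vals ++ e :: es) P) S' (.out c (vss.map .vals ++ e' :: es) P)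

/-- Labels. In an output, `V` is the set of the tuples of numbers which the components send, and
`X` is the list of the quantum names that are sent. -/
inductive Label
  | tau
  | inp (c : Chan) (vs : List Val)
  | out (c : Chan) (V : Set (List ℤ)) (X : List QName)

/-- The process receives the systems `X` from the environment. -/
def Store.receive (S : Store) (X : List QName) : Store :=
  { S with own := S.own ∪ X.toFinset, env := S.env.filter fun x => x ∉ X }

/-- The total weight of the components in which the numbers among `vs` are `w`. -/
noncomputable def Store.outProb (S : Store) (vs : List Val) (w : List ℤ) : ℝ :=
  ∑' v, if numbersOf vs v = w then S.wt v else 0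

/-- The components in which the numbers among `vs` are `w`, with the weights normalised, after
the systems named in `vs` have been sent to the environment. -/
noncomputable def Store.outBranch (S : Store) (vs : List Val) (w : List ℤ) : Store :=
  { S with
    own := S.own \ (namesOf vs).toFinset
    env := namesOf vs ++ S.env
    wt := fun v => if numbersOf vs v = w then S.wt v / S.outProb vs w else 0 }

/-- The labelled transitions of (mixed) configurations. -/
inductive Trans : Config → Label → Config → Prop
  | tau {S P S' P'} : Tau S P S' P' → Trans (.mix S P) .tau (.mix S' P')
  | inp {S : Store} {P c vs P'} : PIn P c vs P' → (∀ v ∈ vs, v.IsClosed) →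
      (namesOf vs).Nodup → (∀ x ∈ namesOf vs, x ∈ S.env) →
      Trans (.mix S P) (.inp c vs) (.mix (S.receive (namesOf vs)) P')
  | out {S : Store} {P c vs P'} : POut P c vs P' →
      (namesOf vs).Nodup → (∀ x ∈ namesOf vs, x ∈ S.own) →
      Trans (.mix S P) (.out c {w | 0 < S.outProb vs w} (namesOf vs))
        (.prob (S.outProb vs) (S.outBranch vs) P')

/-! ### Bisimilarity -/

/-- Zero or more internal transitions. -/
def Weak : Config → Config → Prop := Relation.ReflTransGen fun t u => Trans t .tau u

open Classical in
/-- The probability `μ(t, D)` of reaching the set `D` by a probabilistic transition; a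
configuration which is not a probabilistic one reaches itself with probability `1`. -/
noncomputable def mu : Config → Set Config → ℝ
  | .mix S P, D => if Config.mix S P ∈ D then 1 else 0
  | .prob p S P, D => ∑' w, if 0 < p w ∧ Config.mix (S w) P ∈ D then p w else 0

/-- Probabilistic branching bisimulations. -/
structure IsBisimulation (R : Config → Config → Prop) : Prop where
  equivalence : Equivalence R
  tau : ∀ t u t', R t u → Trans t .tau t' →
    ∃ u' u'', Weak u u' ∧ (Trans u' .tau u'' ∨ u'' = u') ∧ R t u' ∧ R t' u''
  out : ∀ t u c V X p S P, R t u → Trans t (.out c V X) (.prob p S P) →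
    ∃ u' X' p' S' P', Weak u u' ∧ Trans u' (.out c V X') (.prob p' S' P') ∧ R t u' ∧
      ∀ w ∈ V, p w = p' w ∧ (S w).rhoE = (S' w).rhoE ∧ R (.mix (S w) P) (.mix (S' w) P')
  inp : ∀ t u c vs t', R t u → Trans t (.inp c vs) t' →
    ∃ u' u'', Weak u u' ∧ Trans u' (.inp c vs) u'' ∧ R t u' ∧ R t' u''
  prob : ∀ p S P u, R (.prob p S P) u → ∀ r, mu (.prob p S P) {d | R r d} = mu u {d | R r d}

/-- Probabilistic branching bisimilarity of configurations. -/
def Bisimilar (t u : Config) : Prop := ∃ R, IsBisimulation R ∧ R t u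

/-- Full probabilistic branching bisimilarity of processes: bisimilarity in all quantum states
`ψ` of finitely many systems, some of which may be owned by the process, and under all
substitutions of channels for free channels (`κ`) and of values for free variables (`θ`). -/
def FullBisimilar (P Q : Proc) : Prop :=
  ∀ (κ : ℕ → ℕ) (θ : ℕ → Val), (∀ x, θ x = .var x ∨ (θ x).IsClosed) →
  ∀ (own : Finset QName) (env : List QName) (ψ : State), env.Nodup → (∀ x ∈ env, x ∉ own) →
    IsState (own ∪ env.toFinset) ψ →
    Bisimilar (.mix (.pure own env ψ) ((P.rename κ).subst θ))
      (.mix (.pure own env ψ) ((Q.rename κ).subst θ))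

/-! ### The optical elements -/

/-- The single value `x` (a variable) as an expression. -/
def ev (x : ℕ) : Expr := .vals [.var x]

/-- The number `n` as an expression. -/
def num (n : ℤ) : Expr := .vals [.int n]

/-- `PolSe(a,c,d) = a?[q₀:Qbit].{s₀:NS, s₁:NS *= PS(q₀)}.c![s₀].d![s₁].0` -/
def PolSe (a c d : Chan) : Proc :=
  let q₀ := 0; let s₀ := 1; let s₁ := 2
  .inp a [(q₀, .qbit)] <| .ps s₀ s₁ (.var q₀) <| .out c [ev s₀] <| .out d [ev s₁] .nil

/-- `BS(e,f,h,i,η) = e?[s₂:NS].f?[s₃:NS].{s₂,s₃ *= B_η}.h![s₂].i![s₃].0` -/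
def BS (e f h i : Chan) (η : ℝ) : Proc :=
  let s₂ := 2; let s₃ := 3
  .inp e [(s₂, .ns)] <| .inp f [(s₃, .ns)] <| .act (.apply [.var s₂, .var s₃] (.bs η)) <|
    .out h [ev s₂] <| .out i [ev s₃] .nil

/-- `Det(l,m,u) = l?[s₀:NS].m?[s₁:NS].u![measure s₀,s₁].0` -/
def Det (l m u : Chan) : Proc :=
  let s₀ := 0; let s₁ := 1
  .inp l [(s₀, .ns)] <| .inp m [(s₁, .ns)] <| .out u [.measure [.var s₀, .var s₁]] .nil

def PolSeCT (a b c d e f : Chan) : Proc := .par (PolSe a c d) (PolSe b e f)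

/-! Names of the private channels. -/

namespace ch
abbrev c : ℕ := 0
abbrev d : ℕ := 1
abbrev e : ℕ := 2
abbrev f : ℕ := 3
abbrev g : ℕ := 4
abbrev h : ℕ := 5
abbrev i : ℕ := 6
abbrev j : ℕ := 7
abbrev k : ℕ := 8
abbrev l : ℕ := 9
abbrev m : ℕ := 10
abbrev n : ℕ := 11
abbrev o : ℕ := 12
abbrev p : ℕ := 13
abbrev q : ℕ := 14
abbrev r : ℕ := 15
abbrev u : ℕ := 16
abbrev v : ℕ := 17
end ch

/-- The network of the five beam splitters and two vacuum modes, with the control qubit on the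
channels `c, d`, the target qubit on `e, f`, and the outputs on `k, l` and `q, r`. -/
noncomputable def CNOT (c d e f k l q r : Chan) : Proc :=
  let y := 0; let z := 1
  .new [ch.g, ch.h, ch.m, ch.o, ch.i, ch.j, ch.n, ch.p] <| .ns y <| .ns z <|
    .par (BS e f ch.g ch.h (1 / 2)) <|
    .par (.out ch.i [ev y] .nil) <|
    .par (BS c ch.i k ch.j (1 / 3)) <|
    .par (.inp ch.j [(y, .ns)] .nil) <|
    .par (BS ch.g d ch.m l (1 / 3)) <|
    .par (.out ch.n [ev z] .nil) <|
    .par (BS ch.h ch.n ch.o ch.p (1 / 3)) <|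
    .par (.inp ch.p [(z, .ns)] .nil) <|
    BS ch.m ch.o q r (1 / 2)

/-- The coincidence counter: it receives the photon numbers `c₀, c₁` and `t₀, t₁`. If exactly one
photon was found in each pair, then it sends `c₁`, `t₁` and `1`, and otherwise three times `0`. -/
def Counter (u v out₁ cnt out₂ : Chan) : Proc :=
  let c₀ := 0; let c₁ := 1; let t₀ := 2; let t₁ := 3
  let coincidence : Expr :=
    .op .and (.op .eq (.op .add (ev c₀) (ev c₁)) (num 1))
      (.op .eq (.op .add (ev t₀) (ev t₁)) (num 1))
  .inp u [(c₀, .int), (c₁, .int)] <| .inp v [(t₀, .int), (t₁, .int)] <|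
    .out out₁ [.ite coincidence (ev c₁) (num 0)] <|
    .out out₂ [.ite coincidence (ev t₁) (num 0)] <|
    .out cnt [.ite coincidence (num 1) (num 0)] .nil

def MMT (k l q r out₁ cnt out₂ : Chan) : Proc :=
  .new [ch.u, ch.v] <|
    .par (Det k l ch.u) <| .par (Det q r ch.v) (Counter ch.u ch.v out₁ cnt out₂)

/-- The model of the optical CNOT gate. -/
noncomputable def Model₁ (a b out₁ cnt out₂ : Chan) : Proc :=
  .new [ch.c, ch.d, ch.e, ch.f, ch.g, ch.h, ch.m, ch.l, ch.k, ch.o, ch.q, ch.r, ch.u, ch.v] <|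
    .par (PolSeCT a b ch.c ch.d ch.e ch.f) <|
    .par (CNOT ch.c ch.d ch.e ch.f ch.k ch.l ch.q ch.r)
      (MMT ch.k ch.l ch.q ch.r out₁ cnt out₂)

/-! ### The specification -/

/-- The matrix with `U |0⟩ = (√8 / 3) |0⟩ + (1 / 3) |1⟩`, so that measuring `U |0⟩` gives `0` with
probability `8/9` and `1` with probability `1/9`. -/
noncomputable def ninthMatrix : Matrix (Fin 2) (Fin 2) ℂ :=
  !![(√8 : ℝ) / 3, -1 / 3; 1 / 3, (√8 : ℝ) / 3]

theorem ninthMatrix_mem : ninthMatrix ∈ Matrix.unitaryGroup (Fin 2) ℂ := by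
  have h8 : ((√8 : ℝ) : ℂ) * ((√8 : ℝ) : ℂ) = 8 := by
    rw [← Complex.ofReal_mul, Real.mul_self_sqrt (by norm_num)]; norm_num
  rw [Matrix.mem_unitaryGroup_iff]
  have hs : (starRingEnd ℂ) ((√8 : ℝ) : ℂ) = ((√8 : ℝ) : ℂ) := Complex.conj_ofReal _
  have h3 : (starRingEnd ℂ) (3 : ℂ) = 3 := map_ofNat _ 3
  unfold ninthMatrix
  generalize ((√8 : ℝ) : ℂ) = x at h8 hs ⊢
  ext i j
  fin_cases i <;> fin_cases j <;>
    simp [Matrix.mul_apply, Fin.sum_univ_two, Matrix.star_apply, hs, h3] <;>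
    first | linear_combination h8 / 9 | ring

/-- The qubit operator `U_{1/9}`. -/
noncomputable def U₁₉ : Gate := .qubit ⟨ninthMatrix, ninthMatrix_mem⟩

/-- The CNOT gate on two dual rail qubits as Hadamard, controlled Z, Hadamard, together with a
random bit which is `1` with probability `1/9`. -/
noncomputable def OP (c d e f g h i j k : Chan) : Proc :=
  let s₀ := 0; let s₁ := 1; let s₂ := 2; let s₃ := 3; let q₂ := 4
  .qbit q₂ <| .inp c [(s₀, .ns)] <| .inp d [(s₁, .ns)] <| .inp e [(s₂, .ns)] <|
    .inp f [(s₃, .ns)] <| .act (.apply [.var s₂, .var s₃] .had) <| .act (.apply [.var q₂] U₁₉) <|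
    .act (.apply [.var s₀, .var s₁, .var s₂, .var s₃] .cz) <|
    .act (.apply [.var s₂, .var s₃] .had) <|
    .out h [ev s₀] <| .out i [ev s₁] <| .out j [ev s₂] <| .out k [ev s₃] <|
    .out g [.measure [.var q₂]] .nil

/-- If the random bit `x` is `1`, then the logical values of the two dual rail qubits are measured
and sent on `out₁` and `out₂`, and otherwise `0` is sent twice; then `x` is sent on `cnt`. -/
def Output (g h i j k out₁ cnt out₂ : Chan) : Proc :=
  let s₀ := 0; let s₁ := 1; let s₂ := 2; let s₃ := 3; let x := 4
  .inp h [(s₀, .ns)] <| .inp i [(s₁, .ns)] <| .inp j [(s₂, .ns)] <| .inp k [(s₃, .ns)] <|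
    .inp g [(x, .bit)] <|
    .out out₁ [.ite (.op .eq (ev x) (num 1)) (.measure [.var s₁]) (num 0)] <|
    .out out₂ [.ite (.op .eq (ev x) (num 1)) (.measure [.var s₃]) (num 0)] <|
    .out cnt [ev x] .nil

/-- The specification of the optical CNOT gate. -/
noncomputable def Specification₁ (a b out₁ cnt out₂ : Chan) : Proc :=
  .new [ch.c, ch.d, ch.e, ch.f, ch.g, ch.h, ch.i, ch.j, ch.k] <|
    .par (PolSeCT a b ch.c ch.d ch.e ch.f) <|
    .par (OP ch.c ch.d ch.e ch.f ch.g ch.h ch.i ch.j ch.k)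
      (Output ch.g ch.h ch.i ch.j ch.k out₁ cnt out₂)

end CQP

namespace CQP

/-! ### A criterion for bisimilarity -/

section Criterion

variable {A : Type*} (Good : Config → A → Prop)

/-- Two configurations satisfy the predicate with a common parameter. -/
def Linked (t u : Config) : Prop := ∃ α, Good t α ∧ Good u α

variable {Good}

theorem Linked.symm {t u : Config} : Linked Good t u → Linked Good u t :=
  fun ⟨α, h, h'⟩ => ⟨α, h', h⟩

theorem good_of_weak (hτ : ∀ t α t', Good t α → Trans t .tau t' → Good t' α) {t t' : Config} {α : A}
    (h : Good t α) (w : Weak t t') : Good t' α := by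
  induction w with
  | refl => exact h
  | tail _ h2 ih => exact hτ _ _ _ ih h2

/-- If every internal step keeps the parameter of a configuration, and configurations with the same
parameter have the same visible transitions, then such configurations are bisimilar. -/
theorem bisimilar_of_good (hmix : ∀ t α, Good t α → ∃ S P, t = .mix S P)
    (hτ : ∀ t α t', Good t α → Trans t .tau t' → Good t' α)
    (hin : ∀ t u α c vs t', Good t α → Good u α → Trans t (.inp c vs) t' →
      ∃ u', Trans u (.inp c vs) u' ∧ Linked Good t' u')
    (hout : ∀ t u α c V X p S P, Good t α → Good u α → Trans t (.out c V X) (.prob p S P) →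
      ∃ u' X' p' S' P', Weak u u' ∧ Trans u' (.out c V X') (.prob p' S' P') ∧
        ∀ w ∈ V, p w = p' w ∧ (S w).rhoE = (S' w).rhoE ∧
          Linked Good (.mix (S w) P) (.mix (S' w) P'))
    {t u : Config} {α : A} (ht : Good t α) (hu : Good u α) : Bisimilar t u := by
  let R := Relation.ReflTransGen (Linked Good)
  have sym : ∀ {t u}, R t u → R u t := by
    intro t u h
    induction h with
    | refl => exact .refl
    | tail _ h2 ih => exact .head h2.symm ih
  have inert : ∀ {t t' α}, Good t α → Weak t t' → R t t' := fun {t t' α} h w =>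
    .single ⟨α, h, good_of_weak hτ h w⟩
  have lonely : ∀ {t u}, R t u → (¬ ∃ α, Good t α) → t = u := by
    intro t u h hn
    rcases Relation.ReflTransGen.cases_head h with h | ⟨v, ⟨β, hv, _⟩, _⟩
    · exact h
    · exact absurd ⟨β, hv⟩ hn
  refine ⟨R, ⟨⟨fun _ => .refl, sym, fun h h' => h.trans h'⟩, ?_, ?_, ?_, ?_⟩, .single ⟨α, ht, hu⟩⟩
  · intro t u t' h s
    by_cases hg : ∃ α, Good t α
    · obtain ⟨β, hβ⟩ := hg
      exact ⟨u, u, .refl, .inr rfl, h, (sym (inert hβ (.single s))).trans h⟩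
    · obtain rfl := lonely h hg
      exact ⟨t, t', .refl, .inl s, .refl, .refl⟩
  · intro t u c V X p S P h s
    suffices H : ∃ u' X' p' S' P', Weak u u' ∧ Trans u' (.out c V X') (.prob p' S' P') ∧ R u u' ∧
        ∀ w ∈ V, p w = p' w ∧ (S w).rhoE = (S' w).rhoE ∧ R (.mix (S w) P) (.mix (S' w) P') by
      obtain ⟨u', X', p', S', P', h1, h2, h3, h4⟩ := H
      exact ⟨u', X', p', S', P', h1, h2, h.trans h3, h4⟩
    induction h with
    | refl => exact ⟨t, X, p, S, P, .refl, s, .refl, fun w _ => ⟨rfl, rfl, .refl⟩⟩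
    | tail _ h2 ih =>
      obtain ⟨v, X', p', S', P', h3, h4, -, h6⟩ := ih
      obtain ⟨β, hv, hu⟩ := h2
      obtain ⟨u', X'', p'', S'', P'', h7, h8, h9⟩ :=
        hout _ _ β _ _ _ _ _ _ (good_of_weak hτ hv h3) hu h4
      refine ⟨u', X'', p'', S'', P'', h7, h8, inert hu h7, fun w hw => ?_⟩
      obtain ⟨e1, e2, e3⟩ := h6 w hw
      obtain ⟨e4, e5, e6⟩ := h9 w hw
      exact ⟨e1.trans e4, e2.trans e5, e3.trans (.single e6)⟩
  · intro t u c vs t' h s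
    suffices H : ∃ u', Trans u (.inp c vs) u' ∧ R t' u' by
      obtain ⟨u', h1, h2⟩ := H
      exact ⟨u, u', .refl, h1, h, h2⟩
    induction h with
    | refl => exact ⟨t', s, .refl⟩
    | tail _ h2 ih =>
      obtain ⟨v, h3, h4⟩ := ih
      obtain ⟨β, hv, hu⟩ := h2
      obtain ⟨u', h5, h6⟩ := hin _ _ β _ _ _ hv hu h3
      exact ⟨u', h5, h4.trans (.single h6)⟩
  · intro p S P u h r
    have hn : ¬ ∃ α, Good (.prob p S P) α := by
      rintro ⟨β, hβ⟩
      obtain ⟨_, _, h'⟩ := hmix _ _ hβ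
      cases h'
    rw [lonely h hn]

end Criterion

/-! ### Transitions of prefixes -/

theorem pOut_out_iff {c c' : Chan} {es vs P P'} :
    POut (.out c es P) c' vs P' ↔
      c' = c ∧ P' = P ∧ ∃ vss : List (List Val), es = vss.map .vals ∧ vs = vss.flatten := by
  constructor
  · intro h
    generalize hQ : Proc.out c es P = Q at h
    cases h <;> cases hQ
    exact ⟨rfl, rfl, _, rfl, rfl⟩
  · rintro ⟨rfl, rfl, vss, rfl, rfl⟩
    exact .out _ _ _

theorem pOut_singleton_iff {c c' : Chan} {e vs P P'} :
    POut (.out c [e] P) c' vs P' ↔ c' = c ∧ P' = P ∧ e = .vals vs := by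
  rw [pOut_out_iff]
  constructor
  · rintro ⟨h1, h2, vss, h3, h4⟩
    obtain ⟨ws, hws, rfl⟩ : ∃ ws, vss = [ws] ∧ Expr.vals ws = e := by
      match vss, h3 with
      | [ws], h3 => exact ⟨ws, rfl, by simpa using h3.symm⟩
    subst hws h4
    simp [h1, h2]
  · rintro ⟨h1, h2, rfl⟩
    exact ⟨h1, h2, [vs], by simp, by simp⟩

theorem pIn_inp_iff {c c' : Chan} {xs vs P P'} :
    PIn (.inp c xs P) c' vs P' ↔
      c' = c ∧ List.Forall₂ (fun (x : ℕ × Ty) (v : Val) => v.HasTy x.2) xs vs ∧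
        P' = P.subst (bind (xs.map Prod.fst) vs) := by
  constructor
  · intro h
    cases h with
    | inp _ _ _ _ h => exact ⟨rfl, h, rfl⟩
  · rintro ⟨rfl, h, rfl⟩
    exact .inp _ _ _ _ h

theorem Val.HasTy.exists_qb {v : Val} (h : v.HasTy .qbit) : ∃ n, v = .name (.qb n) := by
  cases v <;> try exact h.elim
  rename_i x
  cases x
  · exact ⟨_, rfl⟩
  · exact h.elim

theorem tau_out_singleton_iff {S c e P S' P'} :
    Tau S (.out c [e] P) S' P' ↔ ∃ e', EStep (fun _ => true) S e S' e' ∧ P' = .out c [e'] P := by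
  constructor
  · intro h
    generalize hQ : Proc.out c [e] P = Q at h
    cases h <;> try cases hQ
    case exprOut e₁ e₂ c vss es P h =>
      simp only [Proc.out.injEq] at hQ
      obtain ⟨rfl, hq, rfl⟩ := hQ
      match vss, es, hq with
      | [], [], hq =>
        obtain rfl : e = e₁ := by simpa using hq
        exact ⟨_, h, by simp⟩
      | [], _ :: _, hq => simp at hq
      | _ :: _, _, hq => simp at hq
  · rintro ⟨e', h, rfl⟩
    exact Tau.exprOut c [] [] P h

theorem tau_act_iff {S e P S' P'} :
    Tau S (.act e P) S' P' ↔ (∃ vs, e = .vals vs ∧ S' = S ∧ P' = P) ∨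
      ∃ e', EStep (fun _ => true) S e S' e' ∧ P' = .act e' P := by
  constructor
  · intro h
    cases h with
    | act vs _ => exact .inl ⟨vs, rfl, rfl, rfl⟩
    | exprAct _ h => exact .inr ⟨_, h, rfl⟩
  · rintro (⟨vs, rfl, rfl, rfl⟩ | ⟨e', h, rfl⟩)
    · exact .act _ _
    · exact .exprAct _ h

theorem names_injective : Function.Injective (List.map Val.name) :=
  List.map_injective_iff.2 fun _ _ h => by simpa using h

theorem eStep_apply_iff {G S xs U S' e'} :
    EStep G S (.apply (List.map Val.name xs) U) S' e' ↔
      U.Fits xs ∧ S' = S.transform G (U.act xs) ∧ e' = .vals [] := by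
  constructor
  · intro h
    generalize hQ : Expr.apply (List.map Val.name xs) U = Q at h
    cases h <;> try cases hQ
    case apply ys U hf =>
      simp only [Expr.apply.injEq] at hQ
      obtain ⟨hq, rfl⟩ := hQ
      obtain rfl := names_injective hq
      exact ⟨hf, rfl, rfl⟩
  · rintro ⟨h, rfl, rfl⟩
    exact .apply _ _ h

theorem eStep_measure_ns_iff {G S S' e'} {xs : List QName} (hx : xs ≠ []) (hn : xs.Nodup)
    (hty : ∀ x ∈ xs, x.IsNS) :
    EStep G S (.measure (List.map Val.name xs)) S' e' ↔
      S' = S.measure G xs.length (obsNS xs) ∧ e' = .vals (S.newSlots xs.length) := by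
  constructor
  · intro h
    generalize hQ : Expr.measure (List.map Val.name xs) = Q at h
    cases h <;> try cases hQ
    case measureNS ys _ _ _ =>
      simp only [Expr.measure.injEq] at hQ
      have hq := hQ
      obtain rfl := names_injective hq
      exact ⟨rfl, rfl⟩
    case measureQb ys _ _ h =>
      simp only [Expr.measure.injEq] at hQ
      have hq := hQ
      obtain rfl := names_injective hq
      obtain ⟨y, hy⟩ := List.exists_mem_of_ne_nil _ hx
      have h1 := hty y hy
      have h2 := h y hy
      cases y
      · exact h1.elim
      · exact h2.elim
  · rintro ⟨rfl, rfl⟩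
    exact .measureNS _ hx hn hty

theorem eStep_measure_qb_iff {G S S' e'} {xs : List QName} (hx : xs ≠ []) (hn : xs.Nodup)
    (hty : ∀ x ∈ xs, x.IsQb) :
    EStep G S (.measure (List.map Val.name xs)) S' e' ↔
      S' = S.measure G 1 (obsQb xs) ∧ e' = .vals (S.newSlots 1) := by
  constructor
  · intro h
    generalize hQ : Expr.measure (List.map Val.name xs) = Q at h
    cases h <;> try cases hQ
    case measureQb ys _ _ _ =>
      simp only [Expr.measure.injEq] at hQ
      have hq := hQ
      obtain rfl := names_injective hq
      exact ⟨rfl, rfl⟩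
    case measureNS ys _ _ h =>
      simp only [Expr.measure.injEq] at hQ
      have hq := hQ
      obtain rfl := names_injective hq
      obtain ⟨y, hy⟩ := List.exists_mem_of_ne_nil _ hx
      have h1 := hty y hy
      have h2 := h y hy
      cases y
      · exact h2.elim
      · exact h1.elim
  · rintro ⟨rfl, rfl⟩
    exact .measureQb _ hx hn hty

/-! ### Contexts of parallel threads -/

/-- Contexts built with parallel composition and restriction, with numbered holes. -/
inductive Ctx
  | hole (i : ℕ)
  | par (A B : Ctx)
  | new (cs : List ℕ) (A : Ctx)

namespace Ctx

/-- The term with the threads `f` in the holes. -/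
def fill : Ctx → (ℕ → Proc) → Proc
  | hole i, f => f i
  | par A B, f => .par (A.fill f) (B.fill f)
  | new cs A, f => .new cs (A.fill f)

/-- The numbers of the holes. -/
def holes : Ctx → List ℕ
  | hole i => [i]
  | par A B => A.holes ++ B.holes
  | new _ A => A.holes

/-- Actions of the thread `i` on the channel `c` are visible from outside. -/
def vis : Ctx → ℕ → Chan → Bool
  | hole i, j, _ => i == j
  | par A B, j, c => A.vis j c || B.vis j c
  | new cs A, j, c => cs.all (fun d => c != .priv d) && A.vis j c

/-- The threads `i` and `j` can communicate on the channel `c`. -/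
def com : Ctx → ℕ → ℕ → Chan → Bool
  | hole _, _, _, _ => false
  | par A B, i, j, c =>
    (A.vis i c && B.vis j c) || (B.vis i c && A.vis j c) || A.com i j c || B.com i j c
  | new _ A, i, j, c => A.com i j c

theorem fill_congr {C : Ctx} {f g : ℕ → Proc} (h : ∀ i ∈ C.holes, f i = g i) :
    C.fill f = C.fill g := by
  induction C with
  | hole i => exact h i (by simp [holes])
  | par A B ihA ihB =>
    simp only [holes, List.mem_append] at h
    simp only [fill, ihA fun i hi => h i (.inl hi), ihB fun i hi => h i (.inr hi)]
  | new cs A ih => simp only [fill, ih h]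

theorem fill_update_of_notMem {C : Ctx} {f : ℕ → Proc} {i : ℕ} {X : Proc} (h : i ∉ C.holes) :
    C.fill (Function.update f i X) = C.fill f :=
  fill_congr fun j hj => Function.update_of_ne (by rintro rfl; exact h hj) _ _

theorem mem_holes_of_vis {C : Ctx} {i : ℕ} {c : Chan} (h : C.vis i c = true) : i ∈ C.holes := by
  induction C with
  | hole j =>
    obtain rfl : j = i := by simpa [vis] using h
    simp [holes]
  | par A B ihA ihB =>
    simp only [vis, Bool.or_eq_true] at h
    simp only [holes, List.mem_append]
    exact h.imp ihA ihB
  | new cs A ih =>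
    simp only [vis, Bool.and_eq_true] at h
    exact ih h.2

theorem pOut_inv {C : Ctx} (hC : C.holes.Nodup) {f : ℕ → Proc} {c vs P'}
    (h : POut (C.fill f) c vs P') :
    ∃ i X, C.vis i c = true ∧ POut (f i) c vs X ∧ P' = C.fill (Function.update f i X) := by
  induction C generalizing P' with
  | hole i => exact ⟨i, P', by simp [vis], h, by simp [fill]⟩
  | par A B ihA ihB =>
    have hC' := List.nodup_append.1 hC
    cases h with
    | parLeft _ h =>
      obtain ⟨i, X, h1, h2, rfl⟩ := ihA hC'.1 h
      refine ⟨i, X, by simp [vis, h1], h2, ?_⟩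
      rw [fill, fill_update_of_notMem (C := B)
        fun hi => hC'.2.2 i (mem_holes_of_vis h1) i hi rfl]
    | parRight _ h =>
      obtain ⟨i, X, h1, h2, rfl⟩ := ihB hC'.2.1 h
      refine ⟨i, X, by simp [vis, h1], h2, ?_⟩
      rw [fill, fill_update_of_notMem (C := A)
        fun hi => hC'.2.2 i hi i (mem_holes_of_vis h1) rfl]
  | new cs A ih =>
    cases h with
    | res _ hd h =>
      obtain ⟨i, X, h1, h2, rfl⟩ := ih hC h
      exact ⟨i, X, by simpa [vis, h1] using hd, h2, rfl⟩

theorem pIn_inv {C : Ctx} (hC : C.holes.Nodup) {f : ℕ → Proc} {c vs P'}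
    (h : PIn (C.fill f) c vs P') :
    ∃ i X, C.vis i c = true ∧ PIn (f i) c vs X ∧ P' = C.fill (Function.update f i X) := by
  induction C generalizing P' with
  | hole i => exact ⟨i, P', by simp [vis], h, by simp [fill]⟩
  | par A B ihA ihB =>
    have hC' := List.nodup_append.1 hC
    cases h with
    | parLeft _ h =>
      obtain ⟨i, X, h1, h2, rfl⟩ := ihA hC'.1 h
      refine ⟨i, X, by simp [vis, h1], h2, ?_⟩
      rw [fill, fill_update_of_notMem (C := B)
        fun hi => hC'.2.2 i (mem_holes_of_vis h1) i hi rfl]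
    | parRight _ h =>
      obtain ⟨i, X, h1, h2, rfl⟩ := ihB hC'.2.1 h
      refine ⟨i, X, by simp [vis, h1], h2, ?_⟩
      rw [fill, fill_update_of_notMem (C := A)
        fun hi => hC'.2.2 i hi i (mem_holes_of_vis h1) rfl]
  | new cs A ih =>
    cases h with
    | res _ hd h =>
      obtain ⟨i, X, h1, h2, rfl⟩ := ih hC h
      exact ⟨i, X, by simpa [vis, h1] using hd, h2, rfl⟩

theorem pOut_fill {C : Ctx} (hC : C.holes.Nodup) {f : ℕ → Proc} {i c vs X}
    (hv : C.vis i c = true) (h : POut (f i) c vs X) :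
    POut (C.fill f) c vs (C.fill (Function.update f i X)) := by
  induction C with
  | hole j =>
    obtain rfl : j = i := by simpa [vis] using hv
    simpa [fill] using h
  | par A B ihA ihB =>
    have hC' := List.nodup_append.1 hC
    simp only [vis, Bool.or_eq_true] at hv
    rcases hv with hv | hv
    · have := POut.parLeft (B.fill f) (ihA hC'.1 hv)
      rwa [fill, fill, fill_update_of_notMem (C := B)
        fun hi => hC'.2.2 i (mem_holes_of_vis hv) i hi rfl]
    · have := POut.parRight (A.fill f) (ihB hC'.2.1 hv)
      rwa [fill, fill, fill_update_of_notMem (C := A)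
        fun hi => hC'.2.2 i hi i (mem_holes_of_vis hv) rfl]
  | new cs A ih =>
    simp only [vis, Bool.and_eq_true] at hv
    exact .res cs (by simpa using hv.1) (ih hC hv.2)

theorem pIn_fill {C : Ctx} (hC : C.holes.Nodup) {f : ℕ → Proc} {i c vs X}
    (hv : C.vis i c = true) (h : PIn (f i) c vs X) :
    PIn (C.fill f) c vs (C.fill (Function.update f i X)) := by
  induction C with
  | hole j =>
    obtain rfl : j = i := by simpa [vis] using hv
    simpa [fill] using h
  | par A B ihA ihB =>
    have hC' := List.nodup_append.1 hC
    simp only [vis, Bool.or_eq_true] at hv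
    rcases hv with hv | hv
    · have := PIn.parLeft (B.fill f) (ihA hC'.1 hv)
      rwa [fill, fill, fill_update_of_notMem (C := B)
        fun hi => hC'.2.2 i (mem_holes_of_vis hv) i hi rfl]
    · have := PIn.parRight (A.fill f) (ihB hC'.2.1 hv)
      rwa [fill, fill, fill_update_of_notMem (C := A)
        fun hi => hC'.2.2 i hi i (mem_holes_of_vis hv) rfl]
  | new cs A ih =>
    simp only [vis, Bool.and_eq_true] at hv
    exact .res cs (by simpa using hv.1) (ih hC hv.2)

/-- An internal transition is one of a thread, or a communication between two threads. -/
theorem tau_inv {C : Ctx} (hC : C.holes.Nodup) {f : ℕ → Proc} {S S' P'}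
    (h : Tau S (C.fill f) S' P') :
    (∃ i X, i ∈ C.holes ∧ Tau S (f i) S' X ∧ P' = C.fill (Function.update f i X)) ∨
    (S' = S ∧ ∃ i j c vs X Y, i ∈ C.holes ∧ j ∈ C.holes ∧ i ≠ j ∧ POut (f i) c vs X ∧
      PIn (f j) c vs Y ∧ P' = C.fill (Function.update (Function.update f i X) j Y)) := by
  induction C generalizing P' with
  | hole i => exact .inl ⟨i, P', by simp [holes], h, by simp [fill]⟩
  | par A B ihA ihB =>
    have hC' := List.nodup_append.1 hC
    have hne : ∀ i ∈ A.holes, ∀ j ∈ B.holes, i ≠ j := hC'.2.2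
    have nA : ∀ {f : ℕ → Proc} {i X}, i ∈ B.holes → A.fill (Function.update f i X) = A.fill f :=
      fun hi => fill_update_of_notMem fun hi' => hne _ hi' _ hi rfl
    have nB : ∀ {f : ℕ → Proc} {i X}, i ∈ A.holes → B.fill (Function.update f i X) = B.fill f :=
      fun hi => fill_update_of_notMem fun hi' => hne _ hi _ hi' rfl
    have mA : ∀ {i}, i ∈ A.holes → i ∈ (par A B).holes := fun h => by simp [holes, h]
    have mB : ∀ {i}, i ∈ B.holes → i ∈ (par A B).holes := fun h => by simp [holes, h]
    cases h with
    | comLeft h1 h2 =>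
      obtain ⟨i, X, v1, o1, rfl⟩ := pOut_inv hC'.1 h1
      obtain ⟨j, Y, v2, o2, rfl⟩ := pIn_inv hC'.2.1 h2
      have mi := mem_holes_of_vis v1
      have mj := mem_holes_of_vis v2
      refine .inr ⟨rfl, i, j, _, _, X, Y, mA mi, mB mj, hne _ mi _ mj, o1, o2, ?_⟩
      rw [fill, nA mj, Function.update_comm (hne _ mi _ mj), nB mi]
    | comRight h1 h2 =>
      obtain ⟨j, Y, v2, o2, rfl⟩ := pIn_inv hC'.1 h1
      obtain ⟨i, X, v1, o1, rfl⟩ := pOut_inv hC'.2.1 h2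
      have mi := mem_holes_of_vis v1
      have mj := mem_holes_of_vis v2
      refine .inr ⟨rfl, i, j, _, _, X, Y, mB mi, mA mj, (hne _ mj _ mi).symm, o1, o2, ?_⟩
      rw [fill, nB mj, Function.update_comm (hne _ mj _ mi).symm, nA mi]
    | parLeft _ h =>
      rcases ihA hC'.1 h with ⟨i, X, mi, o, rfl⟩ | ⟨hS, i, j, c, vs, X, Y, mi, mj, ij, o, o', rfl⟩
      · exact .inl ⟨i, X, mA mi, o, by rw [fill, nB mi]⟩
      · exact .inr ⟨hS, i, j, c, vs, X, Y, mA mi, mA mj, ij, o, o', by rw [fill, nB mj, nB mi]⟩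
    | parRight _ h =>
      rcases ihB hC'.2.1 h with ⟨i, X, mi, o, rfl⟩ | ⟨hS, i, j, c, vs, X, Y, mi, mj, ij, o, o', rfl⟩
      · exact .inl ⟨i, X, mB mi, o, by rw [fill, nA mi]⟩
      · exact .inr ⟨hS, i, j, c, vs, X, Y, mB mi, mB mj, ij, o, o', by rw [fill, nA mj, nA mi]⟩
  | new cs A ih =>
    cases h with
    | res _ h =>
      rcases ih hC h with ⟨i, X, mi, o, rfl⟩ | ⟨hS, i, j, c, vs, X, Y, mi, mj, ij, o, o', rfl⟩
      · exact .inl ⟨i, X, mi, o, rfl⟩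
      · exact .inr ⟨hS, i, j, c, vs, X, Y, mi, mj, ij, o, o', rfl⟩

theorem tau_fill {C : Ctx} (hC : C.holes.Nodup) {f : ℕ → Proc} {i S S' X} (hi : i ∈ C.holes)
    (h : Tau S (f i) S' X) : Tau S (C.fill f) S' (C.fill (Function.update f i X)) := by
  induction C with
  | hole j =>
    obtain rfl : i = j := by simpa [holes] using hi
    simpa [fill] using h
  | par A B ihA ihB =>
    have hC' := List.nodup_append.1 hC
    rcases List.mem_append.1 hi with hi | hi
    · have := Tau.parLeft (B.fill f) (ihA hC'.1 hi)
      rwa [fill, fill, fill_update_of_notMem (C := B) fun hi' => hC'.2.2 i hi i hi' rfl]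
    · have := Tau.parRight (A.fill f) (ihB hC'.2.1 hi)
      rwa [fill, fill, fill_update_of_notMem (C := A) fun hi' => hC'.2.2 i hi' i hi rfl]
  | new cs A ih => exact .res cs (ih hC hi)

theorem mem_holes_of_com {C : Ctx} {i j : ℕ} {c : Chan} (h : C.com i j c = true) :
    i ∈ C.holes ∧ j ∈ C.holes := by
  induction C with
  | hole => simp [com] at h
  | par A B ihA ihB =>
    simp only [com, Bool.or_eq_true, Bool.and_eq_true] at h
    simp only [holes, List.mem_append]
    rcases h with ((h | h) | h) | h
    · exact ⟨.inl (mem_holes_of_vis h.1), .inr (mem_holes_of_vis h.2)⟩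
    · exact ⟨.inr (mem_holes_of_vis h.1), .inl (mem_holes_of_vis h.2)⟩
    · exact ⟨.inl (ihA h).1, .inl (ihA h).2⟩
    · exact ⟨.inr (ihB h).1, .inr (ihB h).2⟩
  | new cs A ih => exact ih h

theorem tau_com {C : Ctx} (hC : C.holes.Nodup) {f : ℕ → Proc} {i j c vs S X Y}
    (hc : C.com i j c = true) (ho : POut (f i) c vs X) (hi : PIn (f j) c vs Y) :
    Tau S (C.fill f) S (C.fill (Function.update (Function.update f i X) j Y)) := by
  induction C with
  | hole => simp [com] at hc
  | par A B ihA ihB =>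
    have hC' := List.nodup_append.1 hC
    have hne : ∀ i ∈ A.holes, ∀ j ∈ B.holes, i ≠ j := hC'.2.2
    have nA : ∀ {f : ℕ → Proc} {i X}, i ∈ B.holes → A.fill (Function.update f i X) = A.fill f :=
      fun hi => fill_update_of_notMem fun hi' => hne _ hi' _ hi rfl
    have nB : ∀ {f : ℕ → Proc} {i X}, i ∈ A.holes → B.fill (Function.update f i X) = B.fill f :=
      fun hi => fill_update_of_notMem fun hi' => hne _ hi _ hi' rfl
    simp only [com, Bool.or_eq_true, Bool.and_eq_true] at hc
    rcases hc with ((⟨h1, h2⟩ | ⟨h1, h2⟩) | h) | h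
    · have mi := mem_holes_of_vis h1
      have mj := mem_holes_of_vis h2
      have := Tau.comLeft (S := S) (pOut_fill hC'.1 h1 ho) (pIn_fill hC'.2.1 h2 hi)
      rwa [fill, fill, nA mj, Function.update_comm (hne _ mi _ mj), nB mi]
    · have mi := mem_holes_of_vis h1
      have mj := mem_holes_of_vis h2
      have := Tau.comRight (S := S) (pIn_fill hC'.1 h2 hi) (pOut_fill hC'.2.1 h1 ho)
      rwa [fill, fill, nB mj, Function.update_comm (hne _ mj _ mi).symm, nA mi]
    · have m := mem_holes_of_com h
      have := Tau.parLeft (B.fill f) (ihA hC'.1 h)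
      rwa [fill, fill, nB m.2, nB m.1]
    · have m := mem_holes_of_com h
      have := Tau.parRight (A.fill f) (ihB hC'.2.1 h)
      rwa [fill, fill, nA m.2, nA m.1]
  | new cs A ih => exact .res cs (ih hC hc)

end Ctx

/-! ### Stores as superpositions with a classical record -/

/-- The amplitudes are square summable. -/
def SqSummable (Φ : State) : Prop := Summable fun f => ‖Φ f‖ ^ 2

/-- The components of the store are the parts of the (unnormalised) state `Φ` in which the classical
values are those recorded by `rec`. -/
structure Store.Rep (S : Store) (Φ : State) (rec : Basis → List ℤ) : Prop where
  nonneg : ∀ v, 0 ≤ S.wt v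
  len : ∀ v, S.wt v ≠ 0 → v.length = S.width
  reclen : ∀ f, (rec f).length = S.width
  amp : ∀ v f, ((√(S.wt v) : ℝ) : ℂ) * S.st v f = if v = rec f then Φ f else 0

/-- The weights are the norms of the components. -/
def Store.Normed (S : Store) (Φ : State) (rec : Basis → List ℤ) : Prop :=
  ∀ v, S.wt v = ∑' f, if v = rec f then ‖Φ f‖ ^ 2 else 0

theorem eq_append_iff_take_drop {α : Type*} {w x y : List α} {n : ℕ} (h : x.length = n) :
    w = x ++ y ↔ w.take n = x ∧ w.drop n = y := by
  subst h
  constructor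
  · rintro rfl
    simp
  · rintro ⟨h1, h2⟩
    have := List.take_append_drop x.length w
    rw [h1, h2] at this
    exact this.symm

theorem tsum_tsum_fiber {E β γ : Type*} [NormedAddCommGroup E] [CompleteSpace E] [DecidableEq γ]
    {F : β → E} (hF : Summable F) (r : β → γ) :
    ∑' v, ∑' f, (if v = r f then F f else 0) = ∑' f, F f := by
  have h := (hF.hasSum.tsum_fiberwise r).tsum_eq
  rw [← h]
  refine tsum_congr fun v => ?_
  rw [tsum_subtype (r ⁻¹' {v}) F]
  refine tsum_congr fun f => ?_
  simp [Set.indicator, eq_comm]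

theorem SqSummable.mul_conj {Φ Φ' : State} (h : SqSummable Φ) (h' : SqSummable Φ') :
    Summable fun f => Φ f * (starRingEnd ℂ) (Φ' f) := by
  refine Summable.of_norm_bounded ((Summable.add h h')) fun f => ?_
  rw [norm_mul, RCLike.norm_conj]
  nlinarith [sq_nonneg (‖Φ f‖ - ‖Φ' f‖), sq_nonneg (‖Φ f‖), sq_nonneg ‖Φ' f‖]

theorem SqSummable.shift {Φ : State} (h : SqSummable Φ) (p : Basis) :
    SqSummable fun f => Φ (f + p) :=
  h.comp_injective (i := fun f => f + p) (add_left_injective p)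

theorem SqSummable.of_le {Φ Φ' : State} (h : SqSummable Φ) (hle : ∀ f, ‖Φ' f‖ ≤ ‖Φ f‖) :
    SqSummable Φ' :=
  Summable.of_nonneg_of_le (fun f => by positivity) (fun f => by gcongr; exact hle f) h

theorem summable_ite {E β : Type*} [NormedAddCommGroup E] [CompleteSpace E] {F : β → E}
    (hF : Summable F) (p : β → Prop) [DecidablePred p] :
    Summable fun f => if p f then F f else 0 := by
  have := hF.indicator {f | p f}
  refine this.congr fun f => ?_
  simp [Set.indicator]

namespace Store

theorem rep_pure (own : Finset QName) (env : List QName) (ψ : State) :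
    (Store.pure own env ψ).Rep ψ fun _ => [] where
  nonneg v := by simp only [Store.pure]; split <;> norm_num
  len v h := by
    simp only [Store.pure] at h ⊢
    split at h
    · simp [*]
    · exact absurd rfl h
  reclen _ := rfl
  amp v f := by
    simp only [Store.pure]
    split <;> simp

namespace Rep

variable {S : Store} {Φ : State} {rec : Basis → List ℤ}

theorem congr (h : S.Rep Φ rec) {S' : Store} (h1 : S'.width = S.width) (h2 : S'.wt = S.wt)
    (h3 : S'.st = S.st) : S'.Rep Φ rec where
  nonneg v := by rw [h2]; exact h.nonneg v
  len v := by rw [h1, h2]; exact h.len v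
  reclen f := by rw [h1]; exact h.reclen f
  amp v f := by rw [h2, h3]; exact h.amp v f

/-- The effect of an operator that does not change the recorded values. -/
theorem map (h : S.Rep Φ rec) {S' : Store} {U : State → State}
    (hU : ∀ (c : ℂ) φ, U (fun f => c * φ f) = fun f => c * U φ f)
    (hc : ∀ v φ, U (fun f => if v = rec f then φ f else 0) =
      fun f => if v = rec f then U φ f else 0)
    (h1 : S'.width = S.width) (h2 : S'.wt = S.wt) (h3 : ∀ v, S'.st v = U (S.st v)) :
    S'.Rep (U Φ) rec where
  nonneg v := by rw [h2]; exact h.nonneg v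
  len v := by rw [h1, h2]; exact h.len v
  reclen f := by rw [h1]; exact h.reclen f
  amp v f := by
    rw [h2, h3, ← congrFun (hc v Φ) f, ← congrFun (hU _ (S.st v)) f]
    congr 1
    funext g
    exact h.amp v g

theorem sqSummable_st (h : S.Rep Φ rec) (hΦ : SqSummable Φ) {v : List ℤ} (hv : S.wt v ≠ 0) :
    SqSummable (S.st v) := by
  have h0 : 0 < √(S.wt v) := Real.sqrt_pos.2 (lt_of_le_of_ne (h.nonneg v) hv.symm)
  have h1 : SqSummable fun f => ((√(S.wt v) : ℝ) : ℂ) * S.st v f := by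
    refine hΦ.of_le fun f => ?_
    rw [h.amp]
    split <;> simp
  have h2 := Summable.mul_left ((√(S.wt v))⁻¹ ^ 2) h1
  refine h2.congr fun f => ?_
  rw [norm_mul, mul_pow, Complex.norm_real, Real.norm_eq_abs, abs_of_pos h0, ← mul_assoc,
    ← mul_pow, inv_mul_cancel₀ h0.ne', one_pow, one_mul]

theorem sq_amp (h : S.Rep Φ rec) (v : List ℤ) (f : Basis) :
    S.wt v * ‖S.st v f‖ ^ 2 = if v = rec f then ‖Φ f‖ ^ 2 else 0 := by
  have := congrArg (fun z => ‖z‖ ^ 2) (h.amp v f)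
  simp only [norm_mul, mul_pow, Complex.norm_real, Real.norm_eq_abs, sq_abs,
    Real.sq_sqrt (h.nonneg v)] at this
  rw [this]
  split <;> simp

theorem push (h : S.Rep Φ rec) {r : ℕ} {a : List ℤ → List ℤ} (ha : ∀ v, (a v).length = r) :
    (S.push r a).Rep Φ fun f => rec f ++ a (rec f) where
  nonneg w := by
    simp only [Store.push, Store.branch]
    exact mul_nonneg (h.nonneg _) (by split <;> norm_num)
  len w hw := by
    simp only [Store.push, Store.branch, mul_ite, mul_one, mul_zero, ne_eq, ite_eq_right_iff,
      Classical.not_imp] at hw ⊢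
    rw [← h.len _ hw.2, ← ha (w.take S.width), ← hw.1, ← List.length_append,
      List.take_append_drop]
  reclen f := by simp [Store.push, Store.branch, h.reclen, ha]
  amp w f := by
    simp only [Store.push, Store.branch, eq_append_iff_take_drop (h.reclen f)]
    by_cases h1 : w.drop S.width = a (w.take S.width)
    · rw [if_pos h1, mul_one, h.amp]
      refine if_congr ⟨fun h2 => ⟨h2, ?_⟩, fun h2 => h2.1⟩ rfl rfl
      rw [h1, h2]
    · rw [if_neg h1, mul_zero, Real.sqrt_zero, if_neg]
      · simp
      · rintro ⟨h2, h3⟩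
        exact h1 (by rw [h3, h2])

theorem normed_push (h : S.Rep Φ rec) (hN : S.Normed Φ rec) {r : ℕ} {a : List ℤ → List ℤ} :
    (S.push r a).Normed Φ fun f => rec f ++ a (rec f) := by
  intro w
  simp only [Store.push, Store.branch, eq_append_iff_take_drop (h.reclen _)]
  by_cases h1 : w.drop S.width = a (w.take S.width)
  · rw [if_pos h1, mul_one, hN]
    refine tsum_congr fun f => if_congr ⟨fun h2 => ⟨h2, ?_⟩, fun h2 => h2.1⟩ rfl rfl
    rw [h1, h2]
  · rw [if_neg h1, mul_zero]
    rw [tsum_congr (g := fun _ => (0 : ℝ)), tsum_zero]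
    intro f
    rw [if_neg]
    rintro ⟨h2, h3⟩
    exact h1 (by rw [h3, h2])

theorem measProb_nonneg (obs : Basis → List ℤ) (ψ : State) (o : List ℤ) :
    0 ≤ measProb obs ψ o :=
  tsum_nonneg fun f => by split <;> positivity

theorem measure (h : S.Rep Φ rec) (hΦ : SqSummable Φ) {G : List ℤ → Bool} {r : ℕ}
    {obs : Basis → List ℤ} (hr : ∀ f, (obs f).length = r) :
    (S.measure G r obs).Rep Φ fun f =>
      rec f ++ if G (rec f) then obs f else List.replicate r 0 where
  nonneg w := by
    simp only [Store.measure, Store.branch]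
    refine mul_nonneg (h.nonneg _) ?_
    split
    · exact measProb_nonneg _ _ _
    · dsimp only
      split <;> norm_num
  len w hw := by
    simp only [Store.measure, Store.branch, ne_eq, mul_eq_zero, not_or] at hw ⊢
    have h2 : (w.drop S.width).length = r := by
      by_cases hG : G (w.take S.width) = true
      · rw [if_pos hG] at hw
        by_contra hne
        refine hw.2 ?_
        have : ∀ f, obs f ≠ w.drop S.width := fun f hf => hne (by rw [← hf, hr])
        simp [measProb, this]
      · rw [if_neg hG] at hw
        by_contra hne
        refine hw.2 ?_
        simp only [ite_eq_right_iff, one_ne_zero, imp_false]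
        intro he
        exact hne (by rw [he, List.length_replicate])
    rw [← h.len _ hw.1, ← h2, ← List.length_append, List.take_append_drop]
  reclen f := by
    have : (if G (rec f) = true then obs f else List.replicate r 0).length = r := by
      split <;> simp [hr]
    simp [Store.measure, Store.branch, h.reclen, this]
  amp w f := by
    simp only [Store.measure, Store.branch, eq_append_iff_take_drop (h.reclen f)]
    by_cases hG : G (w.take S.width) = true
    · rw [if_pos hG]
      dsimp only [collapse]
      by_cases ho : obs f = w.drop S.width
      · rw [if_pos ho]
        have e : (if w.take S.width = rec f ∧
            w.drop S.width = (if G (rec f) = true then obs f else List.replicate r 0) then Φ f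
            else 0) = ((√(S.wt (w.take S.width)) : ℝ) : ℂ) * S.st (w.take S.width) f := by
          rw [h.amp]
          refine if_congr ⟨fun h2 => h2.1, fun h2 => ⟨h2, ?_⟩⟩ rfl rfl
          rw [← h2, if_pos hG, ho]
        rw [e]
        by_cases h0 : S.wt (w.take S.width) = 0
        · simp [h0]
        rw [Real.sqrt_mul (h.nonneg _)]
        by_cases hp : measProb obs (S.st (w.take S.width)) (w.drop S.width) = 0
        · have hs := summable_ite (h.sqSummable_st hΦ h0) (fun f => obs f = w.drop S.width)
          have hs' := hs.hasSum
          rw [show (∑' f, if obs f = w.drop S.width then ‖S.st (w.take S.width) f‖ ^ 2 else 0) = 0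
            from hp] at hs'
          have h2 := (hasSum_zero_iff_of_nonneg (fun f => by
            split <;> positivity)).1 hs'
          have h3 := congrFun h2 f
          simp only [ho, if_true, Pi.zero_apply] at h3
          have h4 : S.st (w.take S.width) f = 0 := by simpa using h3
          simp [h4]
        · have hp' : ((√(measProb obs (S.st (w.take S.width)) (w.drop S.width)) : ℝ) : ℂ) ≠ 0 := by
            rw [Complex.ofReal_ne_zero]
            exact (Real.sqrt_pos.2 (lt_of_le_of_ne (measProb_nonneg _ _ _) (Ne.symm hp))).ne'
          push_cast
          field_simp
      · rw [if_neg ho, mul_zero, if_neg]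
        rintro ⟨h2, h3⟩
        rw [← h2, if_pos hG] at h3
        exact ho h3.symm
    · rw [if_neg hG]
      dsimp only
      by_cases h1 : w.drop S.width = List.replicate r 0
      · rw [if_pos h1, mul_one, h.amp]
        refine if_congr ⟨fun h2 => ⟨h2, ?_⟩, fun h2 => h2.1⟩ rfl rfl
        rw [← h2, if_neg hG, h1]
      · rw [if_neg h1, mul_zero, Real.sqrt_zero, if_neg]
        · simp
        · rintro ⟨h2, h3⟩
          rw [← h2, if_neg hG] at h3
          exact h1 h3

theorem normed_measure (h : S.Rep Φ rec) {G : List ℤ → Bool} {r : ℕ} {obs : Basis → List ℤ}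
    (hN : ∀ v, G v = false → S.wt v = ∑' f, if v = rec f then ‖Φ f‖ ^ 2 else 0) :
    (S.measure G r obs).Normed Φ fun f =>
      rec f ++ if G (rec f) then obs f else List.replicate r 0 := by
  intro w
  simp only [Store.measure, Store.branch, eq_append_iff_take_drop (h.reclen _)]
  by_cases hG : G (w.take S.width) = true
  · rw [if_pos hG]
    dsimp only [measProb]
    rw [← tsum_mul_left]
    refine tsum_congr fun f => ?_
    rw [mul_ite, mul_zero, h.sq_amp]
    by_cases h1 : w.take S.width = rec f
    · rw [← h1, if_pos hG]
      simp [eq_comm]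
    · simp [h1]
  · rw [if_neg hG]
    dsimp only
    by_cases h1 : w.drop S.width = List.replicate r 0
    · rw [if_pos h1, mul_one, hN _ (by simpa using hG)]
      refine tsum_congr fun f => if_congr ⟨fun h2 => ⟨h2, ?_⟩, fun h2 => h2.1⟩ rfl rfl
      rw [← h2, if_neg hG, h1]
    · rw [if_neg h1, mul_zero, tsum_congr (g := fun _ => (0 : ℝ)), tsum_zero]
      intro f
      rw [if_neg]
      rintro ⟨h2, h3⟩
      rw [← h2, if_neg hG] at h3
      exact h1 h3

theorem outProb_eq (hN : S.Normed Φ rec) (hΦ : SqSummable Φ) (vs : List Val)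
    (w : List ℤ) :
    S.outProb vs w = ∑' f, if numbersOf vs (rec f) = w then ‖Φ f‖ ^ 2 else 0 := by
  rw [← tsum_tsum_fiber (summable_ite hΦ _) rec, Store.outProb]
  refine tsum_congr fun v => ?_
  by_cases h1 : numbersOf vs v = w
  · rw [if_pos h1, hN v]
    refine tsum_congr fun f => ?_
    by_cases h2 : v = rec f
    · simp [← h2, h1]
    · simp [h2]
  · rw [if_neg h1, tsum_congr (g := fun _ => (0 : ℝ)), tsum_zero]
    intro f
    by_cases h2 : v = rec f
    · simp [← h2, h1]
    · simp [h2]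

theorem outBranch (h : S.Rep Φ rec) {vs : List Val} {w : List ℤ} (hp : 0 < S.outProb vs w) :
    (S.outBranch vs w).Rep
      (fun f => if numbersOf vs (rec f) = w then Φ f / (√(S.outProb vs w) : ℝ) else 0) rec where
  nonneg v := by
    simp only [Store.outBranch]
    split
    · exact div_nonneg (h.nonneg v) hp.le
    · exact le_rfl
  len v hv := by
    simp only [Store.outBranch, ne_eq, ite_eq_right_iff, div_eq_zero_iff, Classical.not_imp,
      not_or] at hv
    exact h.len v hv.2.1
  reclen := h.reclen
  amp v f := by
    simp only [Store.outBranch]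
    by_cases h1 : numbersOf vs v = w
    · rw [if_pos h1, Real.sqrt_div (h.nonneg v), Complex.ofReal_div, div_mul_eq_mul_div, h.amp]
      by_cases h2 : v = rec f
      · simp [← h2, h1]
      · simp [h2]
    · rw [if_neg h1]
      by_cases h2 : v = rec f
      · simp [← h2, h1]
      · simp [h2]

theorem normed_outBranch (hN : S.Normed Φ rec) {vs : List Val} {w : List ℤ}
    (hp : 0 < S.outProb vs w) :
    (S.outBranch vs w).Normed
      (fun f => if numbersOf vs (rec f) = w then Φ f / (√(S.outProb vs w) : ℝ) else 0) rec := by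
  intro v
  simp only [Store.outBranch]
  by_cases h1 : numbersOf vs v = w
  · rw [if_pos h1, hN v, ← tsum_div_const]
    refine tsum_congr fun f => ?_
    by_cases h2 : v = rec f
    · rw [if_pos h2, if_pos h2, ← h2, if_pos h1, norm_div, div_pow, Complex.norm_real,
        Real.norm_eq_abs, sq_abs, Real.sq_sqrt hp.le]
    · simp [h2]
  · rw [if_neg h1, tsum_congr (g := fun _ => (0 : ℝ)), tsum_zero]
    intro f
    by_cases h2 : v = rec f
    · simp [← h2, h1]
    · simp [h2]

end Rep

end Store

/-! ### Reduced states -/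

theorem place_apply_of_notMem {x : QName} {env : List QName} (a : List ℕ) (hx : x ∉ env) :
    place env a x = 0 := by
  induction env generalizing a with
  | nil => simp [place]
  | cons y env ih =>
    simp only [List.mem_cons, not_or] at hx
    cases a with
    | nil => simp [place]
    | cons n a =>
      have := ih a hx.2
      simp only [place] at this ⊢
      simp [this, Ne.symm hx.1]

open Classical in
/-- The matrix element of the reduced operator of the systems `L` in the part `D` of the state
`Φ`. -/
noncomputable def reduced (Φ : State) (D : Basis → Prop) (L : List QName) (a b : Basis) : ℂ :=
  ∑' f, if (∀ x ∈ L, f x = 0) ∧ D f then Φ (f + a) * (starRingEnd ℂ) (Φ (f + b)) else 0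

theorem Store.Rep.rhoE_eq {S : Store} {Φ : State} {rec : Basis → List ℤ} (h : S.Rep Φ rec)
    (hΦ : SqSummable Φ) (hrec : ∀ f p : Basis, (∀ x, x ∉ S.env → p x = 0) → rec (f + p) = rec f)
    (a b : List ℕ) :
    S.rhoE a b = if a.length = S.env.length ∧ b.length = S.env.length then
      reduced Φ (fun _ => True) S.env (place S.env a) (place S.env b) else 0 := by
  rw [Store.rhoE]
  refine if_congr Iff.rfl ?_ rfl
  have hs := summable_ite ((hΦ.shift (place S.env a)).mul_conj (hΦ.shift (place S.env b)))
    (fun f => ∀ x ∈ S.env, f x = 0)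
  have ra : ∀ f, rec (f + place S.env a) = rec f := fun f =>
    hrec f _ fun x hx => place_apply_of_notMem a hx
  have rb : ∀ f, rec (f + place S.env b) = rec f := fun f =>
    hrec f _ fun x hx => place_apply_of_notMem b hx
  simp only [reduced, and_true]
  rw [tsum_congr_decidable, ← tsum_tsum_fiber hs rec]
  refine tsum_congr fun v => ?_
  rw [← tsum_mul_left]
  refine tsum_congr fun f => ?_
  by_cases h1 : ∀ x ∈ S.env, f x = 0
  · rw [if_pos h1, if_pos h1]
    have hw : ((S.wt v : ℝ) : ℂ) = ((√(S.wt v) : ℝ) : ℂ) * (√(S.wt v) : ℝ) := by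
      rw [← Complex.ofReal_mul, Real.mul_self_sqrt (h.nonneg v)]
    have e1 := h.amp v (f + place S.env a)
    have e2 := congrArg (starRingEnd ℂ) (h.amp v (f + place S.env b))
    rw [map_mul, Complex.conj_ofReal] at e2
    rw [hw, mul_mul_mul_comm, e1, e2, ra, rb]
    split <;> simp
  · rw [if_neg h1, if_neg h1]
    simp
where
  tsum_congr_decidable {F : Basis → ℂ} {p : Basis → Prop} [DecidablePred p]
      {i : DecidablePred p} : (∑' f, @ite _ (p f) (i f) (F f) 0) = ∑' f, if p f then F f else 0 :=
    tsum_congr fun f => by congr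

/-! ### Classical expressions -/

/-- A number, or a slot below `w`. -/
def Val.IsData (w : ℕ) : Val → Prop
  | .int _ => True
  | .slot k => k < w
  | _ => False

/-- Expressions of one number that only use data operations. -/
def Expr.IsData (w : ℕ) : Expr → Prop
  | .vals vs => ∃ b, vs = [b] ∧ b.IsData w
  | .op _ e e' => e.IsData w ∧ e'.IsData w
  | .ite b e e' => b.IsData w ∧ e.IsData w ∧ e'.IsData w
  | _ => False

/-- The value of an expression which only uses data operations. -/
def Expr.den : Expr → List ℤ → ℤ
  | .vals vs, v => (vs.headD (.int 0)).at v
  | .op o e e', v => o.eval (e.den v) (e'.den v)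
  | .ite b e e', v => if b.den v ≠ 0 then e.den v else e'.den v
  | _, _ => 0

/-- The number of operations in an expression. -/
def Expr.size : Expr → ℕ
  | .vals _ => 0
  | .op _ e e' => e.size + e'.size + 1
  | .ite b e e' => b.size + e.size + e'.size + 1
  | _ => 1

theorem Val.IsData.isClassical {w : ℕ} {b : Val} (h : b.IsData w) : b.isClassical = true := by
  cases b <;> first | rfl | exact h.elim

theorem Val.IsData.mono {w w' : ℕ} (hw : w ≤ w') {b : Val} (h : b.IsData w) : b.IsData w' := by
  cases b <;> first | exact h.elim | trivial | exact lt_of_lt_of_le h hw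

theorem Val.IsData.at_append {w : ℕ} {b : Val} (h : b.IsData w) {v : List ℤ} (hv : v.length = w)
    (o : List ℤ) : b.at (v ++ o) = b.at v := by
  cases b <;> try rfl
  exact List.getD_append _ _ _ _ (hv ▸ h)

namespace Expr

theorem den_ite (b e e' : Expr) (v : List ℤ) :
    (ite b e e').den v = if b.den v ≠ 0 then e.den v else e'.den v := rfl

theorem IsData.mono {w w' : ℕ} (hw : w ≤ w') {e : Expr} (h : e.IsData w) : e.IsData w' := by
  induction e with
  | vals vs => obtain ⟨b, rfl, hb⟩ := h; exact ⟨b, rfl, hb.mono hw⟩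
  | measure => exact h.elim
  | apply => exact h.elim
  | op o e e' ih ih' => exact ⟨ih h.1, ih' h.2⟩
  | ite b e e' ih ih' ih'' => exact ⟨ih h.1, ih' h.2.1, ih'' h.2.2⟩

theorem IsData.den_append {w : ℕ} {e : Expr} (h : e.IsData w) {v : List ℤ} (hv : v.length = w)
    (o : List ℤ) : e.den (v ++ o) = e.den v := by
  induction e with
  | vals vs => obtain ⟨b, rfl, hb⟩ := h; exact hb.at_append hv o
  | measure => exact h.elim
  | apply => exact h.elim
  | op o e e' ih ih' => simp only [den, ih h.1, ih' h.2]
  | ite b e e' ih ih' ih'' => simp only [den, ih h.1, ih' h.2.1, ih'' h.2.2]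

/-- Evaluation steps of data expressions extend the record and preserve the value. -/
theorem IsData.step {G S e S' e'} (h : EStep G S e S' e') (he : e.IsData S.width) :
    ∃ a : List ℤ → List ℤ, S' = S.push 1 a ∧ (∀ v, (a v).length = 1) ∧
      e'.IsData (S.width + 1) ∧ (∀ v, v.length = S.width → e'.den (v ++ a v) = e.den v) ∧
      e'.size < e.size := by
  induction h with
  | measureNS => exact he.elim
  | measureQb => exact he.elim
  | apply => exact he.elim
  | op o a b ha hb =>
    refine ⟨_, rfl, fun _ => rfl, ⟨_, rfl, by simp [Val.IsData]⟩, fun v hv => ?_, by simp [size]⟩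
    simp [den, Store.newSlots, Val.at, List.getD, ← hv]
  | opLeft o e₂ _ ih =>
    obtain ⟨a, rfl, ha, h1, h2, h3⟩ := ih he.1
    refine ⟨a, rfl, ha, ⟨h1, he.2.mono (Nat.le_succ _)⟩, fun v hv => ?_, by simp [size]; omega⟩
    simp only [den, h2 v hv, he.2.den_append hv]
  | opRight o vs _ ih =>
    obtain ⟨a, rfl, ha, h1, h2, h3⟩ := ih he.2
    refine ⟨a, rfl, ha, ⟨he.1.mono (Nat.le_succ _), h1⟩, fun v hv => ?_, by simp [size]; omega⟩
    exact congrArg₂ o.eval (he.1.den_append hv _) (h2 v hv)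
  | iteCond e₁ e₂ _ ih =>
    obtain ⟨a, rfl, ha, h1, h2, h3⟩ := ih he.1
    refine ⟨a, rfl, ha, ⟨h1, he.2.1.mono (Nat.le_succ _), he.2.2.mono (Nat.le_succ _)⟩,
      fun v hv => ?_, by simp [size]; omega⟩
    rw [den_ite, den_ite, h2 v hv, he.2.1.den_append hv, he.2.2.den_append hv]
  | iteThen b e₂ _ _ ih =>
    obtain ⟨a, rfl, ha, h1, h2, h3⟩ := ih he.2.1
    refine ⟨a, rfl, ha, ⟨he.1.mono (Nat.le_succ _), h1, he.2.2.mono (Nat.le_succ _)⟩,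
      fun v hv => ?_, by simp [size]; omega⟩
    rw [den_ite, den_ite, h2 v hv, he.1.den_append hv, he.2.2.den_append hv]
  | iteElse b xs _ _ ih =>
    obtain ⟨a, rfl, ha, h1, h2, h3⟩ := ih he.2.2
    refine ⟨a, rfl, ha, ⟨he.1.mono (Nat.le_succ _), he.2.1.mono (Nat.le_succ _), h1⟩,
      fun v hv => ?_, by simp [size]; omega⟩
    rw [den_ite, den_ite, h2 v hv, he.1.den_append hv, he.2.1.den_append hv]
  | ite b xs ys _ _ _ _ =>
    obtain ⟨_, ⟨x, rfl, _⟩, ⟨y, rfl, _⟩⟩ := he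
    refine ⟨_, rfl, fun v => ?_, ⟨_, rfl, by simp [Val.IsData]⟩, fun v hv => ?_, by simp [size]⟩
    · split <;> rfl
    · have h1 : ∀ x : ℤ, (v ++ [x]).getD v.length 0 = x := fun x => by simp [List.getD]
      rw [den_ite]
      simp only [den, Store.newSlots, List.length_cons, List.length_nil, ← hv]
      by_cases hb : b.at v = 0
      · simp only [List.headD_cons, hb, ne_eq, not_true_eq_false, if_false]
        exact h1 _
      · simp only [List.headD_cons, hb, ne_eq, not_false_eq_true, if_true]
        exact h1 _

theorem IsData.progress {w : ℕ} {e : Expr} (he : e.IsData w) :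
    (∃ b, e = .vals [b] ∧ b.IsData w) ∨ ∀ G S, ∃ S' e', EStep G S e S' e' := by
  induction e with
  | vals vs => obtain ⟨b, rfl, hb⟩ := he; exact .inl ⟨b, rfl, hb⟩
  | measure => exact he.elim
  | apply => exact he.elim
  | op o e e' ih ih' =>
    right
    intro G S
    rcases ih he.1 with ⟨b, rfl, hb⟩ | h
    · rcases ih' he.2 with ⟨b', rfl, hb'⟩ | h
      · exact ⟨_, _, .op _ _ _ hb.isClassical hb'.isClassical⟩
      · obtain ⟨S', e'', h⟩ := h G S
        exact ⟨_, _, .opRight _ _ h⟩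
    · obtain ⟨S', e'', h⟩ := h G S
      exact ⟨_, _, .opLeft _ _ h⟩
  | ite b e e' ih ih' ih'' =>
    right
    intro G S
    rcases ih he.1 with ⟨b, rfl, hb⟩ | h
    · rcases ih' he.2.1 with ⟨b', rfl, hb'⟩ | h
      · rcases ih'' he.2.2 with ⟨b'', rfl, hb''⟩ | h
        · exact ⟨_, _, .ite _ _ _ hb.isClassical rfl (by simp [hb'.isClassical])
            (by simp [hb''.isClassical])⟩
        · obtain ⟨S', e'', h⟩ := h (fun v => G v && decide (b.at v = 0)) S
          exact ⟨_, _, .iteElse _ _ hb.isClassical h⟩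
      · obtain ⟨S', e'', h⟩ := h (fun v => G v && decide (b.at v ≠ 0)) S
        exact ⟨_, _, .iteThen _ _ hb.isClassical h⟩
    · obtain ⟨S', e'', h⟩ := h G S
      exact ⟨_, _, .iteCond _ _ h⟩

end Expr

/-! ### Updates of basis states -/

theorem update_add_single {f : Basis} {s : QName} (p : Basis) (h : p s = 0) (i : ℕ) :
    (f + p).update s i = f.update s i + p := by
  ext x
  by_cases hx : x = s
  · subst hx; simp [h]
  · simp [Finsupp.update_apply, hx]

theorem update_comm' {f : Basis} {s t : QName} (h : s ≠ t) (i j : ℕ) :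
    (f.update s i).update t j = (f.update t j).update s i := by
  ext x
  simp only [Finsupp.update_apply]
  split_ifs with h1 h2
  · exact absurd (h2.symm.trans h1) h
  all_goals rfl

theorem update_same (f : Basis) (s : QName) (i : ℕ) : f.update s i s = i := by
  simp [Finsupp.update_apply]

theorem update_ne (f : Basis) {s x : QName} (h : x ≠ s) (i : ℕ) : f.update s i x = f x := by
  simp [Finsupp.update_apply, h]

/-! ### Linearity of the operators -/

theorem pairAct_smul (A : ℕ × ℕ → ℕ × ℕ → ℂ) (s t : QName) (c : ℂ) (φ : State) :
    pairAct A s t (fun f => c * φ f) = fun f => c * pairAct A s t φ f := by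
  funext f
  simp only [pairAct, Finset.mul_sum]
  exact Finset.sum_congr rfl fun _ _ => by ring

theorem psAct_smul (q s t : QName) (c : ℂ) (φ : State) :
    psAct q s t (fun f => c * φ f) = fun f => c * psAct q s t φ f := by
  funext f
  simp only [psAct]
  split_ifs <;> simp

theorem czAct_smul (s₀ s₁ s₂ s₃ : QName) (c : ℂ) (φ : State) :
    czAct s₀ s₁ s₂ s₃ (fun f => c * φ f) = fun f => c * czAct s₀ s₁ s₂ s₃ φ f := by
  funext f
  simp only [czAct]
  ring

theorem qubitAct_smul (U : Matrix (Fin 2) (Fin 2) ℂ) (q : QName) (c : ℂ) (φ : State) :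
    qubitAct U q (fun f => c * φ f) = fun f => c * qubitAct U q φ f := by
  funext f
  simp only [qubitAct]
  split_ifs
  · rw [Finset.mul_sum]
    exact Finset.sum_congr rfl fun _ _ => by ring
  · simp

/-- Multiplication with a function of the basis state which does not depend on `s` and `t`. -/
theorem pairAct_mul (A : ℕ × ℕ → ℕ × ℕ → ℂ) {s t : QName} {m : Basis → ℂ}
    (hm : ∀ f i j, m ((f.update s i).update t j) = m f) (φ : State) :
    pairAct A s t (fun f => m f * φ f) = fun f => m f * pairAct A s t φ f := by
  funext f
  simp only [pairAct, Finset.mul_sum, hm]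
  exact Finset.sum_congr rfl fun _ _ => by ring

theorem pairAct_mask (A : ℕ × ℕ → ℕ × ℕ → ℂ) {s t : QName} {rec : Basis → List ℤ}
    (hr : ∀ f i j, rec ((f.update s i).update t j) = rec f) (v : List ℤ) (φ : State) :
    pairAct A s t (fun f => if v = rec f then φ f else 0) =
      fun f => if v = rec f then pairAct A s t φ f else 0 := by
  have := pairAct_mul A (m := fun f => if v = rec f then 1 else 0) (s := s) (t := t)
    (fun f i j => by simp only [hr]) φ
  simpa using this

theorem map_mask_of_const {U : State → State} (hU : U (fun _ => 0) = fun _ => 0)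
    {rec : Basis → List ℤ} (hr : ∀ f f', rec f = rec f') (v : List ℤ) (φ : State) :
    U (fun f => if v = rec f then φ f else 0) = fun f => if v = rec f then U φ f else 0 := by
  by_cases h : v = rec 0
  · simp [hr _ 0, ← h]
  · simp [hr _ 0, h, hU]

theorem psAct_zero (q s t : QName) : psAct q s t (fun _ => 0) = fun _ => 0 := by
  funext f; simp [psAct]

theorem czAct_zero (s₀ s₁ s₂ s₃ : QName) : czAct s₀ s₁ s₂ s₃ (fun _ => 0) = fun _ => 0 := by
  funext f; simp [czAct]

theorem qubitAct_zero (U : Matrix (Fin 2) (Fin 2) ℂ) (q : QName) :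
    qubitAct U q (fun _ => 0) = fun _ => 0 := by
  funext f; simp [qubitAct]

/-! ### Operators on different systems commute -/

theorem pairAct_shift (A : ℕ × ℕ → ℕ × ℕ → ℂ) {s t : QName} {p : Basis} (hs : p s = 0)
    (ht : p t = 0) (φ : State) (f : Basis) :
    pairAct A s t φ (f + p) = pairAct A s t (fun f => φ (f + p)) f := by
  simp [pairAct, hs, ht, update_add_single]

theorem pairAct_comm (A B : ℕ × ℕ → ℕ × ℕ → ℂ) {s t u v : QName} (h1 : s ≠ u) (h2 : s ≠ v)
    (h3 : t ≠ u) (h4 : t ≠ v) (φ : State) :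
    pairAct A s t (pairAct B u v φ) = pairAct B u v (pairAct A s t φ) := by
  funext f
  simp only [pairAct, Finset.mul_sum]
  rw [Finset.sum_congr rfl (g := fun i => ∑ j ∈ Finset.HasAntidiagonal.antidiagonal (f u + f v),
    A i (f s, f t) * (B j (f u, f v) *
      φ ((((f.update s i.1).update t i.2).update u j.1).update v j.2)))]
  · rw [Finset.sum_comm]
    refine Finset.sum_congr rfl fun j _ => ?_
    rw [update_ne _ h2, update_ne _ h1, update_ne _ h4, update_ne _ h3]
    refine Finset.sum_congr rfl fun i _ => ?_
    rw [update_comm' h3, update_comm' h1, update_comm' h4, update_comm' h2]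
    ring
  · intro i _
    rw [update_ne _ h3.symm, update_ne _ h1.symm, update_ne _ h4.symm, update_ne _ h2.symm]

theorem psAct_pairAct (B : ℕ × ℕ → ℕ × ℕ → ℂ) {q s t u v : QName} (h1 : s ≠ u) (h2 : s ≠ v)
    (h3 : t ≠ u) (h4 : t ≠ v) (h5 : q ≠ u) (h6 : q ≠ v) (φ : State) :
    psAct q s t (pairAct B u v φ) = pairAct B u v (psAct q s t φ) := by
  funext f
  simp only [psAct, pairAct]
  simp only [update_ne _ h1, update_ne _ h2, update_ne _ h3, update_ne _ h4, update_ne _ h5,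
    update_ne _ h6, update_ne _ h1.symm, update_ne _ h2.symm, update_ne _ h3.symm,
    update_ne _ h4.symm, update_ne _ h5.symm, update_ne _ h6.symm]
  split_ifs
  · refine Finset.sum_congr rfl fun i _ => ?_
    rw [update_comm' h3, update_comm' h1, update_comm' h4, update_comm' h2]
  · refine Finset.sum_congr rfl fun i _ => ?_
    rw [update_comm' h5, update_comm' h3, update_comm' h1, update_comm' h6, update_comm' h4,
      update_comm' h2]
  · simp

theorem psAct_comm {q s t q' s' t' : QName} (h1 : q ≠ q') (h2 : q ≠ s') (h3 : q ≠ t')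
    (h4 : s ≠ q') (h5 : s ≠ s') (h6 : s ≠ t') (h7 : t ≠ q') (h8 : t ≠ s') (h9 : t ≠ t')
    (φ : State) : psAct q s t (psAct q' s' t' φ) = psAct q' s' t' (psAct q s t φ) := by
  funext f
  simp only [psAct]
  simp only [update_ne _ h1, update_ne _ h2, update_ne _ h3, update_ne _ h4, update_ne _ h5,
    update_ne _ h6, update_ne _ h7, update_ne _ h8, update_ne _ h9, update_ne _ h1.symm,
    update_ne _ h2.symm, update_ne _ h3.symm, update_ne _ h4.symm, update_ne _ h5.symm,
    update_ne _ h6.symm, update_ne _ h7.symm, update_ne _ h8.symm, update_ne _ h9.symm]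
  split_ifs <;> first
    | rfl
    | (congr 1
       ext x
       simp only [Finsupp.update_apply]
       split_ifs <;> simp_all)

/-! ### Square summability -/

theorem SqSummable.add {Φ Φ' : State} (h : SqSummable Φ) (h' : SqSummable Φ') :
    SqSummable fun f => Φ f + Φ' f := by
  refine Summable.of_nonneg_of_le (fun f => by positivity) (fun f => ?_)
    ((Summable.add h h').mul_left 2)
  have := norm_add_le (Φ f) (Φ' f)
  have h2 : ‖Φ f + Φ' f‖ ^ 2 ≤ (‖Φ f‖ + ‖Φ' f‖) ^ 2 := by gcongr
  nlinarith [sq_nonneg (‖Φ f‖ - ‖Φ' f‖)]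

theorem SqSummable.const_mul {Φ : State} (h : SqSummable Φ) (c : ℂ) :
    SqSummable fun f => c * Φ f := by
  refine (Summable.mul_left (‖c‖ ^ 2) h).congr fun f => ?_
  rw [norm_mul, mul_pow]

theorem sqSummable_zero : SqSummable fun _ => 0 := by
  simp [SqSummable, summable_zero]

theorem sqSummable_sum {ι : Type*} (I : Finset ι) {Φ : ι → State} (h : ∀ i ∈ I, SqSummable (Φ i)) :
    SqSummable fun f => ∑ i ∈ I, Φ i f := by
  classical
  induction I using Finset.induction_on with
  | empty => simpa using sqSummable_zero
  | insert i I hi ih =>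
    simp only [Finset.sum_insert hi]
    exact (h i (by simp)).add (ih fun j hj => h j (by simp [hj]))

theorem SqSummable.mask {Φ : State} (h : SqSummable Φ) (p : Basis → Prop) [DecidablePred p] :
    SqSummable fun f => if p f then Φ f else 0 :=
  h.of_le fun f => by split <;> simp

theorem SqSummable.update {Φ : State} (h : SqSummable Φ) (s : QName) (k i : ℕ) :
    SqSummable fun f => if f s = k then Φ (f.update s i) else 0 := by
  have hinj : Function.Injective fun f : {f : Basis // f s = k} => f.1.update s i := by
    rintro ⟨f, hf⟩ ⟨g, hg⟩ he
    ext x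
    by_cases hx : x = s
    · rw [hx]; exact hf.trans hg.symm
    · have := DFunLike.congr_fun he x
      simpa [Finsupp.update_apply, hx] using this
  have h0 : Summable fun f => ‖Φ f‖ ^ 2 := h
  have h1 : Summable fun f : {f : Basis // f s = k} => ‖Φ (f.1.update s i)‖ ^ 2 :=
    h0.comp_injective hinj
  have h2 := (Function.Injective.summable_iff (f := fun f => ‖if f s = k then Φ (f.update s i) else 0‖ ^ 2)
    (Subtype.val_injective (p := fun f : Basis => f s = k)) (fun f hf => ?_)).1
    (h1.congr fun f => ?_)
  · exact h2
  · rw [if_neg fun h => hf ⟨⟨f, h⟩, rfl⟩]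
    simp
  · simp only [Function.comp_apply, if_pos f.2]

/-- Square summable states with bounded occupation numbers of the systems in `Y`. -/
def Tame (Y : Set QName) (Φ : State) : Prop :=
  SqSummable Φ ∧ ∃ M, ∀ f, Φ f ≠ 0 → ∀ x ∈ Y, f x ≤ M

theorem pairAct_support {A : ℕ × ℕ → ℕ × ℕ → ℂ} {s t : QName} {φ : State} {f : Basis}
    (h : pairAct A s t φ f ≠ 0) : ∃ i j, i + j = f s + f t ∧ A (i, j) (f s, f t) ≠ 0 ∧
      φ ((f.update s i).update t j) ≠ 0 := by
  obtain ⟨i, hi, h1⟩ := Finset.exists_ne_zero_of_sum_ne_zero h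
  exact ⟨i.1, i.2, Finset.HasAntidiagonal.mem_antidiagonal.1 hi, left_ne_zero_of_mul h1, right_ne_zero_of_mul h1⟩

theorem Tame.pairAct {Y : Set QName} {Φ : State} (h : Tame Y Φ) (A : ℕ × ℕ → ℕ × ℕ → ℂ)
    {s t : QName} (hs : s ∈ Y) (ht : t ∈ Y) (hst : s ≠ t) : Tame Y (pairAct A s t Φ) := by
  obtain ⟨h1, M, hM⟩ := h
  have hb : ∀ f, CQP.pairAct A s t Φ f ≠ 0 → f s + f t ≤ 2 * M := by
    intro f hf
    obtain ⟨i, j, hij, -, h2⟩ := pairAct_support hf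
    have hi := hM _ h2 s hs
    have hj := hM _ h2 t ht
    rw [update_ne _ hst, update_same] at hi
    rw [update_same] at hj
    omega
  constructor
  · let I := Finset.range (2 * M + 1)
    have h3 : SqSummable fun f => ∑ k ∈ I, ∑ l ∈ I, ∑ i ∈ Finset.HasAntidiagonal.antidiagonal (k + l),
        A i (k, l) * if f t = l then (if (f.update t i.2) s = k then
          Φ ((f.update t i.2).update s i.1) else 0) else 0 :=
      sqSummable_sum _ fun k _ => sqSummable_sum _ fun l _ => sqSummable_sum _ fun i _ =>
        ((h1.update s k i.1).update t l i.2).const_mul _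
    refine h3.of_le fun f => le_of_eq ?_
    by_cases hst2 : f s ∈ I ∧ f t ∈ I
    · rw [Finset.sum_eq_single (f s), Finset.sum_eq_single (f t)]
      · simp only [CQP.pairAct, if_true, update_ne _ hst, update_comm' hst]
      · intro l _ hl
        simp [hl.symm]
      · exact fun h => absurd hst2.2 h
      · intro k _ hk
        simp [update_ne _ hst, hk.symm]
      · exact fun h => absurd hst2.1 h
    · have hf : CQP.pairAct A s t Φ f = 0 := by
        by_contra hf
        have := hb f hf
        exact hst2 ⟨Finset.mem_range.2 (by omega), Finset.mem_range.2 (by omega)⟩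
      rw [hf, Finset.sum_eq_zero]
      intro k hk
      rw [Finset.sum_eq_zero]
      intro l hl
      rw [Finset.sum_eq_zero]
      intro i _
      rw [update_ne _ hst]
      split_ifs with h4 h5
      · exact absurd ⟨h5 ▸ hk, h4 ▸ hl⟩ hst2
      · simp
      · simp
  · refine ⟨2 * M, fun f hf x hx => ?_⟩
    have h2 := hb f hf
    by_cases hxs : x = s
    · subst hxs; omega
    by_cases hxt : x = t
    · subst hxt; omega
    obtain ⟨i, j, -, -, h3⟩ := pairAct_support hf
    have := hM _ h3 x hx
    rw [update_ne _ hxt, update_ne _ hxs] at this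
    omega

theorem Tame.psAct {Y : Set QName} {Φ : State} (h : Tame Y Φ) {q s t : QName} (hq : q ∉ Y)
    (hqs : q ≠ s) (hqt : q ≠ t) (hst : s ≠ t) : Tame Y (psAct q s t Φ) := by
  obtain ⟨h1, M, hM⟩ := h
  constructor
  · have e1 := ((((h1.update t 0 0).update s 1 0)).mask (fun f => f q = 0))
    have e2 := (((((h1.update q 0 1).update t 1 0)).update s 0 0))
    refine (e1.add e2).of_le fun f => le_of_eq ?_
    simp only [CQP.psAct, update_ne _ hst.symm, update_ne _ hqs, update_ne _ hqt]
    by_cases c1 : f q = 0 <;> by_cases c2 : f s = 1 <;> by_cases c3 : f t = 0 <;>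
      by_cases c4 : f s = 0 <;> by_cases c5 : f t = 1 <;> simp_all
  · refine ⟨M + 1, fun f hf x hx => ?_⟩
    have hxq : x ≠ q := fun e => hq (e ▸ hx)
    simp only [CQP.psAct] at hf
    split_ifs at hf with c1 c2
    · have := hM _ hf x hx
      by_cases hxs : x = s
      · subst hxs; omega
      by_cases hxt : x = t
      · subst hxt; omega
      rw [update_ne _ hxt, update_ne _ hxs] at this
      omega
    · have := hM _ hf x hx
      by_cases hxs : x = s
      · subst hxs; omega
      by_cases hxt : x = t
      · subst hxt; omega
      rw [update_ne _ hxq, update_ne _ hxt, update_ne _ hxs] at this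
      omega
    · exact absurd rfl hf

theorem Tame.czAct {Y : Set QName} {Φ : State} (h : Tame Y Φ) (s₀ s₁ s₂ s₃ : QName) :
    Tame Y (czAct s₀ s₁ s₂ s₃ Φ) := by
  obtain ⟨h1, M, hM⟩ := h
  refine ⟨h1.of_le fun f => ?_, M, fun f hf => hM f ?_⟩
  · simp only [CQP.czAct]
    split_ifs <;> simp
  · exact right_ne_zero_of_mul hf

theorem Tame.qubitAct {Y : Set QName} {Φ : State} (h : Tame Y Φ)
    (U : Matrix (Fin 2) (Fin 2) ℂ) (q : QName) : Tame Y (qubitAct U q Φ) := by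
  obtain ⟨h1, M, hM⟩ := h
  constructor
  · have h3 : SqSummable fun f => ∑ k : Fin 2, ∑ b : Fin 2,
        U k b * if f q = k.val then Φ (f.update q b.val) else 0 :=
      sqSummable_sum _ fun k _ => sqSummable_sum _ fun b _ => (h1.update q k b).const_mul _
    refine h3.of_le fun f => le_of_eq ?_
    simp only [CQP.qubitAct]
    symm
    split_ifs with hf
    · rw [Fintype.sum_eq_single (⟨f q, hf⟩ : Fin 2)]
      · simp
      · intro k hk
        have : f q ≠ k.val := fun e => hk (Fin.ext e.symm)
        simp only [if_neg this, mul_zero, Finset.sum_const_zero]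
    · rw [Finset.sum_eq_zero]
      intro k _
      have : f q ≠ k.val := fun e => hf (e ▸ k.2)
      simp only [if_neg this, mul_zero, Finset.sum_const_zero]
  · refine ⟨M + 2, fun f hf x hx => ?_⟩
    simp only [CQP.qubitAct] at hf
    split_ifs at hf with h2
    · obtain ⟨b, -, hb⟩ := Finset.exists_ne_zero_of_sum_ne_zero hf
      have := hM _ (right_ne_zero_of_mul hb) x hx
      by_cases hxq : x = q
      · subst hxq; omega
      · rw [update_ne _ hxq] at this
        omega
    · exact absurd rfl hf

/-! ### Sums over the basis states of some of the systems -/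

theorem summable_block {F : Basis → ℂ} (hF : Summable F) (K : Finset QName) (h : Basis) :
    Summable fun g : Basis => if ∀ x ∈ K, g x = 0 then F (g + h) else 0 := by
  exact summable_ite (hF.comp_injective (add_left_injective h)) _

/-- If the systems `K` can only be in the basis states `h i`, then a sum over basis states is one
over those of the other systems and a finite one. -/
theorem tsum_split {ι : Type*} [Fintype ι] (K : Finset QName) (h : ι → Basis)
    (hK : ∀ i, ∀ x ∉ K, h i x = 0) (hinj : Function.Injective h) {F : Basis → ℂ}
    (hF : Summable F) (hz : ∀ f, F f ≠ 0 → ∃ i, ∀ x ∈ K, f x = h i x) :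
    ∑' f, F f = ∑' g : Basis, if ∀ x ∈ K, g x = 0 then ∑ i, F (g + h i) else 0 := by
  classical
  have e1 : ∀ f, F f = ∑ i, if ∀ x ∈ K, f x = h i x then F f else 0 := by
    intro f
    by_cases hf : F f = 0
    · simp [hf]
    obtain ⟨i, hi⟩ := hz f hf
    rw [Fintype.sum_eq_single i, if_pos hi]
    intro j hj
    rw [if_neg]
    intro hj'
    refine hj (hinj ?_)
    ext x
    by_cases hx : x ∈ K
    · rw [← hj' x hx, ← hi x hx]
    · rw [hK j x hx, hK i x hx]
  have e2 : ∀ i, ∑' f, (if ∀ x ∈ K, f x = h i x then F f else 0) =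
      ∑' g : Basis, if ∀ x ∈ K, g x = 0 then F (g + h i) else 0 := by
    intro i
    rw [← (add_left_injective (h i)).tsum_eq]
    · refine tsum_congr fun g => if_congr (forall₂_congr fun x hx => ?_) rfl rfl
      simp
    · intro f hf
      simp only [Function.mem_support, ne_eq, ite_eq_right_iff, Classical.not_imp] at hf
      refine ⟨f - h i, tsub_add_cancel_of_le fun x => ?_⟩
      by_cases hx : x ∈ K
      · exact (hf.1 x hx).ge
      · rw [hK i x hx]; exact Nat.zero_le _
  rw [tsum_congr e1, Summable.tsum_finsetSum fun i _ => summable_ite hF _, Finset.sum_congr rfl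
    fun i _ => e2 i, ← Summable.tsum_finsetSum fun i _ => summable_block hF K (h i)]
  refine tsum_congr fun g => ?_
  split_ifs <;> simp

/-! ### Unitarity of the beam splitters -/

/-- The operator is an isometry for at most `M` photons. -/
def IsometricUpTo (M : ℕ) (A : ℕ × ℕ → ℕ × ℕ → ℂ) : Prop :=
  ∀ N ≤ M, ∀ i ∈ Finset.HasAntidiagonal.antidiagonal N, ∀ j ∈ Finset.HasAntidiagonal.antidiagonal N,
    ∑ o ∈ Finset.HasAntidiagonal.antidiagonal N, A i o * (starRingEnd ℂ) (A j o) =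
      if i = j then 1 else 0

theorem IsometricUpTo.inner {M : ℕ} {A : ℕ × ℕ → ℕ × ℕ → ℂ} (hA : IsometricUpTo M A) {N : ℕ}
    (hN : N ≤ M) (u u' : ℕ × ℕ → ℂ) :
    ∑ o ∈ Finset.HasAntidiagonal.antidiagonal N,
      (∑ i ∈ Finset.HasAntidiagonal.antidiagonal N, A i o * u i) *
        (starRingEnd ℂ) (∑ j ∈ Finset.HasAntidiagonal.antidiagonal N, A j o * u' j) =
      ∑ o ∈ Finset.HasAntidiagonal.antidiagonal N, u o * (starRingEnd ℂ) (u' o) := by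
  simp only [map_sum, Finset.sum_mul_sum, map_mul]
  rw [Finset.sum_comm]
  refine Finset.sum_congr rfl fun i hi => ?_
  rw [Finset.sum_comm]
  rw [Finset.sum_congr rfl (g := fun j => (if i = j then 1 else 0) * (u i * (starRingEnd ℂ) (u' j)))]
  · simp [hi]
  · intro j hj
    rw [← hA N hN i hi j hj, Finset.sum_mul]
    exact Finset.sum_congr rfl fun _ _ => by ring

theorem pairAct_inner {M : ℕ} {A : ℕ × ℕ → ℕ × ℕ → ℂ} (hA : IsometricUpTo M A) {s t : QName}
    (hst : s ≠ t) {Φ Φ' : State} (h : SqSummable Φ) (h' : SqSummable Φ')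
    (hU : SqSummable (pairAct A s t Φ)) (hU' : SqSummable (pairAct A s t Φ'))
    (hM : ∀ f, Φ f ≠ 0 → f s + f t ≤ M) (C : Basis → Prop) [DecidablePred C]
    (hC : ∀ f i j, C ((f.update s i).update t j) ↔ C f) :
    ∑' f, (if C f then pairAct A s t Φ f * (starRingEnd ℂ) (pairAct A s t Φ' f) else 0) =
      ∑' f, if C f then Φ f * (starRingEnd ℂ) (Φ' f) else 0 := by
  let ι := Σ n : Fin (M + 1), {p : ℕ × ℕ // p ∈ Finset.HasAntidiagonal.antidiagonal n.val}
  let k : ι → Basis := fun i => Finsupp.single s i.2.1.1 + Finsupp.single t i.2.1.2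
  have ks : ∀ i, k i s = i.2.1.1 := fun i => by simp [k, hst.symm]
  have kt : ∀ i, k i t = i.2.1.2 := fun i => by simp [k, hst]
  have hK : ∀ i, ∀ x ∉ ({s, t} : Finset QName), k i x = 0 := by
    intro i x hx
    simp only [Finset.mem_insert, Finset.mem_singleton, not_or] at hx
    simp [k, Ne.symm hx.1, Ne.symm hx.2]
  have hinj : Function.Injective k := by
    rintro ⟨n, p, hp⟩ ⟨m, q, hq⟩ he
    have e1 : p.1 = q.1 := by rw [← ks ⟨n, p, hp⟩, he, ks]
    have e2 : p.2 = q.2 := by rw [← kt ⟨n, p, hp⟩, he, kt]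
    obtain rfl : p = q := Prod.ext e1 e2
    obtain rfl : n = m := Fin.ext (by
      rw [← Finset.HasAntidiagonal.mem_antidiagonal.1 hp,
        ← Finset.HasAntidiagonal.mem_antidiagonal.1 hq])
    rfl
  have hz : ∀ f : Basis, f s + f t ≤ M → ∃ i : ι, ∀ x ∈ ({s, t} : Finset QName), f x = k i x := by
    intro f hf
    refine ⟨⟨⟨f s + f t, by omega⟩, (f s, f t), by simp⟩, fun x hx => ?_⟩
    simp only [Finset.mem_insert, Finset.mem_singleton] at hx
    rcases hx with rfl | rfl
    · rw [ks]
    · rw [kt]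
  have hUM : ∀ f, pairAct A s t Φ f ≠ 0 → f s + f t ≤ M := by
    intro f hf
    obtain ⟨i, j, hij, -, h2⟩ := pairAct_support hf
    have := hM _ h2
    rw [update_ne _ hst, update_same, update_same] at this
    omega
  rw [tsum_split {s, t} k hK hinj (summable_ite (hU.mul_conj hU') _),
    tsum_split {s, t} k hK hinj (summable_ite (h.mul_conj h') _)]
  rotate_left
  · intro f hf
    refine hz f (hM f ?_)
    simp only [ne_eq, ite_eq_right_iff, Classical.not_imp, mul_eq_zero, not_or] at hf
    exact hf.2.1
  · intro f hf
    refine hz f (hUM f ?_)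
    simp only [ne_eq, ite_eq_right_iff, Classical.not_imp, mul_eq_zero, not_or] at hf
    exact hf.2.1
  refine tsum_congr fun g => if_ctx_congr Iff.rfl (fun hg => ?_) fun _ => rfl
  have gs : g s = 0 := hg s (by simp)
  have gt : g t = 0 := hg t (by simp)
  have gC : ∀ i, C (g + k i) ↔ C g := by
    intro i
    rw [← hC g (i.2.1.1) (i.2.1.2)]
    have : (g.update s i.2.1.1).update t i.2.1.2 = g + k i := by
      ext x
      by_cases hx : x = t
      · subst hx; rw [update_same, Finsupp.add_apply, kt, gt, zero_add]
      by_cases hx' : x = s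
      · subst hx'; rw [update_ne _ hx, update_same, Finsupp.add_apply, ks, gs, zero_add]
      · rw [update_ne _ hx, update_ne _ hx', Finsupp.add_apply, hK i x (by simp [hx, hx']),
          add_zero]
    rw [this]
  by_cases hCg : C g
  · simp only [gC, hCg, if_true]
    rw [Fintype.sum_sigma, Fintype.sum_sigma]
    refine Finset.sum_congr rfl fun n _ => ?_
    let u : State → ℕ × ℕ → ℂ := fun φ p => φ (g + (Finsupp.single s p.1 + Finsupp.single t p.2))
    have hu : ∀ φ (p : ℕ × ℕ), p ∈ Finset.HasAntidiagonal.antidiagonal n.val →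
        pairAct A s t φ (g + (Finsupp.single s p.1 + Finsupp.single t p.2)) =
          ∑ i ∈ Finset.HasAntidiagonal.antidiagonal n.val, A i p * u φ i := by
      intro φ p hp
      have e1 : (g + (Finsupp.single s p.1 + Finsupp.single t p.2)) s = p.1 := by
        simp [gs, hst.symm]
      have e2 : (g + (Finsupp.single s p.1 + Finsupp.single t p.2)) t = p.2 := by
        simp [gt, hst]
      rw [pairAct, e1, e2, Finset.HasAntidiagonal.mem_antidiagonal.1 hp]
      refine Finset.sum_congr rfl fun i _ => ?_
      congr 2
      ext x
      by_cases hx : x = t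
      · subst hx; simp [gt, hst]
      by_cases hx' : x = s
      · subst hx'; simp [Finsupp.update_apply, gs, hst]
      · simp [Finsupp.update_apply, hx, hx']
    have key := hA.inner (Nat.le_of_lt_succ n.2) (u Φ) (u Φ')
    rw [← Finset.sum_coe_sort (Finset.HasAntidiagonal.antidiagonal n.val) fun o => _ * _,
      ← Finset.sum_coe_sort (Finset.HasAntidiagonal.antidiagonal n.val)
        fun o => u Φ o * _] at key
    refine Eq.trans (Finset.sum_congr rfl fun p _ => ?_) key
    rw [← hu Φ p.1 p.2, ← hu Φ' p.1 p.2]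
  · simp only [gC, hCg, if_false]

section Amplitudes

open Polynomial

theorem coeff_quadratic (a b c : ℝ) (k : ℕ) : (C a + C b * X + C c * X ^ 2 : ℝ[X]).coeff k =
    (if k = 0 then a else 0) + (if k = 1 then b else 0) + if k = 2 then c else 0 := by
  simp [coeff_C, coeff_X, coeff_X_pow, eq_comm]

theorem bsAmp_eq_coeff (η : ℝ) (m n k l : ℕ) (h : k + l = m + n) {p q r : ℝ}
    (hP : (C √η * X + C √(1 - η)) ^ m * (C √(1 - η) * X - C √η) ^ n =
      (C p + C q * X + C r * X ^ 2 : ℝ[X])) :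
    bsAmp η (m, n) (k, l) = ((√((k.factorial * l.factorial : ℕ) : ℝ) /
      √((m.factorial * n.factorial : ℕ) : ℝ) * ((if k = 0 then p else 0) +
        (if k = 1 then q else 0) + if k = 2 then r else 0) : ℝ) : ℂ) := by
  rw [bsAmp, if_pos h, hP, coeff_quadratic]

variable (η : ℝ)

local notation "c" => √η
local notation "d" => √(1 - η)

theorem bsAmp_00 : bsAmp η (0, 0) (0, 0) = 1 := by
  rw [bsAmp_eq_coeff η 0 0 0 0 rfl (p := 1) (q := 0) (r := 0)] <;> simp

theorem bs_poly_10 : (C c * X + C d) ^ 1 * (C d * X - C c) ^ 0 =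
    (C d + C c * X + C 0 * X ^ 2 : ℝ[X]) := by simp [add_comm]

theorem bs_poly_01 : (C c * X + C d) ^ 0 * (C d * X - C c) ^ 1 =
    (C (-c) + C d * X + C 0 * X ^ 2 : ℝ[X]) := by
  simp only [map_neg, map_zero]; ring

theorem bs_poly_20 : (C c * X + C d) ^ 2 * (C d * X - C c) ^ 0 =
    (C (d * d) + C (2 * c * d) * X + C (c * c) * X ^ 2 : ℝ[X]) := by
  simp only [map_mul, map_ofNat]; ring

theorem bs_poly_11 : (C c * X + C d) ^ 1 * (C d * X - C c) ^ 1 =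
    (C (-(c * d)) + C (d * d - c * c) * X + C (c * d) * X ^ 2 : ℝ[X]) := by
  simp only [map_mul, map_neg, map_sub]; ring

theorem bs_poly_02 : (C c * X + C d) ^ 0 * (C d * X - C c) ^ 2 =
    (C (c * c) + C (-(2 * c * d)) * X + C (d * d) * X ^ 2 : ℝ[X]) := by
  simp only [map_mul, map_ofNat, map_neg]; ring

theorem bsAmp_10_10 : bsAmp η (1, 0) (1, 0) = (c : ℝ) := by
  rw [bsAmp_eq_coeff η 1 0 1 0 rfl (bs_poly_10 η)]; simp

theorem bsAmp_10_01 : bsAmp η (1, 0) (0, 1) = (d : ℝ) := by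
  rw [bsAmp_eq_coeff η 1 0 0 1 rfl (bs_poly_10 η)]; simp

theorem bsAmp_01_10 : bsAmp η (0, 1) (1, 0) = (d : ℝ) := by
  rw [bsAmp_eq_coeff η 0 1 1 0 rfl (bs_poly_01 η)]; simp

theorem bsAmp_01_01 : bsAmp η (0, 1) (0, 1) = (-c : ℝ) := by
  rw [bsAmp_eq_coeff η 0 1 0 1 rfl (bs_poly_01 η)]; simp

theorem two_div_sqrt_two : 2 / √(2 : ℝ) = √2 := by
  rw [div_eq_iff (by positivity), Real.mul_self_sqrt (by norm_num)]

theorem one_div_sqrt_two_mul (x : ℝ) : (√2)⁻¹ * (2 * x) = √2 * x := by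
  rw [← mul_assoc, inv_mul_eq_div, two_div_sqrt_two]

theorem bsAmp_20_20 : bsAmp η (2, 0) (2, 0) = (c * c : ℝ) := by
  rw [bsAmp_eq_coeff η 2 0 2 0 rfl (bs_poly_20 η)]; simp

theorem bsAmp_20_11 : bsAmp η (2, 0) (1, 1) = (√2 * (c * d) : ℝ) := by
  rw [bsAmp_eq_coeff η 2 0 1 1 rfl (bs_poly_20 η)]; simp [mul_assoc, one_div_sqrt_two_mul]

theorem bsAmp_20_02 : bsAmp η (2, 0) (0, 2) = (d * d : ℝ) := by
  rw [bsAmp_eq_coeff η 2 0 0 2 rfl (bs_poly_20 η)]; simp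

theorem bsAmp_11_20 : bsAmp η (1, 1) (2, 0) = (√2 * (c * d) : ℝ) := by
  rw [bsAmp_eq_coeff η 1 1 2 0 rfl (bs_poly_11 η)]; simp

theorem bsAmp_11_11 : bsAmp η (1, 1) (1, 1) = (d * d - c * c : ℝ) := by
  rw [bsAmp_eq_coeff η 1 1 1 1 rfl (bs_poly_11 η)]; simp

theorem bsAmp_11_02 : bsAmp η (1, 1) (0, 2) = (-(√2 * (c * d)) : ℝ) := by
  rw [bsAmp_eq_coeff η 1 1 0 2 rfl (bs_poly_11 η)]; simp

theorem bsAmp_02_20 : bsAmp η (0, 2) (2, 0) = (d * d : ℝ) := by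
  rw [bsAmp_eq_coeff η 0 2 2 0 rfl (bs_poly_02 η)]; simp

theorem bsAmp_02_11 : bsAmp η (0, 2) (1, 1) = (-(√2 * (c * d)) : ℝ) := by
  rw [bsAmp_eq_coeff η 0 2 1 1 rfl (bs_poly_02 η)]; simp [mul_assoc, one_div_sqrt_two_mul]

theorem bsAmp_02_02 : bsAmp η (0, 2) (0, 2) = (c * c : ℝ) := by
  rw [bsAmp_eq_coeff η 0 2 0 2 rfl (bs_poly_02 η)]; simp

theorem antidiagonal_zero' : Finset.HasAntidiagonal.antidiagonal (0 : ℕ) = {(0, 0)} := rfl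

theorem antidiagonal_one' : Finset.HasAntidiagonal.antidiagonal (1 : ℕ) = {(0, 1), (1, 0)} := rfl

theorem antidiagonal_two' :
    Finset.HasAntidiagonal.antidiagonal (2 : ℕ) = {(0, 2), (1, 1), (2, 0)} := rfl

theorem isometric_bsAmp (h0 : 0 ≤ η) (h1 : η ≤ 1) : IsometricUpTo 2 (bsAmp η) := by
  have hcd : c * c + d * d = 1 := by
    rw [Real.mul_self_sqrt h0, Real.mul_self_sqrt (by linarith)]; ring
  have h2 : √(2 : ℝ) * √2 = 2 := Real.mul_self_sqrt (by norm_num)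
  generalize hc : c = x at hcd
  generalize hd : d = y at hcd
  generalize hs : √(2 : ℝ) = r at h2
  intro N hN
  interval_cases N
  · simp only [antidiagonal_zero', Finset.mem_singleton, forall_eq, Finset.sum_singleton, bsAmp_00]
    simp
  · simp only [antidiagonal_one', Finset.mem_insert, Finset.mem_singleton, forall_eq_or_imp,
      forall_eq]
    refine ⟨⟨?_, ?_⟩, ?_, ?_⟩ <;>
    · rw [Finset.sum_pair (by simp)]
      simp only [bsAmp_10_10, bsAmp_10_01, bsAmp_01_10, bsAmp_01_01, Complex.conj_ofReal, hc, hd,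
        ← Complex.ofReal_mul, ← Complex.ofReal_add]
      norm_num
      try norm_cast
      try first | linear_combination hcd | ring
  · simp only [antidiagonal_two', Finset.mem_insert, Finset.mem_singleton, forall_eq_or_imp,
      forall_eq]
    refine ⟨⟨?_, ?_, ?_⟩, ⟨?_, ?_, ?_⟩, ?_, ?_, ?_⟩ <;>
    · rw [Finset.sum_insert (by simp), Finset.sum_pair (by simp)]
      simp only [bsAmp_20_20, bsAmp_20_11, bsAmp_20_02, bsAmp_11_20, bsAmp_11_11, bsAmp_11_02,
        bsAmp_02_20, bsAmp_02_11, bsAmp_02_02, Complex.conj_ofReal, hc, hd, hs,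
        ← Complex.ofReal_mul, ← Complex.ofReal_add]
      simp only [Prod.mk.injEq, OfNat.ofNat_ne_zero, OfNat.zero_ne_ofNat, and_self,
        if_true, if_false, zero_ne_one, one_ne_zero, OfNat.one_ne_ofNat,
        OfNat.ofNat_ne_one]
      norm_cast
      first
        | linear_combination (x * x + y * y + 1) * hcd + x * x * y * y * h2
        | linear_combination (x * x + y * y + 1) * hcd + 2 * x * x * y * y * h2
        | linear_combination x * x * y * y * h2
        | linear_combination -x * x * y * y * h2
        | ring

end Amplitudes

open Finsupp (single)

/-! ### Reduced states in terms of the input qubits -/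

/-- The matrix element of the reduced operator of the systems `L`, where the qubits `q` and `q'` are
projected to the basis states `i` and `j`. -/
noncomputable def blockSum (ψ : State) (q q' : QName) (L : List QName) (a b : Basis) (i j : ℕ) : ℂ :=
  ∑' g : Basis, if (∀ x ∈ L, g x = 0) ∧ g q = 0 ∧ g q' = 0 then
    ψ (g + a + single q i + single q' j) *
      (starRingEnd ℂ) (ψ (g + b + single q i + single q' j)) else 0

theorem reduced_eq_sum {ι : Type*} [Fintype ι] {K : Finset QName} {h : ι → Basis}
    (hK : ∀ k, ∀ x ∉ K, h k x = 0) (hinj : Function.Injective h) {Φ ψ : State}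
    (hΦ : SqSummable Φ) (hψ : SqSummable ψ) (c : ι → ℂ) (i j : ι → ℕ) {q q' : QName}
    (hq : q ∈ K) (hq' : q' ∈ K) {D : Basis → Prop} {Dk : ι → Prop} [DecidablePred Dk]
    {L : List QName} {a b : Basis} (hL : ∀ x ∈ L, x ∉ K) (ha : ∀ x, x ∉ L → a x = 0)
    (hb : ∀ x, x ∉ L → b x = 0) (hDa : ∀ f, D (f + a) ↔ D f)
    (hval : ∀ k (g : Basis), (∀ x ∈ K, g x = 0) →
      Φ (g + h k) = c k * ψ (g + single q (i k) + single q' (j k)))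
    (hz : ∀ f, D f → Φ f ≠ 0 → ∃ k, ∀ x ∈ K, f x = h k x)
    (hD : ∀ k (g : Basis), (∀ x ∈ K, g x = 0) → (D (g + h k) ↔ Dk k))
    (hψK : ∀ k (g : Basis), ψ (g + single q (i k) + single q' (j k)) ≠ 0 → g q = 0 → g q' = 0 →
      ∀ x ∈ K, g x = 0) :
    reduced Φ D L a b =
      ∑ k, if Dk k then c k * (starRingEnd ℂ) (c k) * blockSum ψ q q' L a b (i k) (j k) else 0 := by
  classical
  have aK : ∀ x ∈ K, a x = 0 := fun x hx => ha x fun h => hL x h hx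
  have bK : ∀ x ∈ K, b x = 0 := fun x hx => hb x fun h => hL x h hx
  rw [reduced, tsum_split K h hK hinj (summable_ite ((hΦ.shift a).mul_conj (hΦ.shift b)) _)]
  swap
  · intro f hf
    simp only [ne_eq, ite_eq_right_iff, Classical.not_imp, mul_eq_zero, not_or] at hf
    obtain ⟨k, hk⟩ := hz (f + a) ((hDa f).2 hf.1.2) hf.2.1
    exact ⟨k, fun x hx => by rw [← hk x hx, Finsupp.add_apply, aK x hx, add_zero]⟩
  have e1 : ∀ g : Basis, (if ∀ x ∈ K, g x = 0 then ∑ k, (if (∀ x ∈ L, (g + h k) x = 0) ∧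
      D (g + h k) then Φ (g + h k + a) * (starRingEnd ℂ) (Φ (g + h k + b)) else 0) else 0) =
      ∑ k, if Dk k then c k * (starRingEnd ℂ) (c k) *
        (if (∀ x ∈ L, g x = 0) ∧ g q = 0 ∧ g q' = 0 then
          ψ (g + a + single q (i k) + single q' (j k)) *
            (starRingEnd ℂ) (ψ (g + b + single q (i k) + single q' (j k))) else 0) else 0 := by
    intro g
    by_cases hg : ∀ x ∈ K, g x = 0
    · rw [if_pos hg]
      refine Finset.sum_congr rfl fun k _ => ?_
      have hgL : (∀ x ∈ L, (g + h k) x = 0) ↔ ∀ x ∈ L, g x = 0 :=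
        forall₂_congr fun x hx => by rw [Finsupp.add_apply, hK k x (hL x hx), add_zero]
      rw [if_congr (and_congr hgL (hD k g hg)) rfl rfl]
      by_cases hk : Dk k
      · by_cases hg' : ∀ x ∈ L, g x = 0
        · rw [if_pos ⟨hg', hk⟩, if_pos hk, if_pos ⟨hg', hg q hq, hg q' hq'⟩,
            add_right_comm g (h k) a, add_right_comm g (h k) b, hval k (g + a), hval k (g + b),
            map_mul]
          · ring
          · exact fun x hx => by rw [Finsupp.add_apply, hg x hx, bK x hx]
          · exact fun x hx => by rw [Finsupp.add_apply, hg x hx, aK x hx]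
        · rw [if_neg fun h => hg' h.1, if_pos hk, if_neg fun h => hg' h.1, mul_zero]
      · rw [if_neg fun h => hk h.2, if_neg hk]
    · rw [if_neg hg, Finset.sum_eq_zero]
      intro k _
      split_ifs with h1 h2
      · by_cases h0 : ψ (g + a + single q (i k) + single q' (j k)) = 0
        · simp [h0]
        · refine absurd (fun x hx => ?_) hg
          have := hψK k _ h0 (by rw [Finsupp.add_apply, h2.2.1, aK q hq])
            (by rw [Finsupp.add_apply, h2.2.2, aK q' hq']) x hx
          rw [Finsupp.add_apply, aK x hx, add_zero] at this
          exact this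
      · rw [mul_zero]
      · rfl
  rw [tsum_congr e1, Summable.tsum_finsetSum]
  · refine Finset.sum_congr rfl fun k _ => ?_
    by_cases hk : Dk k
    · simp only [if_pos hk, blockSum]
      rw [tsum_mul_left]
    · simp [hk]
  · intro k _
    by_cases hk : Dk k
    · simp only [if_pos hk]
      refine Summable.mul_left _ (summable_ite ?_ _)
      have := (hψ.shift (a + single q (i k) + single q' (j k))).mul_conj
        (hψ.shift (b + single q (i k) + single q' (j k)))
      simpa only [add_assoc] using this
    · simp [hk]

/-- The expected reduced operator: with probability `1/9` the controlled NOT operation of the input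
qubits, and otherwise only zeros. -/
noncomputable def expected (ψ : State) (q q' : QName) (D : ℤ × ℤ × ℤ → Prop) [DecidablePred D]
    (L : List QName) (a b : Basis) : ℂ :=
  ∑ k : Fin 2 × Fin 2, ((if D (0, 0, 0) then 8 / 9 else 0) +
    if D (k.1.val, k.2.val, 1) then 1 / 9 else 0) *
      blockSum ψ q q' L a b k.1.val ((k.1.val + k.2.val) % 2)

/-! ### The input states of the modes -/

/-- The amplitude of the logical state `i` of a dual rail qubit. -/
noncomputable def dual (i m n : ℕ) : ℂ := if m = 1 - i ∧ n = i then 1 else 0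

/-- Both polarisation qubits are turned into dual rail qubits. -/
noncomputable def inputState (q q' a₀ a₁ b₀ b₁ : QName) (ψ : State) : State :=
  psAct q' b₀ b₁ (psAct q a₀ a₁ ψ)

theorem update_add_single_self {g : Basis} {s : QName} (h : g s = 0) (m i : ℕ) :
    (g + single s m).update s i = g + single s i := by
  ext x
  by_cases hx : x = s
  · subst hx; simp [h]
  · simp [Finsupp.update_apply, hx]

theorem psAct_apply {q s t : QName} (hqs : q ≠ s) (hqt : q ≠ t) (hst : s ≠ t) (φ : State)
    {g : Basis} (hq : g q = 0) (hs : g s = 0) (ht : g t = 0) (m n : ℕ) :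
    psAct q s t φ (g + single s m + single t n) =
      ∑ i ∈ Finset.range 2, dual i m n * φ (g + single q i) := by
  have e1 : (g + single s m + single t n) q = 0 := by
    simp [hq, hqs.symm, hqt.symm]
  have e2 : (g + single s m + single t n) s = m := by simp [hs, hst]
  have e3 : (g + single s m + single t n) t = n := by simp [ht, hst.symm]
  have e4 : ((g + single s m + single t n).update s 0).update t 0 = g := by
    rw [update_add_single _ (by simp [hst]), update_add_single_self hs,
      update_add_single_self (by simp [ht])]
    simp
  have e5 : g.update q 1 = g + single q 1 := by
    have := update_add_single_self hq 0 1
    simpa using this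
  rw [Finset.sum_range_succ, Finset.sum_range_one, psAct, e1, e2, e3, e4, e5]
  by_cases h1 : m = 1 <;> by_cases h2 : n = 0 <;> by_cases h3 : m = 0 <;> by_cases h4 : n = 1 <;>
    first | omega | simp [dual, h1, h2, h3, h4]

theorem psAct_support {q s t : QName} {φ : State} {f : Basis} (hqs : q ≠ s) (hqt : q ≠ t)
    (hst : s ≠ t) (h : psAct q s t φ f ≠ 0) :
    f q = 0 ∧ ∃ i < 2, f s = 1 - i ∧ f t = i ∧ ∃ f', φ f' ≠ 0 ∧ f' q = i ∧
      ∀ x, x ≠ q → x ≠ s → x ≠ t → f' x = f x := by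
  simp only [psAct] at h
  split_ifs at h with c1 c2
  · refine ⟨c1.1, 0, by norm_num, c1.2.1, c1.2.2, _, h, ?_, fun x _ h2 h3 => ?_⟩
    · rw [update_ne _ hqt, update_ne _ hqs, c1.1]
    · rw [update_ne _ h3, update_ne _ h2]
  · refine ⟨c2.1, 1, by norm_num, c2.2.1, c2.2.2, _, h, ?_, fun x h1 h2 h3 => ?_⟩
    · rw [update_same]
    · rw [update_ne _ h1, update_ne _ h3, update_ne _ h2]
  · exact absurd rfl h

section Input

variable {q q' a₀ a₁ b₀ b₁ : QName} (hn : [q, q', a₀, a₁, b₀, b₁].Nodup)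

include hn

theorem inputState_apply (ψ : State) {g : Basis} (hq : g q = 0) (hq' : g q' = 0)
    (h0 : g a₀ = 0) (h1 : g a₁ = 0) (h2 : g b₀ = 0) (h3 : g b₁ = 0) (n₀ n₁ n₂ n₃ : ℕ) :
    inputState q q' a₀ a₁ b₀ b₁ ψ
        (g + single a₀ n₀ + single a₁ n₁ + single b₀ n₂ + single b₁ n₃) =
      ∑ i ∈ Finset.range 2, ∑ j ∈ Finset.range 2,
        dual i n₀ n₁ * dual j n₂ n₃ * ψ (g + single q i + single q' j) := by
  simp at hn
  obtain ⟨⟨q1, q2, q3, q4, q5⟩, ⟨p2, p3, p4, p5⟩, ⟨a1, a2, a3⟩, ⟨b2, b3⟩, c⟩ := hn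
  rw [inputState, psAct_apply p4 p5 c _ (by simp [hq', Ne.symm p2, Ne.symm p3])
    (by simp [h2, a2, b2]) (by simp [h3, a3, b3])]
  rw [Finset.sum_comm]
  refine Finset.sum_congr rfl fun j _ => ?_
  rw [add_right_comm _ (single a₁ n₁), add_right_comm _ (single a₀ n₀),
    psAct_apply q2 q3 a1 _ (by simp [hq, Ne.symm q1])
    (by simp [h0, p2]) (by simp [h1, p3]), Finset.mul_sum]
  refine Finset.sum_congr rfl fun i _ => ?_
  rw [add_right_comm g (single q' j)]
  ring

/-- The input states are dual rail states of the modes, and the qubits are gone. -/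
theorem inputState_support {ψ : State} {f : Basis} (h : inputState q q' a₀ a₁ b₀ b₁ ψ f ≠ 0) :
    ∃ i < 2, ∃ j < 2, f q = 0 ∧ f q' = 0 ∧ f a₀ = 1 - i ∧ f a₁ = i ∧ f b₀ = 1 - j ∧ f b₁ = j ∧
      ∃ f', ψ f' ≠ 0 ∧ f' q = i ∧ f' q' = j ∧ ∀ x ∉ [q, q', a₀, a₁, b₀, b₁], f' x = f x := by
  simp at hn
  obtain ⟨⟨q1, q2, q3, q4, q5⟩, ⟨p2, p3, p4, p5⟩, ⟨a1, a2, a3⟩, ⟨b2, b3⟩, c⟩ := hn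
  obtain ⟨e1, j, hj, e2, e3, f', hf', e4, e5⟩ := psAct_support p4 p5 c h
  obtain ⟨d1, i, hi, d2, d3, f'', hf'', d4, d5⟩ := psAct_support q2 q3 a1 hf'
  refine ⟨i, hi, j, hj, ?_, e1, ?_, ?_, e2, e3, f'', hf'', d4, ?_, ?_⟩
  · rw [← e5 q q1 q4 q5, d1]
  · rw [← e5 a₀ (Ne.symm p2) a2 a3, d2]
  · rw [← e5 a₁ (Ne.symm p3) b2 b3, d3]
  · rw [d5 q' (Ne.symm q1) p2 p3, e4]
  · intro x hx
    simp only [List.mem_cons, not_or, List.not_mem_nil, not_false_eq_true, and_true] at hx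
    rw [d5 x hx.1 hx.2.2.1 hx.2.2.2.1, e5 x hx.2.1 hx.2.2.2.2.1 hx.2.2.2.2.2]

end Input

open Finsupp (single)

theorem reduced_pairAct {M : ℕ} {A : ℕ × ℕ → ℕ × ℕ → ℂ} (hA : IsometricUpTo M A) {s t : QName}
    (hst : s ≠ t) {Φ : State} (h : SqSummable Φ) (hU : SqSummable (pairAct A s t Φ))
    (hM : ∀ f, Φ f ≠ 0 → f s + f t ≤ M) {L : List QName} (hs : s ∉ L) (ht : t ∉ L) {a b : Basis}
    (ha : ∀ x, x ∉ L → a x = 0) (hb : ∀ x, x ∉ L → b x = 0) :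
    reduced (pairAct A s t Φ) (fun _ => True) L a b = reduced Φ (fun _ => True) L a b := by
  classical
  simp only [reduced, and_true]
  have e1 : ∀ f, pairAct A s t Φ (f + a) = pairAct A s t (fun f => Φ (f + a)) f :=
    pairAct_shift A (ha s hs) (ha t ht) Φ
  have e2 : ∀ f, pairAct A s t Φ (f + b) = pairAct A s t (fun f => Φ (f + b)) f :=
    pairAct_shift A (hb s hs) (hb t ht) Φ
  have u1 := hU.shift a
  have u2 := hU.shift b
  simp only [e1, e2] at u1 u2 ⊢
  convert pairAct_inner hA hst (h.shift a) (h.shift b) u1 u2 (fun f hf => ?_)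
    (fun f => ∀ x ∈ L, f x = 0) ?_
  · have := hM _ hf
    rw [Finsupp.add_apply, Finsupp.add_apply, ha s hs, ha t ht] at this
    exact this
  · intro f i j
    refine forall₂_congr fun x hx => ?_
    rw [update_ne _ (by rintro rfl; exact ht hx), update_ne _ (by rintro rfl; exact hs hx)]

theorem pairAct_apply (A : ℕ × ℕ → ℕ × ℕ → ℂ) {s t : QName} (hst : s ≠ t) (φ : State) {p : Basis}
    (hs : p s = 0) (ht : p t = 0) (m n : ℕ) :
    pairAct A s t φ (p + single s m + single t n) =
      ∑ i ∈ Finset.HasAntidiagonal.antidiagonal (m + n),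
        A i (m, n) * φ (p + single s i.1 + single t i.2) := by
  have e2 : (p + single s m + single t n) s = m := by simp [hs, hst]
  have e3 : (p + single s m + single t n) t = n := by simp [ht, hst.symm]
  rw [pairAct, e2, e3]
  refine Finset.sum_congr rfl fun i _ => ?_
  rw [update_add_single _ (by simp [hst]), update_add_single_self hs,
    update_add_single_self (by simp [ht, hst.symm])]

theorem pairAct_support_le {A : ℕ × ℕ → ℕ × ℕ → ℂ} {s t : QName} (hst : s ≠ t) {φ : State}
    {f : Basis} (h : pairAct A s t φ f ≠ 0) :
    ∃ f', φ f' ≠ 0 ∧ f' s + f' t = f s + f t ∧ ∀ x, x ≠ s → x ≠ t → f' x = f x := by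
  obtain ⟨i, j, hij, -, h2⟩ := pairAct_support h
  refine ⟨_, h2, ?_, fun x hs ht => ?_⟩
  · rw [update_ne _ hst, update_same, update_same, hij]
  · rw [update_ne _ ht, update_ne _ hs]

/-! ### The optical network -/

/-- The final state of the network of beam splitters. -/
noncomputable def networkState (q q' a₀ a₁ b₀ b₁ y z : QName) (ψ : State) : State :=
  pairAct (bsAmp (1 / 2)) b₀ b₁ <| pairAct (bsAmp (1 / 3)) b₁ z <|
    pairAct (bsAmp (1 / 3)) b₀ a₁ <| pairAct (bsAmp (1 / 3)) a₀ y <|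
      pairAct (bsAmp (1 / 2)) b₀ b₁ <| inputState q q' a₀ a₁ b₀ b₁ ψ

/-- The numbers that the coincidence counter derives from the photon numbers. -/
def networkOutcome (a₀ a₁ b₀ b₁ : QName) (f : Basis) : ℤ × ℤ × ℤ :=
  if f a₀ + f a₁ = 1 ∧ f b₀ + f b₁ = 1 then (f a₁, f b₁, 1) else (0, 0, 0)

theorem sqrt_facts : ∃ r s t : ℝ, √(1 / 2 : ℝ) = r ∧ √(1 - 1 / 2 : ℝ) = r ∧ √(1 / 3 : ℝ) = s ∧
    √(1 - 1 / 3 : ℝ) = t ∧ r * r = 1 / 2 ∧ s * s = 1 / 3 ∧ t * t = 2 / 3 ∧ √(2 : ℝ) * r = 1 := by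
  refine ⟨_, _, _, rfl, by norm_num, rfl, rfl, Real.mul_self_sqrt (by norm_num),
    Real.mul_self_sqrt (by norm_num), ?_, ?_⟩
  · rw [Real.mul_self_sqrt (by norm_num)]; norm_num
  · rw [← Real.sqrt_mul (by norm_num)]; norm_num

theorem sum_antidiagonal_zero' (F : ℕ × ℕ → ℂ) :
    ∑ i ∈ Finset.HasAntidiagonal.antidiagonal (0 : ℕ), F i = F (0, 0) := by
  simp

theorem sum_antidiagonal_one' (F : ℕ × ℕ → ℂ) :
    ∑ i ∈ Finset.HasAntidiagonal.antidiagonal (1 : ℕ), F i = F (0, 1) + F (1, 0) := by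
  rw [antidiagonal_one', Finset.sum_pair (by simp)]

theorem sum_antidiagonal_two' (F : ℕ × ℕ → ℂ) :
    ∑ i ∈ Finset.HasAntidiagonal.antidiagonal (2 : ℕ), F i = F (0, 2) + (F (1, 1) + F (2, 0)) := by
  rw [antidiagonal_two', Finset.sum_insert (by simp), Finset.sum_pair (by simp)]

section Network

variable {q q' a₀ a₁ b₀ b₁ y z : QName} (hn : [q, q', a₀, a₁, b₀, b₁, y, z].Nodup)
  {ψ : State} (hψ : SqSummable ψ)
  (hsupp : ∀ f, ψ f ≠ 0 → f q ≤ 1 ∧ f q' ≤ 1 ∧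
    f a₀ = 0 ∧ f a₁ = 0 ∧ f b₀ = 0 ∧ f b₁ = 0 ∧ f y = 0 ∧ f z = 0)

include hn hsupp

theorem inputState_network {g : Basis} (hg : ∀ x ∈ [q, q', a₀, a₁, b₀, b₁, y, z], g x = 0)
    (n₀ n₁ n₂ n₃ n₄ n₅ : ℕ) :
    inputState q q' a₀ a₁ b₀ b₁ ψ (g + single a₀ n₀ + single a₁ n₁ + single b₀ n₂ + single b₁ n₃ +
        single y n₄ + single z n₅) =
      if n₄ = 0 ∧ n₅ = 0 then ∑ i ∈ Finset.range 2, ∑ j ∈ Finset.range 2,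
        dual i n₀ n₁ * dual j n₂ n₃ * ψ (g + single q i + single q' j) else 0 := by
  have hn6 : [q, q', a₀, a₁, b₀, b₁].Nodup := hn.sublist (by simp)
  simp at hn
  obtain ⟨⟨q1, q2, q3, q4, q5, q6, q7⟩, ⟨p2, p3, p4, p5, p6, p7⟩, ⟨a1, a2, a3, a4, a5⟩,
    ⟨b2, b3, b4, b5⟩, ⟨c1, c2, c3⟩, ⟨d1, d2⟩, e⟩ := hn
  simp only [List.mem_cons, List.not_mem_nil, or_false, forall_eq_or_imp, forall_eq] at hg
  obtain ⟨g1, g2, g3, g4, g5, g6, g7, g8⟩ := hg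
  have e1 : g + single a₀ n₀ + single a₁ n₁ + single b₀ n₂ + single b₁ n₃ +
      single y n₄ + single z n₅ = (g + single y n₄ + single z n₅) + single a₀ n₀ + single a₁ n₁ +
      single b₀ n₂ + single b₁ n₃ := by abel
  rw [e1, inputState_apply hn6]
  · by_cases h : n₄ = 0 ∧ n₅ = 0
    · rw [if_pos h, h.1, h.2]
      simp
    · rw [if_neg h]
      refine Finset.sum_eq_zero fun i _ => Finset.sum_eq_zero fun j _ => ?_
      rw [mul_eq_zero]
      right
      by_contra h0
      have := hsupp _ h0
      refine h ⟨?_, ?_⟩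
      · have := this.2.2.2.2.2.2.1
        simpa [Finsupp.single_apply, g7, q6, p6, Ne.symm e] using this
      · have := this.2.2.2.2.2.2.2
        simpa [Finsupp.single_apply, g8, q7, p7, e] using this
  all_goals simp [*]

theorem networkState_apply {g : Basis} (hg : ∀ x ∈ [q, q', a₀, a₁, b₀, b₁, y, z], g x = 0)
    {i j : ℕ} (hi : i < 2) (hj : j < 2) :
    networkState q q' a₀ a₁ b₀ b₁ y z ψ
        (g + single a₀ (1 - i) + single a₁ i + single b₀ (1 - j) + single b₁ j +
          single y 0 + single z 0) =
      1 / 3 * ψ (g + single q i + single q' ((i + j) % 2)) := by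
  have hin := inputState_network hn hsupp hg
  simp at hn
  obtain ⟨⟨q1, q2, q3, q4, q5, q6, q7⟩, ⟨p2, p3, p4, p5, p6, p7⟩, ⟨a1, a2, a3, a4, a5⟩,
    ⟨b2, b3, b4, b5⟩, ⟨c1, c2, c3⟩, ⟨d1, d2⟩, e⟩ := hn
  simp only [List.mem_cons, List.not_mem_nil, or_false, forall_eq_or_imp, forall_eq] at hg
  obtain ⟨g1, g2, g3, g4, g5, g6, g7, g8⟩ := hg
  have := Ne.symm a1; have := Ne.symm a2; have := Ne.symm a3; have := Ne.symm a4
  have := Ne.symm a5; have := Ne.symm b2; have := Ne.symm b3; have := Ne.symm b4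
  have := Ne.symm b5; have := Ne.symm c1; have := Ne.symm c2; have := Ne.symm c3
  have := Ne.symm d1; have := Ne.symm d2; have := Ne.symm e
  obtain ⟨N, hN⟩ : ∃ N : ℕ → ℕ → ℕ → ℕ → ℕ → ℕ → Basis, ∀ n₀ n₁ n₂ n₃ n₄ n₅, N n₀ n₁ n₂ n₃ n₄ n₅ =
      g + single a₀ n₀ + single a₁ n₁ + single b₀ n₂ + single b₁ n₃ + single y n₄ + single z n₅ :=
    ⟨_, fun _ _ _ _ _ _ => rfl⟩
  simp only [← hN] at hin ⊢
  have P1 : ∀ (A : ℕ × ℕ → ℕ × ℕ → ℂ) (φ : State) (n₀ n₁ n₂ n₃ n₄ n₅ : ℕ),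
      pairAct A b₀ b₁ φ (N n₀ n₁ n₂ n₃ n₄ n₅) =
        ∑ i ∈ Finset.HasAntidiagonal.antidiagonal (n₂ + n₃), A i (n₂, n₃) * φ (N n₀ n₁ i.1 i.2 n₄ n₅) := by
    intro A φ n₀ n₁ n₂ n₃ n₄ n₅
    have e1 : ∀ m n, N n₀ n₁ m n n₄ n₅ = g + single a₀ n₀ + single a₁ n₁ + single y n₄ + single z n₅ +
        single b₀ m + single b₁ n := fun m n => by rw [hN]; abel
    simp only [e1]
    exact pairAct_apply A c1 φ (by simp [*]) (by simp [*]) n₂ n₃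
  have P2 : ∀ (A : ℕ × ℕ → ℕ × ℕ → ℂ) (φ : State) (n₀ n₁ n₂ n₃ n₄ n₅ : ℕ),
      pairAct A b₁ z φ (N n₀ n₁ n₂ n₃ n₄ n₅) =
        ∑ i ∈ Finset.HasAntidiagonal.antidiagonal (n₃ + n₅), A i (n₃, n₅) * φ (N n₀ n₁ n₂ i.1 n₄ i.2) := by
    intro A φ n₀ n₁ n₂ n₃ n₄ n₅
    have e1 : ∀ m n, N n₀ n₁ n₂ m n₄ n = g + single a₀ n₀ + single a₁ n₁ + single b₀ n₂ + single y n₄ +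
        single b₁ m + single z n := fun m n => by rw [hN]; abel
    simp only [e1]
    exact pairAct_apply A d2 φ (by simp [*]) (by simp [*]) n₃ n₅
  have P3 : ∀ (A : ℕ × ℕ → ℕ × ℕ → ℂ) (φ : State) (n₀ n₁ n₂ n₃ n₄ n₅ : ℕ),
      pairAct A b₀ a₁ φ (N n₀ n₁ n₂ n₃ n₄ n₅) =
        ∑ i ∈ Finset.HasAntidiagonal.antidiagonal (n₂ + n₁), A i (n₂, n₁) * φ (N n₀ i.2 i.1 n₃ n₄ n₅) := by
    intro A φ n₀ n₁ n₂ n₃ n₄ n₅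
    have e1 : ∀ m n, N n₀ n m n₃ n₄ n₅ = g + single a₀ n₀ + single b₁ n₃ + single y n₄ + single z n₅ +
        single b₀ m + single a₁ n := fun m n => by rw [hN]; abel
    simp only [e1]
    exact pairAct_apply A (Ne.symm b2) φ (by simp [*]) (by simp [*]) n₂ n₁
  have P4 : ∀ (A : ℕ × ℕ → ℕ × ℕ → ℂ) (φ : State) (n₀ n₁ n₂ n₃ n₄ n₅ : ℕ),
      pairAct A a₀ y φ (N n₀ n₁ n₂ n₃ n₄ n₅) =
        ∑ i ∈ Finset.HasAntidiagonal.antidiagonal (n₀ + n₄), A i (n₀, n₄) * φ (N i.1 n₁ n₂ n₃ i.2 n₅) := by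
    intro A φ n₀ n₁ n₂ n₃ n₄ n₅
    have e1 : ∀ m n, N m n₁ n₂ n₃ n n₅ = g + single a₁ n₁ + single b₀ n₂ + single b₁ n₃ + single z n₅ +
        single a₀ m + single y n := fun m n => by rw [hN]; abel
    simp only [e1]
    exact pairAct_apply A a4 φ (by simp [*]) (by simp [*]) n₀ n₄
  obtain ⟨r, s, t, hr, hr', hs, ht, h2, h3, h4, h5⟩ := sqrt_facts
  have h2' : (r : ℂ) * r = 1 / 2 := by rw [← Complex.ofReal_mul, h2]; norm_num
  have h3' : (s : ℂ) * s = 1 / 3 := by rw [← Complex.ofReal_mul, h3]; norm_num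
  have h4' : (t : ℂ) * t = 2 / 3 := by rw [← Complex.ofReal_mul, h4]; norm_num
  clear h5
  simp only [networkState]
  have hb1 := bsAmp_10_10 (1 / 2); have hb2 := bsAmp_10_01 (1 / 2)
  have hb3 := bsAmp_01_10 (1 / 2); have hb4 := bsAmp_01_01 (1 / 2)
  have hc1 := bsAmp_10_10 (1 / 3); have hc2 := bsAmp_10_01 (1 / 3)
  have hc3 := bsAmp_01_10 (1 / 3); have hc4 := bsAmp_01_01 (1 / 3)
  have hc5 := bsAmp_11_11 (1 / 3)
  simp only [hr, hr', hs, ht] at hb1 hb2 hb3 hb4 hc1 hc2 hc3 hc4 hc5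
  let χ : ℕ → ℕ → ℂ := fun i j => ψ (g + single q i + single q' j)
  interval_cases i <;> interval_cases j
  all_goals
    simp only [Nat.sub_zero, Nat.sub_self, Nat.add_zero, Nat.zero_add, Nat.zero_mod, Nat.one_mod,
      Nat.reduceAdd, Nat.reduceMod, sum_antidiagonal_zero', sum_antidiagonal_one',
      sum_antidiagonal_two', P1, P2, P3, P4, hin]
    simp only [dual, Finset.sum_range_succ, Finset.sum_range_zero, Nat.sub_zero, Nat.sub_self,
      OfNat.ofNat_ne_zero, OfNat.ofNat_ne_one, one_ne_zero, zero_ne_one, and_false, false_and,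
      and_self, if_true, if_false, mul_zero, zero_mul, add_zero, zero_add, mul_one, one_mul,
      bsAmp_00, hb1, hb2, hb3, hb4, hc1, hc2, hc3, hc4, hc5]
    push_cast
  · linear_combination 2 * χ 0 0 * s * s * h2' + χ 0 0 * h3'
  · linear_combination 2 * χ 0 1 * s * s * h2' + χ 0 1 * h3'
  · linear_combination ((t * t - 2 * s * s) * χ 1 0 + t * t * χ 1 1) * h2' - χ 1 0 * h3' +
      (χ 1 0 + χ 1 1) / 2 * h4'
  · linear_combination ((t * t - 2 * s * s) * χ 1 1 + t * t * χ 1 0) * h2' - χ 1 1 * h3' +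
      (χ 1 0 + χ 1 1) / 2 * h4'

omit hsupp in
theorem inputState_total {φ : State} {f : Basis} (h : inputState q q' a₀ a₁ b₀ b₁ φ f ≠ 0)
    (hφ : ∀ f, φ f ≠ 0 → f y = 0 ∧ f z = 0) :
    f q = 0 ∧ f q' = 0 ∧ f a₀ + f a₁ + f b₀ + f b₁ + f y + f z = 2 := by
  have hn6 : [q, q', a₀, a₁, b₀, b₁].Nodup := hn.sublist (by simp)
  obtain ⟨i, hi, j, hj, e1, e2, e3, e4, e5, e6, f', hf', -, -, e7⟩ := inputState_support hn6 h
  simp at hn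
  obtain ⟨⟨q1, q2, q3, q4, q5, q6, q7⟩, ⟨p2, p3, p4, p5, p6, p7⟩, ⟨a1, a2, a3, a4, a5⟩,
    ⟨b2, b3, b4, b5⟩, ⟨c1, c2, c3⟩, ⟨d1, d2⟩, e⟩ := hn
  have h1 := e7 y (by simp [eq_comm (a := y), *])
  have h2 := e7 z (by simp [eq_comm (a := z), *])
  have := hφ f' hf'
  omega

end Network

theorem Tame.inputState {Y : Set QName} {Φ : State} (h : Tame Y Φ) {q q' a₀ a₁ b₀ b₁ : QName}
    (hn : [q, q', a₀, a₁, b₀, b₁].Nodup) (hq : q ∉ Y) (hq' : q' ∉ Y) :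
    Tame Y (inputState q q' a₀ a₁ b₀ b₁ Φ) := by
  simp at hn
  obtain ⟨⟨q1, q2, q3, q4, q5⟩, ⟨p2, p3, p4, p5⟩, ⟨a1, a2, a3⟩, ⟨b2, b3⟩, c⟩ := hn
  exact (h.psAct hq q2 q3 a1).psAct hq' p4 p5 c

theorem networkState_total {q q' a₀ a₁ b₀ b₁ y z : QName}
    (hn : [q, q', a₀, a₁, b₀, b₁, y, z].Nodup) {ψ : State} {f : Basis}
    (h : networkState q q' a₀ a₁ b₀ b₁ y z ψ f ≠ 0) (hφ : ∀ f, ψ f ≠ 0 → f y = 0 ∧ f z = 0) :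
    f q = 0 ∧ f q' = 0 ∧ f a₀ + f a₁ + f b₀ + f b₁ + f y + f z = 2 := by
  have hin := fun f => inputState_total hn (φ := ψ) (f := f)
  simp at hn
  obtain ⟨⟨q1, q2, q3, q4, q5, q6, q7⟩, ⟨p2, p3, p4, p5, p6, p7⟩, ⟨a1, a2, a3, a4, a5⟩,
    ⟨b2, b3, b4, b5⟩, ⟨c1, c2, c3⟩, ⟨d1, d2⟩, e⟩ := hn
  obtain ⟨f1, h1, k1, l1⟩ := pairAct_support_le c1 h
  obtain ⟨f2, h2, k2, l2⟩ := pairAct_support_le d2 h1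
  obtain ⟨f3, h3, k3, l3⟩ := pairAct_support_le (Ne.symm b2) h2
  obtain ⟨f4, h4, k4, l4⟩ := pairAct_support_le a4 h3
  obtain ⟨f5, h5, k5, l5⟩ := pairAct_support_le c1 h4
  have key := hin f5 h5 hφ
  have m1 := l1 q q4 q5; have m2 := l1 q' p4 p5; have m3 := l1 a₀ a2 a3; have m4 := l1 a₁ b2 b3
  have m5 := l1 y (Ne.symm c2) (Ne.symm d1); have m6 := l1 z (Ne.symm c3) (Ne.symm d2)
  have n1 := l2 q q5 q7; have n2 := l2 q' p5 p7; have n3 := l2 a₀ a3 a5; have n4 := l2 a₁ b3 b5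
  have n5 := l2 b₀ c1 c3; have n6 := l2 y (Ne.symm d1) e
  have r1 := l3 q q4 q3; have r2 := l3 q' p4 p3; have r3 := l3 a₀ a2 a1
  have r4 := l3 b₁ (Ne.symm c1) (Ne.symm b3); have r5 := l3 y (Ne.symm c2) (Ne.symm b4)
  have r6 := l3 z (Ne.symm c3) (Ne.symm b5)
  have s1 := l4 q q2 q6; have s2 := l4 q' p2 p6; have s3 := l4 a₁ (Ne.symm a1) b4
  have s4 := l4 b₀ (Ne.symm a2) c2; have s5 := l4 b₁ (Ne.symm a3) d1
  have s6 := l4 z (Ne.symm a5) (Ne.symm e)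
  have t1 := l5 q q4 q5; have t2 := l5 q' p4 p5; have t3 := l5 a₀ a2 a3; have t4 := l5 a₁ b2 b3
  have t5 := l5 y (Ne.symm c2) (Ne.symm d1); have t6 := l5 z (Ne.symm c3) (Ne.symm d2)
  omega

theorem reduced_mix {Φ : State} (hΦ : SqSummable Φ) {C D : Basis → Prop} {p : Prop} [Decidable p]
    (hD : ∀ f, ¬ C f → (D f ↔ p)) (L : List QName) (a b : Basis) :
    reduced Φ D L a b = reduced Φ (fun f => C f ∧ D f) L a b +
      (if p then 1 else 0) * (reduced Φ (fun _ => True) L a b - reduced Φ C L a b) := by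
  classical
  have hs : ∀ E : Basis → Prop, HasSum (fun f => if (∀ x ∈ L, f x = 0) ∧ E f then
      Φ (f + a) * (starRingEnd ℂ) (Φ (f + b)) else 0) (reduced Φ E L a b) := fun E => by
    rw [reduced]
    convert (summable_ite ((hΦ.shift a).mul_conj (hΦ.shift b)) _).hasSum
  refine (hs D).unique ?_
  convert (hs fun f => C f ∧ D f).add (((hs fun _ => True).sub (hs C)).mul_left
    (if p then (1 : ℂ) else 0)) using 2 with f
  have := hD f
  by_cases h0 : ∀ x ∈ L, f x = 0
  · by_cases h1 : C f
    · simp [h1]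
    · simp only [h1, not_false_eq_true, forall_true_left] at this
      by_cases h2 : p <;> simp [h1, h2, this]
  · simp [h0]

open Finsupp (single)

theorem pairAct_total {A : ℕ × ℕ → ℕ × ℕ → ℂ} {F : Finset QName} {s t : QName} (hs : s ∈ F)
    (ht : t ∈ F) (hst : s ≠ t) {n : ℕ} {φ : State} (h : ∀ f, φ f ≠ 0 → ∑ x ∈ F, f x = n) :
    ∀ f, pairAct A s t φ f ≠ 0 → ∑ x ∈ F, f x = n := by
  intro f hf
  obtain ⟨f', h1, h2, h3⟩ := pairAct_support_le hst hf
  have ht' : t ∈ F.erase s := Finset.mem_erase.2 ⟨hst.symm, ht⟩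
  rw [← h f' h1, ← Finset.add_sum_erase F _ hs, ← Finset.add_sum_erase _ _ ht',
    ← Finset.add_sum_erase F _ hs, ← Finset.add_sum_erase _ _ ht', ← add_assoc, ← add_assoc, h2]
  congr 1
  refine Finset.sum_congr rfl fun x hx => (h3 x ?_ ?_).symm
  · rintro rfl; simp at hx
  · rintro rfl; simp at hx

theorem network_expected {q q' a₀ a₁ b₀ b₁ y z : QName}
    (hn : [q, q', a₀, a₁, b₀, b₁, y, z].Nodup) {ψ : State} (hψ : SqSummable ψ)
    (hsupp : ∀ f, ψ f ≠ 0 → f q ≤ 1 ∧ f q' ≤ 1 ∧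
      f a₀ = 0 ∧ f a₁ = 0 ∧ f b₀ = 0 ∧ f b₁ = 0 ∧ f y = 0 ∧ f z = 0)
    (D : ℤ × ℤ × ℤ → Prop) [DecidablePred D] {L : List QName} {a b : Basis}
    (hL : ∀ x ∈ L, x ∉ [q, q', a₀, a₁, b₀, b₁, y, z]) (ha : ∀ x, x ∉ L → a x = 0)
    (hb : ∀ x, x ∉ L → b x = 0) :
    reduced (networkState q q' a₀ a₁ b₀ b₁ y z ψ) (fun f => D (networkOutcome a₀ a₁ b₀ b₁ f)) L a b =
      expected ψ q q' D L a b := by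
  have hin := fun g => inputState_network hn hsupp (g := g)
  have happ := fun g => networkState_apply hn hsupp (g := g)
  have htot := fun f => networkState_total hn (ψ := ψ) (f := f)
  have hitot := fun f => inputState_total hn (φ := ψ) (f := f)
  have hn6 : [q, q', a₀, a₁, b₀, b₁].Nodup := hn.sublist (by simp)
  have hisupp := fun f => inputState_support hn6 (ψ := ψ) (f := f)
  simp at hn
  obtain ⟨⟨q1, q2, q3, q4, q5, q6, q7⟩, ⟨p2, p3, p4, p5, p6, p7⟩, ⟨a1, a2, a3, a4, a5⟩,
    ⟨b2, b3, b4, b5⟩, ⟨c1, c2, c3⟩, ⟨d1, d2⟩, e⟩ := hn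
  let Y : Set QName := {x | x ∈ [a₀, a₁, b₀, b₁, y, z]}
  have T0 : Tame Y ψ := by
    refine ⟨hψ, 0, fun f hf x hx => ?_⟩
    have := hsupp f hf
    simp only [Y, Set.mem_ofPred_eq, List.mem_cons, List.not_mem_nil, or_false] at hx
    rcases hx with rfl | rfl | rfl | rfl | rfl | rfl <;> omega
  have m0 : a₀ ∈ Y := by simp [Y]
  have m1 : a₁ ∈ Y := by simp [Y]
  have m2 : b₀ ∈ Y := by simp [Y]
  have m3 : b₁ ∈ Y := by simp [Y]
  have m4 : y ∈ Y := by simp [Y]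
  have m5 : z ∈ Y := by simp [Y]
  have T1 : Tame Y (inputState q q' a₀ a₁ b₀ b₁ ψ) := T0.inputState hn6 (by simp [Y, *])
    (by simp [Y, *])
  have T2 := T1.pairAct (bsAmp (1 / 2)) m2 m3 c1
  have T3 := T2.pairAct (bsAmp (1 / 3)) m0 m4 a4
  have T4 := T3.pairAct (bsAmp (1 / 3)) m2 m1 (Ne.symm b2)
  have T5 := T4.pairAct (bsAmp (1 / 3)) m3 m5 d2
  have T6 : Tame Y (networkState q q' a₀ a₁ b₀ b₁ y z ψ) := T5.pairAct (bsAmp (1 / 2)) m2 m3 c1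
  have Lq : ∀ x ∈ [q, q', a₀, a₁, b₀, b₁, y, z], x ∉ L := fun x hx hxL => hL x hxL hx
  simp only [List.mem_cons, List.not_mem_nil, or_false, forall_eq_or_imp, forall_eq] at Lq
  obtain ⟨L0, L1, L2, L3, L4, L5, L6, L7⟩ := Lq
  have hφ : ∀ f, ψ f ≠ 0 → f y = 0 ∧ f z = 0 := fun f hf => (hsupp f hf).2.2.2.2.2.2
  let F : Finset QName := {a₀, a₁, b₀, b₁, y, z}
  have hF : ∀ f : Basis, ∑ x ∈ F, f x = f a₀ + f a₁ + f b₀ + f b₁ + f y + f z := by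
    intro f
    simp only [F]
    rw [Finset.sum_insert (by simp [*]), Finset.sum_insert (by simp [*]),
      Finset.sum_insert (by simp [*]), Finset.sum_insert (by simp [*]),
      Finset.sum_pair e]
    ring
  have bound : ∀ {s t}, s ∈ F → t ∈ F → s ≠ t → ∀ {φ : State},
      (∀ f, φ f ≠ 0 → ∑ x ∈ F, f x = 2) → ∀ f, φ f ≠ 0 → f s + f t ≤ 2 := by
    intro s t hs ht hst φ h f hf
    rw [← h f hf, ← Finset.add_sum_erase F _ hs,
      ← Finset.add_sum_erase _ _ (Finset.mem_erase.2 ⟨hst.symm, ht⟩)]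
    omega
  have F0 : a₀ ∈ F := by simp [F]
  have F1 : a₁ ∈ F := by simp [F]
  have F2 : b₀ ∈ F := by simp [F]
  have F3 : b₁ ∈ F := by simp [F]
  have F4 : y ∈ F := by simp [F]
  have F5 : z ∈ F := by simp [F]
  have S1 : ∀ f, inputState q q' a₀ a₁ b₀ b₁ ψ f ≠ 0 → ∑ x ∈ F, f x = 2 := fun f hf => by
    rw [hF]; exact (hitot f hf hφ).2.2
  have S2 := pairAct_total (A := bsAmp (1 / 2)) F2 F3 c1 S1
  have S3 := pairAct_total (A := bsAmp (1 / 3)) F0 F4 a4 S2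
  have S4 := pairAct_total (A := bsAmp (1 / 3)) F2 F1 (Ne.symm b2) S3
  have S5 := pairAct_total (A := bsAmp (1 / 3)) F3 F5 d2 S4
  have i2 := isometric_bsAmp (η := 1 / 2) (by norm_num) (by norm_num)
  have i3 := isometric_bsAmp (η := 1 / 3) (by norm_num) (by norm_num)
  have hT : reduced (networkState q q' a₀ a₁ b₀ b₁ y z ψ) (fun _ => True) L a b =
      reduced (inputState q q' a₀ a₁ b₀ b₁ ψ) (fun _ => True) L a b := by
    rw [networkState, reduced_pairAct i2 c1 T5.1 T6.1 (bound F2 F3 c1 S5) L4 L5 ha hb,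
      reduced_pairAct i3 d2 T4.1 T5.1 (bound F3 F5 d2 S4) L5 L7 ha hb,
      reduced_pairAct i3 (Ne.symm b2) T3.1 T4.1 (bound F2 F1 (Ne.symm b2) S3) L4 L3 ha hb,
      reduced_pairAct i3 a4 T2.1 T3.1 (bound F0 F4 a4 S2) L2 L6 ha hb,
      reduced_pairAct i2 c1 T1.1 T2.1 (bound F2 F3 c1 S1) L4 L5 ha hb]
  let K : Finset QName := {q, q', a₀, a₁, b₀, b₁, y, z}
  let h : Fin 2 × Fin 2 → Basis := fun k =>
    single a₀ (1 - k.1.val) + single a₁ k.1.val + single b₀ (1 - k.2.val) + single b₁ k.2.val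
  have hv : ∀ k, h k q = 0 ∧ h k q' = 0 ∧ h k a₀ = 1 - k.1.val ∧ h k a₁ = k.1.val ∧
      h k b₀ = 1 - k.2.val ∧ h k b₁ = k.2.val ∧ h k y = 0 ∧ h k z = 0 := by
    intro k
    simp [h, *,
      Ne.symm a1, Ne.symm a2, Ne.symm a3, Ne.symm b2,
      Ne.symm b3, Ne.symm c1]
  have hK : ∀ k, ∀ x ∉ K, h k x = 0 := by
    intro k x hx
    simp only [K, Finset.mem_insert, Finset.mem_singleton, not_or] at hx
    obtain ⟨-, -, x1, x2, x3, x4, -⟩ := hx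
    simp [h, Ne.symm x1, Ne.symm x2, Ne.symm x3, Ne.symm x4]
  have hinj : Function.Injective h := by
    intro k k' hk
    have r1 := (hv k).2.2.2.1; have r2 := (hv k).2.2.2.2.2.1
    rw [hk, (hv k').2.2.2.1] at r1
    rw [hk, (hv k').2.2.2.2.2.1] at r2
    exact Prod.ext (Fin.ext r1.symm) (Fin.ext r2.symm)
  have hKL : ∀ x ∈ L, x ∉ K := fun x hx => by simpa [K] using hL x hx
  have aK : ∀ x ∈ K, a x = 0 := fun x hx => ha x fun h => hKL x h hx
  have hψK : ∀ (i j : ℕ) (g : Basis), ψ (g + single q i + single q' j) ≠ 0 → g q = 0 → g q' = 0 →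
      ∀ x ∈ K, g x = 0 := by
    intro i j g hg h1 h2 x hx
    have := hsupp _ hg
    simp only [Finsupp.add_apply, Finsupp.single_apply] at this
    simp only [K, Finset.mem_insert, Finset.mem_singleton] at hx
    rcases hx with rfl | rfl | rfl | rfl | rfl | rfl | rfl | rfl <;> simp [*] at this ⊢ <;> omega
  have qK : q ∈ K := by simp [K]
  have qK' : q' ∈ K := by simp [K]
  have hCa : ∀ f : Basis, networkOutcome a₀ a₁ b₀ b₁ (f + a) = networkOutcome a₀ a₁ b₀ b₁ f := by
    intro f
    simp [networkOutcome, Finsupp.add_apply, ha _ L2, ha _ L3, ha _ L4, ha _ L5]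
  have hval : ∀ k (g : Basis), (∀ x ∈ K, g x = 0) →
      networkState q q' a₀ a₁ b₀ b₁ y z ψ (g + h k) =
        1 / 3 * ψ (g + single q k.1.val + single q' ((k.1.val + k.2.val) % 2)) := by
    intro k g hg
    have := happ g (by simpa [K] using hg) k.1.2 k.2.2
    rw [Finsupp.single_zero, Finsupp.single_zero, add_zero, add_zero] at this
    rw [← this]
    simp only [h, add_assoc]
  have hz : ∀ f : Basis, f a₀ + f a₁ = 1 ∧ f b₀ + f b₁ = 1 →
      networkState q q' a₀ a₁ b₀ b₁ y z ψ f ≠ 0 → ∃ k, ∀ x ∈ K, f x = h k x := by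
    intro f hC hf
    have := htot f hf hφ
    have k1 : f a₁ < 2 := by omega
    have k2 : f b₁ < 2 := by omega
    refine ⟨(⟨f a₁, k1⟩, ⟨f b₁, k2⟩), fun x hx => ?_⟩
    obtain ⟨v0, v1, v2, v3, v4, v5, v6, v7⟩ := hv (⟨f a₁, k1⟩, ⟨f b₁, k2⟩)
    simp only at v0 v1 v2 v3 v4 v5 v6 v7
    simp only [K, Finset.mem_insert, Finset.mem_singleton] at hx
    rcases hx with h | h | h | h | h | h | h | h <;> rw [h] <;> omega
  have hout : ∀ k (g : Basis), (∀ x ∈ K, g x = 0) →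
      ((g + h k) a₀ + (g + h k) a₁ = 1 ∧ (g + h k) b₀ + (g + h k) b₁ = 1) ∧
        networkOutcome a₀ a₁ b₀ b₁ (g + h k) = ((k.1.val : ℤ), (k.2.val : ℤ), (1 : ℤ)) := by
    intro k g hg
    simp only [K, Finset.mem_insert, Finset.mem_singleton, forall_eq_or_imp, forall_eq] at hg
    obtain ⟨-, -, v2, v3, v4, v5, -, -⟩ := hv k
    have l1 := k.1.2; have l2 := k.2.2
    have hC : (g + h k) a₀ + (g + h k) a₁ = 1 ∧ (g + h k) b₀ + (g + h k) b₁ = 1 := by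
      simp only [Finsupp.add_apply, hg, v2, v3, v4, v5]
      omega
    refine ⟨hC, ?_⟩
    rw [networkOutcome, if_pos hC]
    simp only [Finsupp.add_apply, hg, v3, v5, zero_add]
  have hC : ∀ f : Basis, (f + a) a₀ + (f + a) a₁ = 1 ∧ (f + a) b₀ + (f + a) b₁ = 1 ↔
      f a₀ + f a₁ = 1 ∧ f b₀ + f b₁ = 1 := by
    intro f
    simp [Finsupp.add_apply, ha _ L2, ha _ L3, ha _ L4, ha _ L5]
  rw [reduced_mix T6.1 (C := fun f => f a₀ + f a₁ = 1 ∧ f b₀ + f b₁ = 1) (p := D (0, 0, 0))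
    (fun f hf => by rw [networkOutcome, if_neg hf]), hT,
    reduced_eq_sum hK hinj T6.1 hψ (fun _ => 1 / 3) (fun k => k.1.val)
      (fun k => (k.1.val + k.2.val) % 2) qK qK' (Dk := fun k => D (k.1.val, k.2.val, 1)) hKL ha hb
      (fun f => by rw [hCa, hC]) hval (fun f hf => hz f hf.1)
      (fun k g hg => by rw [(hout k g hg).2]; exact and_iff_right (hout k g hg).1)
      (fun k g => hψK _ _ g),
    reduced_eq_sum hK hinj T6.1 hψ (fun _ => 1 / 3) (fun k => k.1.val)
      (fun k => (k.1.val + k.2.val) % 2) qK qK' (Dk := fun k => True) hKL ha hb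
      (fun f => hC f) hval hz (fun k g hg => iff_true_intro (hout k g hg).1) (fun k g => hψK _ _ g),
    reduced_eq_sum hK hinj T1.1 hψ (fun _ => 1) (fun k => k.1.val)
      (fun k => k.2.val) qK qK' (Dk := fun k => True) hKL ha hb (fun f => Iff.rfl) ?_ ?_
      (fun k g hg => Iff.rfl) (fun k g => hψK _ _ g)]
  · rw [expected]
    simp only [Fintype.sum_prod_type, Fin.sum_univ_two, Fin.isValue, Fin.val_zero, Fin.val_one,
      add_zero, zero_add, Nat.zero_mod, Nat.one_mod, Nat.reduceAdd, Nat.reduceMod, if_true]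
    have e3 : (1 / 3 : ℂ) * (starRingEnd ℂ) (1 / 3) = 1 / 9 := by
      rw [map_div₀, map_one, map_ofNat]; norm_num
    rw [e3, map_one]
    split_ifs <;> ring
  · intro k g hg
    have := hin g (by simpa [K] using hg) (1 - k.1.val) k.1.val (1 - k.2.val) k.2.val 0 0
    rw [Finsupp.single_zero, Finsupp.single_zero, add_zero, add_zero, if_pos ⟨rfl, rfl⟩] at this
    simp only [h, ← add_assoc]
    rw [this]
    obtain ⟨k1, k2⟩ := k
    fin_cases k1 <;> fin_cases k2 <;> simp [Finset.sum_range_succ, dual]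
  · intro f _ hf
    obtain ⟨i, hi, j, hj, r0, r1, r2, r3, r4, r5, -⟩ := hisupp f hf
    have := hitot f hf hφ
    refine ⟨(⟨i, hi⟩, ⟨j, hj⟩), fun x hx => ?_⟩
    obtain ⟨v0, v1, v2, v3, v4, v5, v6, v7⟩ := hv (⟨i, hi⟩, ⟨j, hj⟩)
    simp only at v0 v1 v2 v3 v4 v5 v6 v7
    simp only [K, Finset.mem_insert, Finset.mem_singleton] at hx
    rcases hx with h | h | h | h | h | h | h | h <;> rw [h] <;> omega

open Finsupp (single)

/-! ### The specified operation -/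

/-- The final state of the operation of the specification. -/
noncomputable def specState (q q' q₂ a₀ a₁ b₀ b₁ : QName) (ψ : State) : State :=
  pairAct hadAmp b₀ b₁ <| czAct a₀ a₁ b₀ b₁ <| qubitAct ninthMatrix q₂ <|
    pairAct hadAmp b₀ b₁ <| inputState q q' a₀ a₁ b₀ b₁ ψ

/-- The numbers that the specification sends. -/
def specOutcome (q₂ a₁ b₁ : QName) (f : Basis) : ℤ × ℤ × ℤ :=
  (if f q₂ = 1 then (f a₁ : ℤ) else 0, if f q₂ = 1 then (f b₁ : ℤ) else 0, (f q₂ : ℤ))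

theorem qubitAct_apply {U : Matrix (Fin 2) (Fin 2) ℂ} {q : QName} {φ : State}
    (hφ : ∀ f, φ f ≠ 0 → f q = 0) {p : Basis} (hp : p q = 0) (x : Fin 2) :
    qubitAct U q φ (p + single q x.val) = U x 0 * φ p := by
  have e : (p + single q x.val) q = x.val := by simp [hp]
  have e0 : φ (p + single q 1) = 0 := by
    by_contra h
    have := hφ _ h
    simp [hp] at this
  rw [qubitAct, dif_pos (by rw [e]; exact x.2), Fin.sum_univ_two, update_add_single_self hp,
    update_add_single_self hp, Fin.val_zero, Fin.val_one, Finsupp.single_zero, add_zero, e0,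
    mul_zero, add_zero]
  congr 2
  exact Fin.ext e

theorem qubitAct_support {U : Matrix (Fin 2) (Fin 2) ℂ} {q : QName} {φ : State} {f : Basis}
    (h : qubitAct U q φ f ≠ 0) :
    f q < 2 ∧ ∃ f', φ f' ≠ 0 ∧ ∀ x, x ≠ q → f' x = f x := by
  rw [qubitAct] at h
  split_ifs at h with h1
  · obtain ⟨b, -, hb⟩ := Finset.exists_ne_zero_of_sum_ne_zero h
    exact ⟨h1, _, right_ne_zero_of_mul hb, fun x hx => update_ne _ hx _⟩
  · exact absurd rfl h

section Spec

variable {q q' q₂ a₀ a₁ b₀ b₁ : QName} (hn : [q, q', a₀, a₁, b₀, b₁].Nodup)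
  (hn₂ : q₂ ∉ [a₀, a₁, b₀, b₁]) {ψ : State} (hψ : SqSummable ψ)
  (hsupp : ∀ f, ψ f ≠ 0 → f q ≤ 1 ∧ f q' ≤ 1 ∧
    f a₀ = 0 ∧ f a₁ = 0 ∧ f b₀ = 0 ∧ f b₁ = 0)
  (hq₂ : q₂ = q ∨ q₂ = q' ∨ ∀ f, ψ f ≠ 0 → f q₂ = 0)

include hn hn₂ hq₂

theorem inputState_ancilla {f : Basis} (h : inputState q q' a₀ a₁ b₀ b₁ ψ f ≠ 0) : f q₂ = 0 := by
  obtain ⟨i, hi, j, hj, e1, e2, -, -, -, -, f', hf', h1, h2, h3⟩ := inputState_support hn h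
  by_cases c1 : q₂ = q
  · rw [c1, e1]
  · by_cases c2 : q₂ = q'
    · rw [c2, e2]
    · rw [← h3 q₂ (by simp only [List.mem_cons, not_or] at hn₂ ⊢; exact ⟨c1, c2, hn₂⟩)]
      rcases hq₂ with h | h | h
      · exact absurd h c1
      · exact absurd h c2
      · exact h _ hf'

omit hq₂ in
theorem specState_support {f : Basis} (h : specState q q' q₂ a₀ a₁ b₀ b₁ ψ f ≠ 0) :
    f q₂ < 2 ∧ f a₀ + f a₁ = 1 ∧ f b₀ + f b₁ = 1 ∧ (q₂ ≠ q → f q = 0) ∧ (q₂ ≠ q' → f q' = 0) := by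
  have hn' := hn
  have hn₂' := hn₂
  simp at hn' hn₂'
  obtain ⟨⟨q1, q2, q3, q4, q5⟩, ⟨p2, p3, p4, p5⟩, ⟨a1, a2, a3⟩, ⟨b2, b3⟩, c⟩ := hn'
  obtain ⟨r1, r2, r3, r4⟩ := hn₂'
  obtain ⟨f1, h1, k1, l1⟩ := pairAct_support_le c h
  have h1' := right_ne_zero_of_mul h1
  obtain ⟨hq, f2, h2, l2⟩ := qubitAct_support h1'
  obtain ⟨f3, h3, k3, l3⟩ := pairAct_support_le c h2
  obtain ⟨i, hi, j, hj, e1, e2, e3, e4, e5, e6, -⟩ := inputState_support hn h3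
  have m1 := l1 a₀ a2 a3; have m2 := l1 a₁ b2 b3
  have m3 := l2 a₀ (Ne.symm r1); have m4 := l2 a₁ (Ne.symm r2)
  have m5 := l2 b₀ (Ne.symm r3); have m6 := l2 b₁ (Ne.symm r4)
  have m7 := l3 a₀ a2 a3; have m8 := l3 a₁ b2 b3
  rw [l1 q₂ r3 r4] at hq
  refine ⟨hq, by omega, by omega, fun hne => ?_, fun hne => ?_⟩
  · rw [← l1 q q4 q5, ← l2 q (Ne.symm hne), ← l3 q q4 q5, e1]
  · rw [← l1 q' p4 p5, ← l2 q' (Ne.symm hne), ← l3 q' p4 p5, e2]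

theorem specState_apply {g : Basis} (hg : ∀ x ∈ [q, q', q₂, a₀, a₁, b₀, b₁], g x = 0)
    (i j x : Fin 2) :
    specState q q' q₂ a₀ a₁ b₀ b₁ ψ (g + single a₀ (1 - i.val) + single a₁ i.val +
        single b₀ (1 - j.val) + single b₁ j.val + single q₂ x.val) =
      ninthMatrix x 0 * ψ (g + single q i.val + single q' ((i.val + j.val) % 2)) := by
  have hanc := fun f => inputState_ancilla hn hn₂ (ψ := ψ) hq₂ (f := f)
  have hin := inputState_apply hn ψ (hg q (by simp)) (hg q' (by simp)) (hg a₀ (by simp))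
    (hg a₁ (by simp)) (hg b₀ (by simp)) (hg b₁ (by simp))
  simp at hn hn₂
  obtain ⟨⟨q1, q2, q3, q4, q5⟩, ⟨p2, p3, p4, p5⟩, ⟨a1, a2, a3⟩, ⟨b2, b3⟩, c⟩ := hn
  obtain ⟨r1, r2, r3, r4⟩ := hn₂
  simp only [List.mem_cons, List.not_mem_nil, or_false, forall_eq_or_imp, forall_eq] at hg
  obtain ⟨g1, g2, g3, g4, g5, g6, g7⟩ := hg
  have := Ne.symm a1; have := Ne.symm a2; have := Ne.symm a3; have := Ne.symm b2
  have := Ne.symm b3; have := Ne.symm c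
  have P1 : ∀ (φ : State) (n₀ n₁ n₂ n₃ m : ℕ),
      pairAct hadAmp b₀ b₁ φ (g + single a₀ n₀ + single a₁ n₁ + single b₀ n₂ + single b₁ n₃ +
        single q₂ m) = ∑ i ∈ Finset.HasAntidiagonal.antidiagonal (n₂ + n₃),
        hadAmp i (n₂, n₃) * φ (g + single a₀ n₀ + single a₁ n₁ + single b₀ i.1 + single b₁ i.2 +
        single q₂ m) := by
    intro φ n₀ n₁ n₂ n₃ m
    have e1 : ∀ k l, g + single a₀ n₀ + single a₁ n₁ + single b₀ k + single b₁ l +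
        single q₂ m = (g + single a₀ n₀ + single a₁ n₁ + single q₂ m) + single b₀ k +
        single b₁ l := fun k l => by abel
    simp only [e1]
    exact pairAct_apply _ c φ (by simp [*]) (by simp [*]) n₂ n₃
  have P2 : ∀ (φ : State) (n₀ n₁ n₂ n₃ m : ℕ),
      czAct a₀ a₁ b₀ b₁ φ (g + single a₀ n₀ + single a₁ n₁ + single b₀ n₂ + single b₁ n₃ +
        single q₂ m) = (if n₀ = 0 ∧ n₁ = 1 ∧ n₂ = 0 ∧ n₃ = 1 then -1 else 1) *
        φ (g + single a₀ n₀ + single a₁ n₁ + single b₀ n₂ + single b₁ n₃ + single q₂ m) := by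
    intro φ n₀ n₁ n₂ n₃ m
    rw [czAct]
    simp [*]
  have hsum : ∀ f, pairAct hadAmp b₀ b₁ (inputState q q' a₀ a₁ b₀ b₁ ψ) f ≠ 0 → f q₂ = 0 := by
    intro f hf
    obtain ⟨f', h1, -, h3⟩ := pairAct_support_le c hf
    rw [← h3 q₂ r3 r4, hanc f' h1]
  have P3 : ∀ (n₀ n₁ n₂ n₃ : ℕ) (x : Fin 2),
      qubitAct ninthMatrix q₂ (pairAct hadAmp b₀ b₁ (inputState q q' a₀ a₁ b₀ b₁ ψ))
        (g + single a₀ n₀ + single a₁ n₁ + single b₀ n₂ + single b₁ n₃ + single q₂ x.val) =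
      ninthMatrix x 0 * pairAct hadAmp b₀ b₁ (inputState q q' a₀ a₁ b₀ b₁ ψ)
        (g + single a₀ n₀ + single a₁ n₁ + single b₀ n₂ + single b₁ n₃ + single q₂ 0) := by
    intro n₀ n₁ n₂ n₃ x
    rw [qubitAct_apply hsum, Finsupp.single_zero, add_zero]
    simp [*]
  have hin' : ∀ n₀ n₁ n₂ n₃, inputState q q' a₀ a₁ b₀ b₁ ψ (g + single a₀ n₀ + single a₁ n₁ +
      single b₀ n₂ + single b₁ n₃ + single q₂ 0) = ∑ i ∈ Finset.range 2, ∑ j ∈ Finset.range 2,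
        dual i n₀ n₁ * dual j n₂ n₃ * ψ (g + single q i + single q' j) := by
    intro n₀ n₁ n₂ n₃
    rw [Finsupp.single_zero, add_zero, hin]
  have h2 : ((√2 : ℝ) : ℂ) * (√2 : ℝ) = 2 := by
    rw [← Complex.ofReal_mul, Real.mul_self_sqrt (by norm_num)]; norm_num
  have h0 : ((√2 : ℝ) : ℂ) ≠ 0 := by
    intro h
    rw [h] at h2
    norm_num at h2
  generalize hr : ((√2 : ℝ) : ℂ) = r at h2 h0
  rw [specState]
  generalize hu : ninthMatrix x 0 = u
  have h2' : r ^ 2 = 2 := by rw [pow_two, h2]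
  fin_cases i <;> fin_cases j
  all_goals
    simp only [Fin.isValue,
      Nat.sub_zero, Nat.sub_self, Nat.add_zero, Nat.zero_add, Nat.zero_mod, Nat.one_mod,
      Nat.reduceAdd, Nat.reduceMod, sum_antidiagonal_one', P1, P2, P3, hin', hu]
    simp [dual, Finset.sum_range_succ, hadAmp, hr]
    field_simp
    simp only [h2']
    ring

include hψ hsupp

omit hq₂ in
theorem sqSummable_specState : SqSummable (specState q q' q₂ a₀ a₁ b₀ b₁ ψ) := by
  have hn6 := hn
  simp at hn
  obtain ⟨⟨q1, q2, q3, q4, q5⟩, ⟨p2, p3, p4, p5⟩, ⟨a1, a2, a3⟩, ⟨b2, b3⟩, c⟩ := hn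
  let Y : Set QName := {x | x ∈ [a₀, a₁, b₀, b₁]}
  have T0 : Tame Y ψ := by
    refine ⟨hψ, 0, fun f hf x hx => ?_⟩
    have := hsupp f hf
    simp only [Y, Set.mem_ofPred_eq, List.mem_cons, List.not_mem_nil, or_false] at hx
    rcases hx with rfl | rfl | rfl | rfl <;> omega
  have m2 : b₀ ∈ Y := by simp [Y]
  have m3 : b₁ ∈ Y := by simp [Y]
  have T1 := T0.inputState hn6 (by simp [Y, *]) (by simp [Y, *])
  exact ((((T1.pairAct hadAmp m2 m3 c).qubitAct ninthMatrix q₂).czAct a₀ a₁ b₀ b₁).pairAct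
    hadAmp m2 m3 c).1

theorem spec_expected (D : ℤ × ℤ × ℤ → Prop) [DecidablePred D] {L : List QName} {a b : Basis}
    (hL : ∀ x ∈ L, x ∉ [q, q', q₂, a₀, a₁, b₀, b₁]) (ha : ∀ x, x ∉ L → a x = 0)
    (hb : ∀ x, x ∉ L → b x = 0) :
    reduced (specState q q' q₂ a₀ a₁ b₀ b₁ ψ) (fun f => D (specOutcome q₂ a₁ b₁ f)) L a b =
      expected ψ q q' D L a b := by
  have hn₂' := hn₂
  have happ := fun g => specState_apply hn hn₂ (ψ := ψ) hq₂ (g := g)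
  have hspec := fun f => specState_support hn hn₂ (ψ := ψ) (f := f)
  simp at hn₂
  obtain ⟨r1, r2, r3, r4⟩ := hn₂
  have hn6 := hn
  simp at hn
  obtain ⟨⟨q1, q2, q3, q4, q5⟩, ⟨p2, p3, p4, p5⟩, ⟨a1, a2, a3⟩, ⟨b2, b3⟩, c⟩ := hn
  have T6 := sqSummable_specState (q₂ := q₂) hn6 hn₂' hψ hsupp
  have Lq : ∀ x ∈ [q, q', q₂, a₀, a₁, b₀, b₁], x ∉ L := fun x hx hxL => hL x hxL hx
  simp only [List.mem_cons, List.not_mem_nil, or_false, forall_eq_or_imp, forall_eq] at Lq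
  obtain ⟨L0, L1, L2, L3, L4, L5, L6⟩ := Lq
  let K : Finset QName := {q, q', q₂, a₀, a₁, b₀, b₁}
  let h : Fin 2 × Fin 2 × Fin 2 → Basis := fun k =>
    single a₀ (1 - k.1.val) + single a₁ k.1.val + single b₀ (1 - k.2.1.val) +
      single b₁ k.2.1.val + single q₂ k.2.2.val
  have hv : ∀ k, h k a₀ = 1 - k.1.val ∧ h k a₁ = k.1.val ∧
      h k b₀ = 1 - k.2.1.val ∧ h k b₁ = k.2.1.val ∧ h k q₂ = k.2.2.val ∧
      (q₂ ≠ q → h k q = 0) ∧ (q₂ ≠ q' → h k q' = 0) := by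
    intro k
    simp +contextual [h, *,
      Ne.symm a1, Ne.symm a2, Ne.symm a3,
      Ne.symm b2, Ne.symm b3, Ne.symm c, Ne.symm r1, Ne.symm r2, Ne.symm r3, Ne.symm r4]
  have hK : ∀ k, ∀ x ∉ K, h k x = 0 := by
    intro k x hx
    simp only [K, Finset.mem_insert, Finset.mem_singleton, not_or] at hx
    obtain ⟨-, -, x0, x1, x2, x3, x4⟩ := hx
    simp [h, Ne.symm x0, Ne.symm x1, Ne.symm x2, Ne.symm x3, Ne.symm x4]
  have hinj : Function.Injective h := by
    intro k k' hk
    obtain ⟨-, s1, -, s2, s3, -⟩ := hv k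
    obtain ⟨-, s1', -, s2', s3', -⟩ := hv k'
    rw [hk] at s1 s2 s3
    exact Prod.ext (Fin.ext (s1.symm.trans s1'))
      (Prod.ext (Fin.ext (s2.symm.trans s2')) (Fin.ext (s3.symm.trans s3')))
  have hKL : ∀ x ∈ L, x ∉ K := fun x hx => by simpa [K] using hL x hx
  rw [reduced_eq_sum hK hinj T6 hψ (fun k => ninthMatrix k.2.2 0) (fun k => k.1.val)
      (fun k => (k.1.val + k.2.1.val) % 2) (q := q) (q' := q') (by simp [K]) (by simp [K])
      (Dk := fun k => D (if k.2.2 = 1 then k.1.val else 0, if k.2.2 = 1 then k.2.1.val else 0,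
        k.2.2.val)) hKL ha hb ?_ ?_ ?_ ?_ ?_]
  · rw [expected]
    have h8 : ((√8 : ℝ) : ℂ) * (√8 : ℝ) = 8 := by
      rw [← Complex.ofReal_mul, Real.mul_self_sqrt (by norm_num)]; norm_num
    have e0 : ninthMatrix 0 0 * (starRingEnd ℂ) (ninthMatrix 0 0) = 8 / 9 := by
      simp only [ninthMatrix, Matrix.of_apply, Matrix.cons_val', Matrix.cons_val_zero]
      rw [map_div₀, map_ofNat, Complex.conj_ofReal]
      linear_combination h8 / 9
    have e1 : ninthMatrix 1 0 * (starRingEnd ℂ) (ninthMatrix 1 0) = 1 / 9 := by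
      simp only [ninthMatrix, Matrix.of_apply, Matrix.cons_val', Matrix.cons_val_zero,
        Matrix.cons_val_one]
      rw [map_div₀, map_ofNat, map_one]
      norm_num
    simp only [Fintype.sum_prod_type, Fin.sum_univ_two, e0, e1]
    simp only [Fin.isValue, Fin.val_zero, Fin.val_one, zero_ne_one, if_true, if_false,
      add_zero, zero_add, Nat.zero_mod, Nat.one_mod, Nat.reduceAdd, Nat.reduceMod, Nat.cast_zero,
      Nat.cast_one]
    split_ifs <;> ring
  · intro f
    simp [specOutcome, Finsupp.add_apply, ha _ L2, ha _ L4, ha _ L6]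
  · intro k g hg
    have := happ g (by simpa [K] using hg) k.1 k.2.1 k.2.2
    rw [← this]
    simp only [h, add_assoc]
  · intro f _ hf
    obtain ⟨e1, e2, e3, e4, e5⟩ := hspec f hf
    refine ⟨(⟨f a₁, by omega⟩, ⟨f b₁, by omega⟩, ⟨f q₂, e1⟩), fun x hx => ?_⟩
    obtain ⟨v2, v3, v4, v5, v6, v7, v8⟩ :=
      hv (⟨f a₁, by omega⟩, ⟨f b₁, by omega⟩, ⟨f q₂, e1⟩)
    simp only at v2 v3 v4 v5 v6 v7 v8
    by_cases hx2 : x = q₂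
    · rw [hx2, v6]
    · simp only [K, Finset.mem_insert, Finset.mem_singleton] at hx
      rcases hx with h | h | h | h | h | h | h
      · rw [h, e4 (h ▸ Ne.symm hx2), v7 (h ▸ Ne.symm hx2)]
      · rw [h, e5 (h ▸ Ne.symm hx2), v8 (h ▸ Ne.symm hx2)]
      · exact absurd h hx2
      all_goals rw [h]; omega
  · intro k g hg
    simp only [K, Finset.mem_insert, Finset.mem_singleton, forall_eq_or_imp, forall_eq] at hg
    obtain ⟨v2, v3, v4, v5, v6, -⟩ := hv k
    have : (k.2.2.val = 1) ↔ k.2.2 = 1 := by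
      rw [Fin.ext_iff]; rfl
    simp only [specOutcome, Finsupp.add_apply, hg, v3, v5, v6, zero_add, this]
  · intro k g hg h1 h2 x hx
    have := hsupp _ hg
    simp only [Finsupp.add_apply, Finsupp.single_apply] at this
    simp only [K, Finset.mem_insert, Finset.mem_singleton] at hx
    by_cases hxq : x = q
    · rw [hxq, h1]
    by_cases hxq' : x = q'
    · rw [hxq', h2]
    by_cases hx2 : x = q₂
    · rcases hq₂ with h | h | h
      · exact absurd (hx2.trans h) hxq
      · exact absurd (hx2.trans h) hxq'
      · have := h _ hg
        simp only [Finsupp.add_apply] at this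
        rw [hx2]; omega
    · simp only [hxq, hxq', hx2, false_or] at hx
      rcases hx with rfl | rfl | rfl | rfl <;> simp [*] at this ⊢ <;> omega

end Spec

open Finsupp (single)

/-! ### Operators that have been applied or not -/

/-- The operator `U` is applied if `b` is true. -/
def opt (b : Bool) (U : State → State) (φ : State) : State := if b then U φ else φ

@[simp] theorem opt_true (U : State → State) (φ : State) : opt true U φ = U φ := rfl

@[simp] theorem opt_false (U : State → State) (φ : State) : opt false U φ = φ := rfl

theorem opt_comm {U V : State → State} (h : ∀ φ, U (V φ) = V (U φ)) (b : Bool) (φ : State) :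
    U (opt b V φ) = opt b V (U φ) := by
  cases b
  · rfl
  · exact h φ

/-! ### Links between program counters -/

/-- Each link `(p, i, m, j, n)` stands for a channel `p` on which thread `i` sends at its program
counter `m` and thread `j` receives at its program counter `n`. -/
def Links (L : List (ℕ × ℕ × ℕ × ℕ × ℕ)) (k : ℕ → ℕ) : Prop :=
  ∀ l ∈ L, l.2.2.1 < k l.2.1 ↔ l.2.2.2.2 < k l.2.2.2.1

/-- No two links share an end, and the two ends of a link belong to different threads. -/
def Separated (L : List (ℕ × ℕ × ℕ × ℕ × ℕ)) : Prop :=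
  ∀ l ∈ L, l.2.1 ≠ l.2.2.2.1 ∧ ∀ l' ∈ L, l' = l ∨
    ((l'.2.1 = l.2.1 → l'.2.2.1 ≠ l.2.2.1) ∧ (l'.2.2.2.1 = l.2.2.2.1 → l'.2.2.2.2 ≠ l.2.2.2.2) ∧
      (l'.2.1 = l.2.2.2.1 → l'.2.2.1 ≠ l.2.2.2.2) ∧ (l'.2.2.2.1 = l.2.1 → l'.2.2.2.2 ≠ l.2.2.1))

instance (L : List (ℕ × ℕ × ℕ × ℕ × ℕ)) : Decidable (Separated L) :=
  inferInstanceAs (Decidable (∀ l ∈ L, _))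

/-- The program counter of thread `i` is increased. -/
def incr (k : ℕ → ℕ) (i : ℕ) : ℕ → ℕ := Function.update k i (k i + 1)

theorem incr_same (k : ℕ → ℕ) (i : ℕ) : incr k i i = k i + 1 := Function.update_self ..

theorem incr_ne (k : ℕ → ℕ) {i j : ℕ} (h : j ≠ i) : incr k i j = k j :=
  Function.update_of_ne h _ _

theorem lt_incr_iff {k : ℕ → ℕ} {i j n : ℕ} (h : j = i → n ≠ k i) : n < incr k i j ↔ n < k j := by
  by_cases hj : j = i
  · subst hj
    rw [incr_same]
    have := h rfl
    omega
  · rw [incr_ne k hj]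

theorem Links.step {L : List (ℕ × ℕ × ℕ × ℕ × ℕ)} {k : ℕ → ℕ} (h : Links L k) {i : ℕ}
    (hL : ∀ l ∈ L, (l.2.1 = i → l.2.2.1 ≠ k i) ∧ (l.2.2.2.1 = i → l.2.2.2.2 ≠ k i)) :
    Links L (incr k i) := by
  intro l hl
  rw [lt_incr_iff (hL l hl).1, lt_incr_iff (hL l hl).2]
  exact h l hl

theorem Links.communicate {L : List (ℕ × ℕ × ℕ × ℕ × ℕ)} (hL : Separated L) {k : ℕ → ℕ} (h : Links L k)
    {l : ℕ × ℕ × ℕ × ℕ × ℕ} (hl : l ∈ L) (h1 : k l.2.1 = l.2.2.1) (h2 : k l.2.2.2.1 = l.2.2.2.2) :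
    Links L (incr (incr k l.2.1) l.2.2.2.1) := by
  obtain ⟨hne, hs⟩ := hL l hl
  have e : incr k l.2.1 l.2.2.2.1 = l.2.2.2.2 := by rw [incr_ne k hne.symm, h2]
  intro l' hl'
  rcases hs l' hl' with rfl | ⟨g1, g2, g3, g4⟩
  · rw [incr_same, incr_ne _ hne, incr_same, e, h1]
    omega
  · rw [lt_incr_iff (i := l.2.2.2.1) (j := l'.2.1) (by rw [e]; exact g3),
      lt_incr_iff (i := l.2.2.2.1) (j := l'.2.2.2.1) (by rw [e]; exact g2),
      lt_incr_iff (by rw [h1]; exact g1), lt_incr_iff (by rw [h1]; exact g4)]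
    exact h l' hl'

theorem le_incr_iff {k : ℕ → ℕ} {i j n : ℕ} :
    n ≤ incr k i j ↔ n ≤ k j ∨ (j = i ∧ n = k i + 1) := by
  by_cases hj : j = i
  · subst hj
    rw [incr_same]
    omega
  · rw [incr_ne k hj]
    tauto

/-- Whether the program counters have reached the thresholds in a list of pairs `(i, n)` of a thread
and a value of its program counter. -/
def flags (thr : List (ℕ × ℕ)) (k : ℕ → ℕ) (x : ℕ) : Bool :=
  match thr[x]? with
  | some t => decide (t.2 ≤ k t.1)
  | none => false

theorem flags_zero {thr : List (ℕ × ℕ)} (h : ∀ t ∈ thr, t.2 ≠ 0) :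
    flags thr (fun _ => 0) = fun _ => false := by
  funext x
  unfold flags
  split
  · rename_i t ht
    exact decide_eq_false (fun hc => h t (List.mem_of_getElem? ht) (Nat.le_zero.1 hc))
  · rfl

theorem flags_incr_of_notMem {thr : List (ℕ × ℕ)} {k : ℕ → ℕ} {i n : ℕ} (hn : k i = n)
    (h : (i, n + 1) ∉ thr) : flags thr (incr k i) = flags thr k := by
  funext x
  unfold flags
  split
  · rename_i t ht
    refine decide_eq_decide.2 (le_incr_iff.trans (or_iff_left ?_))
    rintro ⟨h1, h2⟩
    have e : t = (i, n + 1) := Prod.ext h1 (by rw [h2, hn])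
    exact h (e ▸ List.mem_of_getElem? ht)
  · rfl

theorem flags_incr {thr : List (ℕ × ℕ)} (hthr : thr.Nodup) {k : ℕ → ℕ} {i n x : ℕ} (hn : k i = n)
    (hx : thr[x]? = some (i, n + 1)) :
    flags thr (incr k i) = Function.update (flags thr k) x true := by
  funext y
  by_cases hy : y = x
  · subst hy
    rw [Function.update_self]
    simp only [flags, hx, incr_same, hn]
    simp
  · rw [Function.update_of_ne hy]
    unfold flags
    split
    · rename_i t ht
      refine decide_eq_decide.2 (le_incr_iff.trans (or_iff_left ?_))
      rintro ⟨h1, h2⟩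
      refine hy ?_
      have e : t = (i, n + 1) := Prod.ext h1 (by rw [h2, hn])
      rw [e] at ht
      obtain ⟨l1, e1⟩ := List.getElem?_eq_some_iff.1 ht
      obtain ⟨l2, e2⟩ := List.getElem?_eq_some_iff.1 hx
      exact (List.Nodup.getElem_inj_iff hthr).1 (e1.trans e2.symm)
    · rfl

theorem flags_communicate {thr : List (ℕ × ℕ)} {k : ℕ → ℕ} {i j m n : ℕ} (hij : i ≠ j) (hi : k i = m)
    (hj : k j = n) (h1 : (i, m + 1) ∉ thr) (h2 : (j, n + 1) ∉ thr) :
    flags thr (incr (incr k i) j) = flags thr k := by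
  rw [flags_incr_of_notMem (n := n) (by rw [incr_ne k hij.symm, hj]) h2,
    flags_incr_of_notMem hi h1]

/-! ### Names in use -/

/-- The names in use when the qubits `oa` and `ob` have been received, some of them (`pa`, `pb`) have
been turned into modes, and the fresh modes `nm i` for the indices `i` with `As i` have been
created. -/
structure Names (own₀ : Finset QName) (env₀ : List QName) (oa ob : Option ℕ) (pa pb : Bool)
    (nm : ℕ → ℕ) (As : ℕ → Prop) (S : Store) : Prop where
  env_eq : S.env = env₀.filter fun x =>
    decide (oa.map QName.qb ≠ some x) && decide (ob.map QName.qb ≠ some x)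
  mem_a : ∀ n, oa = some n → .qb n ∈ env₀
  mem_b : ∀ n, ob = some n → .qb n ∈ env₀
  ne : ∀ n, oa = some n → ob = some n → False
  own_a : ∀ n, oa = some n → pa = false → .qb n ∈ S.own
  own_b : ∀ n, ob = some n → pb = false → .qb n ∈ S.own
  inj : ∀ i j, As i → As j → nm i = nm j → i = j
  mem : ∀ i, As i → .ns (nm i) ∈ S.own
  new : ∀ i, As i → .ns (nm i) ∉ own₀ ∧ .ns (nm i) ∉ env₀
  cover : ∀ x, x ∈ own₀ ∨ x ∈ env₀ → x ∈ S.own ∨ x ∈ S.env ∨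
    (pa = true ∧ oa.map QName.qb = some x) ∨ (pb = true ∧ ob.map QName.qb = some x)

namespace Names

variable {own₀ : Finset QName} {env₀ : List QName} {oa ob : Option ℕ} {pa pb : Bool} {nm : ℕ → ℕ}
  {As : ℕ → Prop} {S : Store}

theorem pure (own₀ : Finset QName) (env₀ : List QName) (ψ : State) (nm : ℕ → ℕ) {As : ℕ → Prop}
    (hAs : ∀ i, ¬ As i) :
    Names own₀ env₀ none none false false nm As (.pure own₀ env₀ ψ) where
  env_eq := by simp [Store.pure]
  mem_a := by simp
  mem_b := by simp
  ne := by simp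
  own_a := by simp
  own_b := by simp
  inj i _ h := absurd h (hAs i)
  mem i h := absurd h (hAs i)
  new i h := absurd h (hAs i)
  cover x h := by
    rcases h with h | h
    · exact .inl h
    · exact .inr (.inl h)

theorem swap (h : Names own₀ env₀ oa ob pa pb nm As S) :
    Names own₀ env₀ ob oa pb pa nm As S where
  env_eq := by rw [h.env_eq]; simp only [Bool.and_comm]
  mem_a := h.mem_b
  mem_b := h.mem_a
  ne n h1 h2 := h.ne n h2 h1
  own_a := h.own_b
  own_b := h.own_a
  inj := h.inj
  mem := h.mem
  new := h.new
  cover x hx := by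
    rcases h.cover x hx with h | h | h | h
    · exact .inl h
    · exact .inr (.inl h)
    · exact .inr (.inr (.inr h))
    · exact .inr (.inr (.inl h))

theorem grow (h : Names own₀ env₀ oa ob pa pb nm As S) {S' : Store} (h1 : S.own ⊆ S'.own)
    (h2 : S'.env = S.env) : Names own₀ env₀ oa ob pa pb nm As S' where
  env_eq := h2.trans h.env_eq
  mem_a := h.mem_a
  mem_b := h.mem_b
  ne := h.ne
  own_a n h3 h4 := h1 (h.own_a n h3 h4)
  own_b n h3 h4 := h1 (h.own_b n h3 h4)
  inj := h.inj
  mem i hi := h1 (h.mem i hi)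
  new := h.new
  cover x hx := by
    rw [h2]
    exact (h.cover x hx).imp (fun h => h1 h) id

theorem mem_env_iff (h : Names own₀ env₀ oa ob pa pb nm As S) {x : QName} :
    x ∈ S.env ↔ x ∈ env₀ ∧ oa.map QName.qb ≠ some x ∧ ob.map QName.qb ≠ some x := by
  rw [h.env_eq]
  simp

theorem receive (h : Names own₀ env₀ oa ob pa pb nm As S) (ha : oa = none) (hp : pa = false) {n : ℕ}
    (hn : .qb n ∈ S.env) :
    Names own₀ env₀ (some n) ob pa pb nm As (S.receive [.qb n]) where
  env_eq := by
    subst ha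
    simp only [Store.receive, h.env_eq, List.filter_filter]
    refine List.filter_congr fun x _ => ?_
    simp only [List.mem_singleton, Option.map_some, Option.map_none, ne_eq, Option.some.injEq,
      reduceCtorEq, not_false_eq_true, decide_true, Bool.true_and, eq_comm (a := x)]
  mem_a m hm := by cases hm; exact (h.mem_env_iff.1 hn).1
  mem_b := h.mem_b
  ne m hm hm' := by
    cases hm
    have := (h.mem_env_iff.1 hn).2.2
    simp [hm'] at this
  own_a m hm _ := by cases hm; simp [Store.receive]
  own_b m hm h2 := Finset.mem_union_left _ (h.own_b m hm h2)
  inj := h.inj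
  mem i hi := Finset.mem_union_left _ (h.mem i hi)
  new := h.new
  cover x hx := by
    by_cases hxn : x = .qb n
    · left
      simp [Store.receive, hxn]
    · rcases h.cover x hx with h | h | h | h
      · exact .inl (Finset.mem_union_left _ h)
      · right; left
        simp [Store.receive, h, hxn]
      · simp [hp] at h
      · exact .inr (.inr (.inr h))

theorem alloc (h : Names own₀ env₀ oa ob pa pb nm As S) {i m : ℕ} (hm : S.Fresh (.ns m)) (hi : ¬ As i)
    {As' : ℕ → Prop} (hAs : ∀ j, As' j ↔ As j ∨ j = i) {S' : Store}
    (hown : S'.own = insert (.ns m) S.own) (henv : S'.env = S.env) :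
    Names own₀ env₀ oa ob pa pb (Function.update nm i m) As' S' := by
  have hg : Names own₀ env₀ oa ob pa pb nm As S' :=
    h.grow (by rw [hown]; exact Finset.subset_insert _ _) henv
  have hne : ∀ j, As j → nm j ≠ m := fun j hj e => hm.1 (e ▸ h.mem j hj)
  have hval : ∀ j, As j → Function.update nm i m j = nm j := fun j hj =>
    Function.update_of_ne (by rintro rfl; exact hi hj) _ _
  refine { hg with inj := ?_, mem := ?_, new := ?_ }
  · intro j j' hj hj' e
    rcases (hAs j).1 hj with g | rfl <;> rcases (hAs j').1 hj' with g' | rfl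
    · rw [hval _ g, hval _ g'] at e
      exact h.inj _ _ g g' e
    · rw [hval _ g, Function.update_self] at e
      exact absurd e (hne _ g)
    · rw [hval _ g', Function.update_self] at e
      exact absurd e.symm (hne _ g')
    · rfl
  · intro j hj
    rcases (hAs j).1 hj with g | rfl
    · rw [hval _ g]; exact hg.mem j g
    · rw [Function.update_self, hown]; exact Finset.mem_insert_self _ _
  · intro j hj
    rcases (hAs j).1 hj with g | rfl
    · rw [hval _ g]; exact h.new j g
    · rw [Function.update_self]
      by_contra hc
      have := h.cover (.ns m) (by tauto)
      rcases this with h1 | h1 | h1 | h1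
      · exact hm.1 h1
      · exact hm.2 h1
      · cases oa <;> simp at h1
      · cases ob <;> simp at h1

theorem ps (h : Names own₀ env₀ oa ob pa pb nm As S) {q m n i j : ℕ} (hq : oa = some q)
    (hm : S.Fresh (.ns m)) (hn : S.Fresh (.ns n)) (hmn : m ≠ n) (hij : i ≠ j) (hi : ¬ As i)
    (hj : ¬ As j) {As' : ℕ → Prop} (hAs : ∀ l, As' l ↔ As l ∨ l = i ∨ l = j) {S' : Store}
    (hown : S'.own = insert (.ns m) (insert (.ns n) (S.own.erase (.qb q))))
    (henv : S'.env = S.env) :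
    Names own₀ env₀ oa ob true pb (Function.update (Function.update nm i m) j n) As' S' := by
  let S₁ : Store := { S with own := S.own.erase (.qb q) }
  have h₁ : Names own₀ env₀ oa ob true pb nm As S₁ :=
    { h with
      own_a := by simp
      own_b := fun l hl hp => Finset.mem_erase.2
        ⟨by simp only [ne_eq, QName.qb.injEq]; rintro rfl; exact h.ne _ hq hl, h.own_b l hl hp⟩
      mem := fun l hl => Finset.mem_erase.2 ⟨by simp, h.mem l hl⟩
      cover := fun x hx => by
        by_cases hxq : x = .qb q
        · exact .inr (.inr (.inl ⟨rfl, by rw [hq, hxq]; rfl⟩))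
        · rcases h.cover x hx with g | g | g | g
          · exact .inl (Finset.mem_erase.2 ⟨hxq, g⟩)
          · exact .inr (.inl g)
          · exact .inr (.inr (.inl ⟨rfl, g.2⟩))
          · exact .inr (.inr (.inr g)) }
  let S₂ : Store := { S₁ with own := insert (.ns m) S₁.own }
  have h₂ := h₁.alloc (i := i) (m := m) (S' := S₂) (As' := fun l => As l ∨ l = i)
    ⟨fun hc => hm.1 (Finset.mem_of_mem_erase hc), hm.2⟩ hi (fun _ => Iff.rfl) rfl rfl
  refine h₂.alloc (i := j) (m := n) ?_ ?_ (fun l => ?_) ?_ henv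
  · refine ⟨fun hc => ?_, hn.2⟩
    rcases Finset.mem_insert.1 hc with e | hc
    · exact hmn (by simpa using e.symm)
    · exact hn.1 (Finset.mem_of_mem_erase hc)
  · rintro (hc | rfl)
    · exact hj hc
    · exact hij rfl
  · rw [hAs, or_assoc]
  · rw [hown]
    exact Finset.insert_comm _ _ _

theorem eq_zero (h : Names own₀ env₀ oa ob pa pb nm As S) {ψ : State}
    (hψ : IsState (own₀ ∪ env₀.toFinset) ψ) {i : ℕ} (hi : As i) {f : Basis} (hf : ψ f ≠ 0) :
    f (.ns (nm i)) = 0 := by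
  by_contra hc
  have := (hψ.2 f hf).1 (Finsupp.mem_support_iff.2 hc)
  rcases Finset.mem_union.1 this with h1 | h1
  · exact (h.new i hi).1 h1
  · exact (h.new i hi).2 (List.mem_toFinset.1 h1)

theorem qb_notMem_env (h : Names own₀ env₀ oa ob pa pb nm As S) {n : ℕ} (hn : oa = some n) :
    .qb n ∉ S.env := fun hc => (h.mem_env_iff.1 hc).2.1 (by rw [hn]; rfl)

theorem ns_notMem_env (h : Names own₀ env₀ oa ob pa pb nm As S) {i : ℕ} (hi : As i) :
    .ns (nm i) ∉ S.env := fun hc => (h.new i hi).2 (h.mem_env_iff.1 hc).1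

end Names

/-! ### The numbers that have been sent -/

/-- The `j`-th number of the triple. -/
def component (o : ℤ × ℤ × ℤ) (j : ℕ) : ℤ := [o.1, o.2.1, o.2.2].getD j 0

/-- The tuples in `outs` are the first numbers of the triple `o`. -/
def Agrees (outs : List (List ℤ)) (o : ℤ × ℤ × ℤ) : Prop := outs <+: [[o.1], [o.2.1], [o.2.2]]

instance (outs : List (List ℤ)) : DecidablePred (Agrees outs) :=
  fun o => inferInstanceAs (Decidable (outs <+: [[o.1], [o.2.1], [o.2.2]]))

theorem agrees_append {outs : List (List ℤ)} (h : outs.length < 3) (w : List ℤ) (o : ℤ × ℤ × ℤ) :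
    Agrees (outs ++ [w]) o ↔ Agrees outs o ∧ [component o outs.length] = w := by
  match outs, h with
  | [], _ => simp [Agrees, component, eq_comm]
  | [x], _ => simp [Agrees, component, List.cons_prefix_cons, eq_comm]
  | [x, y], _ => simp [Agrees, component, List.cons_prefix_cons, eq_comm, and_assoc]

/-- The normalised part of the state `F` in which the first numbers of `X` are those in `outs`. -/
noncomputable def observed (outs : List (List ℤ)) (π : ℝ) (X : Basis → ℤ × ℤ × ℤ) (F : State) :
    State := fun f => if Agrees outs (X f) then F f / (√π : ℝ) else 0

theorem observed_nil (X : Basis → ℤ × ℤ × ℤ) (F : State) : observed [] 1 X F = F := by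
  funext f
  simp [observed, Agrees]

theorem SqSummable.observed {F : State} (h : SqSummable F) (outs : List (List ℤ)) (π : ℝ)
    (X : Basis → ℤ × ℤ × ℤ) : SqSummable (observed outs π X F) := by
  have := (h.const_mul ((√π : ℝ) : ℂ)⁻¹).mask fun f => Agrees outs (X f)
  refine this.of_le fun f => ?_
  simp only [CQP.observed, div_eq_inv_mul]
  exact le_rfl

theorem reduced_observed {F : State} {outs : List (List ℤ)} {π : ℝ} (hπ : 0 < π)
    {X : Basis → ℤ × ℤ × ℤ} {L : List QName} {a b : Basis} (ha : ∀ f, X (f + a) = X f)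
    (hb : ∀ f, X (f + b) = X f) :
    reduced (observed outs π X F) (fun _ => True) L a b =
      reduced F (fun f => Agrees outs (X f)) L a b / π := by
  have h2 : ((√π : ℝ) : ℂ) * (√π : ℝ) = π := by
    rw [← Complex.ofReal_mul, Real.mul_self_sqrt hπ.le]
  simp only [reduced]
  rw [← tsum_div_const]
  refine tsum_congr fun f => ?_
  simp only [observed, ha, hb]
  by_cases h1 : ∀ x ∈ L, f x = 0 <;> by_cases h3 : Agrees outs (X f)
  · rw [if_pos ⟨h1, trivial⟩, if_pos h3, if_pos h3, if_pos ⟨h1, h3⟩, map_div₀,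
      Complex.conj_ofReal, div_mul_div_comm, h2]
  · rw [if_pos ⟨h1, trivial⟩, if_neg h3, if_neg (fun h => h3 (And.right h)), zero_mul, zero_div]
  all_goals rw [if_neg (fun h => h1 (And.left h)), if_neg (fun h => h1 (And.left h)), zero_div]

section Output

variable {S : Store} {F : State} {X : Basis → ℤ × ℤ × ℤ} {rec : Basis → List ℤ}
  {outs : List (List ℤ)} {π : ℝ} {v : Val}

theorem outProb_observed (hN : S.Normed (observed outs π X F) rec) (hF : SqSummable F) (hπ : 0 < π)
    (ho : outs.length < 3) (hv : v.isClassical = true)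
    (hval : ∀ f, v.at (rec f) = component (X f) outs.length) (w : List ℤ) :
    S.outProb [v] w = (reduced F (fun f => Agrees (outs ++ [w]) (X f)) [] 0 0).re / π := by
  rw [Store.Rep.outProb_eq hN (hF.observed _ _ _)]
  have e : reduced F (fun f => Agrees (outs ++ [w]) (X f)) [] 0 0 =
      ((∑' f, if Agrees (outs ++ [w]) (X f) then ‖F f‖ ^ 2 else 0 : ℝ) : ℂ) := by
    rw [reduced, Complex.ofReal_tsum]
    refine tsum_congr fun f => ?_
    by_cases h : Agrees (outs ++ [w]) (X f)
    · simp [h, Complex.mul_conj, Complex.normSq_eq_norm_sq]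
    · simp [h]
  rw [e, Complex.ofReal_re, ← tsum_div_const]
  refine tsum_congr fun f => ?_
  have hn : numbersOf [v] (rec f) = [component (X f) outs.length] := by
    simp [numbersOf, hv, hval]
  simp only [hn, agrees_append ho, observed]
  by_cases h1 : Agrees outs (X f)
  · by_cases h2 : [component (X f) outs.length] = w
    · simp only [h1, h2, if_true, and_self, norm_div, div_pow, Complex.norm_real, Real.norm_eq_abs,
        sq_abs, Real.sq_sqrt hπ.le]
    · simp [h2]
  · simp [h1]

theorem observed_append (hπ : 0 < π) (ho : outs.length < 3) (hv : v.isClassical = true)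
    (hval : ∀ f, v.at (rec f) = component (X f) outs.length) (w : List ℤ) (p : ℝ) :
    (fun f => if numbersOf [v] (rec f) = w then observed outs π X F f / (√p : ℝ) else 0) =
      observed (outs ++ [w]) (π * p) X F := by
  funext f
  have hn : numbersOf [v] (rec f) = [component (X f) outs.length] := by
    simp [numbersOf, hv, hval]
  simp only [hn, observed, agrees_append ho, Real.sqrt_mul hπ.le, Complex.ofReal_mul]
  by_cases h1 : Agrees outs (X f)
  · by_cases h2 : [component (X f) outs.length] = w
    · simp only [h1, h2, if_true, and_self, div_div]
    · simp [h2]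
  · simp [h1]

end Output

/-! ### The threads -/

/-- The mode `m` as an expression. -/
def mode (m : ℕ) : Expr := .vals [.name (.ns m)]

theorem not_pOut_nil {c vs P} : ¬ POut .nil c vs P := nofun
theorem not_pIn_nil {c vs P} : ¬ PIn .nil c vs P := nofun
theorem not_tau_nil {S S' P} : ¬ Tau S .nil S' P := nofun
theorem not_pOut_inp {d xs Q c vs P} : ¬ POut (.inp d xs Q) c vs P := nofun
theorem not_tau_inp {d xs Q S S' P} : ¬ Tau S (.inp d xs Q) S' P := nofun
theorem not_pIn_out {d es Q c vs P} : ¬ PIn (.out d es Q) c vs P := nofun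
theorem not_pOut_act {e Q c vs P} : ¬ POut (.act e Q) c vs P := nofun
theorem not_pIn_act {e Q c vs P} : ¬ PIn (.act e Q) c vs P := nofun
theorem not_pOut_ps {s t q Q c vs P} : ¬ POut (.ps s t q Q) c vs P := nofun
theorem not_pIn_ps {s t q Q c vs P} : ¬ PIn (.ps s t q Q) c vs P := nofun
theorem not_pOut_qbit {x Q c vs P} : ¬ POut (.qbit x Q) c vs P := nofun
theorem not_pIn_qbit {x Q c vs P} : ¬ PIn (.qbit x Q) c vs P := nofun
theorem not_pOut_ns {x Q c vs P} : ¬ POut (.ns x Q) c vs P := nofun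
theorem not_pIn_ns {x Q c vs P} : ¬ PIn (.ns x Q) c vs P := nofun
theorem not_eStep_vals {G S vs S' e} : ¬ EStep G S (.vals vs) S' e := nofun

theorem tau_ps_iff {S : Store} {s t q : ℕ} {P S' P'} :
    Tau S (.ps s t (.name (.qb q)) P) S' P' ↔
      ∃ m n, .qb q ∈ S.own ∧ S.Fresh (.ns m) ∧ S.Fresh (.ns n) ∧ m ≠ n ∧
        S' = { S with
          own := insert (.ns m) (insert (.ns n) (S.own.erase (.qb q)))
          st := fun v => psAct (.qb q) (.ns m) (.ns n) (S.st v) } ∧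
        P' = P.subst (bind [s, t] [.name (.ns m), .name (.ns n)]) := by
  constructor
  · intro h
    cases h with
    | ps _ m n _ _ _ h1 h2 h3 h4 => exact ⟨m, n, h1, h2, h3, h4, rfl, rfl⟩
  · rintro ⟨m, n, h1, h2, h3, h4, rfl, rfl⟩
    exact .ps _ _ _ _ _ _ h1 h2 h3 h4

/-- The polarising beam splitter with input qubit `q` and output modes `s`, `t`. -/
def polTh (a c d : Chan) (q s t : ℕ) : ℕ → Proc
  | 0 => PolSe a c d
  | 1 => .ps 1 2 (.name (.qb q)) (.out c [ev 1] (.out d [ev 2] .nil))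
  | 2 => .out c [mode s] (.out d [mode t] .nil)
  | 3 => .out d [mode t] .nil
  | _ => .nil

/-- A beam splitter with the modes `s` and `t`. -/
def bsTh (e f h i : Chan) (η : ℝ) (s t : ℕ) : ℕ → Proc
  | 0 => BS e f h i η
  | 1 => .inp f [(3, .ns)] <| .act (.apply [.name (.ns s), .var 3] (.bs η)) <|
    .out h [mode s] <| .out i [ev 3] .nil
  | 2 => .act (.apply ([.ns s, .ns t].map .name) (.bs η)) <| .out h [mode s] <| .out i [mode t] .nil
  | 3 => .act (.vals []) <| .out h [mode s] <| .out i [mode t] .nil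
  | 4 => .out h [mode s] <| .out i [mode t] .nil
  | 5 => .out i [mode t] .nil
  | _ => .nil

/-- The output of a fresh mode. -/
def vacTh (i : Chan) (s : ℕ) : ℕ → Proc
  | 0 => .out i [mode s] .nil
  | _ => .nil

/-- The input of an unused mode. -/
def dumpTh (j : Chan) (x : ℕ) : ℕ → Proc
  | 0 => .inp j [(x, .ns)] .nil
  | _ => .nil

/-- Two classical values as an expression. -/
def slots (w : ℕ) : List Val := [.slot w, .slot (w + 1)]

/-- A detector for the modes `s`, `t` with the results in the slots `w`, `w + 1`. -/
def detTh (l m u : Chan) (s t w : ℕ) : ℕ → Proc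
  | 0 => Det l m u
  | 1 => .inp m [(1, .ns)] <| .out u [.measure [.name (.ns s), .var 1]] .nil
  | 2 => .out u [.measure ([.ns s, .ns t].map .name)] .nil
  | 3 => .out u [.vals (slots w)] .nil
  | _ => .nil

/-- The condition that the counter tests, for the photon numbers in the slots `w`, `w + 1` and
`w'`, `w' + 1`. -/
def coincidence (w w' : ℕ) : Expr :=
  .op .and (.op .eq (.op .add (.vals [.slot w]) (.vals [.slot (w + 1)])) (num 1))
      (.op .eq (.op .add (.vals [.slot w']) (.vals [.slot (w' + 1)])) (num 1))

/-- The expressions that the counter sends. -/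
def countExpr (w w' : ℕ) : ℕ → Expr
  | 0 => .ite (coincidence w w') (.vals [.slot (w + 1)]) (num 0)
  | 1 => .ite (coincidence w w') (.vals [.slot (w' + 1)]) (num 0)
  | _ => .ite (coincidence w w') (num 1) (num 0)

/-- The coincidence counter with the photon numbers in the slots `w`, `w + 1` and `w'`, `w' + 1`, and
the current expression `e`. -/
def countTh (u v out₁ cnt out₂ : Chan) (w w' : ℕ) (e : Expr) : ℕ → Proc
  | 0 => Counter u v out₁ cnt out₂
  | 1 =>
    let K : Expr := .op .and (.op .eq (.op .add (.vals [.slot w]) (.vals [.slot (w + 1)])) (num 1))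
      (.op .eq (.op .add (ev 2) (ev 3)) (num 1))
    .inp v [(2, .int), (3, .int)] <| .out out₁ [.ite K (.vals [.slot (w + 1)]) (num 0)] <|
      .out out₂ [.ite K (ev 3) (num 0)] <| .out cnt [.ite K (num 1) (num 0)] .nil
  | 2 => .out out₁ [e] <| .out out₂ [countExpr w w' 1] <| .out cnt [countExpr w w' 2] .nil
  | 3 => .out out₂ [e] <| .out cnt [countExpr w w' 2] .nil
  | 4 => .out cnt [e] .nil
  | _ => .nil

section Pol

variable {a c d : Chan} {q s t k : ℕ}

theorem polTh_in_iff {ch vs X} : PIn (polTh a c d q s t k) ch vs X ↔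
    k = 0 ∧ ch = a ∧ ∃ n, vs = [.name (.qb n)] ∧ X = polTh a c d n s t 1 := by
  match k with
  | 0 =>
    refine pIn_inp_iff.trans ?_
    constructor
    · rintro ⟨rfl, h, rfl⟩
      match vs, h with
      | [v], h =>
        simp only [List.forall₂_cons, List.Forall₂.nil, and_true] at h
        obtain ⟨n, rfl⟩ := h.exists_qb
        exact ⟨rfl, rfl, n, rfl, rfl⟩
    · rintro ⟨-, rfl, n, rfl, rfl⟩
      exact ⟨rfl, by simp [Val.HasTy, QName.IsQb], rfl⟩
  | 1 => simp [polTh, not_pIn_ps]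
  | 2 => simp [polTh, not_pIn_out]
  | 3 => simp [polTh, not_pIn_out]
  | _ + 4 => simp [polTh, not_pIn_nil]

theorem polTh_out_iff {ch vs X} : POut (polTh a c d q s t k) ch vs X ↔
    (k = 2 ∧ ch = c ∧ vs = [.name (.ns s)] ∧ X = polTh a c d q s t 3) ∨
    (k = 3 ∧ ch = d ∧ vs = [.name (.ns t)] ∧ X = polTh a c d q s t 4) := by
  match k with
  | 0 => simp [polTh, PolSe, not_pOut_inp]
  | 1 => simp [polTh, not_pOut_ps]
  | 2 => simp [polTh, pOut_singleton_iff, mode]; tauto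
  | 3 => simp [polTh, pOut_singleton_iff, mode]; tauto
  | _ + 4 => simp [polTh, not_pOut_nil]

theorem polTh_tau_iff {S : Store} {S' X} : Tau S (polTh a c d q s t k) S' X ↔
    k = 1 ∧ ∃ m n, .qb q ∈ S.own ∧ S.Fresh (.ns m) ∧ S.Fresh (.ns n) ∧ m ≠ n ∧
        S' = { S with
          own := insert (.ns m) (insert (.ns n) (S.own.erase (.qb q)))
          st := fun v => psAct (.qb q) (.ns m) (.ns n) (S.st v) } ∧
        X = polTh a c d q m n 2 := by
  match k with
  | 0 => simp [polTh, PolSe, not_tau_inp]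
  | 1 =>
    refine tau_ps_iff.trans ?_
    simp only [true_and]
    rfl
  | 2 => simp [polTh, tau_out_singleton_iff, mode, not_eStep_vals]
  | 3 => simp [polTh, tau_out_singleton_iff, mode, not_eStep_vals]
  | _ + 4 => simp [polTh, not_tau_nil]

end Pol

section BS

variable {e f h i : Chan} {η : ℝ} {s t k : ℕ}

theorem bsTh_in {ch vs X} (H : PIn (bsTh e f h i η s t k) ch vs X) :
    (k = 0 ∧ ch = e ∧ (vs = [.name (.ns s)] → X = bsTh e f h i η s t 1)) ∨
    (k = 1 ∧ ch = f ∧ (vs = [.name (.ns t)] → X = bsTh e f h i η s t 2)) := by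
  match k with
  | 0 =>
    obtain ⟨rfl, -, rfl⟩ := pIn_inp_iff.1 H
    exact .inl ⟨rfl, rfl, by rintro rfl; rfl⟩
  | 1 =>
    obtain ⟨rfl, -, rfl⟩ := pIn_inp_iff.1 H
    exact .inr ⟨rfl, rfl, by rintro rfl; rfl⟩
  | 2 => exact absurd H not_pIn_act
  | 3 => exact absurd H not_pIn_act
  | 4 => exact absurd H not_pIn_out
  | 5 => exact absurd H not_pIn_out
  | _ + 6 => exact absurd H not_pIn_nil

theorem bsTh_in_zero : PIn (bsTh e f h i η s t 0) e [.name (.ns s)] (bsTh e f h i η s t 1) :=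
  pIn_inp_iff.2 ⟨rfl, by simp [Val.HasTy, QName.IsNS], rfl⟩

theorem bsTh_in_one : PIn (bsTh e f h i η s t 1) f [.name (.ns t)] (bsTh e f h i η s t 2) :=
  pIn_inp_iff.2 ⟨rfl, by simp [Val.HasTy, QName.IsNS], rfl⟩

theorem bsTh_out_iff {ch vs X} : POut (bsTh e f h i η s t k) ch vs X ↔
    (k = 4 ∧ ch = h ∧ vs = [.name (.ns s)] ∧ X = bsTh e f h i η s t 5) ∨
    (k = 5 ∧ ch = i ∧ vs = [.name (.ns t)] ∧ X = bsTh e f h i η s t 6) := by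
  match k with
  | 0 => simp [bsTh, CQP.BS, not_pOut_inp]
  | 1 => simp [bsTh, not_pOut_inp]
  | 2 => simp [bsTh, not_pOut_act]
  | 3 => simp [bsTh, not_pOut_act]
  | 4 => simp [bsTh, pOut_singleton_iff, mode]; tauto
  | 5 => simp [bsTh, pOut_singleton_iff, mode]; tauto
  | _ + 6 => simp [bsTh, not_pOut_nil]

theorem bsTh_tau_iff {S S' X} : Tau S (bsTh e f h i η s t k) S' X ↔
    (k = 2 ∧ s ≠ t ∧ S' = S.transform (fun _ => true) (pairAct (bsAmp η) (.ns s) (.ns t)) ∧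
      X = bsTh e f h i η s t 3) ∨ (k = 3 ∧ S' = S ∧ X = bsTh e f h i η s t 4) := by
  match k with
  | 0 => simp [bsTh, CQP.BS, not_tau_inp]
  | 1 => simp [bsTh, not_tau_inp]
  | 2 =>
    simp only [bsTh, tau_act_iff, eStep_apply_iff]
    constructor
    · rintro (⟨vs, h, -⟩ | ⟨e', ⟨h1, rfl, rfl⟩, rfl⟩)
      · exact absurd h (by simp)
      · exact .inl ⟨trivial, by simpa using h1.2.1, rfl, rfl⟩
    · rintro (⟨-, h1, rfl, rfl⟩ | ⟨h, -⟩)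
      · exact .inr ⟨_, ⟨⟨rfl, by simpa using h1, by simp [QName.IsNS]⟩, rfl, rfl⟩, rfl⟩
      · exact absurd h (by simp)
  | 3 => simp [bsTh, tau_act_iff, not_eStep_vals]
  | 4 => simp [bsTh, tau_out_singleton_iff, mode, not_eStep_vals]
  | 5 => simp [bsTh, tau_out_singleton_iff, mode, not_eStep_vals]
  | _ + 6 => simp [bsTh, not_tau_nil]

end BS

section Det

variable {l m u : Chan} {s t w k : ℕ}

theorem detTh_in {ch vs X} (H : PIn (detTh l m u s t w k) ch vs X) :
    (k = 0 ∧ ch = l ∧ (vs = [.name (.ns s)] → X = detTh l m u s t w 1)) ∨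
    (k = 1 ∧ ch = m ∧ (vs = [.name (.ns t)] → X = detTh l m u s t w 2)) := by
  match k with
  | 0 =>
    obtain ⟨rfl, -, rfl⟩ := pIn_inp_iff.1 H
    exact .inl ⟨rfl, rfl, by rintro rfl; rfl⟩
  | 1 =>
    obtain ⟨rfl, -, rfl⟩ := pIn_inp_iff.1 H
    exact .inr ⟨rfl, rfl, by rintro rfl; rfl⟩
  | 2 => exact absurd H not_pIn_out
  | 3 => exact absurd H not_pIn_out
  | _ + 4 => exact absurd H not_pIn_nil

theorem detTh_in_zero : PIn (detTh l m u s t w 0) l [.name (.ns s)] (detTh l m u s t w 1) :=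
  pIn_inp_iff.2 ⟨rfl, by simp [Val.HasTy, QName.IsNS], rfl⟩

theorem detTh_in_one : PIn (detTh l m u s t w 1) m [.name (.ns t)] (detTh l m u s t w 2) :=
  pIn_inp_iff.2 ⟨rfl, by simp [Val.HasTy, QName.IsNS], rfl⟩

theorem detTh_out_iff {ch vs X} : POut (detTh l m u s t w k) ch vs X ↔
    k = 3 ∧ ch = u ∧ vs = slots w ∧ X = detTh l m u s t w 4 := by
  match k with
  | 0 => simp [detTh, CQP.Det, not_pOut_inp]
  | 1 => simp [detTh, not_pOut_inp]
  | 2 => simp [detTh, pOut_singleton_iff]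
  | 3 => simp [detTh, pOut_singleton_iff]; tauto
  | _ + 4 => simp [detTh, not_pOut_nil]

theorem detTh_tau {S : Store} {S' X} (hst : k = 2 → s ≠ t) : Tau S (detTh l m u s t w k) S' X ↔
    k = 2 ∧ S' = S.measure (fun _ => true) 2 (obsNS [.ns s, .ns t]) ∧
      X = detTh l m u s t S.width 3 := by
  match k, hst with
  | 0, _ => simp [detTh, CQP.Det, not_tau_inp]
  | 1, _ => simp [detTh, not_tau_inp]
  | 2, hst =>
    have hst := hst rfl
    simp only [detTh, tau_out_singleton_iff]
    constructor
    · rintro ⟨e', h1, rfl⟩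
      obtain ⟨rfl, rfl⟩ := (eStep_measure_ns_iff (by simp) (by simpa using hst)
        (by simp [QName.IsNS])).1 h1
      exact ⟨trivial, rfl, rfl⟩
    · rintro ⟨-, rfl, rfl⟩
      exact ⟨_, (eStep_measure_ns_iff (by simp) (by simpa using hst)
        (by simp [QName.IsNS])).2 ⟨rfl, rfl⟩, rfl⟩
  | 3, _ => simp [detTh, tau_out_singleton_iff, not_eStep_vals]
  | _ + 4, _ => simp [detTh, not_tau_nil]

end Det

section Count

variable {u v out₁ cnt out₂ : Chan} {w w' k : ℕ} {e : Expr}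

theorem countTh_in {ch vs X} (H : PIn (countTh u v out₁ cnt out₂ w w' e k) ch vs X) :
    (k = 0 ∧ ch = u ∧ (vs = slots w → X = countTh u v out₁ cnt out₂ w w' e 1)) ∨
    (k = 1 ∧ ch = v ∧ (vs = slots w' →
      X = countTh u v out₁ cnt out₂ w w' (countExpr w w' 0) 2)) := by
  match k with
  | 0 =>
    obtain ⟨rfl, -, rfl⟩ := pIn_inp_iff.1 H
    exact .inl ⟨rfl, rfl, by rintro rfl; rfl⟩
  | 1 =>
    obtain ⟨rfl, -, rfl⟩ := pIn_inp_iff.1 H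
    exact .inr ⟨rfl, rfl, by rintro rfl; rfl⟩
  | 2 => exact absurd H not_pIn_out
  | 3 => exact absurd H not_pIn_out
  | 4 => exact absurd H not_pIn_out
  | _ + 5 => exact absurd H not_pIn_nil

theorem countTh_in_zero : PIn (countTh u v out₁ cnt out₂ w w' e 0) u (slots w)
    (countTh u v out₁ cnt out₂ w w' e 1) :=
  pIn_inp_iff.2 ⟨rfl, by simp [slots, Val.HasTy], rfl⟩

theorem countTh_in_one : PIn (countTh u v out₁ cnt out₂ w w' e 1) v (slots w')
    (countTh u v out₁ cnt out₂ w w' (countExpr w w' 0) 2) :=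
  pIn_inp_iff.2 ⟨rfl, by simp [slots, Val.HasTy], rfl⟩

/-- The channels on which the results are sent. -/
def resultChan (out₁ cnt out₂ : Chan) : ℕ → Chan
  | 0 => out₁
  | 1 => out₂
  | _ => cnt

theorem countTh_out_iff {ch vs X} : POut (countTh u v out₁ cnt out₂ w w' e k) ch vs X ↔
    2 ≤ k ∧ k ≤ 4 ∧ ch = resultChan out₁ cnt out₂ (k - 2) ∧ e = .vals vs ∧
      X = countTh u v out₁ cnt out₂ w w' (countExpr w w' (k - 1)) (k + 1) := by
  match k with
  | 0 => simp [countTh, Counter, not_pOut_inp]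
  | 1 => simp [countTh, not_pOut_inp]
  | 2 => simp [countTh, pOut_singleton_iff, resultChan]; tauto
  | 3 => simp [countTh, pOut_singleton_iff, resultChan]; tauto
  | 4 => simp [countTh, pOut_singleton_iff, resultChan]; tauto
  | _ + 5 => simp [countTh, not_pOut_nil]

theorem countTh_tau_iff {S S' X} : Tau S (countTh u v out₁ cnt out₂ w w' e k) S' X ↔
    2 ≤ k ∧ k ≤ 4 ∧ ∃ e', EStep (fun _ => true) S e S' e' ∧
      X = countTh u v out₁ cnt out₂ w w' e' k := by
  match k with
  | 0 => simp [countTh, Counter, not_tau_inp]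
  | 1 => simp [countTh, not_tau_inp]
  | 2 => simp [countTh, tau_out_singleton_iff]
  | 3 => simp [countTh, tau_out_singleton_iff]
  | 4 => simp [countTh, tau_out_singleton_iff]
  | _ + 5 => simp [countTh, not_tau_nil]

end Count

/-! ### Histories -/

/-- The qubits received so far, the tuples of numbers sent so far, and their probability. -/
structure Hist where
  qa : Option ℕ
  qb : Option ℕ
  outs : List (List ℤ)
  prob : ℝ

namespace Hist

/-- The names left in the environment. -/
def env (α : Hist) (env₀ : List QName) : List QName := env₀.filter fun x =>
  decide (α.qa.map QName.qb ≠ some x) && decide (α.qb.map QName.qb ≠ some x)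

/-- The reduced operator expected after the tuples `outs` have been sent. -/
noncomputable def expect (α : Hist) (ψ : State) (outs : List (List ℤ)) (L : List QName)
    (a b : Basis) : ℂ :=
  expected ψ (.qb (α.qa.getD 0)) (.qb (α.qb.getD 0)) (Agrees outs) L a b

/-- The probability of the next tuple. -/
noncomputable def nextProb (α : Hist) (ψ : State) (w : List ℤ) : ℝ :=
  (α.expect ψ (α.outs ++ [w]) [] 0 0).re / α.prob

/-- The history after the next tuple. -/
noncomputable def next (α : Hist) (ψ : State) (w : List ℤ) : Hist :=
  { α with outs := α.outs ++ [w], prob := α.prob * α.nextProb ψ w }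

/-- The reduced density matrix of the environment after the next tuple. -/
noncomputable def nextRho (α : Hist) (env₀ : List QName) (ψ : State) (w : List ℤ) (a b : List ℕ) : ℂ :=
  if a.length = (α.env env₀).length ∧ b.length = (α.env env₀).length then
    α.expect ψ (α.outs ++ [w]) (α.env env₀) (place (α.env env₀) a) (place (α.env env₀) b) /
      (α.prob * α.nextProb ψ w : ℝ)
  else 0

end Hist

theorem classical_namesOf {v : Val} (hv : v.isClassical = true) : namesOf [v] = [] := by
  cases v <;> first | rfl | exact absurd hv (by simp [Val.isClassical])

theorem output_step {env₀ : List QName} {ψ : State} {α : Hist} {S : Store} {F : State}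
    {X : Basis → ℤ × ℤ × ℤ} {rec : Basis → List ℤ} {v : Val} (henv : S.env = α.env env₀)
    (hR : S.Rep (observed α.outs α.prob X F) rec) (hN : S.Normed (observed α.outs α.prob X F) rec)
    (hF : SqSummable F) (hπ : 0 < α.prob) (ho : α.outs.length < 3) (hv : v.isClassical = true)
    (hval : ∀ f, v.at (rec f) = component (X f) α.outs.length)
    (hX : ∀ f p : Basis, (∀ x, x ∉ S.env → p x = 0) → X (f + p) = X f)
    (hrec : ∀ f p : Basis, (∀ x, x ∉ S.env → p x = 0) → rec (f + p) = rec f)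
    (hexp : ∀ outs L a b, (∀ x ∈ L, x ∈ S.env) → (∀ x, x ∉ L → a x = 0) → (∀ x, x ∉ L → b x = 0) →
      reduced F (fun f => Agrees outs (X f)) L a b = α.expect ψ outs L a b) :
    S.outProb [v] = α.nextProb ψ ∧ ∀ w, 0 < α.nextProb ψ w →
      (S.outBranch [v] w).rhoE = α.nextRho env₀ ψ w ∧
      (S.outBranch [v] w).Rep (observed (α.next ψ w).outs (α.next ψ w).prob X F) rec ∧
      (S.outBranch [v] w).Normed (observed (α.next ψ w).outs (α.next ψ w).prob X F) rec ∧
      0 < (α.next ψ w).prob ∧ (S.outBranch [v] w).own = S.own ∧ (S.outBranch [v] w).env = S.env := by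
  have hp : S.outProb [v] = α.nextProb ψ := by
    funext w
    rw [outProb_observed hN hF hπ ho hv hval,
      hexp _ _ _ _ (by simp) (fun _ _ => rfl) (fun _ _ => rfl), Hist.nextProb]
  refine ⟨hp, fun w hw => ?_⟩
  have hw' : 0 < S.outProb [v] w := by rw [hp]; exact hw
  have h1 := hR.outBranch hw'
  have h2 := Store.Rep.normed_outBranch hN hw'
  rw [observed_append hπ ho hv hval, hp] at h1 h2
  have h3 : 0 < α.prob * α.nextProb ψ w := mul_pos hπ hw
  have h4 : (S.outBranch [v] w).env = S.env := by
    simp [Store.outBranch, classical_namesOf hv]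
  refine ⟨?_, h1, h2, h3, by simp [Store.outBranch, classical_namesOf hv], h4⟩
  funext a b
  rw [h1.rhoE_eq (hF.observed _ _ _) (by rw [h4]; exact hrec), h4, Hist.nextRho, ← henv]
  refine if_congr Iff.rfl ?_ rfl
  have ha : ∀ x, x ∉ S.env → place S.env a x = 0 := fun x hx => place_apply_of_notMem a hx
  have hb : ∀ x, x ∉ S.env → place S.env b x = 0 := fun x hx => place_apply_of_notMem b hx
  rw [reduced_observed h3 (fun f => hX f _ ha) (fun f => hX f _ hb),
    hexp _ _ _ _ (fun _ h => h) ha hb]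

/-! ### The common behaviour of the model and of the specification -/

/-- The visible behaviour, for configurations with a history. -/
structure Behaves (env₀ : List QName) (ψ : State) (a b : ℕ) (ch : ℕ → Chan)
    (G : Config → Hist → Prop) : Prop where
  mix : ∀ {t α}, G t α → ∃ S P, t = .mix S P
  tau : ∀ {t α t'}, G t α → Trans t .tau t' → G t' α
  inp : ∀ {t α c vs t'}, G t α → Trans t (.inp c vs) t' →
    ∃ n, vs = [.name (.qb n)] ∧ .qb n ∈ α.env env₀ ∧
      ((c = .pub a ∧ α.qa = none ∧ G t' { α with qa := some n }) ∨
        (c = .pub b ∧ α.qb = none ∧ G t' { α with qb := some n }))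
  receive_a : ∀ {t α n}, G t α → α.qa = none → .qb n ∈ α.env env₀ →
    ∃ t', Trans t (.inp (.pub a) [.name (.qb n)]) t' ∧ G t' { α with qa := some n }
  receive_b : ∀ {t α n}, G t α → α.qb = none → .qb n ∈ α.env env₀ →
    ∃ t', Trans t (.inp (.pub b) [.name (.qb n)]) t' ∧ G t' { α with qb := some n }
  out : ∀ {t α c V X p S P}, G t α → Trans t (.out c V X) (.prob p S P) →
    α.qa.isSome ∧ α.qb.isSome ∧ α.outs.length < 3 ∧ c = ch α.outs.length ∧ p = α.nextProb ψ ∧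
      V = {w | 0 < p w} ∧
      ∀ w, 0 < p w → (S w).rhoE = α.nextRho env₀ ψ w ∧ G (.mix (S w) P) (α.next ψ w)
  send : ∀ {t α}, G t α → α.qa.isSome → α.qb.isSome → α.outs.length < 3 →
    ∃ t' c V X p S P, Weak t t' ∧ Trans t' (.out c V X) (.prob p S P)

theorem Behaves.or {env₀ : List QName} {ψ : State} {a b : ℕ} {ch : ℕ → Chan}
    {G G' : Config → Hist → Prop} (h : Behaves env₀ ψ a b ch G) (h' : Behaves env₀ ψ a b ch G') :
    Behaves env₀ ψ a b ch fun t α => G t α ∨ G' t α where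
  mix := by
    rintro t α (g | g)
    · exact h.mix g
    · exact h'.mix g
  tau := by
    rintro t α t' (g | g) s
    · exact .inl (h.tau g s)
    · exact .inr (h'.tau g s)
  inp := by
    rintro t α c vs t' (g | g) s
    · obtain ⟨n, h1, h2, h3⟩ := h.inp g s
      exact ⟨n, h1, h2, h3.imp (fun h => ⟨h.1, h.2.1, .inl h.2.2⟩)
        (fun h => ⟨h.1, h.2.1, .inl h.2.2⟩)⟩
    · obtain ⟨n, h1, h2, h3⟩ := h'.inp g s
      exact ⟨n, h1, h2, h3.imp (fun h => ⟨h.1, h.2.1, .inr h.2.2⟩)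
        (fun h => ⟨h.1, h.2.1, .inr h.2.2⟩)⟩
  receive_a := by
    rintro t α n (g | g) h1 h2
    · obtain ⟨t', h3, h4⟩ := h.receive_a g h1 h2
      exact ⟨t', h3, .inl h4⟩
    · obtain ⟨t', h3, h4⟩ := h'.receive_a g h1 h2
      exact ⟨t', h3, .inr h4⟩
  receive_b := by
    rintro t α n (g | g) h1 h2
    · obtain ⟨t', h3, h4⟩ := h.receive_b g h1 h2
      exact ⟨t', h3, .inl h4⟩
    · obtain ⟨t', h3, h4⟩ := h'.receive_b g h1 h2
      exact ⟨t', h3, .inr h4⟩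
  out := by
    rintro t α c V X p S P (g | g) s
    · obtain ⟨h1, h2, h3, h4, h5, h6, h7⟩ := h.out g s
      exact ⟨h1, h2, h3, h4, h5, h6, fun w hw => ⟨(h7 w hw).1, .inl (h7 w hw).2⟩⟩
    · obtain ⟨h1, h2, h3, h4, h5, h6, h7⟩ := h'.out g s
      exact ⟨h1, h2, h3, h4, h5, h6, fun w hw => ⟨(h7 w hw).1, .inr (h7 w hw).2⟩⟩
  send := by
    rintro t α (g | g) h1 h2 h3
    · exact h.send g h1 h2 h3
    · exact h'.send g h1 h2 h3

theorem Behaves.bisimilar {env₀ : List QName} {ψ : State} {a b : ℕ} {ch : ℕ → Chan}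
    {G : Config → Hist → Prop} (h : Behaves env₀ ψ a b ch G) {t u : Config} {α : Hist}
    (ht : G t α) (hu : G u α) : Bisimilar t u := by
  refine bisimilar_of_good (Good := G) (fun _ _ => h.mix) (fun _ _ _ => h.tau) ?_ ?_ ht hu
  · intro t u α c vs t' g g' s
    obtain ⟨n, rfl, hn, ⟨rfl, h1, h2⟩ | ⟨rfl, h1, h2⟩⟩ := h.inp g s
    · obtain ⟨u', h3, h4⟩ := h.receive_a g' h1 hn
      exact ⟨u', h3, _, h2, h4⟩
    · obtain ⟨u', h3, h4⟩ := h.receive_b g' h1 hn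
      exact ⟨u', h3, _, h2, h4⟩
  · intro t u α c V X p S P g g' s
    obtain ⟨h1, h2, h3, rfl, rfl, rfl, h7⟩ := h.out g s
    obtain ⟨u', c', V', X', p', S', P', w, s'⟩ := h.send g' h1 h2 h3
    obtain ⟨-, -, -, rfl, rfl, rfl, k7⟩ :=
      h.out (good_of_weak (Good := G) (fun _ _ _ => h.tau) g' w) s'
    refine ⟨u', X', _, S', P', w, s', fun v hv => ⟨rfl, ?_, _, (h7 v hv).2, (k7 v hv).2⟩⟩
    rw [(h7 v hv).1, (k7 v hv).1]

/-! ### The threads of the specification -/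

/-- The end of the operation, which sends the modes and the random bit. -/
def opSend (h i j k g : Chan) (x₀ x₁ x₂ x₃ : Val) (q : ℕ) : Proc :=
  .out h [.vals [x₀]] <| .out i [.vals [x₁]] <| .out j [.vals [x₂]] <| .out k [.vals [x₃]] <|
    .out g [.measure ([.qb q].map .name)] .nil

/-- The part of the operation from the second Hadamard gate. -/
noncomputable def opHad (h i j k g : Chan) (x₀ x₁ x₂ x₃ : Val) (q : ℕ) : Proc :=
  .act (.apply [x₂, x₃] .had) (opSend h i j k g x₀ x₁ x₂ x₃ q)

/-- The part of the operation from the controlled Z gate. -/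
noncomputable def opCz (h i j k g : Chan) (x₀ x₁ x₂ x₃ : Val) (q : ℕ) : Proc :=
  .act (.apply [x₀, x₁, x₂, x₃] .cz) (opHad h i j k g x₀ x₁ x₂ x₃ q)

/-- The part of the operation from the preparation of the random bit. -/
noncomputable def opBit (h i j k g : Chan) (x₀ x₁ x₂ x₃ : Val) (q : ℕ) : Proc :=
  .act (.apply ([.qb q].map .name) U₁₉) (opCz h i j k g x₀ x₁ x₂ x₃ q)

/-- The part of the operation from the first Hadamard gate. -/
noncomputable def opGates (h i j k g : Chan) (x₀ x₁ x₂ x₃ : Val) (q : ℕ) : Proc :=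
  .act (.apply [x₂, x₃] .had) (opBit h i j k g x₀ x₁ x₂ x₃ q)

/-- A mode as a value. -/
def modeVal (m : ℕ) : Val := .name (.ns m)

/-- The operation on the modes `m₀, …, m₃` with the random bit in the qubit `q` and then in the slot
`w`. -/
noncomputable def opTh (c d e f g h i j k : Chan) (m₀ m₁ m₂ m₃ q w : ℕ) : ℕ → Proc
  | 0 => OP c d e f g h i j k
  | 1 => .inp c [(0, .ns)] <| .inp d [(1, .ns)] <| .inp e [(2, .ns)] <| .inp f [(3, .ns)] <|
    opGates h i j k g (.var 0) (.var 1) (.var 2) (.var 3) q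
  | 2 => .inp d [(1, .ns)] <| .inp e [(2, .ns)] <| .inp f [(3, .ns)] <|
    opGates h i j k g (modeVal m₀) (.var 1) (.var 2) (.var 3) q
  | 3 => .inp e [(2, .ns)] <| .inp f [(3, .ns)] <|
    opGates h i j k g (modeVal m₀) (modeVal m₁) (.var 2) (.var 3) q
  | 4 => .inp f [(3, .ns)] <|
    opGates h i j k g (modeVal m₀) (modeVal m₁) (modeVal m₂) (.var 3) q
  | 5 => opGates h i j k g (modeVal m₀) (modeVal m₁) (modeVal m₂) (modeVal m₃) q
  | 6 => .act (.vals []) <| opBit h i j k g (modeVal m₀) (modeVal m₁) (modeVal m₂) (modeVal m₃) q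
  | 7 => opBit h i j k g (modeVal m₀) (modeVal m₁) (modeVal m₂) (modeVal m₃) q
  | 8 => .act (.vals []) <| opCz h i j k g (modeVal m₀) (modeVal m₁) (modeVal m₂) (modeVal m₃) q
  | 9 => opCz h i j k g (modeVal m₀) (modeVal m₁) (modeVal m₂) (modeVal m₃) q
  | 10 => .act (.vals []) <| opHad h i j k g (modeVal m₀) (modeVal m₁) (modeVal m₂) (modeVal m₃) q
  | 11 => opHad h i j k g (modeVal m₀) (modeVal m₁) (modeVal m₂) (modeVal m₃) q
  | 12 => .act (.vals []) <| opSend h i j k g (modeVal m₀) (modeVal m₁) (modeVal m₂) (modeVal m₃) q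
  | 13 => opSend h i j k g (modeVal m₀) (modeVal m₁) (modeVal m₂) (modeVal m₃) q
  | 14 => .out i [.vals [modeVal m₁]] <| .out j [.vals [modeVal m₂]] <| .out k [.vals [modeVal m₃]] <|
    .out g [.measure ([.qb q].map .name)] .nil
  | 15 => .out j [.vals [modeVal m₂]] <| .out k [.vals [modeVal m₃]] <|
    .out g [.measure ([.qb q].map .name)] .nil
  | 16 => .out k [.vals [modeVal m₃]] <| .out g [.measure ([.qb q].map .name)] .nil
  | 17 => .out g [.measure ([.qb q].map .name)] .nil
  | 18 => .out g [.vals [.slot w]] .nil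
  | _ => .nil

/-- The expressions that the specification sends, for the random bit `x` and the modes `y`, `z`. -/
def resultExpr (x y z : Val) : ℕ → Expr
  | 0 => .ite (.op .eq (.vals [x]) (num 1)) (.measure [y]) (num 0)
  | 1 => .ite (.op .eq (.vals [x]) (num 1)) (.measure [z]) (num 0)
  | _ => .vals [x]

/-- The output of the results. -/
def results (out₁ cnt out₂ : Chan) (x y z : Val) (e : Expr) : Proc :=
  .out out₁ [e] <| .out out₂ [resultExpr x y z 1] <| .out cnt [resultExpr x y z 2] .nil

/-- The output of the specification for the modes `m₀, …, m₃`, the random bit in the slot `w` and the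
current expression `e`. -/
def outputTh (g h i j k out₁ cnt out₂ : Chan) (m₁ m₃ w : ℕ) (e : Expr) : ℕ → Proc
  | 0 => Output g h i j k out₁ cnt out₂
  | 1 => .inp i [(1, .ns)] <| .inp j [(2, .ns)] <| .inp k [(3, .ns)] <| .inp g [(4, .bit)] <|
    results out₁ cnt out₂ (.var 4) (.var 1) (.var 3) (resultExpr (.var 4) (.var 1) (.var 3) 0)
  | 2 => .inp j [(2, .ns)] <| .inp k [(3, .ns)] <| .inp g [(4, .bit)] <|
    results out₁ cnt out₂ (.var 4) (modeVal m₁) (.var 3) (resultExpr (.var 4) (modeVal m₁) (.var 3) 0)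
  | 3 => .inp k [(3, .ns)] <| .inp g [(4, .bit)] <|
    results out₁ cnt out₂ (.var 4) (modeVal m₁) (.var 3) (resultExpr (.var 4) (modeVal m₁) (.var 3) 0)
  | 4 => .inp g [(4, .bit)] <| results out₁ cnt out₂ (.var 4) (modeVal m₁) (modeVal m₃)
    (resultExpr (.var 4) (modeVal m₁) (modeVal m₃) 0)
  | 5 => results out₁ cnt out₂ (.slot w) (modeVal m₁) (modeVal m₃) e
  | 6 => .out out₂ [e] <| .out cnt [resultExpr (.slot w) (modeVal m₁) (modeVal m₃) 2] .nil
  | 7 => .out cnt [e] .nil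
  | _ => .nil

section OP

variable {c d e f g h i j k : Chan} {m₀ m₁ m₂ m₃ q w n : ℕ}

local notation "op" => opTh c d e f g h i j k m₀ m₁ m₂ m₃ q w

theorem opTh_in {ch vs X} (H : PIn (op n) ch vs X) :
    (n = 1 ∧ ch = c ∧ (vs = [modeVal m₀] → X = op 2)) ∨
    (n = 2 ∧ ch = d ∧ (vs = [modeVal m₁] → X = op 3)) ∨
    (n = 3 ∧ ch = e ∧ (vs = [modeVal m₂] → X = op 4)) ∨
    (n = 4 ∧ ch = f ∧ (vs = [modeVal m₃] → X = op 5)) := by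
  match n with
  | 0 => exact absurd H not_pIn_qbit
  | 1 =>
    obtain ⟨rfl, -, rfl⟩ := pIn_inp_iff.1 H
    exact .inl ⟨rfl, rfl, by rintro rfl; rfl⟩
  | 2 =>
    obtain ⟨rfl, -, rfl⟩ := pIn_inp_iff.1 H
    exact .inr (.inl ⟨rfl, rfl, by rintro rfl; rfl⟩)
  | 3 =>
    obtain ⟨rfl, -, rfl⟩ := pIn_inp_iff.1 H
    exact .inr (.inr (.inl ⟨rfl, rfl, by rintro rfl; rfl⟩))
  | 4 =>
    obtain ⟨rfl, -, rfl⟩ := pIn_inp_iff.1 H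
    exact .inr (.inr (.inr ⟨rfl, rfl, by rintro rfl; rfl⟩))
  | 5 | 6 | 7 | 8 | 9 | 10 | 11 | 12 => exact absurd H not_pIn_act
  | 13 | 14 | 15 | 16 | 17 | 18 => exact absurd H not_pIn_out
  | _ + 19 => exact absurd H not_pIn_nil

theorem opTh_in_one : PIn (op 1) c [modeVal m₀] (op 2) :=
  pIn_inp_iff.2 ⟨rfl, by simp [modeVal, Val.HasTy, QName.IsNS], rfl⟩

theorem opTh_in_two : PIn (op 2) d [modeVal m₁] (op 3) :=
  pIn_inp_iff.2 ⟨rfl, by simp [modeVal, Val.HasTy, QName.IsNS], rfl⟩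

theorem opTh_in_three : PIn (op 3) e [modeVal m₂] (op 4) :=
  pIn_inp_iff.2 ⟨rfl, by simp [modeVal, Val.HasTy, QName.IsNS], rfl⟩

theorem opTh_in_four : PIn (op 4) f [modeVal m₃] (op 5) :=
  pIn_inp_iff.2 ⟨rfl, by simp [modeVal, Val.HasTy, QName.IsNS], rfl⟩

theorem opTh_out_iff {ch vs X} : POut (op n) ch vs X ↔
    (n = 13 ∧ ch = h ∧ vs = [modeVal m₀] ∧ X = op 14) ∨
    (n = 14 ∧ ch = i ∧ vs = [modeVal m₁] ∧ X = op 15) ∨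
    (n = 15 ∧ ch = j ∧ vs = [modeVal m₂] ∧ X = op 16) ∨
    (n = 16 ∧ ch = k ∧ vs = [modeVal m₃] ∧ X = op 17) ∨
    (n = 18 ∧ ch = g ∧ vs = [.slot w] ∧ X = op 19) := by
  match n with
  | 0 => simp [opTh, CQP.OP, not_pOut_qbit]
  | 1 | 2 | 3 | 4 => simp [opTh, not_pOut_inp]
  | 5 | 6 | 7 | 8 | 9 | 10 | 11 | 12 =>
    simp [opTh, opGates, opBit, opCz, opHad, not_pOut_act]
  | 13 | 14 | 15 | 16 | 17 | 18 => simp [opTh, opSend, pOut_singleton_iff]; try tauto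
  | _ + 19 => simp [opTh, not_pOut_nil]

theorem tau_qbit_iff {S : Store} {x P S' P'} : Tau S (.qbit x P) S' P' ↔
    ∃ n, S.Fresh (.qb n) ∧ S' = { S with own := insert (.qb n) S.own } ∧
      P' = P.subst (bind [x] [.name (.qb n)]) := by
  constructor
  · intro H
    cases H with
    | qbit n _ _ h => exact ⟨n, h, rfl, rfl⟩
  · rintro ⟨n, h, rfl, rfl⟩
    exact .qbit _ _ _ h

theorem tau_gate_iff {S : Store} {U : Gate} {xs : List QName} (hU : U.Fits xs) {P S' P'} :
    Tau S (.act (.apply (xs.map .name) U) P) S' P' ↔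
      S' = S.transform (fun _ => true) (U.act xs) ∧ P' = .act (.vals []) P := by
  rw [tau_act_iff]
  constructor
  · rintro (⟨vs, h, -⟩ | ⟨e', h1, rfl⟩)
    · exact absurd h (by simp)
    · obtain ⟨-, rfl, rfl⟩ := eStep_apply_iff.1 h1
      exact ⟨rfl, rfl⟩
  · rintro ⟨rfl, rfl⟩
    exact .inr ⟨_, eStep_apply_iff.2 ⟨hU, rfl, rfl⟩, rfl⟩

theorem tau_skip_iff {S : Store} {P S' P'} :
    Tau S (.act (.vals []) P) S' P' ↔ S' = S ∧ P' = P := by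
  rw [tau_act_iff]
  constructor
  · rintro (⟨vs, -, h1, h2⟩ | ⟨e', h1, -⟩)
    · exact ⟨h1, h2⟩
    · exact absurd h1 not_eStep_vals
  · rintro ⟨rfl, rfl⟩
    exact .inl ⟨_, rfl, rfl, rfl⟩

/-- The operation that is performed from the program counter `n`. -/
noncomputable def opGate (m₀ m₁ m₂ m₃ q n : ℕ) : State → State :=
  if n = 5 ∨ n = 11 then pairAct hadAmp (.ns m₂) (.ns m₃)
  else if n = 7 then qubitAct ninthMatrix (.qb q)
  else if n = 9 then czAct (.ns m₀) (.ns m₁) (.ns m₂) (.ns m₃)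
  else id

theorem transform_id (S : Store) : S.transform (fun _ => true) id = S := rfl

theorem opTh_tau_iff (hm : [m₀, m₁, m₂, m₃].Nodup ∨ n < 5) {S : Store} {S' X} :
    Tau S (op n) S' X ↔
    (n = 0 ∧ ∃ q', S.Fresh (.qb q') ∧ S' = { S with own := insert (.qb q') S.own } ∧
      X = opTh c d e f g h i j k m₀ m₁ m₂ m₃ q' w 1) ∨
    (5 ≤ n ∧ n ≤ 12 ∧ S' = S.transform (fun _ => true) (opGate m₀ m₁ m₂ m₃ q n) ∧ X = op (n + 1)) ∨
    (n = 17 ∧ S' = S.measure (fun _ => true) 1 (obsQb [.qb q]) ∧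
      X = opTh c d e f g h i j k m₀ m₁ m₂ m₃ q S.width 18) := by
  have hm' : 5 ≤ n → [m₀, m₁, m₂, m₃].Nodup := fun hn => hm.resolve_right (by omega)
  match n with
  | 0 =>
    refine tau_qbit_iff.trans ?_
    simp only [true_and, show ¬ 5 ≤ 0 by omega, false_and, or_false,
      show (0 : ℕ) ≠ 17 by omega]
    rfl
  | 1 | 2 | 3 | 4 => simp [opTh, not_tau_inp]
  | 5 =>
    have := hm' (by omega)
    refine (tau_gate_iff (xs := [.ns m₂, .ns m₃]) (by
      simp [Gate.Fits, QName.IsNS] at this ⊢; tauto)).trans ?_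
    simp [opGate, opTh]; exact fun _ => Iff.rfl
  | 7 =>
    refine (tau_gate_iff (xs := [.qb q]) (by simp [U₁₉, Gate.Fits, QName.IsQb])).trans ?_
    simp [opGate, opTh]; exact fun _ => Iff.rfl
  | 9 =>
    have := hm' (by omega)
    refine (tau_gate_iff (xs := [.ns m₀, .ns m₁, .ns m₂, .ns m₃]) (by
      simp [Gate.Fits, QName.IsNS] at this ⊢; tauto)).trans ?_
    simp [opGate, opTh]; exact fun _ => Iff.rfl
  | 11 =>
    have := hm' (by omega)
    refine (tau_gate_iff (xs := [.ns m₂, .ns m₃]) (by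
      simp [Gate.Fits, QName.IsNS] at this ⊢; tauto)).trans ?_
    simp [opGate, opTh]; exact fun _ => Iff.rfl
  | 6 | 8 | 10 | 12 =>
    refine tau_skip_iff.trans ?_
    simp [opGate, opTh, transform_id]
  | 13 | 14 | 15 | 16 => simp [opTh, opSend, tau_out_singleton_iff, not_eStep_vals]
  | 17 =>
    simp only [opTh, tau_out_singleton_iff]
    constructor
    · rintro ⟨e', h1, rfl⟩
      obtain ⟨rfl, rfl⟩ := (eStep_measure_qb_iff (by simp) (by simp)
        (by simp [QName.IsQb])).1 h1
      exact .inr (.inr ⟨trivial, rfl, rfl⟩)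
    · rintro (⟨h1, -⟩ | ⟨-, h1, -⟩ | ⟨-, rfl, rfl⟩)
      · omega
      · omega
      · exact ⟨_, (eStep_measure_qb_iff (by simp) (by simp)
          (by simp [QName.IsQb])).2 ⟨rfl, rfl⟩, rfl⟩
  | 18 => simp [opTh, tau_out_singleton_iff, not_eStep_vals]
  | n + 19 =>
    simp only [opTh, not_tau_nil, false_iff, not_or, not_and]
    refine ⟨by omega, by omega, by omega⟩

end OP

section Output

variable {g h i j k out₁ cnt out₂ : Chan} {m₀ m₁ m₂ m₃ w n : ℕ} {e : Expr}

local notation "output" => outputTh g h i j k out₁ cnt out₂ m₁ m₃ w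

theorem outputTh_in {ch vs X} (H : PIn (output e n) ch vs X) :
    (n = 0 ∧ ch = h ∧ (vs = [modeVal m₀] → X = output e 1)) ∨
    (n = 1 ∧ ch = i ∧ (vs = [modeVal m₁] → X = output e 2)) ∨
    (n = 2 ∧ ch = j ∧ (vs = [modeVal m₂] → X = output e 3)) ∨
    (n = 3 ∧ ch = k ∧ (vs = [modeVal m₃] → X = output e 4)) ∨
    (n = 4 ∧ ch = g ∧ (vs = [.slot w] →
      X = output (resultExpr (.slot w) (modeVal m₁) (modeVal m₃) 0) 5)) := by
  match n with
  | 0 =>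
    obtain ⟨rfl, -, rfl⟩ := pIn_inp_iff.1 H
    exact .inl ⟨rfl, rfl, by rintro rfl; rfl⟩
  | 1 =>
    obtain ⟨rfl, -, rfl⟩ := pIn_inp_iff.1 H
    exact .inr (.inl ⟨rfl, rfl, by rintro rfl; rfl⟩)
  | 2 =>
    obtain ⟨rfl, -, rfl⟩ := pIn_inp_iff.1 H
    exact .inr (.inr (.inl ⟨rfl, rfl, by rintro rfl; rfl⟩))
  | 3 =>
    obtain ⟨rfl, -, rfl⟩ := pIn_inp_iff.1 H
    exact .inr (.inr (.inr (.inl ⟨rfl, rfl, by rintro rfl; rfl⟩)))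
  | 4 =>
    obtain ⟨rfl, -, rfl⟩ := pIn_inp_iff.1 H
    exact .inr (.inr (.inr (.inr ⟨rfl, rfl, by rintro rfl; rfl⟩)))
  | 5 | 6 | 7 => exact absurd H not_pIn_out
  | _ + 8 => exact absurd H not_pIn_nil

theorem outputTh_in_zero : PIn (output e 0) h [modeVal m₀] (output e 1) :=
  pIn_inp_iff.2 ⟨rfl, by simp [modeVal, Val.HasTy, QName.IsNS], rfl⟩

theorem outputTh_in_one : PIn (output e 1) i [modeVal m₁] (output e 2) :=
  pIn_inp_iff.2 ⟨rfl, by simp [modeVal, Val.HasTy, QName.IsNS], rfl⟩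

theorem outputTh_in_two : PIn (output e 2) j [modeVal m₂] (output e 3) :=
  pIn_inp_iff.2 ⟨rfl, by simp [modeVal, Val.HasTy, QName.IsNS], rfl⟩

theorem outputTh_in_three : PIn (output e 3) k [modeVal m₃] (output e 4) :=
  pIn_inp_iff.2 ⟨rfl, by simp [modeVal, Val.HasTy, QName.IsNS], rfl⟩

theorem outputTh_in_four : PIn (output e 4) g [.slot w]
    (output (resultExpr (.slot w) (modeVal m₁) (modeVal m₃) 0) 5) :=
  pIn_inp_iff.2 ⟨rfl, by simp [Val.HasTy], rfl⟩

theorem outputTh_out_iff {ch vs X} : POut (output e n) ch vs X ↔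
    5 ≤ n ∧ n ≤ 7 ∧ ch = resultChan out₁ cnt out₂ (n - 5) ∧ e = .vals vs ∧
      X = output (resultExpr (.slot w) (modeVal m₁) (modeVal m₃) (n - 4)) (n + 1) := by
  match n with
  | 0 => simp [outputTh, CQP.Output, not_pOut_inp]
  | 1 | 2 | 3 | 4 => simp [outputTh, not_pOut_inp]
  | 5 | 6 | 7 => simp [outputTh, results, pOut_singleton_iff, resultChan]; try tauto
  | _ + 8 => simp [outputTh, not_pOut_nil]

theorem outputTh_tau_iff {S S' X} : Tau S (output e n) S' X ↔
    5 ≤ n ∧ n ≤ 7 ∧ ∃ e', EStep (fun _ => true) S e S' e' ∧ X = output e' n := by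
  match n with
  | 0 => simp [outputTh, CQP.Output, not_tau_inp]
  | 1 | 2 | 3 | 4 => simp [outputTh, not_tau_inp]
  | 5 | 6 | 7 => simp [outputTh, results, tau_out_singleton_iff]
  | _ + 8 => simp [outputTh, not_tau_nil]

end Output

/-! ### The quantum states of the specification -/

/-- Names, slots, the current expression and program counters of the specification. -/
structure SpecLoc where
  nm : ℕ → ℕ
  qa : ℕ
  qb : ℕ
  q₂ : ℕ
  w : ℕ
  e : Option Expr
  k : ℕ → ℕ

/-- The events in a run of the specification: the two polarisation qubits are split (`0`, `1`), the
four gates are applied (`2` to `5`), the random bit is measured (`6`) and created (`7`), and the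
polarisation qubits are received (`8`, `9`). -/
def specThr : List (ℕ × ℕ) :=
  [(0, 2), (1, 2), (2, 6), (2, 8), (2, 10), (2, 12), (2, 18), (2, 1), (0, 1), (1, 1)]

namespace SpecLoc

/-- The global state after the events `b`. -/
noncomputable def state (L : SpecLoc) (b : ℕ → Bool) (ψ : State) : State :=
  opt (b 5) (pairAct hadAmp (.ns (L.nm 2)) (.ns (L.nm 3))) <|
  opt (b 4) (czAct (.ns (L.nm 0)) (.ns (L.nm 1)) (.ns (L.nm 2)) (.ns (L.nm 3))) <|
  opt (b 3) (qubitAct ninthMatrix (.qb L.q₂)) <|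
  opt (b 2) (pairAct hadAmp (.ns (L.nm 2)) (.ns (L.nm 3))) <|
  opt (b 1) (psAct (.qb L.qb) (.ns (L.nm 2)) (.ns (L.nm 3))) <|
  opt (b 0) (psAct (.qb L.qa) (.ns (L.nm 0)) (.ns (L.nm 1))) ψ

/-- The numbers that are sent. -/
def outcome (L : SpecLoc) : Basis → ℤ × ℤ × ℤ :=
  specOutcome (.qb L.q₂) (.ns (L.nm 1)) (.ns (L.nm 3))

/-- The modes created after the events `b`. -/
def Created (b : ℕ → Bool) (i : ℕ) : Prop := (i < 2 ∧ b 0 = true) ∨ (2 ≤ i ∧ i < 4 ∧ b 1 = true)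

end SpecLoc

/-- The configuration after the events `b`. -/
structure SpecQuant (own₀ : Finset QName) (env₀ : List QName) (ψ : State) (α : Hist) (L : SpecLoc)
    (b : ℕ → Bool) (S : Store) (rec : Basis → List ℤ) : Prop where
  names : Names own₀ env₀ α.qa α.qb (b 0) (b 1) L.nm (SpecLoc.Created b) S
  qa_eq : α.qa = if b 8 then some L.qa else none
  qb_eq : α.qb = if b 9 then some L.qb else none
  ancilla : b 7 = true → .qb L.q₂ ∉ S.env ∧ ((∀ f, ψ f ≠ 0 → f (.qb L.q₂) = 0) ∨
    (b 0 = true ∧ b 8 = true ∧ L.q₂ = L.qa) ∨ (b 1 = true ∧ b 9 = true ∧ L.q₂ = L.qb))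
  pos : 0 < α.prob
  prob_nil : α.outs = [] → α.prob = 1
  rep : S.Rep (observed α.outs α.prob L.outcome (L.state b ψ)) rec
  normed : b 6 = true → S.Normed (observed α.outs α.prob L.outcome (L.state b ψ)) rec
  rec_congr : ∀ f f' : Basis, (b 6 = true → f (.qb L.q₂) = f' (.qb L.q₂) ∧
    f (.ns (L.nm 1)) = f' (.ns (L.nm 1)) ∧ f (.ns (L.nm 3)) = f' (.ns (L.nm 3))) → rec f = rec f'
  slot : b 6 = true → L.w < S.width ∧ ∀ f, (rec f).getD L.w 0 = (f (.qb L.q₂) : ℤ)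

theorem observed_of_nil {α : Hist} (ho : α.outs = []) (hp : α.prob = 1) (X : Basis → ℤ × ℤ × ℤ)
    (F : State) : observed α.outs α.prob X F = F := by
  rw [ho, hp, observed_nil]

namespace SpecQuant

variable {own₀ : Finset QName} {env₀ : List QName} {ψ : State} {α : Hist} {L : SpecLoc}
  {b : ℕ → Bool} {S : Store} {rec : Basis → List ℤ}

theorem receive_a (h : SpecQuant own₀ env₀ ψ α L b S rec) (h0 : b 0 = false) (h8 : b 8 = false)
    {n : ℕ} (hn : .qb n ∈ S.env) :
    SpecQuant own₀ env₀ ψ { α with qa := some n } { L with qa := n } (Function.update b 8 true)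
      (S.receive [.qb n]) rec where
  names := h.names.receive (by rw [h.qa_eq, h8]; rfl) h0 hn
  qa_eq := rfl
  qb_eq := h.qb_eq
  ancilla hb := by
    obtain ⟨h1, h2 | h2 | h2⟩ := h.ancilla hb
    · exact ⟨fun hc => h1 (List.mem_filter.1 hc).1, .inl h2⟩
    · simp [h0] at h2
    · exact ⟨fun hc => h1 (List.mem_filter.1 hc).1, .inr (.inr h2)⟩
  pos := h.pos
  prob_nil := h.prob_nil
  rep := by
    have := h.rep
    simp only [SpecLoc.state, h0] at this
    have e : Function.update b 8 true 0 = false := h0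
    simp only [SpecLoc.state, e]
    exact this.congr rfl rfl rfl
  normed hb := by
    have := h.normed hb
    simp only [SpecLoc.state, h0] at this
    have e : Function.update b 8 true 0 = false := h0
    simp only [SpecLoc.state, e]
    exact this
  rec_congr := h.rec_congr
  slot := h.slot

theorem receive_b (h : SpecQuant own₀ env₀ ψ α L b S rec) (h1 : b 1 = false) (h9 : b 9 = false)
    {n : ℕ} (hn : .qb n ∈ S.env) :
    SpecQuant own₀ env₀ ψ { α with qb := some n } { L with qb := n } (Function.update b 9 true)
      (S.receive [.qb n]) rec where
  names := (h.names.swap.receive (by rw [h.qb_eq, h9]; rfl) h1 hn).swap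
  qa_eq := h.qa_eq
  qb_eq := rfl
  ancilla hb := by
    obtain ⟨g1, h2 | h2 | h2⟩ := h.ancilla hb
    · exact ⟨fun hc => g1 (List.mem_filter.1 hc).1, .inl h2⟩
    · exact ⟨fun hc => g1 (List.mem_filter.1 hc).1, .inr (.inl h2)⟩
    · simp [h1] at h2
  pos := h.pos
  prob_nil := h.prob_nil
  rep := by
    have := h.rep
    simp only [SpecLoc.state, h1] at this
    have e : Function.update b 9 true 1 = false := h1
    simp only [SpecLoc.state, e]
    exact this.congr rfl rfl rfl
  normed hb := by
    have := h.normed hb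
    simp only [SpecLoc.state, h1] at this
    have e : Function.update b 9 true 1 = false := h1
    simp only [SpecLoc.state, e]
    exact this
  rec_congr := h.rec_congr
  slot := h.slot

theorem rec_const (h : SpecQuant own₀ env₀ ψ α L b S rec) (h6 : b 6 = false) (f f' : Basis) :
    rec f = rec f' := h.rec_congr f f' (by simp [h6])

theorem created_split_a {b : ℕ → Bool} (h0 : b 0 = false) (l : ℕ) :
    SpecLoc.Created (Function.update b 0 true) l ↔ SpecLoc.Created b l ∨ l = 0 ∨ l = 1 := by
  have e : Function.update b 0 true 1 = b 1 := rfl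
  simp only [SpecLoc.Created, h0, e, Function.update_self]
  rcases Bool.eq_false_or_eq_true (b 1) with h | h <;> simp [h] <;> omega

theorem created_split_b {b : ℕ → Bool} (h1 : b 1 = false) (l : ℕ) :
    SpecLoc.Created (Function.update b 1 true) l ↔ SpecLoc.Created b l ∨ l = 2 ∨ l = 3 := by
  have e : Function.update b 1 true 0 = b 0 := rfl
  simp only [SpecLoc.Created, h1, e, Function.update_self]
  rcases Bool.eq_false_or_eq_true (b 0) with h | h <;> simp [h] <;> omega

theorem split_a (h : SpecQuant own₀ env₀ ψ α L b S rec) (ho : α.outs = []) (h0 : b 0 = false)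
    (h8 : b 8 = true) (h9 : b 1 = true → b 9 = true) (hb : ∀ x, 2 ≤ x → x ≤ 6 → b x = false)
    {m n : ℕ} (hm : S.Fresh (.ns m)) (hn : S.Fresh (.ns n)) (hmn : m ≠ n) :
    SpecQuant own₀ env₀ ψ α { L with nm := Function.update (Function.update L.nm 0 m) 1 n }
      (Function.update b 0 true)
      { S with
        own := insert (.ns m) (insert (.ns n) (S.own.erase (.qb L.qa)))
        st := fun v => psAct (.qb L.qa) (.ns m) (.ns n) (S.st v) } rec := by
  have hqa : α.qa = some L.qa := by rw [h.qa_eq, h8]; rfl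
  have hN := h.names.ps (i := 0) (j := 1) hqa hm hn hmn (by simp)
    (As' := SpecLoc.Created (Function.update b 0 true)) (by simp [SpecLoc.Created, h0])
    (by simp [SpecLoc.Created, h0]) (created_split_a h0)
    (S' := { S with
        own := insert (.ns m) (insert (.ns n) (S.own.erase (.qb L.qa)))
        st := fun v => psAct (.qb L.qa) (.ns m) (.ns n) (S.st v) }) rfl rfl
  have h6 := hb 6 (by omega) (by omega)
  refine ⟨hN, h.qa_eq, h.qb_eq, fun hb7 => ?_, h.pos, h.prob_nil, ?_, fun hb6 => ?_,
    fun f f' _ => h.rec_const h6 f f', fun hb6 => ?_⟩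
  · obtain ⟨h1, h2⟩ := h.ancilla hb7
    refine ⟨h1, h2.imp id (Or.imp (fun h => ?_) id)⟩
    simp [h0] at h
  · have hR := h.rep
    rw [observed_of_nil ho (h.prob_nil ho)] at hR ⊢
    have hR' := hR.map (U := psAct (.qb L.qa) (.ns m) (.ns n)) (psAct_smul _ _ _)
      (map_mask_of_const (psAct_zero _ _ _) (h.rec_const h6)) (S' := { S with
        own := insert (.ns m) (insert (.ns n) (S.own.erase (.qb L.qa)))
        st := fun v => psAct (.qb L.qa) (.ns m) (.ns n) (S.st v) }) rfl rfl fun _ => rfl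
    convert hR' using 1
    simp only [SpecLoc.state, hb 2 (by omega) (by omega), hb 3 (by omega) (by omega),
      hb 4 (by omega) (by omega), hb 5 (by omega) (by omega), h0, opt_false,
      show Function.update b 0 true 2 = false from hb 2 (by omega) (by omega),
      show Function.update b 0 true 3 = false from hb 3 (by omega) (by omega),
      show Function.update b 0 true 4 = false from hb 4 (by omega) (by omega),
      show Function.update b 0 true 5 = false from hb 5 (by omega) (by omega),
      show Function.update b 0 true 0 = true from rfl, opt_true]
    show opt (b 1) (psAct (.qb L.qb) (.ns (L.nm 2)) (.ns (L.nm 3))) _ = _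
    by_cases hb1 : b 1 = true
    · have d : ∀ i j, i < 2 → 2 ≤ j → j < 4 →
          (Function.update (Function.update L.nm 0 m) 1 n) i ≠ L.nm j := by
        intro i j hi hj hj4 e
        have := hN.inj i j (.inl ⟨hi, rfl⟩) (.inr ⟨hj, hj4, hb1⟩) (by
          rw [e, Function.update_of_ne (by omega), Function.update_of_ne (by omega)])
        omega
      have d1 := d 0 2 (by omega) (by omega) (by omega)
      have d2 := d 0 3 (by omega) (by omega) (by omega)
      have d3 := d 1 2 (by omega) (by omega) (by omega)
      have d4 := d 1 3 (by omega) (by omega) (by omega)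
      have hqb : α.qb = some L.qb := by rw [h.qb_eq, h9 hb1]; rfl
      rw [← opt_comm (fun φ => ?_)]
      · rfl
      · refine psAct_comm ?_ (by simp) (by simp) (by simp) (by simpa using d1) (by simpa using d2)
          (by simp) (by simpa using d3) (by simpa using d4) φ
        intro e
        exact h.names.ne L.qa hqa (by rw [hqb]; simpa using e.symm)
    · rw [Bool.not_eq_true] at hb1
      rw [hb1]
      rfl
  · exact absurd (hb6 : b 6 = true) (by simp [h6])
  · exact absurd (hb6 : b 6 = true) (by simp [h6])

theorem split_b (h : SpecQuant own₀ env₀ ψ α L b S rec) (ho : α.outs = []) (h1 : b 1 = false)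
    (h9 : b 9 = true) (hb : ∀ x, 2 ≤ x → x ≤ 6 → b x = false)
    {m n : ℕ} (hm : S.Fresh (.ns m)) (hn : S.Fresh (.ns n)) (hmn : m ≠ n) :
    SpecQuant own₀ env₀ ψ α { L with nm := Function.update (Function.update L.nm 2 m) 3 n }
      (Function.update b 1 true)
      { S with
        own := insert (.ns m) (insert (.ns n) (S.own.erase (.qb L.qb)))
        st := fun v => psAct (.qb L.qb) (.ns m) (.ns n) (S.st v) } rec := by
  have hqb : α.qb = some L.qb := by rw [h.qb_eq, h9]; rfl
  have hN := (h.names.swap.ps (i := 2) (j := 3) hqb hm hn hmn (by simp)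
    (As' := SpecLoc.Created (Function.update b 1 true)) (by simp [SpecLoc.Created, h1])
    (by simp [SpecLoc.Created, h1]) (created_split_b h1)
    (S' := { S with
        own := insert (.ns m) (insert (.ns n) (S.own.erase (.qb L.qb)))
        st := fun v => psAct (.qb L.qb) (.ns m) (.ns n) (S.st v) }) rfl rfl).swap
  have h6 := hb 6 (by omega) (by omega)
  refine ⟨hN, h.qa_eq, h.qb_eq, fun hb7 => ?_, h.pos, h.prob_nil, ?_, fun hb6 => ?_,
    fun f f' _ => h.rec_const h6 f f', fun hb6 => ?_⟩
  · obtain ⟨g1, h2⟩ := h.ancilla hb7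
    refine ⟨g1, h2.imp id (Or.imp id fun h => ?_)⟩
    simp [h1] at h
  · have hR := h.rep
    rw [observed_of_nil ho (h.prob_nil ho)] at hR ⊢
    have hR' := hR.map (U := psAct (.qb L.qb) (.ns m) (.ns n)) (psAct_smul _ _ _)
      (map_mask_of_const (psAct_zero _ _ _) (h.rec_const h6)) (S' := { S with
        own := insert (.ns m) (insert (.ns n) (S.own.erase (.qb L.qb)))
        st := fun v => psAct (.qb L.qb) (.ns m) (.ns n) (S.st v) }) rfl rfl fun _ => rfl
    convert hR' using 1
    simp only [SpecLoc.state, hb 2 (by omega) (by omega), hb 3 (by omega) (by omega),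
      hb 4 (by omega) (by omega), hb 5 (by omega) (by omega), h1, opt_false,
      show Function.update b 1 true 2 = false from hb 2 (by omega) (by omega),
      show Function.update b 1 true 3 = false from hb 3 (by omega) (by omega),
      show Function.update b 1 true 4 = false from hb 4 (by omega) (by omega),
      show Function.update b 1 true 5 = false from hb 5 (by omega) (by omega),
      show Function.update b 1 true 1 = true from rfl, opt_true]
    rfl
  · exact absurd (hb6 : b 6 = true) (by simp [h6])
  · exact absurd (hb6 : b 6 = true) (by simp [h6])

theorem create (h : SpecQuant own₀ env₀ ψ α L b S rec) (hψ : IsState (own₀ ∪ env₀.toFinset) ψ)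
    (ho : α.outs = []) (h3 : b 3 = false) (h6 : b 6 = false) {n : ℕ} (hn : S.Fresh (.qb n)) :
    SpecQuant own₀ env₀ ψ α { L with q₂ := n } (Function.update b 7 true)
      { S with own := insert (.qb n) S.own } rec := by
  refine ⟨h.names.grow (Finset.subset_insert _ _) rfl, h.qa_eq, h.qb_eq, fun _ => ⟨hn.2, ?_⟩, h.pos,
    h.prob_nil, ?_, fun hb6 => ?_, fun f f' _ => h.rec_const h6 f f', fun hb6 => ?_⟩
  · by_cases hc : .qb n ∈ own₀ ∨ .qb n ∈ env₀
    · rcases h.names.cover _ hc with g | g | ⟨g1, g2⟩ | ⟨g1, g2⟩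
      · exact absurd g hn.1
      · exact absurd g hn.2
      · right; left
        rw [h.qa_eq] at g2
        cases h8 : b 8
        · simp [h8] at g2
        · exact ⟨g1, h8, by simpa [h8, eq_comm] using g2⟩
      · right; right
        rw [h.qb_eq] at g2
        cases h9 : b 9
        · simp [h9] at g2
        · exact ⟨g1, h9, by simpa [h9, eq_comm] using g2⟩
    · left
      intro f hf
      by_contra hne
      have := (hψ.2 f hf).1 (Finsupp.mem_support_iff.2 hne)
      simp only [Finset.mem_union, List.mem_toFinset] at this
      exact hc this
  · have hR := h.rep
    rw [observed_of_nil ho (h.prob_nil ho)] at hR ⊢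
    simp only [SpecLoc.state, h3, opt_false] at hR
    simp only [SpecLoc.state, show Function.update b 7 true 3 = false from h3, opt_false]
    exact hR.congr rfl rfl rfl
  · exact absurd (hb6 : b 6 = true) (by simp [h6])
  · exact absurd (hb6 : b 6 = true) (by simp [h6])

/-- A gate acts. -/
theorem gate (h : SpecQuant own₀ env₀ ψ α L b S rec) (ho : α.outs = []) (h6 : b 6 = false) {x : ℕ}
    (hx : 2 ≤ x) (hx' : x ≤ 5) {U : State → State}
    (hU : ∀ (c : ℂ) φ, U (fun f => c * φ f) = fun f => c * U φ f) (hU₀ : U (fun _ => 0) = fun _ => 0)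
    (hs : L.state (Function.update b x true) ψ = U (L.state b ψ)) :
    SpecQuant own₀ env₀ ψ α L (Function.update b x true) (S.transform (fun _ => true) U) rec := by
  have e : ∀ y, y < 2 ∨ 6 ≤ y → Function.update b x true y = b y := fun y hy =>
    Function.update_of_ne (by omega) _ _
  have hC : SpecLoc.Created (Function.update b x true) = SpecLoc.Created b := by
    funext i
    simp only [SpecLoc.Created, e 0 (by omega), e 1 (by omega)]
  refine ⟨?_, ?_, ?_, ?_, h.pos, h.prob_nil, ?_, fun hb6 => ?_, fun f f' _ => h.rec_const h6 f f',
    fun hb6 => ?_⟩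
  · rw [e 0 (by omega), e 1 (by omega), hC]
    exact h.names.grow (Finset.Subset.refl _) rfl
  · rw [e 8 (by omega)]; exact h.qa_eq
  · rw [e 9 (by omega)]; exact h.qb_eq
  · rw [e 7 (by omega), e 0 (by omega), e 8 (by omega), e 1 (by omega), e 9 (by omega)]
    exact h.ancilla
  · have hR := h.rep
    rw [observed_of_nil ho (h.prob_nil ho)] at hR ⊢
    rw [hs]
    exact hR.map hU (map_mask_of_const hU₀ (h.rec_const h6)) rfl rfl fun _ => rfl
  · rw [e 6 (by omega), h6] at hb6; cases hb6
  · rw [e 6 (by omega), h6] at hb6; cases hb6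

section Ready

theorem nodup (h : SpecQuant own₀ env₀ ψ α L b S rec) (h0 : b 0 = true) (h1 : b 1 = true) :
    [L.nm 0, L.nm 1, L.nm 2, L.nm 3].Nodup := by
  have d : ∀ i j, i < 4 → j < 4 → i ≠ j → L.nm i ≠ L.nm j := by
    intro i j hi hj hij e
    refine hij (h.names.inj i j ?_ ?_ e) <;> simp only [SpecLoc.Created, h0, h1, and_true] <;> omega
  simp only [List.nodup_cons, List.mem_cons, List.not_mem_nil, or_false, not_or, not_false_eq_true,
    List.nodup_nil, and_true]
  exact ⟨⟨d 0 1 (by omega) (by omega) (by omega), d 0 2 (by omega) (by omega) (by omega),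
    d 0 3 (by omega) (by omega) (by omega)⟩, ⟨d 1 2 (by omega) (by omega) (by omega),
    d 1 3 (by omega) (by omega) (by omega)⟩, d 2 3 (by omega) (by omega) (by omega)⟩

theorem state_eq (hb : ∀ x ≤ 5, b x = true) :
    L.state b ψ = specState (.qb L.qa) (.qb L.qb) (.qb L.q₂) (.ns (L.nm 0)) (.ns (L.nm 1))
      (.ns (L.nm 2)) (.ns (L.nm 3)) ψ := by
  simp only [SpecLoc.state, hb _ (show 0 ≤ 5 by omega), hb _ (show 1 ≤ 5 by omega),
    hb _ (show 2 ≤ 5 by omega), hb _ (show 3 ≤ 5 by omega), hb _ (show 4 ≤ 5 by omega),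
    hb _ (show 5 ≤ 5 by omega), opt_true]
  rfl

variable (h : SpecQuant own₀ env₀ ψ α L b S rec) (hψ : IsState (own₀ ∪ env₀.toFinset) ψ)
  (h0 : b 0 = true) (h1 : b 1 = true) (h8 : b 8 = true) (h9 : b 9 = true)
include h h0 h1 h8 h9

theorem nodup_names : [QName.qb L.qa, .qb L.qb, .ns (L.nm 0), .ns (L.nm 1), .ns (L.nm 2),
    .ns (L.nm 3)].Nodup := by
  have hqa : α.qa = some L.qa := by rw [h.qa_eq, h8]; rfl
  have hqb : α.qb = some L.qb := by rw [h.qb_eq, h9]; rfl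
  have hne : L.qa ≠ L.qb := fun e => h.names.ne L.qa hqa (by rw [hqb, e])
  have := h.nodup h0 h1
  simp at this ⊢
  tauto

include hψ

omit h8 h9 in
theorem support (f : Basis) (hf : ψ f ≠ 0) : f (.qb L.qa) ≤ 1 ∧ f (.qb L.qb) ≤ 1 ∧
    f (.ns (L.nm 0)) = 0 ∧ f (.ns (L.nm 1)) = 0 ∧ f (.ns (L.nm 2)) = 0 ∧ f (.ns (L.nm 3)) = 0 :=
  ⟨(hψ.2 f hf).2 _, (hψ.2 f hf).2 _, h.names.eq_zero hψ (.inl ⟨by omega, h0⟩) hf,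
    h.names.eq_zero hψ (.inl ⟨by omega, h0⟩) hf,
    h.names.eq_zero hψ (.inr ⟨by omega, by omega, h1⟩) hf,
    h.names.eq_zero hψ (.inr ⟨by omega, by omega, h1⟩) hf⟩

theorem sqSummable (hb : ∀ x ≤ 5, b x = true) : SqSummable (L.state b ψ) := by
  rw [state_eq hb]
  exact sqSummable_specState (h.nodup_names h0 h1 h8 h9) (by simp) hψ.1.summable
    (h.support hψ h0 h1)

end Ready

end SpecQuant

/-! ### The evaluation of the results of the specification -/

/-- The expression `e` is being evaluated to the `j`-th number of the specification. -/
def SpecExpr (L : SpecLoc) (W : ℕ) (rec : Basis → List ℤ) (j : ℕ) (e : Expr) : Prop :=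
  (e.IsData W ∧ ∀ f, e.den (rec f) = component (L.outcome f) j) ∨
    (j < 2 ∧ ∃ c : Expr, e = .ite c (.measure [modeVal (L.nm (2 * j + 1))]) (num 0) ∧ c.IsData W ∧
      ∀ f, c.den (rec f) ≠ 0 ↔ f (.qb L.q₂) = 1)

namespace SpecQuant

variable {own₀ : Finset QName} {env₀ : List QName} {ψ : State} {α : Hist} {L : SpecLoc}
  {b : ℕ → Bool} {S : Store} {rec : Basis → List ℤ}

theorem extend (h : SpecQuant own₀ env₀ ψ α L b S rec) (h6 : b 6 = true) {S' : Store}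
    {t : Basis → List ℤ} (hown : S'.own = S.own) (henv : S'.env = S.env) (hW : S.width ≤ S'.width)
    (hR : S'.Rep (observed α.outs α.prob L.outcome (L.state b ψ)) fun f => rec f ++ t f)
    (hN : S'.Normed (observed α.outs α.prob L.outcome (L.state b ψ)) fun f => rec f ++ t f)
    (ht : ∀ f f' : Basis, f (.qb L.q₂) = f' (.qb L.q₂) → f (.ns (L.nm 1)) = f' (.ns (L.nm 1)) →
      f (.ns (L.nm 3)) = f' (.ns (L.nm 3)) → t f = t f') :
    SpecQuant own₀ env₀ ψ α L b S' fun f => rec f ++ t f where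
  names := h.names.grow hown.symm.subset henv
  qa_eq := h.qa_eq
  qb_eq := h.qb_eq
  ancilla := by rw [henv]; exact h.ancilla
  pos := h.pos
  prob_nil := h.prob_nil
  rep := hR
  normed _ := hN
  rec_congr f f' hf := by
    rw [h.rec_congr f f' hf, ht f f' (hf h6).1 (hf h6).2.1 (hf h6).2.2]
  slot _ := by
    obtain ⟨h1, h2⟩ := h.slot h6
    refine ⟨h1.trans_le hW, fun f => ?_⟩
    rw [List.getD_append _ _ _ _ (by rw [h.rep.reclen]; exact h1), h2]

theorem measure_bit (h : SpecQuant own₀ env₀ ψ α L b S rec) (hψ : IsState (own₀ ∪ env₀.toFinset) ψ)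
    (hb : ∀ x ≤ 9, x ≠ 6 → b x = true) (h6 : b 6 = false) :
    SpecQuant own₀ env₀ ψ α { L with w := S.width } (Function.update b 6 true)
      (S.measure (fun _ => true) 1 (obsQb [.qb L.q₂]))
      fun f => rec f ++ [(f (.qb L.q₂) : ℤ)] := by
  have hF := h.sqSummable hψ (hb 0 (by omega) (by omega)) (hb 1 (by omega) (by omega))
    (hb 8 (by omega) (by omega)) (hb 9 (by omega) (by omega)) fun x hx => hb x (by omega) (by omega)
  have e : (fun f => rec f ++ if true = true then obsQb [.qb L.q₂] f else List.replicate 1 0) =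
      fun f => rec f ++ [(f (.qb L.q₂) : ℤ)] := by
    funext f
    simp [obsQb]
  refine ⟨h.names.grow (Finset.Subset.refl _) rfl, h.qa_eq, h.qb_eq, h.ancilla, h.pos, h.prob_nil,
    ?_, fun _ => ?_, fun f f' hf => ?_, fun _ => ⟨?_, fun f => ?_⟩⟩
  · have := h.rep.measure (hF.observed _ _ _) (G := fun _ => true) (r := 1)
      (obs := obsQb [.qb L.q₂]) fun f => rfl
    rw [← e]
    exact this
  · have := Store.Rep.normed_measure h.rep (G := fun _ => true) (r := 1)
      (obs := obsQb [.qb L.q₂]) (by simp)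
    rw [← e]
    exact this
  · rw [h.rec_const h6 f f', (hf rfl).1]
  · show S.width < S.width + 1
    omega
  · have := h.rep.reclen f
    show (rec f ++ [(f (.qb L.q₂) : ℤ)]).getD S.width 0 = _
    rw [← this]
    simp

theorem outcome_congr {f f' : Basis} (h1 : f (.qb L.q₂) = f' (.qb L.q₂))
    (h2 : f (.ns (L.nm 1)) = f' (.ns (L.nm 1))) (h3 : f (.ns (L.nm 3)) = f' (.ns (L.nm 3))) :
    L.outcome f = L.outcome f' := by
  simp only [SpecLoc.outcome, specOutcome, h1, h2, h3]

theorem specExpr_result (h : SpecQuant own₀ env₀ ψ α L b S rec) (h6 : b 6 = true) {j : ℕ}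
    (hj : j < 3) : SpecExpr L S.width rec j
      (resultExpr (.slot L.w) (modeVal (L.nm 1)) (modeVal (L.nm 3)) j) := by
  obtain ⟨h1, h2⟩ := h.slot h6
  have hc : ∀ f, (Expr.op .eq (.vals [.slot L.w]) (num 1)).den (rec f) ≠ 0 ↔ f (.qb L.q₂) = 1 := by
    intro f
    simp only [Expr.den, List.headD, num, Val.at, h2, DataOp.eval]
    norm_cast
    simp
  match j with
  | 0 => exact .inr ⟨by omega, _, rfl, ⟨⟨_, rfl, h1⟩, ⟨_, rfl, trivial⟩⟩, hc⟩
  | 1 => exact .inr ⟨by omega, _, rfl, ⟨⟨_, rfl, h1⟩, ⟨_, rfl, trivial⟩⟩, hc⟩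
  | 2 => exact .inl ⟨⟨_, rfl, h1⟩, h2⟩

theorem eStep (h : SpecQuant own₀ env₀ ψ α L b S rec) (hψ : IsState (own₀ ∪ env₀.toFinset) ψ)
    (hb : ∀ x ≤ 9, b x = true) {j : ℕ} {e : Expr} (he : SpecExpr L S.width rec j e) {S' : Store}
    {e' : Expr} (H : EStep (fun _ => true) S e S' e') :
    ∃ rec', SpecQuant own₀ env₀ ψ α L b S' rec' ∧ SpecExpr L S'.width rec' j e' ∧
      e'.size < e.size := by
  have h6 := hb 6 (by omega)
  have hpush : ∀ {a : List ℤ → List ℤ}, (∀ v, (a v).length = 1) →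
      SpecQuant own₀ env₀ ψ α L b (S.push 1 a) fun f => rec f ++ a (rec f) := fun ha =>
    h.extend h6 rfl rfl (Nat.le_add_right _ _) (h.rep.push ha)
      (Store.Rep.normed_push h.rep (h.normed h6))
      fun f f' g1 g2 g3 => by rw [h.rec_congr f f' fun _ => ⟨g1, g2, g3⟩]
  rcases he with ⟨h1, h2⟩ | ⟨hj, c, rfl, h1, h2⟩
  · obtain ⟨a, rfl, ha, g1, g2, g3⟩ := h1.step H
    exact ⟨_, hpush ha, .inl ⟨g1, fun f => by rw [g2 _ (h.rep.reclen f), h2]⟩, g3⟩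
  · cases H with
    | iteCond _ _ H =>
      obtain ⟨a, rfl, ha, g1, g2, g3⟩ := h1.step H
      refine ⟨_, hpush ha, .inr ⟨hj, _, rfl, g1, fun f => by rw [g2 _ (h.rep.reclen f), h2]⟩, ?_⟩
      simp only [Expr.size]
      omega
    | iteThen v _ hv H =>
      obtain ⟨rfl, rfl⟩ := (eStep_measure_ns_iff (xs := [.ns (L.nm (2 * j + 1))]) (by simp) (by simp)
        (by simp [QName.IsNS])).1 H
      obtain ⟨v', g1, g2⟩ := h1
      obtain rfl : v = v' := by simpa using g1
      have h3 : ∀ f, v.at (rec f) ≠ 0 ↔ f (.qb L.q₂) = 1 := h2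
      have hF := h.sqSummable hψ (hb 0 (by omega)) (hb 1 (by omega)) (hb 8 (by omega))
        (hb 9 (by omega)) fun x hx => hb x (by omega)
      refine ⟨_, h.extend h6 rfl rfl (Nat.le_add_right _ _)
        (h.rep.measure (hF.observed _ _ _) fun f => by simp [obsNS])
        (Store.Rep.normed_measure h.rep fun v _ => h.normed h6 v)
        fun f f' k1 k2 k3 => ?_, .inl ⟨⟨⟨_, rfl, g2.mono (Nat.le_add_right _ _)⟩, ⟨_, rfl, ?_⟩,
          ⟨_, rfl, trivial⟩⟩, fun f => ?_⟩, ?_⟩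
      · have k4 : f (.ns (L.nm (2 * j + 1))) = f' (.ns (L.nm (2 * j + 1))) := by
          obtain rfl | rfl : j = 0 ∨ j = 1 := by omega
          · exact k2
          · exact k3
        rw [h.rec_congr f f' fun _ => ⟨k1, k2, k3⟩]
        simp only [obsNS, List.map_cons, List.map_nil, k4]
      · show S.width + 0 < S.width + 1
        omega
      · have k1 : ∀ o, v.at (rec f ++ o) = v.at (rec f) := g2.at_append (h.rep.reclen f)
        have k2 := h.rep.reclen f
        show (if v.at (rec f ++ _) ≠ 0 then (rec f ++ _).getD S.width 0 else 0) = _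
        rw [k1]
        by_cases hq : f (.qb L.q₂) = 1
        · have := (h3 f).2 hq
          rw [if_pos this, if_pos (by simpa using this), ← k2]
          obtain rfl | rfl : j = 0 ∨ j = 1 := by omega
          all_goals simp [obsNS, component, SpecLoc.outcome, specOutcome, hq]
        · have := mt (h3 f).1 hq
          rw [if_neg this]
          obtain rfl | rfl : j = 0 ∨ j = 1 := by omega
          all_goals simp [component, SpecLoc.outcome, specOutcome, hq]
      · simp [Expr.size, num]

theorem specExpr_progress {W : ℕ} {j : ℕ} {e : Expr} (he : SpecExpr L W rec j e) :
    (∃ v, e = .vals [v]) ∨ ∀ S, ∃ S' e', EStep (fun _ => true) S e S' e' := by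
  rcases he with ⟨h1, -⟩ | ⟨-, c, rfl, h1, -⟩
  · rcases h1.progress with ⟨v, h, -⟩ | h
    · exact .inl ⟨v, h⟩
    · exact .inr fun S => h _ S
  · right
    intro S
    rcases h1.progress with ⟨v, rfl, hv⟩ | h
    · exact ⟨_, _, .iteThen v _ hv.isClassical
        ((eStep_measure_ns_iff (xs := [.ns (L.nm (2 * j + 1))]) (by simp) (by simp)
          (by simp [QName.IsNS])).2 ⟨rfl, rfl⟩)⟩
    · obtain ⟨S', c', h⟩ := h (fun _ => true) S
      exact ⟨S', _, .iteCond _ _ h⟩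

theorem specExpr_vals {W : ℕ} {j : ℕ} {vs : List Val} (he : SpecExpr L W rec j (.vals vs)) :
    ∃ v, vs = [v] ∧ v.isClassical = true ∧ ∀ f, v.at (rec f) = component (L.outcome f) j := by
  rcases he with ⟨⟨v, rfl, hv⟩, h⟩ | ⟨-, c, h, -⟩
  · exact ⟨v, rfl, hv.isClassical, h⟩
  · cases h

theorem out (h : SpecQuant own₀ env₀ ψ α L b S rec) (hψ : IsState (own₀ ∪ env₀.toFinset) ψ)
    (hb : ∀ x ≤ 9, b x = true) (ho : α.outs.length < 3) {v : Val} (hv : v.isClassical = true)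
    (hval : ∀ f, v.at (rec f) = component (L.outcome f) α.outs.length) :
    S.outProb [v] = α.nextProb ψ ∧ ∀ w, 0 < α.nextProb ψ w →
      (S.outBranch [v] w).rhoE = α.nextRho env₀ ψ w ∧
      SpecQuant own₀ env₀ ψ (α.next ψ w) L b (S.outBranch [v] w) rec := by
  have h0 := hb 0 (by omega)
  have h1 := hb 1 (by omega)
  have h8 := hb 8 (by omega)
  have h9 := hb 9 (by omega)
  have h6 := hb 6 (by omega)
  have hqa : α.qa = some L.qa := by rw [h.qa_eq, h8]; rfl
  have hqb : α.qb = some L.qb := by rw [h.qb_eq, h9]; rfl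
  obtain ⟨n1, n2⟩ := h.ancilla (hb 7 (by omega))
  have n3 : ∀ i < 4, .ns (L.nm i) ∉ S.env := fun i hi => h.names.ns_notMem_env (by
    simp only [SpecLoc.Created, h0, h1, and_true]
    omega)
  have hz : ∀ f p : Basis, (∀ x, x ∉ S.env → p x = 0) → (f + p) (.qb L.q₂) = f (.qb L.q₂) ∧
      (f + p) (.ns (L.nm 1)) = f (.ns (L.nm 1)) ∧ (f + p) (.ns (L.nm 3)) = f (.ns (L.nm 3)) := by
    intro f p hp
    simp [hp _ n1, hp _ (n3 1 (by omega)), hp _ (n3 3 (by omega))]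
  have henv : S.env = α.env env₀ := h.names.env_eq
  have hs := h.support hψ h0 h1
  have hst := state_eq (L := L) (b := b) (ψ := ψ) fun x hx => hb x (by omega)
  obtain ⟨k1, k2⟩ := output_step henv h.rep (h.normed h6)
    (h.sqSummable hψ h0 h1 h8 h9 fun x hx => hb x (by omega)) h.pos ho hv hval
    (fun f p hp => outcome_congr (hz f p hp).1 (hz f p hp).2.1 (hz f p hp).2.2)
    (fun f p hp => h.rec_congr _ _ fun _ => hz f p hp)
    (fun outs M a b' hM ha hb' => by
      rw [hst, Hist.expect, hqa, hqb]
      refine spec_expected (h.nodup_names h0 h1 h8 h9) (by simp) hψ.1.summable hs ?_ _ ?_ ha hb'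
      · rcases n2 with n2 | ⟨-, -, n2⟩ | ⟨-, -, n2⟩
        · exact .inr (.inr n2)
        · exact .inl (by rw [n2])
        · exact .inr (.inl (by rw [n2]))
      · intro x hx hc
        have := hM x hx
        simp only [List.mem_cons, List.not_mem_nil, or_false] at hc
        rcases hc with rfl | rfl | rfl | rfl | rfl | rfl | rfl
        · exact h.names.qb_notMem_env hqa this
        · exact h.names.swap.qb_notMem_env hqb this
        · exact n1 this
        · exact n3 0 (by omega) this
        · exact n3 1 (by omega) this
        · exact n3 2 (by omega) this
        · exact n3 3 (by omega) this)
  refine ⟨k1, fun w hw => ?_⟩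
  obtain ⟨g1, g2, g3, g4, g5, g6⟩ := k2 w hw
  refine ⟨g1, ?_⟩
  exact {
    names := h.names.grow g5.symm.subset g6
    qa_eq := h.qa_eq
    qb_eq := h.qb_eq
    ancilla := by rw [g6]; exact h.ancilla
    pos := g4
    prob_nil := fun hc => absurd hc (by simp [Hist.next])
    rep := g2
    normed := fun _ => g3
    rec_congr := h.rec_congr
    slot := h.slot }

end SpecQuant

/-! ### Threads connected by links -/

/-- The threads `T i` at the program counters `k i` send and receive the values `V p` on the
channels `p` of the links. Apart from that, they only communicate on public channels, and there they
only receive qubits, and do not send them. -/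
structure Wired (C : Ctx) (L : List (ℕ × ℕ × ℕ × ℕ × ℕ)) (T : ℕ → ℕ → Proc) (V : ℕ → List Val)
    (k : ℕ → ℕ) : Prop where
  holes : C.holes.Nodup
  hidden : ∀ l ∈ L, C.vis l.2.1 (.priv l.1) = false ∧ C.vis l.2.2.2.1 (.priv l.1) = false
  com : ∀ l ∈ L, l.2.1 ∈ C.holes → l.2.2.2.1 ∈ C.holes →
    C.com l.2.1 l.2.2.2.1 (.priv l.1) = true
  send : ∀ l ∈ L, k l.2.1 = l.2.2.1 →
    POut (T l.2.1 l.2.2.1) (.priv l.1) (V l.1) (T l.2.1 (l.2.2.1 + 1))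
  recv : ∀ l ∈ L, k l.2.2.2.1 = l.2.2.2.2 →
    PIn (T l.2.2.2.1 l.2.2.2.2) (.priv l.1) (V l.1) (T l.2.2.2.1 (l.2.2.2.2 + 1))
  pOut : ∀ {i c vs X}, i ∈ C.holes → POut (T i (k i)) c vs X →
    (∃ l ∈ L, c = .priv l.1 ∧ i = l.2.1 ∧ k i = l.2.2.1 ∧ vs = V l.1 ∧ X = T i (k i + 1)) ∨
      ∃ p, c = .pub p ∧ ∀ q, vs ≠ [.name q]
  pIn : ∀ {i c vs X}, i ∈ C.holes → PIn (T i (k i)) c vs X →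
    (∃ l ∈ L, c = .priv l.1 ∧ i = l.2.2.2.1 ∧ k i = l.2.2.2.2 ∧ (vs = V l.1 → X = T i (k i + 1))) ∨
      ∃ p q, c = .pub p ∧ vs = [.name q]

/-- The process with the threads `T` at the program counters `k`. -/
def Ctx.run (C : Ctx) (T : ℕ → ℕ → Proc) (k : ℕ → ℕ) : Proc := C.fill fun i => T i (k i)

theorem Ctx.fill_update_run {C : Ctx} {T T' : ℕ → ℕ → Proc} {k k' : ℕ → ℕ} {i : ℕ}
    (h : ∀ j ∈ C.holes, j ≠ i → T j (k j) = T' j (k' j)) :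
    C.fill (Function.update (fun i => T i (k i)) i (T' i (k' i))) = C.run T' k' := by
  refine Ctx.fill_congr fun j hj => ?_
  by_cases hji : j = i
  · subst hji
    rw [Function.update_self]
  · rw [Function.update_of_ne hji]
    exact h j hj hji

namespace Wired

variable {C : Ctx} {L : List (ℕ × ℕ × ℕ × ℕ × ℕ)} {T : ℕ → ℕ → Proc} {V : ℕ → List Val}
  {k : ℕ → ℕ}

theorem tau_inv (h : Wired C L T V k) (hL : ∀ l ∈ L, ∀ l' ∈ L, l.1 = l'.1 → l = l')
    {S : Store} {S' P'} (H : Tau S (C.run T k) S' P') :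
    (∃ i X, i ∈ C.holes ∧ Tau S (T i (k i)) S' X ∧
      P' = C.fill (Function.update (fun i => T i (k i)) i X)) ∨
    (S' = S ∧ ∃ l ∈ L, l.2.1 ∈ C.holes ∧ l.2.2.2.1 ∈ C.holes ∧ k l.2.1 = l.2.2.1 ∧
      k l.2.2.2.1 = l.2.2.2.2 ∧ P' = C.run T (incr (incr k l.2.1) l.2.2.2.1)) := by
  rcases Ctx.tau_inv h.holes H with h1 | ⟨rfl, i, j, c, vs, X, Y, hi, hj, hij, ho, hin, rfl⟩
  · exact .inl h1
  · right
    refine ⟨rfl, ?_⟩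
    rcases h.pOut hi ho with ⟨l, hl, rfl, rfl, h2, rfl, rfl⟩ | ⟨p, rfl, h2⟩
    · rcases h.pIn hj hin with ⟨l', hl', h3, rfl, h4, h5⟩ | ⟨p, q, h3, -⟩
      · obtain rfl : l = l' := hL l hl l' hl' (by simpa using h3)
        rw [h5 rfl]
        refine ⟨l, hl, hi, hj, h2, h4, ?_⟩
        refine Ctx.fill_congr fun m hm => ?_
        by_cases hmj : m = l.2.2.2.1
        · subst hmj
          rw [Function.update_self, incr_same, incr_ne _ hij.symm]
        · rw [Function.update_of_ne hmj, incr_ne _ hmj]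
          by_cases hmi : m = l.2.1
          · subst hmi
            rw [Function.update_self, incr_same]
          · rw [Function.update_of_ne hmi, incr_ne _ hmi]
      · cases h3
    · rcases h.pIn hj hin with ⟨l', hl', h3, -⟩ | ⟨p, q, -, rfl⟩
      · cases h3
      · exact absurd rfl (h2 _)

theorem tau_com (h : Wired C L T V k) {S : Store} {l : ℕ × ℕ × ℕ × ℕ × ℕ} (hl : l ∈ L)
    (h1 : l.2.1 ∈ C.holes) (h2 : l.2.2.2.1 ∈ C.holes) (h3 : k l.2.1 = l.2.2.1)
    (h4 : k l.2.2.2.1 = l.2.2.2.2) : ∃ P', Tau S (C.run T k) S P' := by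
  have ho : POut (T l.2.1 (k l.2.1)) (.priv l.1) (V l.1) (T l.2.1 (l.2.2.1 + 1)) := by
    rw [h3]; exact h.send l hl h3
  have hi : PIn (T l.2.2.2.1 (k l.2.2.2.1)) (.priv l.1) (V l.1)
      (T l.2.2.2.1 (l.2.2.2.2 + 1)) := by
    rw [h4]; exact h.recv l hl h4
  exact ⟨_, Ctx.tau_com (f := fun i => T i (k i)) h.holes (h.com l hl h1 h2) ho hi⟩

theorem pOut_inv (h : Wired C L T V k) {c vs P'} (H : POut (C.run T k) c vs P') :
    ∃ i X p, i ∈ C.holes ∧ c = .pub p ∧ POut (T i (k i)) c vs X ∧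
      P' = C.fill (Function.update (fun i => T i (k i)) i X) := by
  obtain ⟨i, X, h1, h2, h3⟩ := Ctx.pOut_inv h.holes H
  have hi := Ctx.mem_holes_of_vis h1
  rcases h.pOut hi h2 with ⟨l, hl, rfl, rfl, -⟩ | ⟨p, rfl, -⟩
  · rw [(h.hidden l hl).1] at h1; cases h1
  · exact ⟨i, X, p, hi, rfl, h2, h3⟩

theorem pIn_inv (h : Wired C L T V k) {c vs P'} (H : PIn (C.run T k) c vs P') :
    ∃ i X p, i ∈ C.holes ∧ c = .pub p ∧ PIn (T i (k i)) c vs X ∧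
      P' = C.fill (Function.update (fun i => T i (k i)) i X) := by
  obtain ⟨i, X, h1, h2, h3⟩ := Ctx.pIn_inv h.holes H
  have hi := Ctx.mem_holes_of_vis h1
  rcases h.pIn hi h2 with ⟨l, hl, rfl, rfl, -⟩ | ⟨p, q, rfl, -⟩
  · rw [(h.hidden l hl).2] at h1; cases h1
  · exact ⟨i, X, p, hi, rfl, h2, h3⟩

end Wired

/-- The number in a name. -/
def QName.index : QName → ℕ
  | .qb n => n
  | .ns n => n

theorem Store.exists_fresh (S : Store) : ∃ N, ∀ n ≥ N, S.Fresh (.qb n) ∧ S.Fresh (.ns n) := by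
  have h : ∀ x, x.index ≥ (S.own ∪ S.env.toFinset).sup QName.index + 1 → S.Fresh x := by
    intro x hx
    refine ⟨fun hc => ?_, fun hc => ?_⟩
    · have := Finset.le_sup (f := QName.index) (Finset.mem_union_left S.env.toFinset hc)
      omega
    · have := Finset.le_sup (f := QName.index)
        (Finset.mem_union_right S.own (List.mem_toFinset.2 hc))
      omega
  exact ⟨_, fun n hn => ⟨h (.qb n) hn, h (.ns n) hn⟩⟩

/-! ### The runs of the specification -/

/-- The public channels `a`, `b`, `out₁`, `cnt`, `out₂`. -/
structure Ports where
  a : ℕ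
  b : ℕ
  o₁ : ℕ
  c : ℕ
  o₂ : ℕ

/-- The channels of the results. -/
def Ports.result (p : Ports) : ℕ → Chan := resultChan (.pub p.o₁) (.pub p.c) (.pub p.o₂)

/-- The links between the two polarising beam splitters, the operation and the output. -/
def specLinks : List (ℕ × ℕ × ℕ × ℕ × ℕ) :=
  [(0, 0, 2, 2, 1), (1, 0, 3, 2, 2), (2, 1, 2, 2, 3), (3, 1, 3, 2, 4), (5, 2, 13, 3, 0),
    (6, 2, 14, 3, 1), (7, 2, 15, 3, 2), (8, 2, 16, 3, 3), (4, 2, 18, 3, 4)]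

/-- The arrangement of the threads of the specification. -/
def specCtx : Ctx :=
  .new [ch.c, ch.d, ch.e, ch.f, ch.g, ch.h, ch.i, ch.j, ch.k] <|
    .par (.par (.hole 0) (.hole 1)) (.par (.hole 2) (.hole 3))

namespace SpecLoc

/-- The expression for the next result. -/
def result (L : SpecLoc) (j : ℕ) : Expr :=
  resultExpr (.slot L.w) (modeVal (L.nm 1)) (modeVal (L.nm 3)) j

/-- The current expression of the output at the program counter `n`. -/
def expr (L : SpecLoc) (n : ℕ) : Expr := L.e.getD (L.result (n - 5))

/-- The threads of the specification. -/
noncomputable def thread (p : Ports) (L : SpecLoc) : ℕ → ℕ → Proc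
  | 0 => polTh (.pub p.a) ch.c ch.d L.qa (L.nm 0) (L.nm 1)
  | 1 => polTh (.pub p.b) ch.e ch.f L.qb (L.nm 2) (L.nm 3)
  | 2 => opTh ch.c ch.d ch.e ch.f ch.g ch.h ch.i ch.j ch.k (L.nm 0) (L.nm 1) (L.nm 2) (L.nm 3)
    L.q₂ L.w
  | _ => fun n => outputTh ch.g ch.h ch.i ch.j ch.k (.pub p.o₁) (.pub p.c) (.pub p.o₂) (L.nm 1)
    (L.nm 3) L.w (L.expr n) n

/-- The values that are sent on the channels. -/
def value (L : SpecLoc) : ℕ → List Val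
  | 0 => [modeVal (L.nm 0)]
  | 1 => [modeVal (L.nm 1)]
  | 2 => [modeVal (L.nm 2)]
  | 3 => [modeVal (L.nm 3)]
  | 4 => [.slot L.w]
  | 5 => [modeVal (L.nm 0)]
  | 6 => [modeVal (L.nm 1)]
  | 7 => [modeVal (L.nm 2)]
  | _ => [modeVal (L.nm 3)]

/-- The process of the specification. -/
noncomputable def proc (p : Ports) (L : SpecLoc) : Proc := specCtx.run (L.thread p) L.k

/-- A bound for the number of remaining steps. -/
def rank (L : SpecLoc) : ℕ :=
  (4 - L.k 0) + (4 - L.k 1) + (19 - L.k 2) + (8 - L.k 3) + (L.expr (L.k 3)).size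

theorem wired (p : Ports) (L : SpecLoc) (h4 : L.k 3 ≤ 4 → L.e = none)
    (he : ∀ q, L.e ≠ some (.vals [.name q])) :
    Wired specCtx specLinks (L.thread p) L.value L.k where
  holes := by decide
  hidden := by decide
  com := by decide
  send := by
    simp only [specLinks, List.forall_mem_cons, List.not_mem_nil, false_implies, implies_true,
      and_true, thread, value]
    refine ⟨fun _ => ?_, fun _ => ?_, fun _ => ?_, fun _ => ?_, fun _ => ?_, fun _ => ?_, fun _ => ?_,
      fun _ => ?_, fun _ => ?_⟩
    · exact polTh_out_iff.2 (.inl ⟨rfl, rfl, rfl, rfl⟩)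
    · exact polTh_out_iff.2 (.inr ⟨rfl, rfl, rfl, rfl⟩)
    · exact polTh_out_iff.2 (.inl ⟨rfl, rfl, rfl, rfl⟩)
    · exact polTh_out_iff.2 (.inr ⟨rfl, rfl, rfl, rfl⟩)
    · exact opTh_out_iff.2 (.inl ⟨rfl, rfl, rfl, rfl⟩)
    · exact opTh_out_iff.2 (.inr (.inl ⟨rfl, rfl, rfl, rfl⟩))
    · exact opTh_out_iff.2 (.inr (.inr (.inl ⟨rfl, rfl, rfl, rfl⟩)))
    · exact opTh_out_iff.2 (.inr (.inr (.inr (.inl ⟨rfl, rfl, rfl, rfl⟩))))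
    · exact opTh_out_iff.2 (.inr (.inr (.inr (.inr ⟨rfl, rfl, rfl, rfl⟩))))
  recv := by
    simp only [specLinks, List.forall_mem_cons, List.not_mem_nil, false_implies, implies_true,
      and_true, thread, value]
    refine ⟨fun _ => opTh_in_one, fun _ => opTh_in_two, fun _ => opTh_in_three,
      fun _ => opTh_in_four, fun _ => outputTh_in_zero, fun _ => outputTh_in_one,
      fun _ => outputTh_in_two, fun _ => outputTh_in_three, fun h => ?_⟩
    have : L.expr 5 = L.result 0 := by rw [expr, h4 h.le]; rfl
    simp only [this]
    exact outputTh_in_four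
  pOut := by
    intro i c vs X hi H
    simp only [specCtx, Ctx.holes, List.mem_append, List.mem_singleton] at hi
    obtain (rfl | rfl) | rfl | rfl := hi
    · rcases polTh_out_iff.1 H with ⟨h1, h2, h3, h4⟩ | ⟨h1, h2, h3, h4⟩ <;> rw [h1, h2, h3, h4]
      · exact .inl ⟨_, .head _, rfl, rfl, rfl, rfl, rfl⟩
      · exact .inl ⟨(1, 0, 3, 2, 2), by decide, rfl, rfl, rfl, rfl, rfl⟩
    · rcases polTh_out_iff.1 H with ⟨h1, h2, h3, h4⟩ | ⟨h1, h2, h3, h4⟩ <;> rw [h1, h2, h3, h4]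
      · exact .inl ⟨(2, 1, 2, 2, 3), by decide, rfl, rfl, rfl, rfl, rfl⟩
      · exact .inl ⟨(3, 1, 3, 2, 4), by decide, rfl, rfl, rfl, rfl, rfl⟩
    · left
      rcases opTh_out_iff.1 H with ⟨h1, h2, h3, h4⟩ | ⟨h1, h2, h3, h4⟩ | ⟨h1, h2, h3, h4⟩ |
        ⟨h1, h2, h3, h4⟩ | ⟨h1, h2, h3, h4⟩ <;> rw [h1, h2, h3, h4]
      · exact ⟨(5, 2, 13, 3, 0), by decide, rfl, rfl, rfl, rfl, rfl⟩
      · exact ⟨(6, 2, 14, 3, 1), by decide, rfl, rfl, rfl, rfl, rfl⟩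
      · exact ⟨(7, 2, 15, 3, 2), by decide, rfl, rfl, rfl, rfl, rfl⟩
      · exact ⟨(8, 2, 16, 3, 3), by decide, rfl, rfl, rfl, rfl, rfl⟩
      · exact ⟨(4, 2, 18, 3, 4), by decide, rfl, rfl, rfl, rfl, rfl⟩
    · right
      obtain ⟨h1, h2, rfl, h3, -⟩ := outputTh_out_iff.1 H
      have h4 : ∀ q, vs ≠ [.name q] := by
        rintro q rfl
        rcases hL : L.e with _ | e
        · rw [expr, hL, Option.getD_none, result] at h3
          obtain h | h | h : L.k 3 - 5 = 0 ∨ L.k 3 - 5 = 1 ∨ L.k 3 - 5 = 2 := by omega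
          all_goals rw [h] at h3; simp [resultExpr] at h3
        · rw [expr, hL, Option.getD_some] at h3
          exact he q (by rw [hL, h3])
      obtain h | h | h : L.k 3 - 5 = 0 ∨ L.k 3 - 5 = 1 ∨ L.k 3 - 5 = 2 := by omega
      all_goals rw [h]; exact ⟨_, rfl, h4⟩
  pIn := by
    intro i c vs X hi H
    simp only [specCtx, Ctx.holes, List.mem_append, List.mem_singleton] at hi
    obtain (rfl | rfl) | rfl | rfl := hi
    · obtain ⟨-, rfl, n, rfl, -⟩ := polTh_in_iff.1 H
      exact .inr ⟨_, _, rfl, rfl⟩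
    · obtain ⟨-, rfl, n, rfl, -⟩ := polTh_in_iff.1 H
      exact .inr ⟨_, _, rfl, rfl⟩
    · left
      rcases opTh_in H with ⟨h1, h2, h3⟩ | ⟨h1, h2, h3⟩ | ⟨h1, h2, h3⟩ | ⟨h1, h2, h3⟩ <;> rw [h1, h2]
      · exact ⟨(0, 0, 2, 2, 1), by decide, rfl, rfl, rfl, h3⟩
      · exact ⟨(1, 0, 3, 2, 2), by decide, rfl, rfl, rfl, h3⟩
      · exact ⟨(2, 1, 2, 2, 3), by decide, rfl, rfl, rfl, h3⟩
      · exact ⟨(3, 1, 3, 2, 4), by decide, rfl, rfl, rfl, h3⟩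
    · left
      rcases outputTh_in H with ⟨h1, h2, h3⟩ | ⟨h1, h2, h3⟩ | ⟨h1, h2, h3⟩ | ⟨h1, h2, h3⟩ |
        ⟨h1, h2, h3⟩ <;> rw [h1, h2]
      · exact ⟨(5, 2, 13, 3, 0), by decide, rfl, rfl, rfl, h3⟩
      · exact ⟨(6, 2, 14, 3, 1), by decide, rfl, rfl, rfl, h3⟩
      · exact ⟨(7, 2, 15, 3, 2), by decide, rfl, rfl, rfl, h3⟩
      · exact ⟨(8, 2, 16, 3, 3), by decide, rfl, rfl, rfl, h3⟩
      · refine ⟨(4, 2, 18, 3, 4), by decide, rfl, rfl, rfl, fun hv => (h3 hv).trans ?_⟩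
        have : L.expr 5 = L.result 0 := by rw [expr, h4 h1.le]; rfl
        simp only [thread, this]
        rfl

end SpecLoc

theorem opTh_congr {c d e f g h i j k : Chan} {m₀ m₁ m₂ m₃ q w m₀' m₁' m₂' m₃' q' w' n : ℕ}
    (h₀ : n ≤ 1 ∨ m₀ = m₀' ∧ m₁ = m₁') (h₁ : n ≤ 3 ∨ m₂ = m₂' ∧ m₃ = m₃') (h₂ : n = 0 ∨ q = q')
    (h₃ : n ≤ 17 ∨ w = w') : opTh c d e f g h i j k m₀ m₁ m₂ m₃ q w n =
      opTh c d e f g h i j k m₀' m₁' m₂' m₃' q' w' n := by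
  rcases h₃ with h₃ | rfl
  · rcases h₂ with rfl | rfl
    · rfl
    · rcases h₁ with h₁ | ⟨rfl, rfl⟩ <;> rcases h₀ with h₀ | ⟨rfl, rfl⟩ <;> interval_cases n <;> rfl
  · rcases h₂ with rfl | rfl
    · rfl
    · rcases h₁ with h₁ | ⟨rfl, rfl⟩
      · interval_cases n <;> rcases h₀ with h₀ | ⟨rfl, rfl⟩ <;> first | rfl | omega
      · rcases h₀ with h₀ | ⟨rfl, rfl⟩
        · interval_cases n <;> rfl
        · rfl

theorem outputTh_congr {g h i j k o₁ c o₂ : Chan} {m₁ m₃ w m₁' m₃' w' n : ℕ} {e e' : Expr}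
    (h₀ : n ≤ 1 ∨ m₁ = m₁') (h₁ : n ≤ 3 ∨ m₃ = m₃') (h₂ : n ≤ 4 ∨ w = w' ∧ e = e') :
    outputTh g h i j k o₁ c o₂ m₁ m₃ w e n = outputTh g h i j k o₁ c o₂ m₁' m₃' w' e' n := by
  rcases h₀ with h₀ | rfl
  · interval_cases n <;> rfl
  · rcases h₁ with h₁ | rfl
    · interval_cases n <;> rfl
    · rcases h₂ with h₂ | ⟨rfl, rfl⟩
      · interval_cases n <;> rfl
      · rfl

theorem SpecLoc.size_expr {L L' : SpecLoc} (he : L.e = L'.e) {m n : ℕ} (h : m - 5 = n - 5) :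
    (L.expr m).size = (L'.expr n).size := by
  rw [SpecLoc.expr, SpecLoc.expr, he, h]
  cases L'.e
  · simp only [Option.getD_none, SpecLoc.result]
    generalize n - 5 = j
    match j with
    | 0 => rfl
    | 1 => rfl
    | _ + 2 => rfl
  · rfl

theorem SpecLoc.rank_incr {L L' : SpecLoc} {i : ℕ} (h : L.k i < [4, 4, 19].getD i 0)
    (hk : L'.k = incr L.k i) (he : L'.e = L.e) : L'.rank < L.rank := by
  have hi : i < 3 := by
    by_contra hc
    rw [List.getD_eq_default _ _ (by simp; omega)] at h
    omega
  have h3 : L'.k 3 = L.k 3 := by rw [hk, incr_ne _ (by omega)]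
  rw [rank, rank, h3, size_expr he rfl, hk]
  refine Nat.add_lt_add_right ?_ _
  interval_cases i
  · change L.k 0 < 4 at h
    show (4 - (L.k 0 + 1)) + (4 - L.k 1) + (19 - L.k 2) + (8 - L.k 3) < _
    omega
  · change L.k 1 < 4 at h
    show (4 - L.k 0) + (4 - (L.k 1 + 1)) + (19 - L.k 2) + (8 - L.k 3) < _
    omega
  · change L.k 2 < 19 at h
    show (4 - L.k 0) + (4 - L.k 1) + (19 - (L.k 2 + 1)) + (8 - L.k 3) < _
    omega

theorem incr_incr_apply (k : ℕ → ℕ) {i j : ℕ} (h : i ≠ j) (m : ℕ) :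
    incr (incr k i) j m = k m + (if m = i then 1 else 0) + if m = j then 1 else 0 := by
  by_cases hj : m = j
  · subst hj
    rw [incr_same, incr_ne k h.symm, if_neg h.symm, if_pos rfl]
  · rw [incr_ne _ hj, if_neg hj]
    by_cases hi : m = i
    · subst hi
      rw [incr_same, if_pos rfl]
    · rw [incr_ne _ hi, if_neg hi]
      rfl

/-- The reachable configurations of the specification. -/
structure SpecInv (own₀ : Finset QName) (env₀ : List QName) (ψ : State) (α : Hist) (L : SpecLoc)
    (S : Store) : Prop where
  links : Links specLinks L.k
  bound₀ : L.k 0 ≤ 4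
  bound₁ : L.k 1 ≤ 4
  bound₂ : L.k 2 ≤ 19
  bound₃ : L.k 3 ≤ 8
  len : α.outs.length = L.k 3 - 5
  low : L.k 3 ≤ 4 → L.e = none
  data : ∀ q, L.e ≠ some (.vals [.name q])
  quant : ∃ rec, SpecQuant own₀ env₀ ψ α L (flags specThr L.k) S rec ∧
    (5 ≤ L.k 3 → L.k 3 ≤ 7 → SpecExpr L S.width rec (L.k 3 - 5) (L.expr (L.k 3)))

namespace SpecInv

variable {own₀ : Finset QName} {env₀ : List QName} {ψ : State} {α : Hist} {L : SpecLoc} {S : Store}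

theorem order (h : SpecInv own₀ env₀ ψ α L S) :
    (2 < L.k 0 ↔ 1 < L.k 2) ∧ (3 < L.k 0 ↔ 2 < L.k 2) ∧ (2 < L.k 1 ↔ 3 < L.k 2) ∧
    (3 < L.k 1 ↔ 4 < L.k 2) ∧ (13 < L.k 2 ↔ 0 < L.k 3) ∧ (14 < L.k 2 ↔ 1 < L.k 3) ∧
    (15 < L.k 2 ↔ 2 < L.k 3) ∧ (16 < L.k 2 ↔ 3 < L.k 3) ∧ (18 < L.k 2 ↔ 4 < L.k 3) := by
  simpa [Links, specLinks] using h.links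

theorem wired (h : SpecInv own₀ env₀ ψ α L S) (p : Ports) :
    Wired specCtx specLinks (L.thread p) L.value L.k := L.wired p h.low h.data

theorem outs_eq_nil (h : SpecInv own₀ env₀ ψ α L S) (hk : L.k 3 ≤ 5) : α.outs = [] :=
  List.eq_nil_of_length_eq_zero (by rw [h.len]; omega)

theorem flags_true (h : SpecInv own₀ env₀ ψ α L S) (hk : 5 ≤ L.k 3) :
    ∀ x ≤ 9, flags specThr L.k x = true := by
  have := h.order
  intro x hx
  interval_cases x <;> simp [flags, specThr] <;> omega

theorem communicate (h : SpecInv own₀ env₀ ψ α L S) {l : ℕ × ℕ × ℕ × ℕ × ℕ} (hl : l ∈ specLinks)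
    (h1 : L.k l.2.1 = l.2.2.1) (h2 : L.k l.2.2.2.1 = l.2.2.2.2) :
    SpecInv own₀ env₀ ψ α { L with k := incr (incr L.k l.2.1) l.2.2.2.1 } S ∧
      { L with k := incr (incr L.k l.2.1) l.2.2.2.1 }.rank < L.rank := by
  have ho := h.order
  obtain ⟨rec, hq, hx⟩ := h.quant
  have hlinks := h.links.communicate (by decide) hl h1 h2
  have ht := (by decide : ∀ l ∈ specLinks, l.2.1 ≠ l.2.2.2.1 ∧ (l.2.1, l.2.2.1 + 1) ∉ specThr ∧
      (l.2.2.2.1, l.2.2.2.2 + 1) ∉ specThr) l hl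
  have hflags := flags_communicate ht.1 h1 h2 ht.2.1 ht.2.2
  have hk := incr_incr_apply L.k ht.1
  generalize incr (incr L.k l.2.1) l.2.2.2.1 = k' at hlinks hflags hk ⊢
  have k0 := hk 0
  have k1 := hk 1
  have k2 := hk 2
  have k3 := hk 3
  have b0 := h.bound₀
  have b1 := h.bound₁
  have b2 := h.bound₂
  obtain ⟨c0, c1, c2, c3, c4, c5, c6⟩ : k' 0 ≤ 4 ∧ k' 1 ≤ 4 ∧ k' 2 ≤ 19 ∧ k' 3 ≤ 5 ∧ L.k 3 ≤ 4 ∧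
      (L.k 3 = 4 → L.k 2 = 18) ∧ (4 - k' 0) + (4 - k' 1) + (19 - k' 2) + (8 - k' 3) <
        (4 - L.k 0) + (4 - L.k 1) + (19 - L.k 2) + (8 - L.k 3) := by
    clear hk hx hq hflags hlinks ht
    simp only [specLinks, List.mem_cons, List.not_mem_nil, or_false] at hl
    rcases hl with rfl | rfl | rfl | rfl | rfl | rfl | rfl | rfl | rfl <;>
      simp only [Nat.reduceEqDiff, if_true, if_false] at h1 h2 k0 k1 k2 k3 <;> omega
  have hr : ({ L with k := k' } : SpecLoc).expr (k' 3) = L.expr (L.k 3) := by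
    show L.expr (k' 3) = _
    rw [SpecLoc.expr, SpecLoc.expr, show k' 3 - 5 = L.k 3 - 5 by omega]
  refine ⟨⟨hlinks, c0, c1, c2, c3.trans (by decide), ?_, fun _ => h.low c4, h.data, rec, ?_,
    fun h5 _ => ?_⟩, ?_⟩
  · show _ = k' 3 - 5
    rw [h.len]
    omega
  · show SpecQuant _ _ _ _ _ (flags specThr k') _ _
    rw [hflags]
    exact { hq with }
  · change 5 ≤ k' 3 at h5
    have h3 : L.k 3 = 4 := by
      by_contra hc
      have := k3
      split_ifs at this with g g' <;> omega
    rw [hr, SpecLoc.expr, h.low c4, h3]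
    show SpecExpr _ _ _ (k' 3 - 5) _
    rw [show k' 3 - 5 = 0 by omega]
    have h18 := c5 h3
    exact hq.specExpr_result (j := 0) (by simp [flags, specThr]; omega) (by omega)
  · rw [SpecLoc.rank, SpecLoc.rank, hr]
    exact Nat.add_lt_add_right c6 _

theorem split_a (h : SpecInv own₀ env₀ ψ α L S) (hk : L.k 0 = 1) {m n : ℕ} (hm : S.Fresh (.ns m))
    (hn : S.Fresh (.ns n)) (hmn : m ≠ n) :
    SpecInv own₀ env₀ ψ α
      { L with nm := Function.update (Function.update L.nm 0 m) 1 n, k := incr L.k 0 }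
      { S with
        own := insert (.ns m) (insert (.ns n) (S.own.erase (.qb L.qa)))
        st := fun v => psAct (.qb L.qa) (.ns m) (.ns n) (S.st v) } := by
  have ho := h.order
  obtain ⟨rec, hq, -⟩ := h.quant
  refine ⟨h.links.step (by rw [hk]; decide), ?_, h.bound₁, h.bound₂, h.bound₃, h.len, h.low, h.data,
    rec, ?_, fun h5 => ?_⟩
  · show L.k 0 + 1 ≤ 4
    omega
  · rw [flags_incr (x := 0) (by decide) hk rfl]
    have := hq.split_a (h.outs_eq_nil (by omega)) (by simp [flags, specThr]; omega)
      (by simp [flags, specThr]; omega) (by simp [flags, specThr]; omega)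
      (fun x hx hx' => by interval_cases x <;> simp [flags, specThr] <;> omega) hm hn hmn
    exact { this with }
  · change 5 ≤ L.k 3 at h5
    omega

theorem split_b (h : SpecInv own₀ env₀ ψ α L S) (hk : L.k 1 = 1) {m n : ℕ} (hm : S.Fresh (.ns m))
    (hn : S.Fresh (.ns n)) (hmn : m ≠ n) :
    SpecInv own₀ env₀ ψ α
      { L with nm := Function.update (Function.update L.nm 2 m) 3 n, k := incr L.k 1 }
      { S with
        own := insert (.ns m) (insert (.ns n) (S.own.erase (.qb L.qb)))
        st := fun v => psAct (.qb L.qb) (.ns m) (.ns n) (S.st v) } := by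
  have ho := h.order
  obtain ⟨rec, hq, -⟩ := h.quant
  refine ⟨h.links.step (by rw [hk]; decide), h.bound₀, ?_, h.bound₂, h.bound₃, h.len, h.low, h.data,
    rec, ?_, fun h5 => ?_⟩
  · show L.k 1 + 1 ≤ 4
    omega
  · rw [flags_incr (x := 1) (by decide) hk rfl]
    have := hq.split_b (h.outs_eq_nil (by omega)) (by simp [flags, specThr]; omega)
      (by simp [flags, specThr]; omega)
      (fun x hx hx' => by interval_cases x <;> simp [flags, specThr] <;> omega) hm hn hmn
    exact { this with }
  · change 5 ≤ L.k 3 at h5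
    omega

theorem create (h : SpecInv own₀ env₀ ψ α L S) (hψ : IsState (own₀ ∪ env₀.toFinset) ψ)
    (hk : L.k 2 = 0) {n : ℕ} (hn : S.Fresh (.qb n)) :
    SpecInv own₀ env₀ ψ α { L with q₂ := n, k := incr L.k 2 }
      { S with own := insert (.qb n) S.own } := by
  have ho := h.order
  obtain ⟨rec, hq, -⟩ := h.quant
  refine ⟨h.links.step (by rw [hk]; decide), h.bound₀, h.bound₁, ?_, h.bound₃, h.len, h.low, h.data,
    rec, ?_, fun h5 => ?_⟩
  · show L.k 2 + 1 ≤ 19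
    omega
  · rw [flags_incr (x := 7) (by decide) hk rfl]
    have := hq.create hψ (h.outs_eq_nil (by omega)) (by simp [flags, specThr]; omega)
      (by simp [flags, specThr]; omega) hn
    exact { this with }
  · change 5 ≤ L.k 3 at h5
    omega

theorem gate (h : SpecInv own₀ env₀ ψ α L S) (hk : 5 ≤ L.k 2) (hk' : L.k 2 ≤ 12) :
    SpecInv own₀ env₀ ψ α { L with k := incr L.k 2 } (S.transform (fun _ => true)
      (opGate (L.nm 0) (L.nm 1) (L.nm 2) (L.nm 3) L.q₂ (L.k 2))) := by
  have ho := h.order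
  obtain ⟨rec, hq, -⟩ := h.quant
  refine ⟨h.links.step ?_, h.bound₀, h.bound₁, ?_, h.bound₃, h.len, h.low, h.data,
    rec, ?_, fun h5 => ?_⟩
  · generalize L.k 2 = n at hk hk'
    interval_cases n <;> decide
  · show L.k 2 + 1 ≤ 19
    omega
  · have hnil := h.outs_eq_nil (by omega)
    have h6 : flags specThr L.k 6 = false := by simp [flags, specThr]; omega
    have f0 : flags specThr L.k 0 = true := by simp [flags, specThr]; omega
    have f1 : flags specThr L.k 1 = true := by simp [flags, specThr]; omega
    have f2 : flags specThr L.k 2 = decide (6 ≤ L.k 2) := rfl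
    have f3 : flags specThr L.k 3 = decide (8 ≤ L.k 2) := rfl
    have f4 : flags specThr L.k 4 = decide (10 ≤ L.k 2) := rfl
    have f5 : flags specThr L.k 5 = decide (12 ≤ L.k 2) := rfl
    have key : ∀ x U, 2 ≤ x → x ≤ 5 → (∀ (c : ℂ) φ, U (fun f => c * φ f) = fun f => c * U φ f) →
        U (fun _ => 0) = (fun _ => 0) →
        opGate (L.nm 0) (L.nm 1) (L.nm 2) (L.nm 3) L.q₂ (L.k 2) = U →
        specThr[x]? = some (2, L.k 2 + 1) →
        L.state (Function.update (flags specThr L.k) x true) ψ =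
          U (L.state (flags specThr L.k) ψ) → SpecQuant own₀ env₀ ψ α { L with k := incr L.k 2 }
            (flags specThr (incr L.k 2)) (S.transform (fun _ => true)
            (opGate (L.nm 0) (L.nm 1) (L.nm 2) (L.nm 3) L.q₂ (L.k 2))) rec := by
      intro x U h1 h2 h3 h4 h5 h7 h8
      rw [flags_incr (x := x) (by decide) rfl h7, h5]
      exact { hq.gate hnil h6 h1 h2 h3 h4 h8 with }
    have skip : L.k 2 = 6 ∨ L.k 2 = 8 ∨ L.k 2 = 10 ∨ L.k 2 = 12 →
        SpecQuant own₀ env₀ ψ α { L with k := incr L.k 2 }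
            (flags specThr (incr L.k 2)) (S.transform (fun _ => true)
            (opGate (L.nm 0) (L.nm 1) (L.nm 2) (L.nm 3) L.q₂ (L.k 2))) rec := by
      intro h1
      rw [flags_incr_of_notMem rfl (by rcases h1 with h | h | h | h <;> rw [h] <;> decide),
        opGate, if_neg (by omega), if_neg (by omega), if_neg (by omega), transform_id]
      exact { hq with }
    obtain hn | hn | hn | hn | hn : L.k 2 = 5 ∨ L.k 2 = 7 ∨ L.k 2 = 9 ∨ L.k 2 = 11 ∨
      (L.k 2 = 6 ∨ L.k 2 = 8 ∨ L.k 2 = 10 ∨ L.k 2 = 12) := by omega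
    · refine key 2 (pairAct hadAmp (.ns (L.nm 2)) (.ns (L.nm 3))) (by omega) (by omega)
        (pairAct_smul _ _ _) ?_ (by rw [hn]; rfl) (by rw [hn]; rfl) ?_
      · funext f; simp [pairAct]
      · simp [SpecLoc.state, f0, f1, f2, f3, f4, f5, hn]
    · refine key 3 (qubitAct ninthMatrix (.qb L.q₂)) (by omega) (by omega)
        (qubitAct_smul _ _) (qubitAct_zero _ _) (by rw [hn]; rfl) (by rw [hn]; rfl) ?_
      simp [SpecLoc.state, f0, f1, f2, f3, f4, f5, hn]
    · refine key 4 (czAct (.ns (L.nm 0)) (.ns (L.nm 1)) (.ns (L.nm 2)) (.ns (L.nm 3))) (by omega)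
        (by omega) (czAct_smul _ _ _ _) (czAct_zero _ _ _ _) (by rw [hn]; rfl) (by rw [hn]; rfl) ?_
      simp [SpecLoc.state, f0, f1, f2, f3, f4, f5, hn]
    · refine key 5 (pairAct hadAmp (.ns (L.nm 2)) (.ns (L.nm 3))) (by omega) (by omega)
        (pairAct_smul _ _ _) ?_ (by rw [hn]; rfl) (by rw [hn]; rfl) ?_
      · funext f; simp [pairAct]
      · simp [SpecLoc.state, f0, f1, f2, f3, f4, f5, hn]
    · exact skip hn
  · change 5 ≤ L.k 3 at h5
    omega

theorem measure (h : SpecInv own₀ env₀ ψ α L S) (hψ : IsState (own₀ ∪ env₀.toFinset) ψ)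
    (hk : L.k 2 = 17) : SpecInv own₀ env₀ ψ α { L with w := S.width, k := incr L.k 2 }
      (S.measure (fun _ => true) 1 (obsQb [.qb L.q₂])) := by
  have ho := h.order
  obtain ⟨rec, hq, -⟩ := h.quant
  have hq' := hq.measure_bit hψ
    (fun x hx hx' => by interval_cases x <;> simp [flags, specThr] <;> omega)
    (by simp [flags, specThr]; omega)
  rw [← flags_incr (x := 6) (by decide) hk rfl] at hq'
  refine ⟨h.links.step (by rw [hk]; decide), h.bound₀, h.bound₁, ?_, h.bound₃, h.len, h.low, h.data,
    _, { hq' with }, fun h5 => ?_⟩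
  · show L.k 2 + 1 ≤ 19
    omega
  · change 5 ≤ L.k 3 at h5
    omega

theorem eval (h : SpecInv own₀ env₀ ψ α L S) (hψ : IsState (own₀ ∪ env₀.toFinset) ψ)
    (hk : 5 ≤ L.k 3) (hk' : L.k 3 ≤ 7) {S' : Store} {e' : Expr}
    (H : EStep (fun _ => true) S (L.expr (L.k 3)) S' e') :
    SpecInv own₀ env₀ ψ α { L with e := some e' } S' ∧
      { L with e := some e' }.rank < L.rank := by
  obtain ⟨rec, hq, hx⟩ := h.quant
  obtain ⟨rec', h1, h2, h3⟩ := hq.eStep hψ (h.flags_true hk) (hx hk hk') H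
  refine ⟨⟨h.links, h.bound₀, h.bound₁, h.bound₂, h.bound₃, h.len, fun h4 => ?_, fun q h4 => ?_,
    rec', { h1 with }, fun _ _ => h2⟩, ?_⟩
  · exact absurd h4 (by show ¬ L.k 3 ≤ 4; omega)
  · cases h4
    obtain ⟨v, g1, g2, -⟩ := SpecQuant.specExpr_vals h2
    cases g1
    cases g2
  · have : ({ L with e := some e' } : SpecLoc).expr (L.k 3) = e' := rfl
    rw [SpecLoc.rank, SpecLoc.rank, this]
    exact Nat.add_lt_add_left h3 _

end SpecInv

/-- The process of a store and the threads `T'`, where only thread `i` has changed. -/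
theorem Ctx.fill_update_eq {C : Ctx} {T T' : ℕ → ℕ → Proc} {k k' : ℕ → ℕ} {i : ℕ} {X : Proc}
    (hX : X = T' i (k' i)) (h : ∀ j ∈ C.holes, j ≠ i → T j (k j) = T' j (k' j)) :
    C.fill (Function.update (fun i => T i (k i)) i X) = C.run T' k' := by
  rw [hX]
  exact Ctx.fill_update_run h

namespace SpecLoc

theorem forall_holes {P : ℕ → Prop} (h0 : P 0) (h1 : P 1) (h2 : P 2) (h3 : P 3) :
    ∀ j ∈ specCtx.holes, P j := by
  intro j hj
  simp only [specCtx, Ctx.holes, List.mem_append, List.mem_singleton] at hj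
  obtain (rfl | rfl) | rfl | rfl := hj <;> assumption

end SpecLoc

namespace SpecInv

variable {own₀ : Finset QName} {env₀ : List QName} {ψ : State} {α : Hist} {L : SpecLoc} {S : Store}

theorem nodup (h : SpecInv own₀ env₀ ψ α L S) :
    [L.nm 0, L.nm 1, L.nm 2, L.nm 3].Nodup ∨ L.k 2 < 5 := by
  have ho := h.order
  obtain ⟨rec, hq, -⟩ := h.quant
  by_cases hk : L.k 2 < 5
  · exact .inr hk
  · exact .inl (hq.nodup (by simp [flags, specThr]; omega) (by simp [flags, specThr]; omega))

theorem tau (h : SpecInv own₀ env₀ ψ α L S) (hψ : IsState (own₀ ∪ env₀.toFinset) ψ) {p : Ports}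
    {S' : Store} {P' : Proc} (H : Tau S (L.proc p) S' P') :
    ∃ L', P' = SpecLoc.proc p L' ∧ SpecInv own₀ env₀ ψ α L' S' ∧ L'.rank < L.rank := by
  have ho := h.order
  have b0 := h.bound₀
  have b1 := h.bound₁
  have b2 := h.bound₂
  have b3 := h.bound₃
  rcases (h.wired p).tau_inv (by decide) H with ⟨i, X, hi, K, rfl⟩ | ⟨rfl, l, hl, -, -, h1, h2, rfl⟩
  · simp only [specCtx, Ctx.holes, List.mem_append, List.mem_singleton] at hi
    obtain (rfl | rfl) | rfl | rfl := hi
    · obtain ⟨hk, m, n, -, hm, hn, hmn, rfl, rfl⟩ := polTh_tau_iff.1 K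
      refine ⟨_, Ctx.fill_update_eq ?_ ?_, h.split_a hk hm hn hmn, ?_⟩
      · simp only [incr_same, hk]; rfl
      · refine SpecLoc.forall_holes (absurd rfl) (fun _ => rfl)
          (fun _ => opTh_congr (.inl (by omega)) (.inr ⟨rfl, rfl⟩) (.inr rfl) (.inr rfl))
          (fun _ => outputTh_congr (.inl (by omega)) (.inr rfl) (.inl (by omega)))
      · exact SpecLoc.rank_incr (by rw [hk]; decide) rfl rfl
    · obtain ⟨hk, m, n, -, hm, hn, hmn, rfl, rfl⟩ := polTh_tau_iff.1 K
      refine ⟨_, Ctx.fill_update_eq ?_ ?_, h.split_b hk hm hn hmn, ?_⟩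
      · simp only [incr_same, hk]; rfl
      · refine SpecLoc.forall_holes (fun _ => rfl) (absurd rfl)
          (fun _ => opTh_congr (.inr ⟨rfl, rfl⟩) (.inl (by omega)) (.inr rfl) (.inr rfl))
          (fun _ => outputTh_congr (.inr rfl) (.inl (by omega)) (.inl (by omega)))
      · exact SpecLoc.rank_incr (by rw [hk]; decide) rfl rfl
    · rcases (opTh_tau_iff h.nodup).1 K with ⟨hk, q', hq', rfl, rfl⟩ | ⟨hk, hk', rfl, rfl⟩ |
        ⟨hk, rfl, rfl⟩
      · refine ⟨_, Ctx.fill_update_eq ?_ ?_, h.create hψ hk hq', ?_⟩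
        · simp only [incr_same, hk]; rfl
        · exact SpecLoc.forall_holes (fun _ => rfl) (fun _ => rfl) (absurd rfl) (fun _ => rfl)
        · exact SpecLoc.rank_incr (by rw [hk]; decide) rfl rfl
      · refine ⟨_, Ctx.fill_update_eq ?_ ?_, h.gate hk hk', ?_⟩
        · simp only [incr_same]; rfl
        · exact SpecLoc.forall_holes (fun _ => rfl) (fun _ => rfl) (absurd rfl) (fun _ => rfl)
        · exact SpecLoc.rank_incr (i := 2) (hk'.trans_lt (by decide)) rfl rfl
      · refine ⟨_, Ctx.fill_update_eq ?_ ?_, h.measure hψ hk, ?_⟩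
        · simp only [incr_same, hk]; rfl
        · exact SpecLoc.forall_holes (fun _ => rfl) (fun _ => rfl) (absurd rfl)
            (fun _ => outputTh_congr (.inr rfl) (.inr rfl) (.inl (by omega)))
        · exact SpecLoc.rank_incr (by rw [hk]; decide) rfl rfl
    · obtain ⟨hk, hk', e', He, rfl⟩ := outputTh_tau_iff.1 K
      obtain ⟨h1, h2⟩ := h.eval hψ hk hk' He
      refine ⟨_, Ctx.fill_update_eq rfl ?_, h1, h2⟩
      exact SpecLoc.forall_holes (fun _ => rfl) (fun _ => rfl) (fun _ => rfl) (absurd rfl)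
  · obtain ⟨g1, g2⟩ := h.communicate hl h1 h2
    exact ⟨_, rfl, g1, g2⟩

theorem progress (h : SpecInv own₀ env₀ ψ α L S) (p : Ports) (ha : α.qa.isSome = true)
    (hb : α.qb.isSome = true) (hlt : α.outs.length < 3) :
    (∃ S' P', Tau S (L.proc p) S' P') ∨
      5 ≤ L.k 3 ∧ L.k 3 ≤ 7 ∧ ∃ v, L.expr (L.k 3) = .vals [v] := by
  have ho := h.order
  have hlen := h.len
  have b3 := h.bound₃
  have b2 := h.bound₂
  have b0 := h.bound₀
  have b1 := h.bound₁
  obtain ⟨rec, hq, hx⟩ := h.quant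
  have k0 : 1 ≤ L.k 0 := by
    rw [hq.qa_eq] at ha
    by_contra hc
    have : flags specThr L.k 8 = false := by simp [flags, specThr]; omega
    simp [this] at ha
  have k1 : 1 ≤ L.k 1 := by
    rw [hq.qb_eq] at hb
    by_contra hc
    have : flags specThr L.k 9 = false := by simp [flags, specThr]; omega
    simp [this] at hb
  have hC := (h.wired p).holes
  have com : ∀ l ∈ specLinks, L.k l.2.1 = l.2.2.1 → L.k l.2.2.2.1 = l.2.2.2.2 →
      ∃ S' P', Tau S (L.proc p) S' P' := fun l hl h1 h2 =>
    ⟨S, (h.wired p).tau_com hl ((by decide : ∀ l ∈ specLinks, l.2.1 ∈ specCtx.holes) l hl)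
      ((by decide : ∀ l ∈ specLinks, l.2.2.2.1 ∈ specCtx.holes) l hl) h1 h2⟩
  have loc : ∀ i ∈ specCtx.holes, ∀ S' X, Tau S (L.thread p i (L.k i)) S' X →
      ∃ S' P', Tau S (L.proc p) S' P' := fun i hi S' X H =>
    ⟨S', _, Ctx.tau_fill (f := fun i => L.thread p i (L.k i)) hC hi H⟩
  obtain ⟨N, hN⟩ := S.exists_fresh
  have hqa : α.qa = some L.qa := by
    rw [hq.qa_eq, show flags specThr L.k 8 = true by simp [flags, specThr]; omega]; rfl
  have hqb : α.qb = some L.qb := by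
    rw [hq.qb_eq, show flags specThr L.k 9 = true by simp [flags, specThr]; omega]; rfl
  by_cases c0 : L.k 0 = 1
  · exact .inl (loc 0 (by decide) _ _ (polTh_tau_iff.2 ⟨c0, N, N + 1,
      hq.names.own_a _ hqa (by simp [flags, specThr]; omega), (hN _ (by omega)).2,
      (hN _ (by omega)).2, by omega, rfl, rfl⟩))
  by_cases c1 : L.k 1 = 1
  · exact .inl (loc 1 (by decide) _ _ (polTh_tau_iff.2 ⟨c1, N, N + 1,
      hq.names.own_b _ hqb (by simp [flags, specThr]; omega), (hN _ (by omega)).2,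
      (hN _ (by omega)).2, by omega, rfl, rfl⟩))
  by_cases c2 : L.k 2 = 0
  · exact .inl (loc 2 (by decide) _ _ ((opTh_tau_iff h.nodup).2
      (.inl ⟨c2, N, (hN _ le_rfl).1, rfl, rfl⟩)))
  by_cases c3 : 5 ≤ L.k 2 ∧ L.k 2 ≤ 12
  · exact .inl (loc 2 (by decide) _ _ ((opTh_tau_iff h.nodup).2
      (.inr (.inl ⟨c3.1, c3.2, rfl, rfl⟩))))
  by_cases c4 : L.k 2 = 17
  · exact .inl (loc 2 (by decide) _ _ ((opTh_tau_iff h.nodup).2 (.inr (.inr ⟨c4, rfl, rfl⟩))))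
  by_cases c5 : 5 ≤ L.k 3
  · rcases SpecQuant.specExpr_progress (hx c5 (by omega)) with ⟨v, hv⟩ | hv
    · exact .inr ⟨c5, by omega, v, hv⟩
    · obtain ⟨S', e', He⟩ := hv S
      exact .inl (loc 3 (by decide) _ _ (outputTh_tau_iff.2 ⟨c5, by omega, e', He, rfl⟩))
  left
  obtain c | c | c | c | c | c | c | c | c : L.k 2 = 1 ∨ L.k 2 = 2 ∨ L.k 2 = 3 ∨ L.k 2 = 4 ∨
    L.k 2 = 13 ∨ L.k 2 = 14 ∨ L.k 2 = 15 ∨ L.k 2 = 16 ∨ L.k 2 = 18 := by omega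
  · exact com (0, 0, 2, 2, 1) (by decide) (by simp only; omega) c
  · exact com (1, 0, 3, 2, 2) (by decide) (by simp only; omega) c
  · exact com (2, 1, 2, 2, 3) (by decide) (by simp only; omega) c
  · exact com (3, 1, 3, 2, 4) (by decide) (by simp only; omega) c
  · exact com (5, 2, 13, 3, 0) (by decide) c (by simp only; omega)
  · exact com (6, 2, 14, 3, 1) (by decide) c (by simp only; omega)
  · exact com (7, 2, 15, 3, 2) (by decide) c (by simp only; omega)
  · exact com (8, 2, 16, 3, 3) (by decide) c (by simp only; omega)
  · exact com (4, 2, 18, 3, 4) (by decide) c (by simp only; omega)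

end SpecInv

/-- The configurations that the specification reaches with a history. -/
def SpecGood (p : Ports) (own₀ : Finset QName) (env₀ : List QName) (ψ : State) (t : Config)
    (α : Hist) : Prop :=
  ∃ L S, t = .mix S (SpecLoc.proc p L) ∧ SpecInv own₀ env₀ ψ α L S

namespace SpecInv

variable {own₀ : Finset QName} {env₀ : List QName} {ψ : State} {α : Hist} {L : SpecLoc} {S : Store}

theorem qa_eq_none_iff (h : SpecInv own₀ env₀ ψ α L S) : α.qa = none ↔ L.k 0 = 0 := by
  obtain ⟨rec, hq, -⟩ := h.quant
  rw [hq.qa_eq, show flags specThr L.k 8 = decide (1 ≤ L.k 0) from rfl]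
  simp

theorem qb_eq_none_iff (h : SpecInv own₀ env₀ ψ α L S) : α.qb = none ↔ L.k 1 = 0 := by
  obtain ⟨rec, hq, -⟩ := h.quant
  rw [hq.qb_eq, show flags specThr L.k 9 = decide (1 ≤ L.k 1) from rfl]
  simp

theorem env_eq (h : SpecInv own₀ env₀ ψ α L S) : S.env = α.env env₀ := by
  obtain ⟨rec, hq, -⟩ := h.quant
  exact hq.names.env_eq

theorem receive_a (h : SpecInv own₀ env₀ ψ α L S) (hk : L.k 0 = 0) {n : ℕ} (hn : .qb n ∈ S.env) :
    SpecInv own₀ env₀ ψ { α with qa := some n } { L with qa := n, k := incr L.k 0 }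
      (S.receive [.qb n]) := by
  obtain ⟨rec, hq, hx⟩ := h.quant
  refine ⟨h.links.step (by rw [hk]; decide), ?_, h.bound₁, h.bound₂, h.bound₃, h.len, h.low, h.data,
    rec, ?_, hx⟩
  · show L.k 0 + 1 ≤ 4
    omega
  · rw [flags_incr (x := 8) (by decide) hk rfl]
    exact { hq.receive_a (by simp [flags, specThr]; omega) (by simp [flags, specThr]; omega) hn with }

theorem receive_b (h : SpecInv own₀ env₀ ψ α L S) (hk : L.k 1 = 0) {n : ℕ} (hn : .qb n ∈ S.env) :
    SpecInv own₀ env₀ ψ { α with qb := some n } { L with qb := n, k := incr L.k 1 }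
      (S.receive [.qb n]) := by
  obtain ⟨rec, hq, hx⟩ := h.quant
  refine ⟨h.links.step (by rw [hk]; decide), h.bound₀, ?_, h.bound₂, h.bound₃, h.len, h.low, h.data,
    rec, ?_, hx⟩
  · show L.k 1 + 1 ≤ 4
    omega
  · rw [flags_incr (x := 9) (by decide) hk rfl]
    exact { hq.receive_b (by simp [flags, specThr]; omega) (by simp [flags, specThr]; omega) hn with }

theorem fill_receive_a (p : Ports) (hk : L.k 0 = 0) (n : ℕ) :
    specCtx.fill (Function.update (fun i => L.thread p i (L.k i)) 0
      (polTh (.pub p.a) ch.c ch.d n (L.nm 0) (L.nm 1) 1)) =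
      SpecLoc.proc p { L with qa := n, k := incr L.k 0 } := by
  refine Ctx.fill_update_eq ?_
    (SpecLoc.forall_holes (absurd rfl) (fun _ => rfl) (fun _ => rfl) (fun _ => rfl))
  simp only [incr_same, hk]
  rfl

theorem fill_receive_b (p : Ports) (hk : L.k 1 = 0) (n : ℕ) :
    specCtx.fill (Function.update (fun i => L.thread p i (L.k i)) 1
      (polTh (.pub p.b) ch.e ch.f n (L.nm 2) (L.nm 3) 1)) =
      SpecLoc.proc p { L with qb := n, k := incr L.k 1 } := by
  refine Ctx.fill_update_eq ?_
    (SpecLoc.forall_holes (fun _ => rfl) (absurd rfl) (fun _ => rfl) (fun _ => rfl))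
  simp only [incr_same, hk]
  rfl

theorem output (h : SpecInv own₀ env₀ ψ α L S) (hψ : IsState (own₀ ∪ env₀.toFinset) ψ)
    (hk : 5 ≤ L.k 3) (hk' : L.k 3 ≤ 7) {vs : List Val} (he : L.expr (L.k 3) = .vals vs) :
    S.outProb vs = α.nextProb ψ ∧ ∀ w, 0 < α.nextProb ψ w →
      (S.outBranch vs w).rhoE = α.nextRho env₀ ψ w ∧
      SpecInv own₀ env₀ ψ (α.next ψ w) { L with e := none, k := incr L.k 3 }
        (S.outBranch vs w) := by
  have ho := h.order
  have hlen := h.len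
  obtain ⟨rec, hq, hx⟩ := h.quant
  have hx := hx hk hk'
  rw [he, ← hlen] at hx
  obtain ⟨v, rfl, hv, hval⟩ := SpecQuant.specExpr_vals hx
  obtain ⟨g1, g2⟩ := hq.out hψ (h.flags_true hk) (by omega) hv hval
  refine ⟨g1, fun w hw => ⟨(g2 w hw).1, ?_⟩⟩
  have hq' := (g2 w hw).2
  refine ⟨h.links.step ?_, h.bound₀, h.bound₁, h.bound₂, ?_, ?_, fun _ => rfl, by simp, rec, ?_,
    fun h5 h7 => ?_⟩
  · have : ∀ n, 5 ≤ n → n ≤ 7 → ∀ l ∈ specLinks,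
        (l.2.1 = 3 → l.2.2.1 ≠ n) ∧ (l.2.2.2.1 = 3 → l.2.2.2.2 ≠ n) := by
      intro n h1 h2
      interval_cases n <;> decide
    exact this _ hk hk'
  · show L.k 3 + 1 ≤ 8
    omega
  · show (α.outs ++ [w]).length = L.k 3 + 1 - 5
    rw [List.length_append, hlen, List.length_singleton]
    omega
  · rw [flags_incr_of_notMem rfl ?_]
    · exact { hq' with }
    · intro hc
      simp [specThr] at hc
  · have := hq'.specExpr_result (j := L.k 3 + 1 - 5) (h.flags_true hk 6 (by omega)) (by
      change L.k 3 + 1 ≤ 7 at h7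
      omega)
    exact this

end SpecInv

theorem vis_pub_specCtx {i : ℕ} (hi : i ∈ specCtx.holes) (n : ℕ) :
    specCtx.vis i (.pub n) = true := by
  exact SpecLoc.forall_holes (P := fun i => specCtx.vis i (.pub n) = true) (by simp [specCtx, Ctx.vis])
    (by simp [specCtx, Ctx.vis]) (by simp [specCtx, Ctx.vis]) (by simp [specCtx, Ctx.vis]) i hi

theorem spec_behaves (p : Ports) {own₀ : Finset QName} {env₀ : List QName} {ψ : State}
    (hψ : IsState (own₀ ∪ env₀.toFinset) ψ) :
    Behaves env₀ ψ p.a p.b p.result (SpecGood p own₀ env₀ ψ) where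
  mix := by
    rintro t α ⟨L, S, rfl, -⟩
    exact ⟨_, _, rfl⟩
  tau := by
    rintro t α t' ⟨L, S, rfl, h⟩ H
    cases H with
    | tau H =>
      obtain ⟨L', rfl, h', -⟩ := h.tau hψ H
      exact ⟨L', _, rfl, h'⟩
  inp := by
    rintro t α c vs t' ⟨L, S, rfl, h⟩ H
    cases H with
    | inp H h1 h2 h3 =>
      obtain ⟨i, X, q, hi, hc, K, rfl⟩ := (h.wired p).pIn_inv H
      simp only [specCtx, Ctx.holes, List.mem_append, List.mem_singleton] at hi
      obtain (rfl | rfl) | rfl | rfl := hi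
      · obtain ⟨hk, rfl, n, rfl, rfl⟩ := polTh_in_iff.1 K
        have hn : .qb n ∈ S.env := h3 _ (by simp [namesOf])
        refine ⟨n, rfl, h.env_eq ▸ hn, .inl ⟨rfl, h.qa_eq_none_iff.2 hk, _, _, ?_,
          h.receive_a hk hn⟩⟩
        rw [SpecInv.fill_receive_a p hk]
        rfl
      · obtain ⟨hk, rfl, n, rfl, rfl⟩ := polTh_in_iff.1 K
        have hn : .qb n ∈ S.env := h3 _ (by simp [namesOf])
        refine ⟨n, rfl, h.env_eq ▸ hn, .inr ⟨rfl, h.qb_eq_none_iff.2 hk, _, _, ?_,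
          h.receive_b hk hn⟩⟩
        rw [SpecInv.fill_receive_b p hk]
        rfl
      · subst hc
        rcases opTh_in K with ⟨-, h, -⟩ | ⟨-, h, -⟩ | ⟨-, h, -⟩ | ⟨-, h, -⟩ <;> cases h
      · subst hc
        rcases outputTh_in (m₀ := 0) (m₂ := 0) K with ⟨-, h, -⟩ | ⟨-, h, -⟩ | ⟨-, h, -⟩ | ⟨-, h, -⟩ | ⟨-, h, -⟩ <;>
          cases h
  receive_a := by
    rintro t α n ⟨L, S, rfl, h⟩ h1 h2
    have hk := h.qa_eq_none_iff.1 h1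
    have hn : .qb n ∈ S.env := by rw [h.env_eq]; exact h2
    refine ⟨_, .inp (Ctx.pIn_fill (h.wired p).holes (vis_pub_specCtx (by decide) _)
      (f := fun i => L.thread p i (L.k i)) (i := 0) (polTh_in_iff.2 ⟨hk, rfl, n, rfl, rfl⟩))
      (by simp [Val.IsClosed]) (by simp [namesOf]) (by simpa [namesOf] using hn),
      _, _, ?_, h.receive_a hk hn⟩
    rw [SpecInv.fill_receive_a p hk]
    rfl
  receive_b := by
    rintro t α n ⟨L, S, rfl, h⟩ h1 h2
    have hk := h.qb_eq_none_iff.1 h1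
    have hn : .qb n ∈ S.env := by rw [h.env_eq]; exact h2
    refine ⟨_, .inp (Ctx.pIn_fill (h.wired p).holes (vis_pub_specCtx (by decide) _)
      (f := fun i => L.thread p i (L.k i)) (i := 1) (polTh_in_iff.2 ⟨hk, rfl, n, rfl, rfl⟩))
      (by simp [Val.IsClosed]) (by simp [namesOf]) (by simpa [namesOf] using hn),
      _, _, ?_, h.receive_b hk hn⟩
    rw [SpecInv.fill_receive_b p hk]
    rfl
  out := by
    rintro t α c V X q S' P' ⟨L, S, rfl, h⟩ H
    cases H with
    | out H h1 h2 =>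
      obtain ⟨i, X, q, hi, hc, K, rfl⟩ := (h.wired p).pOut_inv H
      subst hc
      simp only [specCtx, Ctx.holes, List.mem_append, List.mem_singleton] at hi
      obtain (rfl | rfl) | rfl | rfl := hi
      · rcases polTh_out_iff.1 K with ⟨-, h, -⟩ | ⟨-, h, -⟩ <;> cases h
      · rcases polTh_out_iff.1 K with ⟨-, h, -⟩ | ⟨-, h, -⟩ <;> cases h
      · rcases opTh_out_iff.1 K with ⟨-, h, -⟩ | ⟨-, h, -⟩ | ⟨-, h, -⟩ | ⟨-, h, -⟩ | ⟨-, h, -⟩ <;>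
          cases h
      · obtain ⟨hk, hk', hc, he, rfl⟩ := outputTh_out_iff.1 K
        obtain ⟨g1, g2⟩ := h.output hψ hk hk' he
        have ho := h.order
        have hlen := h.len
        refine ⟨?_, ?_, by omega, ?_, g1, by rw [g1], fun w hw => ?_⟩
        · rw [Option.isSome_iff_ne_none, ne_eq, h.qa_eq_none_iff]
          omega
        · rw [Option.isSome_iff_ne_none, ne_eq, h.qb_eq_none_iff]
          omega
        · rw [hc, hlen]; rfl
        · rw [g1] at hw
          refine ⟨(g2 w hw).1, _, _, ?_, (g2 w hw).2⟩
          congr 1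
  send := by
    rintro t α ⟨L, S, rfl, h⟩ ha hb hlt
    induction hr : L.rank using Nat.strong_induction_on generalizing L S with
    | _ r ih =>
      rcases h.progress p ha hb hlt with ⟨S', P', H⟩ | ⟨hk, hk', v, hv⟩
      · obtain ⟨L', rfl, h', hlt'⟩ := h.tau hψ H
        obtain ⟨t', c, V, X, q, S'', P'', hw, H'⟩ := ih L'.rank (hr ▸ hlt') L' S' h' rfl
        exact ⟨t', c, V, X, q, S'', P'', .head (.tau H) hw, H'⟩
      · obtain ⟨rec, hq, hx⟩ := h.quant
        have hx := hx hk hk'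
        rw [hv] at hx
        obtain ⟨v', hv', hc, -⟩ := SpecQuant.specExpr_vals hx
        obtain rfl : v = v' := by simpa using hv'
        refine ⟨_, _, _, _, _, _, _, .refl, .out (Ctx.pOut_fill (h.wired p).holes
          (f := fun i => L.thread p i (L.k i)) (i := 3) (c := p.result (L.k 3 - 5)) ?_
          (outputTh_out_iff.2 ⟨hk, hk', rfl, hv, rfl⟩)) ?_ ?_⟩
        · obtain c | c | c : L.k 3 - 5 = 0 ∨ L.k 3 - 5 = 1 ∨ L.k 3 - 5 = 2 := by omega
          all_goals rw [c]; exact vis_pub_specCtx (by decide) _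
        · rw [classical_namesOf hc]; exact List.nodup_nil
        · rw [classical_namesOf hc]; simp

theorem spec_initial (a b o₁ c o₂ : ℕ) (own₀ : Finset QName) (env₀ : List QName) (ψ : State)
    (κ : ℕ → ℕ) (θ : ℕ → Val) :
    SpecGood ⟨κ a, κ b, κ o₁, κ c, κ o₂⟩ own₀ env₀ ψ (.mix (.pure own₀ env₀ ψ)
      (((Specification₁ (.pub a) (.pub b) (.pub o₁) (.pub c) (.pub o₂)).rename κ).subst θ))
      ⟨none, none, [], 1⟩ := by
  refine ⟨⟨fun _ => 0, 0, 0, 0, 0, none, fun _ => 0⟩, .pure own₀ env₀ ψ, ?_, ?_⟩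
  · rfl
  · refine ⟨by simp [Links, specLinks], by simp, by simp, by simp, by simp, rfl, fun _ => rfl, by simp,
      fun _ => [], ?_, by simp⟩
    show SpecQuant _ _ _ _ _ (flags specThr fun _ => 0) _ _
    rw [flags_zero (by decide)]
    exact {
      names := Names.pure own₀ env₀ ψ _ (by simp [SpecLoc.Created])
      qa_eq := rfl
      qb_eq := rfl
      ancilla := by simp
      pos := one_pos
      prob_nil := fun _ => rfl
      rep := by
        rw [observed_of_nil rfl rfl]
        exact Store.rep_pure _ _ _
      normed := by simp
      rec_congr := fun _ _ _ => rfl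
      slot := by simp }

/-! ### The quantum states of the model -/

/-- Names, slots, the current expression and program counters of the model. The photon numbers of the
control and the target are in the slots from `w 0` and `w 1` on. -/
structure ModelLoc where
  nm : ℕ → ℕ
  qa : ℕ
  qb : ℕ
  w : ℕ → ℕ
  e : Option Expr
  k : ℕ → ℕ

/-- The events in a run of the model: the two polarisation qubits are split (`0`, `1`), the photons pass
the five beam splitters (`2` to `6`), the photons of the control and of the target are counted (`7`,
`8`), the two vacuum modes are created (`9`, `10`), and the polarisation qubits are received (`11`,
`12`). -/
def modelThr : List (ℕ × ℕ) :=
  [(0, 2), (1, 2), (2, 3), (4, 3), (6, 3), (8, 3), (10, 3), (11, 3), (12, 3), (14, 1), (14, 2), (0, 1),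
    (1, 1)]

/-- The modes that are the output of an optical element. -/
def opticalPair (x : ℕ) : ℕ × ℕ :=
  [(0, 1), (2, 3), (2, 3), (0, 4), (2, 1), (3, 5), (2, 3)].getD x (0, 1)

/-- The reflectivities of the beam splitters. -/
noncomputable def reflectivity : ℕ → ℝ
  | 2 => 1 / 2
  | 6 => 1 / 2
  | _ => 1 / 3

/-- Two optical elements with different output modes. -/
def Apart (x y : ℕ) : Prop :=
  (opticalPair x).1 ≠ (opticalPair y).1 ∧ (opticalPair x).1 ≠ (opticalPair y).2 ∧
    (opticalPair x).2 ≠ (opticalPair y).1 ∧ (opticalPair x).2 ≠ (opticalPair y).2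

instance (x y : ℕ) : Decidable (Apart x y) := inferInstanceAs (Decidable (_ ∧ _))

namespace ModelLoc

/-- The optical elements. -/
noncomputable def op (L : ModelLoc) : ℕ → State → State
  | 0 => psAct (.qb L.qa) (.ns (L.nm 0)) (.ns (L.nm 1))
  | 1 => psAct (.qb L.qb) (.ns (L.nm 2)) (.ns (L.nm 3))
  | x => pairAct (bsAmp (reflectivity x)) (.ns (L.nm (opticalPair x).1))
    (.ns (L.nm (opticalPair x).2))

/-- The global state after the events `b`, as far as the first optical elements are concerned. -/
noncomputable def state (L : ModelLoc) (b : ℕ → Bool) (ψ : State) : ℕ → State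
  | 0 => ψ
  | n + 1 => opt (b n) (L.op n) (L.state b ψ n)

/-- The numbers that are sent. -/
def outcome (L : ModelLoc) : Basis → ℤ × ℤ × ℤ :=
  networkOutcome (.ns (L.nm 0)) (.ns (L.nm 1)) (.ns (L.nm 2)) (.ns (L.nm 3))

/-- The modes created after the events `b`. -/
def Created (b : ℕ → Bool) (i : ℕ) : Prop :=
  (i < 2 ∧ b 0 = true) ∨ (2 ≤ i ∧ i < 4 ∧ b 1 = true) ∨ (i = 4 ∧ b 9 = true) ∨ (i = 5 ∧ b 10 = true)

/-- The optical elements in use only act on modes which have been created. -/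
def Sound (b : ℕ → Bool) : Prop := ∀ x < 7, b x = true →
  Created b (opticalPair x).1 ∧ Created b (opticalPair x).2

theorem op_smul (L : ModelLoc) (x : ℕ) (c : ℂ) (φ : State) :
    L.op x (fun f => c * φ f) = fun f => c * L.op x φ f := by
  match x with
  | 0 => exact psAct_smul _ _ _ _ _
  | 1 => exact psAct_smul _ _ _ _ _
  | _ + 2 => exact pairAct_smul _ _ _ _ _

theorem op_zero (L : ModelLoc) (x : ℕ) : L.op x (fun _ => 0) = fun _ => 0 := by
  simpa using L.op_smul x 0 fun _ => 0

theorem op_congr {L L' : ModelLoc} {x : ℕ} (ha : L.qa = L'.qa ∨ x ≠ 0) (hb : L.qb = L'.qb ∨ x ≠ 1)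
    (h1 : L.nm (opticalPair x).1 = L'.nm (opticalPair x).1)
    (h2 : L.nm (opticalPair x).2 = L'.nm (opticalPair x).2) : L.op x = L'.op x := by
  match x with
  | 0 =>
    change L.nm 0 = L'.nm 0 at h1
    change L.nm 1 = L'.nm 1 at h2
    simp only [op, ha.resolve_right (absurd rfl), h1, h2]
  | 1 =>
    change L.nm 2 = L'.nm 2 at h1
    change L.nm 3 = L'.nm 3 at h2
    simp only [op, hb.resolve_right (absurd rfl), h1, h2]
  | _ + 2 => simp only [op, h1, h2]

theorem op_comm {L : ModelLoc} {x y : ℕ} (hxy : x < y) (hq : y = 1 → L.qa ≠ L.qb)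
    (h1 : L.nm (opticalPair x).1 ≠ L.nm (opticalPair y).1)
    (h2 : L.nm (opticalPair x).1 ≠ L.nm (opticalPair y).2)
    (h3 : L.nm (opticalPair x).2 ≠ L.nm (opticalPair y).1)
    (h4 : L.nm (opticalPair x).2 ≠ L.nm (opticalPair y).2) (φ : State) :
    L.op x (L.op y φ) = L.op y (L.op x φ) := by
  have e : ∀ {m n : ℕ}, m ≠ n → QName.ns m ≠ .ns n := fun h h' => h (by simpa using h')
  match x, y with
  | 0, 1 =>
    exact psAct_comm (fun h => hq rfl (by simpa using h)) (by simp) (by simp) (by simp) (e h1) (e h2)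
      (by simp) (e h3) (e h4) φ
  | 0, _ + 2 => exact psAct_pairAct _ (e h1) (e h2) (e h3) (e h4) (by simp) (by simp) φ
  | 1, _ + 2 => exact psAct_pairAct _ (e h1) (e h2) (e h3) (e h4) (by simp) (by simp) φ
  | _ + 2, _ + 2 => exact pairAct_comm _ _ (e h1) (e h2) (e h3) (e h4) φ

theorem state_congr {L L' : ModelLoc} {b b' : ℕ → Bool} {ψ : State} {n : ℕ}
    (hb : ∀ y < n, b y = b' y) (h : ∀ y < n, b y = true → L.op y = L'.op y) :
    L.state b ψ n = L'.state b' ψ n := by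
  induction n with
  | zero => rfl
  | succ n ih =>
    rw [state, state, ih (fun y hy => hb y (by omega)) (fun y hy => h y (by omega)),
      ← hb n (by omega)]
    cases hn : b n
    · rfl
    · rw [h n (by omega) hn]

theorem state_update {L : ModelLoc} {b : ℕ → Bool} {ψ : State} {x n : ℕ} (hx : x < n)
    (hb : b x = false)
    (h : ∀ y < n, x < y → b y = true → ∀ φ, L.op x (L.op y φ) = L.op y (L.op x φ)) :
    L.state (Function.update b x true) ψ n = L.op x (L.state b ψ n) := by
  induction n with
  | zero => omega
  | succ n ih =>
    rw [state, state]
    by_cases hxn : x = n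
    · subst hxn
      rw [Function.update_self, hb, opt_true, opt_false]
      congr 1
      exact state_congr (fun y hy => Function.update_of_ne (by omega) _ _) fun _ _ _ => rfl
    · rw [Function.update_of_ne (by omega), ih (by omega) fun y hy => h y (by omega)]
      cases hn : b n
      · rfl
      · exact (h n (by omega) (by omega) hn _).symm

end ModelLoc

/-- The configuration after the events `b`. -/
structure ModelQuant (own₀ : Finset QName) (env₀ : List QName) (ψ : State) (α : Hist) (L : ModelLoc)
    (b : ℕ → Bool) (S : Store) (rec : Basis → List ℤ) : Prop where
  names : Names own₀ env₀ α.qa α.qb (b 0) (b 1) L.nm (ModelLoc.Created b) S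
  qa_eq : α.qa = if b 11 then some L.qa else none
  qb_eq : α.qb = if b 12 then some L.qb else none
  pos : 0 < α.prob
  prob_nil : α.outs = [] → α.prob = 1
  rep : S.Rep (observed α.outs α.prob L.outcome (L.state b ψ 7)) rec
  normed : b 7 = true → b 8 = true →
    S.Normed (observed α.outs α.prob L.outcome (L.state b ψ 7)) rec
  rec_congr : ∀ f f' : Basis, (∀ s < 2, b (7 + s) = true →
    f (.ns (L.nm (2 * s))) = f' (.ns (L.nm (2 * s))) ∧
    f (.ns (L.nm (2 * s + 1))) = f' (.ns (L.nm (2 * s + 1)))) → rec f = rec f'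
  slot : ∀ s < 2, b (7 + s) = true → L.w s + 1 < S.width ∧ ∀ f,
    (rec f).getD (L.w s) 0 = (f (.ns (L.nm (2 * s))) : ℤ) ∧
    (rec f).getD (L.w s + 1) 0 = (f (.ns (L.nm (2 * s + 1))) : ℤ)

namespace ModelQuant

variable {own₀ : Finset QName} {env₀ : List QName} {ψ : State} {α : Hist} {L : ModelLoc}
  {b : ℕ → Bool} {S : Store} {rec : Basis → List ℤ}

theorem receive_a (h : ModelQuant own₀ env₀ ψ α L b S rec) (h0 : b 0 = false) (h11 : b 11 = false)
    {n : ℕ} (hn : .qb n ∈ S.env) :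
    ModelQuant own₀ env₀ ψ { α with qa := some n } { L with qa := n } (Function.update b 11 true)
      (S.receive [.qb n]) rec := by
  have e : L.state b ψ 7 =
      ({ L with qa := n } : ModelLoc).state (Function.update b 11 true) ψ 7 :=
    ModelLoc.state_congr (fun y hy => (Function.update_of_ne (by omega) _ _).symm) fun y hy hby =>
      ModelLoc.op_congr (.inr (by rintro rfl; simp [h0] at hby)) (.inl rfl) rfl rfl
  exact {
    names := h.names.receive (by rw [h.qa_eq, h11]; rfl) h0 hn
    qa_eq := rfl
    qb_eq := h.qb_eq
    pos := h.pos
    prob_nil := h.prob_nil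
    rep := by rw [← e]; exact h.rep.congr rfl rfl rfl
    normed := by rw [← e]; exact h.normed
    rec_congr := fun f f' hf => h.rec_congr f f' fun s hs hb => hf s hs (by
      rwa [Function.update_of_ne (by omega)])
    slot := fun s hs hb => h.slot s hs (by rwa [Function.update_of_ne (by omega)] at hb) }

theorem receive_b (h : ModelQuant own₀ env₀ ψ α L b S rec) (h1 : b 1 = false) (h12 : b 12 = false)
    {n : ℕ} (hn : .qb n ∈ S.env) :
    ModelQuant own₀ env₀ ψ { α with qb := some n } { L with qb := n } (Function.update b 12 true)
      (S.receive [.qb n]) rec := by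
  have e : L.state b ψ 7 =
      ({ L with qb := n } : ModelLoc).state (Function.update b 12 true) ψ 7 :=
    ModelLoc.state_congr (fun y hy => (Function.update_of_ne (by omega) _ _).symm) fun y hy hby =>
      ModelLoc.op_congr (.inl rfl) (.inr (by rintro rfl; simp [h1] at hby)) rfl rfl
  exact {
    names := (h.names.swap.receive (by rw [h.qb_eq, h12]; rfl) h1 hn).swap
    qa_eq := h.qa_eq
    qb_eq := rfl
    pos := h.pos
    prob_nil := h.prob_nil
    rep := by rw [← e]; exact h.rep.congr rfl rfl rfl
    normed := by rw [← e]; exact h.normed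
    rec_congr := fun f f' hf => h.rec_congr f f' fun s hs hb => hf s hs (by
      rwa [Function.update_of_ne (by omega)])
    slot := fun s hs hb => h.slot s hs (by rwa [Function.update_of_ne (by omega)] at hb) }

theorem with_counters (h : ModelQuant own₀ env₀ ψ α L b S rec) (e : Option Expr) (k : ℕ → ℕ) :
    ModelQuant own₀ env₀ ψ α { L with e := e, k := k } b S rec := by
  have hs : ({ L with e := e, k := k } : ModelLoc).state b ψ 7 = L.state b ψ 7 :=
    ModelLoc.state_congr (fun _ _ => rfl) fun _ _ _ =>
      ModelLoc.op_congr (.inl rfl) (.inl rfl) rfl rfl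
  exact { h with
    rep := by rw [hs]; exact h.rep
    normed := by rw [hs]; exact h.normed }

theorem rec_const (h : ModelQuant own₀ env₀ ψ α L b S rec) (h7 : b 7 = false) (h8 : b 8 = false)
    (f f' : Basis) : rec f = rec f' := h.rec_congr f f' fun s hs hb => by
  interval_cases s
  · simp [h7] at hb
  · simp [h8] at hb

/-- A mode in the vacuum state is created. -/
theorem create (h : ModelQuant own₀ env₀ ψ α L b S rec) {i n : ℕ} (hi : 4 ≤ i) (hi' : i ≤ 5)
    (hb : b (5 + i) = false)
    (hx : ∀ x < 7, b x = true → (opticalPair x).1 ≠ i ∧ (opticalPair x).2 ≠ i)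
    (hn : S.Fresh (.ns n)) :
    ModelQuant own₀ env₀ ψ α { L with nm := Function.update L.nm i n }
      (Function.update b (5 + i) true) { S with own := insert (.ns n) S.own } rec := by
  have e : L.state b ψ 7 = ({ L with nm := Function.update L.nm i n } : ModelLoc).state
      (Function.update b (5 + i) true) ψ 7 :=
    ModelLoc.state_congr (fun y hy => (Function.update_of_ne (by omega) _ _).symm) fun y hy hby =>
      ModelLoc.op_congr (.inl rfl) (.inl rfl) (Function.update_of_ne (hx y hy hby).1 _ _).symm
        (Function.update_of_ne (hx y hy hby).2 _ _).symm
  have g : ∀ j < 4, Function.update L.nm i n j = L.nm j := fun j hj =>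
    Function.update_of_ne (by omega) _ _
  have e2 : ({ L with nm := Function.update L.nm i n } : ModelLoc).outcome = L.outcome := by
    simp only [ModelLoc.outcome, g 0 (by omega), g 1 (by omega), g 2 (by omega), g 3 (by omega)]
  have u : ∀ y, y ≠ 5 + i → Function.update b (5 + i) true y = b y := fun y hy =>
    Function.update_of_ne hy _ _
  have hN := h.names.alloc (i := i) hn (by
      simp only [ModelLoc.Created]
      obtain rfl | rfl : i = 4 ∨ i = 5 := by omega
      · simp [show b 9 = false from hb]
      · simp [show b 10 = false from hb])
    (As' := ModelLoc.Created (Function.update b (5 + i) true))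
    (by
      intro j
      simp only [ModelLoc.Created, u 0 (by omega), u 1 (by omega)]
      obtain rfl | rfl : i = 4 ∨ i = 5 := by omega
      · simp [show b 9 = false from hb]
        tauto
      · simp [show b 10 = false from hb]
        tauto) (S' := { S with own := insert (.ns n) S.own }) rfl rfl
  refine ⟨?_, ?_, ?_, h.pos, h.prob_nil, ?_, ?_, fun f f' hf => h.rec_congr f f' fun s hs hbs => ?_,
    fun s hs hbs => ?_⟩
  · rwa [u 0 (by omega), u 1 (by omega)]
  · rw [u 11 (by omega)]; exact h.qa_eq
  · rw [u 12 (by omega)]; exact h.qb_eq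
  · rw [← e, e2]; exact h.rep.congr rfl rfl rfl
  · rw [← e, e2, u 7 (by omega), u 8 (by omega)]; exact h.normed
  · have := hf s hs (by rwa [u _ (by omega)])
    rw [← g (2 * s) (by omega), ← g (2 * s + 1) (by omega)]
    exact this
  · rw [u _ (by omega)] at hbs
    have := h.slot s hs hbs
    rwa [← g (2 * s) (by omega), ← g (2 * s + 1) (by omega)] at this

/-- An optical element acts. -/
theorem apply (h : ModelQuant own₀ env₀ ψ α L b S rec) (ho : α.outs = []) {x : ℕ} (hx : x < 7)
    (hb : b x = false) (hn : b 7 = false ∨ b 8 = false) {L' : ModelLoc} {S' : Store}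
    (hN : Names own₀ env₀ α.qa α.qb (Function.update b x true 0) (Function.update b x true 1) L'.nm
      (ModelLoc.Created (Function.update b x true)) S')
    (hs : ModelLoc.Sound (Function.update b x true))
    (hy : ∀ y < 7, x < y → b y = true → Apart x y)
    (hq : x = 0 → b 1 = true → L'.qa ≠ L'.qb)
    (hop : ∀ y < 7, b y = true → L.op y = L'.op y) (hqa : L'.qa = L.qa) (hqb : L'.qb = L.qb)
    (hw : L'.w = L.w)
    (hnm : ∀ s < 2, b (7 + s) = true → L'.nm (2 * s) = L.nm (2 * s) ∧
      L'.nm (2 * s + 1) = L.nm (2 * s + 1))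
    (hm : ∀ v φ, L'.op x (fun f => if v = rec f then φ f else 0) =
      fun f => if v = rec f then L'.op x φ f else 0)
    (h1 : S'.width = S.width) (h2 : S'.wt = S.wt) (h3 : ∀ v, S'.st v = L'.op x (S.st v)) :
    ModelQuant own₀ env₀ ψ α L' (Function.update b x true) S' rec := by
  have u : ∀ y ≥ 7, Function.update b x true y = b y := fun y hy =>
    Function.update_of_ne (by omega) _ _
  refine ⟨hN, ?_, ?_, h.pos, h.prob_nil, ?_, fun h7 h8 => ?_, fun f f' hf => h.rec_congr f f'
    fun s hs hbs => ?_, fun s hs hbs => ?_⟩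
  · rw [u 11 (by omega), hqa]; exact h.qa_eq
  · rw [u 12 (by omega), hqb]; exact h.qb_eq
  · have hR := h.rep
    rw [observed_of_nil ho (h.prob_nil ho)] at hR ⊢
    rw [ModelLoc.state_update hx hb ?_, ← ModelLoc.state_congr (fun _ _ => rfl) hop]
    · exact hR.map (L'.op_smul x) hm h1 h2 h3
    · intro y hy7 hxy hby φ
      have hd := hy y hy7 hxy hby
      have hc := hs x hx (Function.update_self ..)
      have hc' := hs y hy7 (by rw [Function.update_of_ne (by omega), hby])
      exact ModelLoc.op_comm hxy (by rintro rfl; exact hq (by omega) hby)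
        (fun e => hd.1 (hN.inj _ _ hc.1 hc'.1 e)) (fun e => hd.2.1 (hN.inj _ _ hc.1 hc'.2 e))
        (fun e => hd.2.2.1 (hN.inj _ _ hc.2 hc'.1 e)) (fun e => hd.2.2.2 (hN.inj _ _ hc.2 hc'.2 e)) φ
  · rw [u 7 (by omega)] at h7
    rw [u 8 (by omega)] at h8
    simp [h7, h8] at hn
  · have := hf s hs (by rwa [u _ (by omega)])
    rwa [(hnm s hs hbs).1, (hnm s hs hbs).2] at this
  · rw [u _ (by omega)] at hbs
    rw [h1, hw, (hnm s hs hbs).1, (hnm s hs hbs).2]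
    exact h.slot s hs hbs

theorem ne_of_isSome (h : ModelQuant own₀ env₀ ψ α L b S rec) (h11 : b 11 = true)
    (h12 : b 12 = true) : L.qa ≠ L.qb := fun e =>
  h.names.ne L.qa (by rw [h.qa_eq, h11]; rfl) (by rw [h.qb_eq, h12, e]; rfl)

theorem split_a (h : ModelQuant own₀ env₀ ψ α L b S rec) (ho : α.outs = []) (h0 : b 0 = false)
    (h11 : b 11 = true) (h12 : b 1 = true → b 12 = true) (h7 : b 7 = false) (h8 : b 8 = false)
    (hy : ∀ y < 7, b y = true → Apart 0 y) (hs : ModelLoc.Sound (Function.update b 0 true))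
    {m n : ℕ} (hm : S.Fresh (.ns m)) (hn : S.Fresh (.ns n)) (hmn : m ≠ n) :
    ModelQuant own₀ env₀ ψ α { L with nm := Function.update (Function.update L.nm 0 m) 1 n }
      (Function.update b 0 true)
      { S with
        own := insert (.ns m) (insert (.ns n) (S.own.erase (.qb L.qa)))
        st := fun v => psAct (.qb L.qa) (.ns m) (.ns n) (S.st v) } rec := by
  have hqa : α.qa = some L.qa := by rw [h.qa_eq, h11]; rfl
  refine h.apply ho (by omega) h0 (.inl h7) (h.names.ps (i := 0) (j := 1) hqa hm hn hmn (by simp)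
    (As' := ModelLoc.Created (Function.update b 0 true)) (by simp [ModelLoc.Created, h0])
    (by simp [ModelLoc.Created, h0]) (fun l => ?_) rfl rfl) hs (fun y hy7 _ => hy y hy7)
    (fun _ h1 => h.ne_of_isSome h11 (h12 h1)) (fun y hy7 hby => ?_) rfl rfl rfl (fun s hs hbs => ?_)
    (map_mask_of_const (ModelLoc.op_zero _ _) (h.rec_const h7 h8)) rfl rfl fun _ => rfl
  · have u : ∀ y, y ≠ 0 → Function.update b 0 true y = b y := fun y hy =>
      Function.update_of_ne hy _ _
    simp only [ModelLoc.Created, h0, u 1 (by omega), u 9 (by omega), u 10 (by omega),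
      Function.update_self, and_true, Bool.false_eq_true, and_false, false_or]
    rw [show l < 2 ↔ l = 0 ∨ l = 1 by omega]
    tauto
  · obtain ⟨g1, g2, g3, g4⟩ := hy y hy7 hby
    refine ModelLoc.op_congr (.inl rfl) (.inl rfl) ?_ ?_
    · exact ((Function.update_of_ne g3.symm _ _).trans (Function.update_of_ne g1.symm _ _)).symm
    · exact ((Function.update_of_ne g4.symm _ _).trans (Function.update_of_ne g2.symm _ _)).symm
  · interval_cases s
    · simp [h7] at hbs
    · simp [h8] at hbs

theorem split_b (h : ModelQuant own₀ env₀ ψ α L b S rec) (ho : α.outs = []) (h1 : b 1 = false)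
    (h11 : b 0 = true → b 11 = true) (h12 : b 12 = true) (h7 : b 7 = false) (h8 : b 8 = false)
    (hy : ∀ y < 7, y ≠ 1 → b y = true → Apart 1 y)
    (hs : ModelLoc.Sound (Function.update b 1 true))
    {m n : ℕ} (hm : S.Fresh (.ns m)) (hn : S.Fresh (.ns n)) (hmn : m ≠ n) :
    ModelQuant own₀ env₀ ψ α { L with nm := Function.update (Function.update L.nm 2 m) 3 n }
      (Function.update b 1 true)
      { S with
        own := insert (.ns m) (insert (.ns n) (S.own.erase (.qb L.qb)))
        st := fun v => psAct (.qb L.qb) (.ns m) (.ns n) (S.st v) } rec := by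
  have hqb : α.qb = some L.qb := by rw [h.qb_eq, h12]; rfl
  have hN := (h.names.swap.ps (i := 2) (j := 3) hqb hm hn hmn
    (by simp) (As' := ModelLoc.Created (Function.update b 1 true)) (by simp [ModelLoc.Created, h1])
    (by simp [ModelLoc.Created, h1]) (fun l => ?_) (S' := { S with
        own := insert (.ns m) (insert (.ns n) (S.own.erase (.qb L.qb)))
        st := fun v => psAct (.qb L.qb) (.ns m) (.ns n) (S.st v) }) rfl rfl).swap
  refine h.apply ho (by omega) h1 (.inl h7) hN hs (fun y hy7 hy1 => hy y hy7 (by omega)) (fun h1' => ?_) (fun y hy7 hby => ?_) rfl rfl rfl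
    (fun s hs hbs => ?_) (map_mask_of_const (ModelLoc.op_zero _ _) (h.rec_const h7 h8)) rfl rfl
    fun _ => rfl
  · omega
  · obtain ⟨g1, g2, g3, g4⟩ := hy y hy7 (by rintro rfl; simp [h1] at hby) hby
    refine ModelLoc.op_congr (.inl rfl) (.inl rfl) ?_ ?_
    · exact ((Function.update_of_ne g3.symm _ _).trans (Function.update_of_ne g1.symm _ _)).symm
    · exact ((Function.update_of_ne g4.symm _ _).trans (Function.update_of_ne g2.symm _ _)).symm
  · interval_cases s
    · simp [h7] at hbs
    · simp [h8] at hbs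
  · have u : ∀ y, y ≠ 1 → Function.update b 1 true y = b y := fun y hy =>
      Function.update_of_ne hy _ _
    simp only [ModelLoc.Created, h1, u 0 (by omega), u 9 (by omega), u 10 (by omega),
      Function.update_self, and_true, Bool.false_eq_true, and_false, false_or]
    rw [show 2 ≤ l ∧ l < 4 ↔ l = 2 ∨ l = 3 by omega]
    tauto

/-- The photons pass a beam splitter. -/
theorem gate (h : ModelQuant own₀ env₀ ψ α L b S rec) (ho : α.outs = []) {x : ℕ} (hx : x < 7)
    (hx2 : 2 ≤ x) (hb : b x = false) (hn : b 7 = false ∨ b 8 = false)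
    (hs : ModelLoc.Sound (Function.update b x true))
    (hy : ∀ y < 7, x < y → b y = true → Apart x y)
    (hd : ∀ s < 2, b (7 + s) = true → b s = true ∧ Apart x s) :
    ModelQuant own₀ env₀ ψ α L (Function.update b x true)
      (S.transform (fun _ => true) (pairAct (bsAmp (reflectivity x)) (.ns (L.nm (opticalPair x).1))
        (.ns (L.nm (opticalPair x).2)))) rec := by
  have e : L.op x = pairAct (bsAmp (reflectivity x)) (.ns (L.nm (opticalPair x).1))
      (.ns (L.nm (opticalPair x).2)) := by
    obtain ⟨x, rfl⟩ : ∃ y, x = y + 2 := ⟨x - 2, by omega⟩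
    rfl
  have u : ∀ y, y ≠ x → Function.update b x true y = b y := fun y hy => Function.update_of_ne hy _ _
  have hC : ModelLoc.Created (Function.update b x true) = ModelLoc.Created b := by
    funext i
    simp only [ModelLoc.Created, u 0 (by omega), u 1 (by omega), u 9 (by omega), u 10 (by omega)]
  refine h.apply ho hx hb hn ?_ hs hy (fun _ => by omega) (fun _ _ _ => rfl) rfl rfl
    rfl (fun _ _ _ => ⟨rfl, rfl⟩) ?_ rfl rfl fun v => by rw [e]; rfl
  · rw [u 0 (by omega), u 1 (by omega), hC]
    exact h.names.grow (Finset.Subset.refl _) rfl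
  · rw [e]
    refine pairAct_mask _ fun f i j => h.rec_congr _ _ fun s hs2 hbs => ?_
    have hc := hs x hx (Function.update_self ..)
    rw [hC] at hc
    obtain ⟨hbs, a1, a2, a3, a4⟩ := hd s hs2 hbs
    have hp : opticalPair s = (2 * s, 2 * s + 1) := by interval_cases s <;> rfl
    rw [hp] at a1 a2 a3 a4
    have hcs : ModelLoc.Created b (2 * s) ∧ ModelLoc.Created b (2 * s + 1) := by
      interval_cases s <;> simp [ModelLoc.Created, hbs]
    have e : ∀ {i j}, ModelLoc.Created b i → ModelLoc.Created b j → i ≠ j →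
        QName.ns (L.nm j) ≠ .ns (L.nm i) := fun hi hj hij e =>
      hij (h.names.inj _ _ hi hj (by simpa using e.symm))
    rw [update_ne _ (e hc.2 hcs.1 a3), update_ne _ (e hc.1 hcs.1 a1), update_ne _ (e hc.2 hcs.2 a4),
      update_ne _ (e hc.1 hcs.2 a2)]
    exact ⟨rfl, rfl⟩

theorem sqSummable (h : ModelQuant own₀ env₀ ψ α L b S rec)
    (hψ : IsState (own₀ ∪ env₀.toFinset) ψ) (hs : ModelLoc.Sound b) :
    SqSummable (L.state b ψ 7) := by
  let Y : Set QName := {x | ∃ i, ModelLoc.Created b i ∧ x = .ns (L.nm i)}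
  have hT : ∀ n ≤ 7, Tame Y (L.state b ψ n) := by
    intro n
    induction n with
    | zero =>
      refine fun _ => ⟨hψ.1.summable, 0, fun f hf x hx => ?_⟩
      obtain ⟨i, hi, rfl⟩ := hx
      exact (h.names.eq_zero hψ hi hf).le
    | succ n ih =>
      intro hn
      have hT := ih (by omega)
      rw [ModelLoc.state]
      cases hb : b n
      · exact hT
      · obtain ⟨h1, h2⟩ := hs n (by omega) hb
        have hne : QName.ns (L.nm (opticalPair n).1) ≠ .ns (L.nm (opticalPair n).2) := fun e =>
          (by decide : ∀ n < 7, (opticalPair n).1 ≠ (opticalPair n).2) n (by omega)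
            (h.names.inj _ _ h1 h2 (by simpa using e))
        match n with
        | 0 => exact hT.psAct (by simp [Y]) (by simp) (by simp) hne
        | 1 => exact hT.psAct (by simp [Y]) (by simp) (by simp) hne
        | _ + 2 => exact hT.pairAct _ ⟨_, h1, rfl⟩ ⟨_, h2, rfl⟩ hne
  exact (hT 7 le_rfl).1

/-- The photons of the control (`s = 0`) or of the target (`s = 1`) are counted. -/
theorem detect (h : ModelQuant own₀ env₀ ψ α L b S rec) (hψ : IsState (own₀ ∪ env₀.toFinset) ψ)
    (hs : ModelLoc.Sound b) {s : ℕ} (hs2 : s < 2) (hb : b (7 + s) = false) :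
    ModelQuant own₀ env₀ ψ α { L with w := Function.update L.w s S.width }
      (Function.update b (7 + s) true)
      (S.measure (fun _ => true) 2 (obsNS [.ns (L.nm (2 * s)), .ns (L.nm (2 * s + 1))]))
      fun f => rec f ++ [(f (.ns (L.nm (2 * s))) : ℤ), (f (.ns (L.nm (2 * s + 1))) : ℤ)] := by
  have u : ∀ y, y ≠ 7 + s → Function.update b (7 + s) true y = b y := fun y hy =>
    Function.update_of_ne hy _ _
  have hC : ModelLoc.Created (Function.update b (7 + s) true) = ModelLoc.Created b := by
    funext i
    simp only [ModelLoc.Created, u 0 (by omega), u 1 (by omega), u 9 (by omega), u 10 (by omega)]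
  have hst : ({ L with w := Function.update L.w s S.width } : ModelLoc).state
      (Function.update b (7 + s) true) ψ 7 = L.state b ψ 7 :=
    ModelLoc.state_congr (fun y hy => u y (by omega)) fun y _ _ =>
      ModelLoc.op_congr (.inl rfl) (.inl rfl) rfl rfl
  have e : (fun f => rec f ++ if true = true then
      obsNS [.ns (L.nm (2 * s)), .ns (L.nm (2 * s + 1))] f else List.replicate 2 0) =
      fun f => rec f ++ [(f (.ns (L.nm (2 * s))) : ℤ), (f (.ns (L.nm (2 * s + 1))) : ℤ)] := by
    funext f
    simp [obsNS]
  refine ⟨?_, ?_, ?_, h.pos, h.prob_nil, ?_, fun _ _ => ?_, fun f f' hf => ?_, fun r hr hbr => ?_⟩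
  · rw [u 0 (by omega), u 1 (by omega), hC]
    exact h.names.grow (Finset.Subset.refl _) rfl
  · rw [u 11 (by omega)]; exact h.qa_eq
  · rw [u 12 (by omega)]; exact h.qb_eq
  · rw [hst, ← e]
    exact h.rep.measure ((h.sqSummable hψ hs).observed _ _ _) (G := fun _ => true) (r := 2)
      fun f => by simp [obsNS]
  · rw [hst, ← e]
    exact Store.Rep.normed_measure h.rep (G := fun _ => true) (r := 2) (by simp)
  · have hf' := hf s hs2 (Function.update_self ..)
    rw [h.rec_congr f f' fun r hr hbr => hf r hr (by
      by_cases hrs : r = s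
      · rw [hrs, Function.update_self]
      · rw [u _ (by omega), hbr])]
    exact congrArg₂ (fun x y : ℕ => rec f' ++ [(x : ℤ), (y : ℤ)]) hf'.1 hf'.2
  · have hl := h.rep.reclen
    by_cases hrs : r = s
    · subst hrs
      show Function.update L.w r S.width r + 1 < S.width + 2 ∧ _
      simp only [Function.update_self]
      refine ⟨by omega, fun f => ?_⟩
      rw [← hl f]
      simp [List.getD]
    · rw [u _ (by omega)] at hbr
      obtain ⟨g1, g2⟩ := h.slot r hr hbr
      show Function.update L.w s S.width r + 1 < S.width + 2 ∧ _
      simp only [Function.update_of_ne hrs]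
      refine ⟨by omega, fun f => ?_⟩
      rw [List.getD_append _ _ _ _ (by rw [hl]; omega), List.getD_append _ _ _ _ (by rw [hl]; omega)]
      exact g2 f

end ModelQuant

/-! ### The evaluation of the results of the model -/

/-- The expression `e` is being evaluated to the `j`-th number of the model. -/
def ModelExpr (L : ModelLoc) (W : ℕ) (rec : Basis → List ℤ) (j : ℕ) (e : Expr) : Prop :=
  e.IsData W ∧ ∀ f, e.den (rec f) = component (L.outcome f) j

namespace ModelQuant

variable {own₀ : Finset QName} {env₀ : List QName} {ψ : State} {α : Hist} {L : ModelLoc}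
  {b : ℕ → Bool} {S : Store} {rec : Basis → List ℤ}

theorem modelExpr_count (h : ModelQuant own₀ env₀ ψ α L b S rec) (h7 : b 7 = true)
    (h8 : b 8 = true) {j : ℕ} (hj : j < 3) :
    ModelExpr L S.width rec j (countExpr (L.w 0) (L.w 1) j) := by
  obtain ⟨w0, g0⟩ := h.slot 0 (by omega) h7
  obtain ⟨w1, g1⟩ := h.slot 1 (by omega) h8
  have hv : ∀ {n}, n < S.width → (Expr.vals [.slot n]).IsData S.width := fun h => ⟨_, rfl, h⟩
  have hn : ∀ n, (num n).IsData S.width := fun n => ⟨_, rfl, trivial⟩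
  have hc : (coincidence (L.w 0) (L.w 1)).IsData S.width :=
    ⟨⟨⟨hv (by omega), hv w0⟩, hn 1⟩, ⟨hv (by omega), hv w1⟩, hn 1⟩
  have hd : ∀ f, (coincidence (L.w 0) (L.w 1)).den (rec f) ≠ 0 ↔
      f (.ns (L.nm 0)) + f (.ns (L.nm 1)) = 1 ∧ f (.ns (L.nm 2)) + f (.ns (L.nm 3)) = 1 := by
    intro f
    obtain ⟨a1, a2⟩ := g0 f
    obtain ⟨a3, a4⟩ := g1 f
    simp only [coincidence, Expr.den, List.headD, num, Val.at, DataOp.eval, a1, a2, a3, a4]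
    norm_cast
    by_cases c1 : f (.ns (L.nm 0)) + f (.ns (L.nm 1)) = 1 <;>
      by_cases c2 : f (.ns (L.nm 2)) + f (.ns (L.nm 3)) = 1 <;> simp [c1, c2]
  have key : ∀ {e : Expr}, e.IsData S.width → (∀ f, e.den (rec f) =
      [(f (.ns (L.nm 1)) : ℤ), (f (.ns (L.nm 3)) : ℤ), 1].getD j 0) →
      ModelExpr L S.width rec j (.ite (coincidence (L.w 0) (L.w 1)) e (num 0)) := by
    refine fun he hden => ⟨⟨hc, he, hn 0⟩, fun f => ?_⟩
    rw [Expr.den_ite, component, ModelLoc.outcome, networkOutcome]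
    by_cases c : f (.ns (L.nm 0)) + f (.ns (L.nm 1)) = 1 ∧ f (.ns (L.nm 2)) + f (.ns (L.nm 3)) = 1
    · rw [if_pos ((hd f).2 c), if_pos c, hden]
    · rw [if_neg (mt (hd f).1 c), if_neg c]
      interval_cases j <;> rfl
  match j with
  | 0 => exact key (hv w0) fun f => (g0 f).2
  | 1 => exact key (hv w1) fun f => (g1 f).2
  | 2 => exact key (hn 1) fun f => rfl

theorem eStep (h : ModelQuant own₀ env₀ ψ α L b S rec) (h7 : b 7 = true) (h8 : b 8 = true) {j : ℕ}
    {e : Expr} (he : ModelExpr L S.width rec j e) {S' : Store} {e' : Expr}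
    (H : EStep (fun _ => true) S e S' e') :
    ∃ rec', ModelQuant own₀ env₀ ψ α L b S' rec' ∧ ModelExpr L S'.width rec' j e' ∧
      e'.size < e.size := by
  obtain ⟨a, rfl, ha, g1, g2, g3⟩ := he.1.step H
  refine ⟨fun f => rec f ++ a (rec f), ?_, ⟨g1, fun f => by rw [g2 _ (h.rep.reclen f), he.2]⟩, g3⟩
  exact {
    names := h.names.grow (Finset.Subset.refl _) rfl
    qa_eq := h.qa_eq
    qb_eq := h.qb_eq
    pos := h.pos
    prob_nil := h.prob_nil
    rep := h.rep.push ha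
    normed := fun _ _ => Store.Rep.normed_push h.rep (h.normed h7 h8)
    rec_congr := fun f f' hf => by rw [h.rec_congr f f' hf]
    slot := fun s hs hb => by
      obtain ⟨k1, k2⟩ := h.slot s hs hb
      refine ⟨k1.trans_le (Nat.le_add_right _ _), fun f => ?_⟩
      rw [List.getD_append _ _ _ _ (by rw [h.rep.reclen]; omega),
        List.getD_append _ _ _ _ (by rw [h.rep.reclen]; omega)]
      exact k2 f }

theorem modelExpr_vals {W : ℕ} {j : ℕ} {vs : List Val} (he : ModelExpr L W rec j (.vals vs)) :
    ∃ v, vs = [v] ∧ v.isClassical = true ∧ ∀ f, v.at (rec f) = component (L.outcome f) j := by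
  obtain ⟨⟨v, rfl, hv⟩, h⟩ := he
  exact ⟨v, rfl, hv.isClassical, h⟩

theorem out (h : ModelQuant own₀ env₀ ψ α L b S rec) (hψ : IsState (own₀ ∪ env₀.toFinset) ψ)
    (hs : ModelLoc.Sound b) (hb : ∀ x ≤ 12, b x = true) (ho : α.outs.length < 3) {v : Val}
    (hv : v.isClassical = true)
    (hval : ∀ f, v.at (rec f) = component (L.outcome f) α.outs.length) :
    S.outProb [v] = α.nextProb ψ ∧ ∀ w, 0 < α.nextProb ψ w →
      (S.outBranch [v] w).rhoE = α.nextRho env₀ ψ w ∧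
      ModelQuant own₀ env₀ ψ (α.next ψ w) L b (S.outBranch [v] w) rec := by
  have hqa : α.qa = some L.qa := by rw [h.qa_eq, hb 11 (by omega)]; rfl
  have hqb : α.qb = some L.qb := by rw [h.qb_eq, hb 12 (by omega)]; rfl
  have hC : ∀ i < 6, ModelLoc.Created b i := by
    intro i hi
    simp only [ModelLoc.Created, hb 0 (by omega), hb 1 (by omega), hb 9 (by omega),
      hb 10 (by omega), and_true]
    omega
  have n3 : ∀ i < 6, .ns (L.nm i) ∉ S.env := fun i hi => h.names.ns_notMem_env (hC i hi)
  have hz : ∀ f p : Basis, (∀ x, x ∉ S.env → p x = 0) → ∀ i < 6,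
      (f + p) (.ns (L.nm i)) = f (.ns (L.nm i)) := by
    intro f p hp i hi
    simp [hp _ (n3 i hi)]
  have hst : L.state b ψ 7 = networkState (.qb L.qa) (.qb L.qb) (.ns (L.nm 0)) (.ns (L.nm 1))
      (.ns (L.nm 2)) (.ns (L.nm 3)) (.ns (L.nm 4)) (.ns (L.nm 5)) ψ := by
    simp only [ModelLoc.state, hb 0 (by omega), hb 1 (by omega), hb 2 (by omega), hb 3 (by omega),
      hb 4 (by omega), hb 5 (by omega), hb 6 (by omega), opt_true]
    rfl
  have hinj : ∀ i < 6, ∀ j < 6, i ≠ j → L.nm i ≠ L.nm j := fun i hi j hj hij e =>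
    hij (h.names.inj i j (hC i hi) (hC j hj) e)
  have hnd : [QName.qb L.qa, .qb L.qb, .ns (L.nm 0), .ns (L.nm 1), .ns (L.nm 2), .ns (L.nm 3),
      .ns (L.nm 4), .ns (L.nm 5)].Nodup := by
    have := h.ne_of_isSome (hb 11 (by omega)) (hb 12 (by omega))
    simp [this, hinj]
  have hN : ∀ x ∈ [QName.qb L.qa, .qb L.qb, .ns (L.nm 0), .ns (L.nm 1), .ns (L.nm 2), .ns (L.nm 3),
      .ns (L.nm 4), .ns (L.nm 5)], x ∉ S.env := by
    simp only [List.forall_mem_cons, List.not_mem_nil, false_implies, implies_true, and_true]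
    exact ⟨h.names.qb_notMem_env hqa, h.names.swap.qb_notMem_env hqb, n3 0 (by omega),
      n3 1 (by omega), n3 2 (by omega), n3 3 (by omega), n3 4 (by omega), n3 5 (by omega)⟩
  obtain ⟨k1, k2⟩ := output_step h.names.env_eq h.rep (h.normed (hb 7 (by omega)) (hb 8 (by omega)))
    (h.sqSummable hψ hs) h.pos ho hv hval
    (fun f p hp => by
      have := hz f p hp
      simp only [ModelLoc.outcome, networkOutcome, this 0 (by omega), this 1 (by omega),
        this 2 (by omega), this 3 (by omega)])
    (fun f p hp => h.rec_congr _ _ fun s hs _ => ⟨hz f p hp _ (by omega), hz f p hp _ (by omega)⟩)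
    (fun outs M a b' hM ha hb' => by
      rw [hst, Hist.expect, hqa, hqb]
      exact network_expected hnd hψ.1.summable (fun f hf => ⟨(hψ.2 f hf).2 _, (hψ.2 f hf).2 _,
        h.names.eq_zero hψ (hC 0 (by omega)) hf, h.names.eq_zero hψ (hC 1 (by omega)) hf,
        h.names.eq_zero hψ (hC 2 (by omega)) hf, h.names.eq_zero hψ (hC 3 (by omega)) hf,
        h.names.eq_zero hψ (hC 4 (by omega)) hf, h.names.eq_zero hψ (hC 5 (by omega)) hf⟩) _
        (fun x hx hc => hN x hc (hM x hx)) ha hb')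
  refine ⟨k1, fun w hw => ?_⟩
  obtain ⟨g1, g2, g3, g4, g5, g6⟩ := k2 w hw
  refine ⟨g1, ?_⟩
  exact {
    names := h.names.grow g5.symm.subset g6
    qa_eq := h.qa_eq
    qb_eq := h.qb_eq
    pos := g4
    prob_nil := fun hc => absurd hc (by simp [Hist.next])
    rep := g2
    normed := fun _ _ => g3
    rec_congr := h.rec_congr
    slot := h.slot }

end ModelQuant

/-! ### The runs of the model -/

theorem vacTh_out_iff {i : Chan} {s k : ℕ} {ch vs X} : POut (vacTh i s k) ch vs X ↔
    k = 0 ∧ ch = i ∧ vs = [.name (.ns s)] ∧ X = vacTh i s 1 := by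
  match k with
  | 0 => simp [vacTh, pOut_singleton_iff, mode]; tauto
  | _ + 1 => simp [vacTh, not_pOut_nil]

theorem dumpTh_in {j : Chan} {x k : ℕ} {ch vs X} (H : PIn (dumpTh j x k) ch vs X) :
    k = 0 ∧ ch = j ∧ X = dumpTh j x 1 := by
  match k with
  | 0 =>
    obtain ⟨rfl, -, rfl⟩ := pIn_inp_iff.1 H
    exact ⟨rfl, rfl, rfl⟩
  | _ + 1 => exact absurd H not_pIn_nil

theorem dumpTh_in_zero {j : Chan} {x s : ℕ} :
    PIn (dumpTh j x 0) j [.name (.ns s)] (dumpTh j x 1) :=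
  pIn_inp_iff.2 ⟨rfl, by simp [Val.HasTy, QName.IsNS], rfl⟩

theorem not_pIn_vacTh {i : Chan} {s k : ℕ} {c vs X} : ¬ PIn (vacTh i s k) c vs X := by
  match k with
  | 0 => exact not_pIn_out
  | _ + 1 => exact not_pIn_nil

theorem not_tau_vacTh {i : Chan} {s k : ℕ} {S S' X} : ¬ Tau S (vacTh i s k) S' X := by
  match k with
  | 0 => simp [vacTh, mode, tau_out_singleton_iff, not_eStep_vals]
  | _ + 1 => exact not_tau_nil

theorem not_pOut_dumpTh {j : Chan} {x k : ℕ} {c vs X} : ¬ POut (dumpTh j x k) c vs X := by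
  match k with
  | 0 => exact not_pOut_inp
  | _ + 1 => exact not_pOut_nil

theorem not_tau_dumpTh {j : Chan} {x k : ℕ} {S S' X} : ¬ Tau S (dumpTh j x k) S' X := by
  match k with
  | 0 => exact not_tau_inp
  | _ + 1 => exact not_tau_nil

/-- The network of beam splitters with the vacuum modes `ey` and `ez`. -/
noncomputable def network (ey ez : Expr) : Proc :=
  .par (BS ch.e ch.f ch.g ch.h (1 / 2)) <| .par (.out ch.i [ey] .nil) <|
    .par (BS ch.c ch.i ch.k ch.j (1 / 3)) <| .par (.inp ch.j [(0, .ns)] .nil) <|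
    .par (BS ch.g ch.d ch.m ch.l (1 / 3)) <| .par (.out ch.n [ez] .nil) <|
    .par (BS ch.h ch.n ch.o ch.p (1 / 3)) <| .par (.inp ch.p [(1, .ns)] .nil) <|
    BS ch.m ch.o ch.q ch.r (1 / 2)

/-- The network before the creation of the vacuum modes, the first of which is `s`. -/
noncomputable def preTh (s : ℕ) : ℕ → Proc
  | 0 => .ns 0 (.ns 1 (network (ev 0) (ev 1)))
  | 1 => .ns 1 (network (mode s) (ev 1))
  | _ => .nil

theorem not_pOut_preTh {s k : ℕ} {c vs X} : ¬ POut (preTh s k) c vs X := by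
  match k with
  | 0 => exact not_pOut_ns
  | 1 => exact not_pOut_ns
  | _ + 2 => exact not_pOut_nil

theorem not_pIn_preTh {s k : ℕ} {c vs X} : ¬ PIn (preTh s k) c vs X := by
  match k with
  | 0 => exact not_pIn_ns
  | 1 => exact not_pIn_ns
  | _ + 2 => exact not_pIn_nil

theorem preTh_tau_iff {s k : ℕ} {S S' X} : Tau S (preTh s k) S' X ↔
    ∃ n, S.Fresh (.ns n) ∧ S' = { S with own := insert (.ns n) S.own } ∧
      (k = 0 ∧ X = preTh n 1 ∨ k = 1 ∧ X = network (mode s) (mode n)) := by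
  match k with
  | 0 =>
    constructor
    · intro h
      cases h with
      | ns n _ _ hn => exact ⟨n, hn, rfl, .inl ⟨rfl, rfl⟩⟩
    · rintro ⟨n, hn, rfl, ⟨-, rfl⟩ | ⟨h, -⟩⟩
      · exact .ns n _ _ hn
      · cases h
  | 1 =>
    constructor
    · intro h
      cases h with
      | ns n _ _ hn => exact ⟨n, hn, rfl, .inr ⟨rfl, rfl⟩⟩
    · rintro ⟨n, hn, rfl, ⟨h, -⟩ | ⟨-, rfl⟩⟩
      · cases h
      · exact .ns n _ _ hn
  | _ + 2 => simp [preTh, not_tau_nil]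

/-- The links between the polarising beam splitters (`0`, `1`), the beam splitters (`2`, `4`, `6`, `8`,
`10`), the sources of vacuum (`3`, `7`), the unused outputs (`5`, `9`), the detectors (`11`, `12`) and
the counter (`13`). -/
def modelLinks : List (ℕ × ℕ × ℕ × ℕ × ℕ) :=
  [(0, 0, 2, 4, 0), (1, 0, 3, 6, 1), (2, 1, 2, 2, 0), (3, 1, 3, 2, 1), (4, 2, 4, 6, 0),
    (5, 2, 5, 8, 0), (6, 3, 0, 4, 1), (7, 4, 5, 5, 0), (8, 4, 4, 11, 0), (9, 6, 5, 11, 1),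
    (10, 6, 4, 10, 0), (11, 7, 0, 8, 1), (12, 8, 4, 10, 1), (13, 8, 5, 9, 0), (14, 10, 4, 12, 0),
    (15, 10, 5, 12, 1), (16, 11, 3, 13, 0), (17, 12, 3, 13, 1)]

/-- The arrangement of the threads around the network. -/
def outerCtx (C : Ctx) : Ctx :=
  .new [ch.c, ch.d, ch.e, ch.f, ch.g, ch.h, ch.m, ch.l, ch.k, ch.o, ch.q, ch.r, ch.u, ch.v] <|
    .par (.par (.hole 0) (.hole 1)) <|
    .par (.new [ch.g, ch.h, ch.m, ch.o, ch.i, ch.j, ch.n, ch.p] C)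
      (.new [ch.u, ch.v] (.par (.hole 11) (.par (.hole 12) (.hole 13))))

/-- The arrangement of the threads of the model before the creation of the vacuum modes. -/
def preCtx : Ctx := outerCtx (.hole 14)

/-- The arrangement of the threads of the model. -/
def modelCtx : Ctx := outerCtx <|
  .par (.hole 2) <| .par (.hole 3) <| .par (.hole 4) <| .par (.hole 5) <| .par (.hole 6) <|
    .par (.hole 7) <| .par (.hole 8) <| .par (.hole 9) (.hole 10)

namespace ModelLoc

/-- The current expression of the counter at the program counter `n`. -/
def expr (L : ModelLoc) (n : ℕ) : Expr := L.e.getD (countExpr (L.w 0) (L.w 1) (n - 2))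

/-- The thread of the beam splitter `x`. -/
noncomputable def splitter (L : ModelLoc) (x : ℕ) (e f h i : Chan) : ℕ → Proc :=
  bsTh e f h i (reflectivity x) (L.nm (opticalPair x).1) (L.nm (opticalPair x).2)

/-- The threads of the model. -/
noncomputable def thread (p : Ports) (L : ModelLoc) : ℕ → ℕ → Proc
  | 0 => polTh (.pub p.a) ch.c ch.d L.qa (L.nm 0) (L.nm 1)
  | 1 => polTh (.pub p.b) ch.e ch.f L.qb (L.nm 2) (L.nm 3)
  | 2 => L.splitter 2 ch.e ch.f ch.g ch.h
  | 3 => vacTh ch.i (L.nm 4)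
  | 4 => L.splitter 3 ch.c ch.i ch.k ch.j
  | 5 => dumpTh ch.j 0
  | 6 => L.splitter 4 ch.g ch.d ch.m ch.l
  | 7 => vacTh ch.n (L.nm 5)
  | 8 => L.splitter 5 ch.h ch.n ch.o ch.p
  | 9 => dumpTh ch.p 1
  | 10 => L.splitter 6 ch.m ch.o ch.q ch.r
  | 11 => detTh ch.k ch.l ch.u (L.nm 0) (L.nm 1) (L.w 0)
  | 12 => detTh ch.q ch.r ch.v (L.nm 2) (L.nm 3) (L.w 1)
  | 13 => fun n => countTh ch.u ch.v (.pub p.o₁) (.pub p.c) (.pub p.o₂) (L.w 0) (L.w 1) (L.expr n) n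
  | _ => preTh (L.nm 4)

/-- The values that are sent on the channels. -/
def value (L : ModelLoc) : ℕ → List Val
  | 16 => slots (L.w 0)
  | 17 => slots (L.w 1)
  | n => [modeVal (L.nm ([0, 1, 2, 3, 2, 3, 4, 4, 0, 1, 2, 5, 3, 5, 2, 3].getD n 0))]

/-- The current arrangement of the threads. -/
def ctx (L : ModelLoc) : Ctx := if L.k 14 < 2 then preCtx else modelCtx

/-- The process of the model. -/
noncomputable def proc (p : Ports) (L : ModelLoc) : Proc := L.ctx.run (L.thread p) L.k

theorem ctx_cases {P : Ctx → Prop} (L : ModelLoc) (h1 : P preCtx) (h2 : P modelCtx) : P L.ctx := by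
  unfold ctx
  split
  · exact h1
  · exact h2

theorem lt_of_mem_holes {L : ModelLoc} {i : ℕ} (hi : i ∈ L.ctx.holes) : i < 15 :=
  L.ctx_cases (P := fun C => ∀ i ∈ C.holes, i < 15) (by decide) (by decide) i hi

theorem wired (p : Ports) (L : ModelLoc) (h1 : L.k 13 ≤ 1 → L.e = none)
    (he : ∀ q, L.e ≠ some (.vals [.name q])) :
    Wired L.ctx modelLinks (L.thread p) L.value L.k where
  holes := L.ctx_cases (P := fun C => C.holes.Nodup) (by decide) (by decide)
  hidden := L.ctx_cases (P := fun C => ∀ l ∈ modelLinks, C.vis l.2.1 (.priv l.1) = false ∧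
    C.vis l.2.2.2.1 (.priv l.1) = false) (by decide) (by decide)
  com := L.ctx_cases (P := fun C => ∀ l ∈ modelLinks, l.2.1 ∈ C.holes → l.2.2.2.1 ∈ C.holes →
    C.com l.2.1 l.2.2.2.1 (.priv l.1) = true) (by decide) (by decide)
  send := by
    simp only [modelLinks, List.forall_mem_cons, List.not_mem_nil, false_implies, implies_true,
      and_true, thread, splitter]
    refine ⟨fun _ => polTh_out_iff.2 (.inl ?_), fun _ => polTh_out_iff.2 (.inr ?_),
      fun _ => polTh_out_iff.2 (.inl ?_), fun _ => polTh_out_iff.2 (.inr ?_),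
      fun _ => bsTh_out_iff.2 (.inl ?_), fun _ => bsTh_out_iff.2 (.inr ?_),
      fun _ => vacTh_out_iff.2 ⟨rfl, rfl, rfl, rfl⟩, fun _ => bsTh_out_iff.2 (.inr ?_),
      fun _ => bsTh_out_iff.2 (.inl ?_), fun _ => bsTh_out_iff.2 (.inr ?_),
      fun _ => bsTh_out_iff.2 (.inl ?_), fun _ => vacTh_out_iff.2 ⟨rfl, rfl, rfl, rfl⟩,
      fun _ => bsTh_out_iff.2 (.inl ?_), fun _ => bsTh_out_iff.2 (.inr ?_),
      fun _ => bsTh_out_iff.2 (.inl ?_), fun _ => bsTh_out_iff.2 (.inr ?_),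
      fun _ => detTh_out_iff.2 ⟨rfl, rfl, rfl, rfl⟩, fun _ => detTh_out_iff.2 ⟨rfl, rfl, rfl, rfl⟩⟩
    all_goals exact ⟨rfl, rfl, rfl, rfl⟩
  recv := by
    simp only [modelLinks, List.forall_mem_cons, List.not_mem_nil, false_implies, implies_true,
      and_true, thread, splitter]
    refine ⟨fun _ => bsTh_in_zero, fun _ => bsTh_in_one, fun _ => bsTh_in_zero, fun _ => bsTh_in_one,
      fun _ => bsTh_in_zero, fun _ => bsTh_in_zero, fun _ => bsTh_in_one, fun _ => dumpTh_in_zero,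
      fun _ => detTh_in_zero, fun _ => detTh_in_one, fun _ => bsTh_in_zero, fun _ => bsTh_in_one,
      fun _ => bsTh_in_one, fun _ => dumpTh_in_zero, fun _ => detTh_in_zero, fun _ => detTh_in_one,
      fun h => ?_, fun h => ?_⟩
    · exact countTh_in_zero
    · have : L.expr 2 = countExpr (L.w 0) (L.w 1) 0 := by rw [expr, h1 h.le]; rfl
      simp only [Nat.reduceAdd, this]
      exact countTh_in_one
  pOut := by
    intro i c vs X hi H
    have := lt_of_mem_holes hi
    have pol : ∀ {i ch₀ c₁ c₂ q s t k₁ k₂}, L.thread p i = polTh ch₀ (.priv c₁) (.priv c₂) q s t →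
        (c₁, i, 2, k₁) ∈ modelLinks → (c₂, i, 3, k₂) ∈ modelLinks →
        L.value c₁ = [modeVal s] → L.value c₂ = [modeVal t] → POut (L.thread p i (L.k i)) c vs X →
        ∃ l ∈ modelLinks, c = .priv l.1 ∧ i = l.2.1 ∧ L.k i = l.2.2.1 ∧ vs = L.value l.1 ∧
          X = L.thread p i (L.k i + 1) := by
      intro i ch₀ c₁ c₂ q s t k₁ k₂ hT m₁ m₂ v₁ v₂ H
      rw [hT] at H ⊢
      rcases polTh_out_iff.1 H with ⟨h1, h2, h3, h4⟩ | ⟨h1, h2, h3, h4⟩ <;> rw [h1, h2, h3, h4]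
      · exact ⟨_, m₁, rfl, rfl, rfl, v₁.symm, rfl⟩
      · exact ⟨_, m₂, rfl, rfl, rfl, v₂.symm, rfl⟩
    have bs : ∀ {i e f c₁ c₂ η s t k₁ k₂}, L.thread p i = bsTh e f (.priv c₁) (.priv c₂) η s t →
        (c₁, i, 4, k₁) ∈ modelLinks → (c₂, i, 5, k₂) ∈ modelLinks →
        L.value c₁ = [modeVal s] → L.value c₂ = [modeVal t] → POut (L.thread p i (L.k i)) c vs X →
        ∃ l ∈ modelLinks, c = .priv l.1 ∧ i = l.2.1 ∧ L.k i = l.2.2.1 ∧ vs = L.value l.1 ∧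
          X = L.thread p i (L.k i + 1) := by
      intro i e f c₁ c₂ η s t k₁ k₂ hT m₁ m₂ v₁ v₂ H
      rw [hT] at H ⊢
      rcases bsTh_out_iff.1 H with ⟨h1, h2, h3, h4⟩ | ⟨h1, h2, h3, h4⟩ <;> rw [h1, h2, h3, h4]
      · exact ⟨_, m₁, rfl, rfl, rfl, v₁.symm, rfl⟩
      · exact ⟨_, m₂, rfl, rfl, rfl, v₂.symm, rfl⟩
    have d : ∀ l ∈ modelLinks, l ∈ modelLinks := fun _ => id
    interval_cases i
    · exact .inl (pol rfl (d (0, 0, 2, 4, 0) (by decide)) (d (1, 0, 3, 6, 1) (by decide)) rfl rfl H)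
    · exact .inl (pol rfl (d (2, 1, 2, 2, 0) (by decide)) (d (3, 1, 3, 2, 1) (by decide)) rfl rfl H)
    · exact .inl (bs rfl (d (4, 2, 4, 6, 0) (by decide)) (d (5, 2, 5, 8, 0) (by decide)) rfl rfl H)
    · obtain ⟨h1, h2, h3, h4⟩ := vacTh_out_iff.1 H
      rw [h1, h2, h3, h4]
      exact .inl ⟨(6, 3, 0, 4, 1), by decide, rfl, rfl, rfl, rfl, rfl⟩
    · exact .inl (bs rfl (d (8, 4, 4, 11, 0) (by decide)) (d (7, 4, 5, 5, 0) (by decide)) rfl rfl H)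
    · exact absurd H not_pOut_dumpTh
    · exact .inl (bs rfl (d (10, 6, 4, 10, 0) (by decide)) (d (9, 6, 5, 11, 1) (by decide)) rfl rfl H)
    · obtain ⟨h1, h2, h3, h4⟩ := vacTh_out_iff.1 H
      rw [h1, h2, h3, h4]
      exact .inl ⟨(11, 7, 0, 8, 1), by decide, rfl, rfl, rfl, rfl, rfl⟩
    · exact .inl (bs rfl (d (12, 8, 4, 10, 1) (by decide)) (d (13, 8, 5, 9, 0) (by decide)) rfl rfl H)
    · exact absurd H not_pOut_dumpTh
    · exact .inl (bs rfl (d (14, 10, 4, 12, 0) (by decide)) (d (15, 10, 5, 12, 1) (by decide)) rfl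
        rfl H)
    · obtain ⟨h1, h2, h3, h4⟩ := detTh_out_iff.1 H
      rw [h1, h2, h3, h4]
      exact .inl ⟨(16, 11, 3, 13, 0), by decide, rfl, rfl, rfl, rfl, rfl⟩
    · obtain ⟨h1, h2, h3, h4⟩ := detTh_out_iff.1 H
      rw [h1, h2, h3, h4]
      exact .inl ⟨(17, 12, 3, 13, 1), by decide, rfl, rfl, rfl, rfl, rfl⟩
    · right
      obtain ⟨g1, g2, rfl, g3, -⟩ := countTh_out_iff.1 H
      have h4 : ∀ q, vs ≠ [.name q] := by
        rintro q rfl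
        rcases hL : L.e with _ | e
        · rw [expr, hL, Option.getD_none] at g3
          obtain h | h | h : L.k 13 - 2 = 0 ∨ L.k 13 - 2 = 1 ∨ L.k 13 - 2 = 2 := by omega
          all_goals rw [h] at g3; simp [countExpr] at g3
        · rw [expr, hL, Option.getD_some] at g3
          exact he q (by rw [hL, g3])
      obtain h | h | h : L.k 13 - 2 = 0 ∨ L.k 13 - 2 = 1 ∨ L.k 13 - 2 = 2 := by omega
      all_goals rw [h]; exact ⟨_, rfl, h4⟩
    · exact absurd H not_pOut_preTh
  pIn := by
    intro i c vs X hi H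
    have := lt_of_mem_holes hi
    have bs : ∀ {i h j c₁ c₂ η s t k₁ n₁ k₂ n₂},
        L.thread p i = bsTh (.priv c₁) (.priv c₂) h j η s t →
        (c₁, k₁, n₁, i, 0) ∈ modelLinks → (c₂, k₂, n₂, i, 1) ∈ modelLinks →
        L.value c₁ = [modeVal s] → L.value c₂ = [modeVal t] → PIn (L.thread p i (L.k i)) c vs X →
        ∃ l ∈ modelLinks, c = .priv l.1 ∧ i = l.2.2.2.1 ∧ L.k i = l.2.2.2.2 ∧
          (vs = L.value l.1 → X = L.thread p i (L.k i + 1)) := by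
      intro i h j c₁ c₂ η s t k₁ n₁ k₂ n₂ hT m₁ m₂ v₁ v₂ H
      rw [hT] at H ⊢
      rcases bsTh_in H with ⟨h1, h2, h3⟩ | ⟨h1, h2, h3⟩ <;> rw [h1, h2]
      · exact ⟨_, m₁, rfl, rfl, rfl, fun hv => h3 (hv.trans v₁)⟩
      · exact ⟨_, m₂, rfl, rfl, rfl, fun hv => h3 (hv.trans v₂)⟩
    have d : ∀ l ∈ modelLinks, l ∈ modelLinks := fun _ => id
    interval_cases i
    · obtain ⟨-, rfl, n, rfl, -⟩ := polTh_in_iff.1 H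
      exact .inr ⟨_, _, rfl, rfl⟩
    · obtain ⟨-, rfl, n, rfl, -⟩ := polTh_in_iff.1 H
      exact .inr ⟨_, _, rfl, rfl⟩
    · exact .inl (bs rfl (d (2, 1, 2, 2, 0) (by decide)) (d (3, 1, 3, 2, 1) (by decide)) rfl rfl H)
    · exact absurd H not_pIn_vacTh
    · exact .inl (bs rfl (d (0, 0, 2, 4, 0) (by decide)) (d (6, 3, 0, 4, 1) (by decide)) rfl rfl H)
    · obtain ⟨h1, h2, h3⟩ := dumpTh_in H
      rw [h1, h2]
      exact .inl ⟨(7, 4, 5, 5, 0), by decide, rfl, rfl, rfl, fun _ => h3⟩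
    · exact .inl (bs rfl (d (4, 2, 4, 6, 0) (by decide)) (d (1, 0, 3, 6, 1) (by decide)) rfl rfl H)
    · exact absurd H not_pIn_vacTh
    · exact .inl (bs rfl (d (5, 2, 5, 8, 0) (by decide)) (d (11, 7, 0, 8, 1) (by decide)) rfl rfl H)
    · obtain ⟨h1, h2, h3⟩ := dumpTh_in H
      rw [h1, h2]
      exact .inl ⟨(13, 8, 5, 9, 0), by decide, rfl, rfl, rfl, fun _ => h3⟩
    · exact .inl (bs rfl (d (10, 6, 4, 10, 0) (by decide)) (d (12, 8, 4, 10, 1) (by decide)) rfl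
        rfl H)
    · left
      rcases detTh_in H with ⟨h1, h2, h3⟩ | ⟨h1, h2, h3⟩ <;> rw [h1, h2]
      · exact ⟨(8, 4, 4, 11, 0), by decide, rfl, rfl, rfl, h3⟩
      · exact ⟨(9, 6, 5, 11, 1), by decide, rfl, rfl, rfl, h3⟩
    · left
      rcases detTh_in H with ⟨h1, h2, h3⟩ | ⟨h1, h2, h3⟩ <;> rw [h1, h2]
      · exact ⟨(14, 10, 4, 12, 0), by decide, rfl, rfl, rfl, h3⟩
      · exact ⟨(15, 10, 5, 12, 1), by decide, rfl, rfl, rfl, h3⟩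
    · left
      rcases countTh_in H with ⟨h2, h3, h4⟩ | ⟨h2, h3, h4⟩ <;> rw [h2, h3]
      · exact ⟨(16, 11, 3, 13, 0), by decide, rfl, rfl, rfl, h4⟩
      · refine ⟨(17, 12, 3, 13, 1), by decide, rfl, rfl, rfl, fun hv => (h4 hv).trans ?_⟩
        have : L.expr 2 = countExpr (L.w 0) (L.w 1) 0 := by rw [expr, h1 h2.le]; rfl
        simp only [thread, Nat.reduceAdd, this]
    · exact absurd H not_pIn_preTh

end ModelLoc

theorem bsTh_congr {e f h i : Chan} {η : ℝ} {s t s' t' n : ℕ} (hs : n = 0 ∨ s = s')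
    (ht : n ≤ 1 ∨ t = t') : bsTh e f h i η s t n = bsTh e f h i η s' t' n := by
  rcases hs with rfl | rfl
  · rfl
  · rcases ht with ht | rfl
    · interval_cases n <;> rfl
    · rfl

theorem detTh_congr {l m u : Chan} {s t w s' t' w' n : ℕ} (hs : n = 0 ∨ s = s')
    (ht : n ≤ 1 ∨ t = t') (hw : n ≤ 2 ∨ w = w') :
    detTh l m u s t w n = detTh l m u s' t' w' n := by
  rcases hs with rfl | rfl
  · rfl
  · rcases ht with ht | rfl
    · interval_cases n <;> rfl
    · rcases hw with hw | rfl
      · interval_cases n <;> rfl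
      · rfl

theorem countTh_congr {u v o₁ c o₂ : Chan} {w w' r r' n : ℕ} {e e' : Expr}
    (h : n = 0 ∨ w = r ∧ n = 1) :
    countTh u v o₁ c o₂ w w' e n = countTh u v o₁ c o₂ r r' e' n := by
  rcases h with rfl | ⟨rfl, rfl⟩
  · rfl
  · rfl

namespace ModelLoc

/-- The lengths of the threads. -/
def bound (i : ℕ) : ℕ := [4, 4, 6, 1, 6, 1, 6, 1, 6, 1, 6, 4, 4, 5, 2].getD i 0

/-- The number of remaining steps of the threads. -/
def remaining (k : ℕ → ℕ) : ℕ := ∑ i ∈ Finset.range 15, (bound i - k i)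

/-- A bound for the number of remaining steps. -/
def rank (L : ModelLoc) : ℕ := remaining L.k + (L.expr (L.k 13)).size

theorem remaining_incr {k : ℕ → ℕ} {i : ℕ} (hi : i < 15) (h : k i < bound i) :
    remaining (incr k i) < remaining k := by
  refine Finset.sum_lt_sum (fun j _ => ?_) ⟨i, Finset.mem_range.2 hi, ?_⟩
  · by_cases hj : j = i
    · subst hj
      rw [incr_same]
      omega
    · rw [incr_ne k hj]
  · rw [incr_same]
    omega

theorem incr_le_bound {k : ℕ → ℕ} (h : ∀ i < 15, k i ≤ bound i) {i : ℕ} (hi : k i < bound i) :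
    ∀ j < 15, incr k i j ≤ bound j := by
  intro j hj
  by_cases hji : j = i
  · subst hji
    rw [incr_same]
    omega
  · rw [incr_ne k hji]
    exact h j hj

theorem size_expr {L L' : ModelLoc} (he : L.e = L'.e) {m n : ℕ} (h : m - 2 = n - 2) :
    (L.expr m).size = (L'.expr n).size := by
  rw [expr, expr, he, h]
  cases L'.e
  · simp only [Option.getD_none]
    generalize n - 2 = j
    match j with
    | 0 => rfl
    | 1 => rfl
    | _ + 2 => rfl
  · rfl

theorem rank_incr {L L' : ModelLoc} {i : ℕ} (hi : i < 15) (h : L.k i < bound i)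
    (hk : L'.k = incr L.k i) (he : L'.e = L.e) (h13 : i ≠ 13) : L'.rank < L.rank := by
  rw [rank, rank, size_expr he (n := L.k 13) (by rw [hk, incr_ne _ h13.symm]), hk]
  exact Nat.add_lt_add_right (remaining_incr hi h) _

theorem fill_eq_proc {p : Ports} {L L' : ModelLoc} {i : ℕ} {X : Proc} (h14 : L'.k 14 = L.k 14)
    (hX : X = L'.thread p i (L'.k i))
    (h : ∀ j < 15, j ≠ i → L.thread p j (L.k j) = L'.thread p j (L'.k j)) :
    L.ctx.fill (Function.update (fun i => L.thread p i (L.k i)) i X) = L'.proc p := by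
  have e : L'.ctx = L.ctx := by rw [ctx, ctx, h14]
  rw [proc, e]
  exact Ctx.fill_update_eq hX fun j hj => h j (lt_of_mem_holes hj)

end ModelLoc

/-! ### Stages of a run of the model -/

section Stages

variable {k : ℕ → ℕ} (h : Links modelLinks k)
include h

theorem model_order : (2 < k 0 ↔ 0 < k 4) ∧ (3 < k 0 ↔ 1 < k 6) ∧ (2 < k 1 ↔ 0 < k 2) ∧
    (3 < k 1 ↔ 1 < k 2) ∧ (4 < k 2 ↔ 0 < k 6) ∧ (5 < k 2 ↔ 0 < k 8) ∧ (0 < k 3 ↔ 1 < k 4) ∧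
    (5 < k 4 ↔ 0 < k 5) ∧ (4 < k 4 ↔ 0 < k 11) ∧ (5 < k 6 ↔ 1 < k 11) ∧ (4 < k 6 ↔ 0 < k 10) ∧
    (0 < k 7 ↔ 1 < k 8) ∧ (4 < k 8 ↔ 1 < k 10) ∧ (5 < k 8 ↔ 0 < k 9) ∧ (4 < k 10 ↔ 0 < k 12) ∧
    (5 < k 10 ↔ 1 < k 12) ∧ (3 < k 11 ↔ 0 < k 13) ∧ (3 < k 12 ↔ 1 < k 13) := by
  simpa [Links, modelLinks] using h

theorem stage_of_le_one (h0 : k 0 ≤ 1) :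
    k 4 = 0 ∧ k 6 ≤ 1 ∧ k 10 = 0 ∧ k 11 = 0 ∧ k 12 = 0 ∧ k 13 = 0 := by
  obtain ⟨l0, l1, -, -, -, -, -, -, l8, -, l10, -, -, -, l14, -, l16, -⟩ := model_order h
  refine ⟨?_, ?_, ?_, ?_, ?_, ?_⟩ <;> omega

theorem stage_of_le_one' (h1 : k 1 ≤ 1) :
    k 2 = 0 ∧ k 6 = 0 ∧ k 8 = 0 ∧ k 10 = 0 ∧ k 11 ≤ 1 ∧ k 12 = 0 ∧ k 13 = 0 := by
  obtain ⟨-, -, l2, -, l4, l5, -, -, -, l9, l10, -, -, -, l14, -, l16, -⟩ := model_order h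
  refine ⟨?_, ?_, ?_, ?_, ?_, ?_, ?_⟩ <;> omega

theorem stage_two (h2 : k 2 ≤ 2) :
    k 6 = 0 ∧ k 8 = 0 ∧ k 10 = 0 ∧ k 11 ≤ 1 ∧ k 12 = 0 ∧ k 13 = 0 := by
  obtain ⟨-, -, -, -, l4, l5, -, -, -, l9, l10, -, -, -, l14, -, l16, -⟩ := model_order h
  refine ⟨?_, ?_, ?_, ?_, ?_, ?_⟩ <;> omega

theorem stage_four (h4 : k 4 ≤ 2) : k 11 = 0 ∧ k 13 = 0 := by
  obtain ⟨-, -, -, -, -, -, -, -, l8, -, -, -, -, -, -, -, l16, -⟩ := model_order h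
  refine ⟨?_, ?_⟩ <;> omega

theorem stage_six (h6 : k 6 ≤ 2) : k 10 = 0 ∧ k 11 ≤ 1 ∧ k 12 = 0 ∧ k 13 = 0 := by
  obtain ⟨-, -, -, -, -, -, -, -, -, l9, l10, -, -, -, l14, -, l16, -⟩ := model_order h
  refine ⟨?_, ?_, ?_, ?_⟩ <;> omega

theorem stage_eight (h8 : k 8 ≤ 2) : k 10 ≤ 1 ∧ k 12 = 0 ∧ k 13 ≤ 1 := by
  obtain ⟨-, -, -, -, -, -, -, -, -, -, -, -, l12, -, l14, -, -, l17⟩ := model_order h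
  refine ⟨?_, ?_, ?_⟩ <;> omega

theorem stage_ten (h10 : k 10 ≤ 2) : k 12 = 0 ∧ k 13 ≤ 1 := by
  obtain ⟨-, -, -, -, -, -, -, -, -, -, -, -, -, -, l14, -, -, l17⟩ := model_order h
  refine ⟨?_, ?_⟩ <;> omega

theorem stage_eleven (h11 : k 11 ≤ 3) : k 13 = 0 := by
  obtain ⟨-, -, -, -, -, -, -, -, -, -, -, -, -, -, -, -, l16, -⟩ := model_order h
  omega

theorem stage_twelve (h12 : k 12 ≤ 3) : k 13 ≤ 1 := by
  obtain ⟨-, -, -, -, -, -, -, -, -, -, -, -, -, -, -, -, -, l17⟩ := model_order h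
  omega

theorem two_lt_of_four (h4 : 0 < k 4) : 2 < k 0 := (model_order h).1.2 h4

theorem two_lt_of_two (h2 : 0 < k 2) : 2 < k 1 := (model_order h).2.2.1.2 h2

theorem of_six (h6 : 1 < k 6) : 3 < k 0 ∧ 4 < k 2 := by
  obtain ⟨-, l1, -, -, l4, -⟩ := model_order h
  omega

theorem of_eight (h8 : 0 < k 8) : 5 < k 2 := by
  obtain ⟨-, -, -, -, -, l5, -⟩ := model_order h
  omega

theorem of_ten (h10 : 1 < k 10) : 4 < k 6 ∧ 4 < k 8 := by
  obtain ⟨-, -, -, -, -, -, -, -, -, -, l10, -, l12, -⟩ := model_order h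
  omega

theorem of_eleven (h11 : 1 < k 11) : 4 < k 4 ∧ 5 < k 6 := by
  obtain ⟨-, -, -, -, -, -, -, -, l8, l9, -⟩ := model_order h
  omega

theorem of_twelve (h12 : 1 < k 12) : 5 < k 10 := by
  obtain ⟨-, -, -, -, -, -, -, -, -, -, -, -, -, -, -, l15, -⟩ := model_order h
  omega

theorem of_thirteen (h13 : 1 < k 13) : 3 < k 11 ∧ 3 < k 12 := by
  obtain ⟨-, -, -, -, -, -, -, -, -, -, -, -, -, -, -, -, l16, l17⟩ := model_order h
  omega

theorem model_sound (hpre : k 14 < 2 → ∀ i, 2 ≤ i → i ≤ 10 → k i = 0) :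
    ModelLoc.Sound (flags modelThr k) := by
  have f0 : flags modelThr k 0 = decide (2 ≤ k 0) := rfl
  have f1 : flags modelThr k 1 = decide (2 ≤ k 1) := rfl
  have f9 : flags modelThr k 9 = decide (1 ≤ k 14) := rfl
  have f10 : flags modelThr k 10 = decide (2 ≤ k 14) := rfl
  intro x hx hb
  have p0 := hpre
  simp only [ModelLoc.Created, f0, f1, f9, f10, decide_eq_true_eq]
  interval_cases x <;> simp only [flags, modelThr, List.getElem?_cons_zero,
    List.getElem?_cons_succ, decide_eq_true_eq] at hb <;> simp [opticalPair]
  · exact hb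
  · exact hb
  · have := two_lt_of_two h (by omega)
    omega
  · have := two_lt_of_four h (by omega)
    have : ¬ k 14 < 2 := fun hc => by have := hpre hc 4 (by omega) (by omega); omega
    omega
  · have g := of_six h (by omega)
    have := two_lt_of_two h (by omega)
    omega
  · have g := of_eight h (by omega)
    have := two_lt_of_two h (by omega)
    have : ¬ k 14 < 2 := fun hc => by have := hpre hc 8 (by omega) (by omega); omega
    omega
  · have g := of_ten h (by omega)
    have g' := of_six h (by omega)
    have := two_lt_of_two h (by omega)
    omega

theorem model_flags_true (hpre : k 14 < 2 → ∀ i, 2 ≤ i → i ≤ 10 → k i = 0) (h13 : 2 ≤ k 13) :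
    ∀ x ≤ 12, flags modelThr k x = true := by
  obtain ⟨g1, g2⟩ := of_thirteen h h13
  obtain ⟨g3, g4⟩ := of_eleven h (by omega)
  have g5 := of_twelve h (by omega)
  obtain ⟨g6, g7⟩ := of_ten h (by omega)
  obtain ⟨g8, g9⟩ := of_six h (by omega)
  have g10 := two_lt_of_two h (by omega)
  have : ¬ k 14 < 2 := fun hc => by have := hpre hc 4 (by omega) (by omega); omega
  intro x hx
  interval_cases x <;> simp [flags, modelThr] <;> omega

end Stages

/-- The reachable configurations of the model. -/
structure ModelInv (own₀ : Finset QName) (env₀ : List QName) (ψ : State) (α : Hist) (L : ModelLoc)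
    (S : Store) : Prop where
  links : Links modelLinks L.k
  bound : ∀ i < 15, L.k i ≤ ModelLoc.bound i
  pre : L.k 14 < 2 → ∀ i, 2 ≤ i → i ≤ 10 → L.k i = 0
  len : α.outs.length = L.k 13 - 2
  low : L.k 13 ≤ 1 → L.e = none
  data : ∀ q, L.e ≠ some (.vals [.name q])
  quant : ∃ rec, ModelQuant own₀ env₀ ψ α L (flags modelThr L.k) S rec ∧
    (2 ≤ L.k 13 → L.k 13 ≤ 4 → ModelExpr L S.width rec (L.k 13 - 2) (L.expr (L.k 13)))

namespace ModelInv

variable {own₀ : Finset QName} {env₀ : List QName} {ψ : State} {α : Hist} {L : ModelLoc} {S : Store}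

theorem wired (h : ModelInv own₀ env₀ ψ α L S) (p : Ports) :
    Wired L.ctx modelLinks (L.thread p) L.value L.k := L.wired p h.low h.data

theorem outs_eq_nil (h : ModelInv own₀ env₀ ψ α L S) (hk : L.k 13 ≤ 2) : α.outs = [] :=
  List.eq_nil_of_length_eq_zero (by rw [h.len]; omega)

theorem sound (h : ModelInv own₀ env₀ ψ α L S) : ModelLoc.Sound (flags modelThr L.k) :=
  model_sound h.links h.pre

theorem flags_true (h : ModelInv own₀ env₀ ψ α L S) (hk : 2 ≤ L.k 13) :
    ∀ x ≤ 12, flags modelThr L.k x = true := model_flags_true h.links h.pre hk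

/-- A step of a single thread which does not concern the results. -/
theorem step (h : ModelInv own₀ env₀ ψ α L S) {α' : Hist} {L' : ModelLoc} {S' : Store} {i n : ℕ}
    (hi : i < 15) (hn : L.k i = n) (h13 : i ≠ 13) (hk : L'.k = incr L.k i) (he : L'.e = L.e)
    (hlt : n < ModelLoc.bound i)
    (hL : ∀ l ∈ modelLinks, (l.2.1 = i → l.2.2.1 ≠ n) ∧ (l.2.2.2.1 = i → l.2.2.2.2 ≠ n))
    (hpre : L'.k 14 < 2 → i < 2 ∨ 10 < i) (hα : α'.outs = α.outs)
    (hq : (L'.k 14 < 2 → ∀ i, 2 ≤ i → i ≤ 10 → L'.k i = 0) → ∀ rec,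
      ModelQuant own₀ env₀ ψ α L (flags modelThr L.k) S rec →
      (2 ≤ L.k 13 → L.k 13 ≤ 4 → ModelExpr L S.width rec (L.k 13 - 2) (L.expr (L.k 13))) →
      ∃ rec', ModelQuant own₀ env₀ ψ α' L' (flags modelThr L'.k) S' rec' ∧
        (2 ≤ L.k 13 → L.k 13 ≤ 4 →
          ModelExpr L' S'.width rec' (L.k 13 - 2) (L'.expr (L.k 13)))) :
    ModelInv own₀ env₀ ψ α' L' S' ∧ L'.rank < L.rank := by
  subst hn
  have e13 : L'.k 13 = L.k 13 := by rw [hk, incr_ne _ h13.symm]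
  have hp : L'.k 14 < 2 → ∀ i, 2 ≤ i → i ≤ 10 → L'.k i = 0 := by
    intro hc j hj hj'
    have hij := hpre hc
    rw [hk, incr_ne _ (by omega)]
    refine h.pre ?_ j hj hj'
    rw [hk] at hc
    refine lt_of_le_of_lt ?_ hc
    by_cases h14 : 14 = i
    · subst h14
      rw [incr_same]
      omega
    · rw [incr_ne _ h14]
  obtain ⟨rec, hr, hx⟩ := h.quant
  obtain ⟨rec', hr', hx'⟩ := hq hp rec hr hx
  refine ⟨⟨?_, ?_, hp, ?_, ?_, ?_, rec', hr', ?_⟩, ModelLoc.rank_incr hi hlt hk he h13⟩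
  · rw [hk]
    exact h.links.step hL
  · rw [hk]
    exact ModelLoc.incr_le_bound h.bound hlt
  · rw [hα, e13]
    exact h.len
  · rw [e13, he]
    exact h.low
  · rw [he]
    exact h.data
  · rw [e13]
    exact hx'

theorem split_a (h : ModelInv own₀ env₀ ψ α L S) (hk : L.k 0 = 1) {m n : ℕ} (hm : S.Fresh (.ns m))
    (hn : S.Fresh (.ns n)) (hmn : m ≠ n) {L' : ModelLoc} (hL : L' =
      { L with nm := Function.update (Function.update L.nm 0 m) 1 n, k := incr L.k 0 }) :
    ModelInv own₀ env₀ ψ α L' { S with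
        own := insert (.ns m) (insert (.ns n) (S.own.erase (.qb L.qa)))
        st := fun v => psAct (.qb L.qa) (.ns m) (.ns n) (S.st v) } ∧ L'.rank < L.rank := by
  subst hL
  obtain ⟨g4, g6, g10, g11, g12, g13⟩ := stage_of_le_one h.links hk.le
  refine h.step (i := 0) (by omega) hk (by omega) rfl rfl (by decide) (by decide)
    (fun _ => .inl (by omega)) rfl fun hp rec hq _ => ⟨rec, ?_, fun h2 => by omega⟩
  have hs := model_sound (h.links.step (i := 0) (by rw [hk]; decide)) hp
  show ModelQuant _ _ _ _ _ (flags modelThr (incr L.k 0)) _ _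
  rw [flags_incr (x := 0) (by decide) hk rfl] at hs ⊢
  exact (hq.split_a (h.outs_eq_nil (by omega)) (by simp [flags, modelThr]; omega)
    (by simp [flags, modelThr]; omega) (by simp [flags, modelThr]; omega)
    (by simp [flags, modelThr]; omega) (by simp [flags, modelThr]; omega) (fun y hy hb => by
      interval_cases y <;> first
        | decide
        | (simp [flags, modelThr] at hb; omega)) hs hm hn hmn).with_counters _ _

theorem split_b (h : ModelInv own₀ env₀ ψ α L S) (hk : L.k 1 = 1) {m n : ℕ} (hm : S.Fresh (.ns m))
    (hn : S.Fresh (.ns n)) (hmn : m ≠ n) {L' : ModelLoc} (hL : L' =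
      { L with nm := Function.update (Function.update L.nm 2 m) 3 n, k := incr L.k 1 }) :
    ModelInv own₀ env₀ ψ α L' { S with
        own := insert (.ns m) (insert (.ns n) (S.own.erase (.qb L.qb)))
        st := fun v => psAct (.qb L.qb) (.ns m) (.ns n) (S.st v) } ∧ L'.rank < L.rank := by
  subst hL
  obtain ⟨g2, g6, g8, g10, g11, g12, g13⟩ := stage_of_le_one' h.links hk.le
  refine h.step (i := 1) (by omega) hk (by omega) rfl rfl (by decide) (by decide)
    (fun _ => .inl (by omega)) rfl fun hp rec hq _ => ⟨rec, ?_, fun h2 => by omega⟩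
  have hs := model_sound (h.links.step (i := 1) (by rw [hk]; decide)) hp
  show ModelQuant _ _ _ _ _ (flags modelThr (incr L.k 1)) _ _
  rw [flags_incr (x := 1) (by decide) hk rfl] at hs ⊢
  exact (hq.split_b (h.outs_eq_nil (by omega)) (by simp [flags, modelThr]; omega)
    (by simp [flags, modelThr]; omega) (by simp [flags, modelThr]; omega)
    (by simp [flags, modelThr]; omega) (by simp [flags, modelThr]; omega) (fun y hy _ hb => by
      interval_cases y <;> first
        | decide
        | (simp [flags, modelThr] at hb; omega)) hs hm hn hmn).with_counters _ _

theorem create (h : ModelInv own₀ env₀ ψ α L S) (hk : L.k 14 < 2) {n : ℕ} (hn : S.Fresh (.ns n))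
    {L' : ModelLoc} (hL : L' =
      { L with nm := Function.update L.nm (4 + L.k 14) n, k := incr L.k 14 }) :
    ModelInv own₀ env₀ ψ α L' { S with own := insert (.ns n) S.own } ∧ L'.rank < L.rank := by
  subst hL
  have hpre := h.pre hk
  have g10 := (stage_ten h.links (by rw [hpre 10 (by omega) le_rfl]; omega)).1
  have g13 := (stage_four h.links (by rw [hpre 4 (by omega) (by omega)]; omega)).2
  have key : ∀ j, L.k 14 = j → j < 2 → (∀ l ∈ modelLinks, (l.2.1 = 14 → l.2.2.1 ≠ j) ∧
      (l.2.2.2.1 = 14 → l.2.2.2.2 ≠ j)) ∧ modelThr[9 + j]? = some (14, j + 1) := by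
    intro j _ hj
    interval_cases j <;> decide
  obtain ⟨k1, k2⟩ := key _ rfl hk
  refine h.step (i := 14) (by omega) rfl (by omega) rfl rfl hk k1
    (fun _ => .inr (by omega)) rfl fun hp rec hq _ => ⟨rec, ?_, fun h2 => by omega⟩
  show ModelQuant _ _ _ _ _ (flags modelThr (incr L.k 14)) _ _
  rw [flags_incr (x := 9 + L.k 14) (by decide) rfl k2]
  have hb : flags modelThr L.k (9 + L.k 14) = false := by
    simp [flags, k2]
  have := hq.create (i := 4 + L.k 14) (by omega) (by omega)
    (by rw [show 5 + (4 + L.k 14) = 9 + L.k 14 by omega]; exact hb) (fun x hx hbx => ?_) hn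
  · rw [show 5 + (4 + L.k 14) = 9 + L.k 14 by omega] at this
    exact this.with_counters _ _
  · have p2 := hpre 2 (by omega) (by omega)
    have p4 := hpre 4 (by omega) (by omega)
    have p6 := hpre 6 (by omega) (by omega)
    have p8 := hpre 8 (by omega) (by omega)
    have p10 := hpre 10 (by omega) (by omega)
    interval_cases x <;> first
      | (simp [flags, modelThr, p2, p4, p6, p8, p10] at hbx; done)
      | (simp [opticalPair]; omega)

/-- The photons pass a beam splitter. -/
theorem gate (h : ModelInv own₀ env₀ ψ α L S) {i x : ℕ} (hi : i < 15) (hk : L.k i = 2)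
    (hx : x < 7) (hx2 : 2 ≤ x) (hthr : modelThr[x]? = some (i, 3)) (hb : 2 < ModelLoc.bound i)
    (hl : ∀ l ∈ modelLinks, (l.2.1 = i → l.2.2.1 ≠ 2) ∧ (l.2.2.2.1 = i → l.2.2.2.2 ≠ 2))
    (hi' : 2 ≤ i ∧ i ≤ 10) (h12 : L.k 13 ≤ 1) (h78 : L.k 11 ≤ 2 ∨ L.k 12 ≤ 2)
    (hy : ∀ y < 7, x < y → flags modelThr L.k y = true → Apart x y)
    (hd : ∀ s < 2, flags modelThr L.k (7 + s) = true → Apart x s) {L' : ModelLoc}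
    (hL : L' = { L with k := incr L.k i }) :
    ModelInv own₀ env₀ ψ α L' (S.transform (fun _ => true) (pairAct (bsAmp (reflectivity x))
      (.ns (L.nm (opticalPair x).1)) (.ns (L.nm (opticalPair x).2)))) ∧ L'.rank < L.rank := by
  subst hL
  have h14 : ¬ incr L.k i 14 < 2 := by
    rw [incr_ne _ (by omega)]
    intro hc
    have := h.pre hc i hi'.1 hi'.2
    omega
  refine h.step (i := i) (by omega) hk (by omega) rfl rfl hb hl (fun hc => absurd hc h14) rfl
    fun hp rec hq _ => ⟨rec, ?_, fun h2 => by omega⟩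
  have hs := model_sound (h.links.step (i := i) (by rw [hk]; exact hl)) hp
  show ModelQuant _ _ _ _ _ (flags modelThr (incr L.k i)) _ _
  rw [flags_incr (x := x) (by decide) hk hthr] at hs ⊢
  refine (hq.gate (h.outs_eq_nil (by omega)) hx hx2 ?_ ?_ hs hy
    (fun s hs2 hbs => ⟨?_, hd s hs2 hbs⟩)).with_counters _ _
  · simp [flags, hthr, hk]
  · exact h78.imp (fun h => by simp [flags, modelThr]; omega)
      (fun h => by simp [flags, modelThr]; omega)
  · interval_cases s
    · change decide (3 ≤ L.k 11) = true at hbs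
      have h3 : 3 ≤ L.k 11 := of_decide_eq_true hbs
      have g := of_eleven h.links (by omega)
      have := two_lt_of_four h.links (by omega)
      simp [flags, modelThr]
      omega
    · change decide (3 ≤ L.k 12) = true at hbs
      have h3 : 3 ≤ L.k 12 := of_decide_eq_true hbs
      have g := of_twelve h.links (by omega)
      have g' := of_ten h.links (by omega)
      have g'' := of_six h.links (by omega)
      have := two_lt_of_two h.links (by omega)
      simp [flags, modelThr]
      omega

theorem skip (h : ModelInv own₀ env₀ ψ α L S) {i : ℕ} (hi : i < 15) (hk : L.k i = 3)
    (hthr : (i, 4) ∉ modelThr) (hb : 3 < ModelLoc.bound i)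
    (hl : ∀ l ∈ modelLinks, (l.2.1 = i → l.2.2.1 ≠ 3) ∧ (l.2.2.2.1 = i → l.2.2.2.2 ≠ 3))
    (hi' : 2 ≤ i ∧ i ≤ 10) {L' : ModelLoc} (hL : L' = { L with k := incr L.k i }) :
    ModelInv own₀ env₀ ψ α L' S ∧ L'.rank < L.rank := by
  subst hL
  have h14 : ¬ incr L.k i 14 < 2 := by
    rw [incr_ne _ (by omega)]
    intro hc
    have := h.pre hc i hi'.1 hi'.2
    omega
  refine h.step (i := i) (by omega) hk (by omega) rfl rfl hb hl (fun hc => absurd hc h14) rfl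
    fun hp rec hq hx => ⟨rec, ?_, hx⟩
  show ModelQuant _ _ _ _ _ (flags modelThr (incr L.k i)) _ _
  rw [flags_incr_of_notMem hk hthr]
  exact hq.with_counters _ _

/-- The photons of the control (`s = 0`) or of the target (`s = 1`) are counted. -/
theorem detect (h : ModelInv own₀ env₀ ψ α L S) (hψ : IsState (own₀ ∪ env₀.toFinset) ψ) {s : ℕ}
    (hs : s < 2) (hk : L.k (11 + s) = 2) (h12 : L.k 13 ≤ 1) {L' : ModelLoc} (hL : L' =
      { L with w := Function.update L.w s S.width, k := incr L.k (11 + s) }) :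
    ModelInv own₀ env₀ ψ α L' (S.measure (fun _ => true) 2
      (obsNS [.ns (L.nm (2 * s)), .ns (L.nm (2 * s + 1))])) ∧ L'.rank < L.rank := by
  subst hL
  have key : (∀ l ∈ modelLinks, (l.2.1 = 11 + s → l.2.2.1 ≠ 2) ∧
      (l.2.2.2.1 = 11 + s → l.2.2.2.2 ≠ 2)) ∧ modelThr[7 + s]? = some (11 + s, 3) ∧
      2 < ModelLoc.bound (11 + s) := by
    interval_cases s <;> decide
  refine h.step (i := 11 + s) (by omega) hk (by omega) rfl rfl key.2.2 key.1
    (fun _ => .inr (by omega)) rfl fun hp rec hq _ => ⟨fun f =>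
      rec f ++ [(f (.ns (L.nm (2 * s))) : ℤ), (f (.ns (L.nm (2 * s + 1))) : ℤ)], ?_,
      fun h2 => absurd h2 (by omega)⟩
  · show ModelQuant _ _ _ _ _ (flags modelThr (incr L.k (11 + s))) _ _
    rw [flags_incr (x := 7 + s) (by decide) hk key.2.1]
    exact (hq.detect hψ h.sound hs (by simp [flags, key.2.1, hk])).with_counters _ _

theorem communicate (h : ModelInv own₀ env₀ ψ α L S) {l : ℕ × ℕ × ℕ × ℕ × ℕ} (hl : l ∈ modelLinks)
    (hc1 : l.2.1 ∈ L.ctx.holes) (hc2 : l.2.2.2.1 ∈ L.ctx.holes)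
    (h1 : L.k l.2.1 = l.2.2.1) (h2 : L.k l.2.2.2.1 = l.2.2.2.2) {L' : ModelLoc}
    (hL : L' = { L with k := incr (incr L.k l.2.1) l.2.2.2.1 }) :
    L'.ctx = L.ctx ∧ ModelInv own₀ env₀ ψ α L' S ∧ L'.rank < L.rank := by
  subst hL
  obtain ⟨hne, t1, t2, b1, b2, l1, l2, n1, n2⟩ :=
    (by decide : ∀ l ∈ modelLinks, l.2.1 ≠ l.2.2.2.1 ∧ (l.2.1, l.2.2.1 + 1) ∉ modelThr ∧
      (l.2.2.2.1, l.2.2.2.2 + 1) ∉ modelThr ∧ l.2.2.1 < ModelLoc.bound l.2.1 ∧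
      l.2.2.2.2 < ModelLoc.bound l.2.2.2.1 ∧ l.2.1 < 13 ∧ l.2.2.2.1 < 14 ∧
      (l.2.2.2.1 = 13 → l.2.2.2.2 ≤ 1) ∧
      (l.2.1 ∈ preCtx.holes → l.2.2.2.1 ∈ preCtx.holes → 10 < l.2.1 ∧ 10 < l.2.2.2.1)) l hl
  have hflags := flags_communicate hne h1 h2 t1 t2
  have h2' : incr L.k l.2.1 l.2.2.2.1 = l.2.2.2.2 := by rw [incr_ne _ hne.symm, h2]
  have e14 : incr (incr L.k l.2.1) l.2.2.2.1 14 = L.k 14 := by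
    rw [incr_ne _ (by omega), incr_ne _ (by omega)]
  have e13 : incr (incr L.k l.2.1) l.2.2.2.1 13 = L.k 13 ∨
      (L.k 13 ≤ 1 ∧ incr (incr L.k l.2.1) l.2.2.2.1 13 = L.k 13 + 1) := by
    by_cases hj : 13 = l.2.2.2.1
    · right
      rw [hj, incr_same, incr_ne _ hne.symm]
      exact ⟨by rw [h2]; exact n1 hj.symm, rfl⟩
    · left
      rw [incr_ne _ hj, incr_ne _ (by omega)]
  have hlinks := h.links.communicate (by decide) hl h1 h2
  have hpre : incr (incr L.k l.2.1) l.2.2.2.1 14 < 2 → ∀ i, 2 ≤ i → i ≤ 10 →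
      incr (incr L.k l.2.1) l.2.2.2.1 i = 0 := by
    intro hc i hi hi'
    rw [e14] at hc
    rw [ModelLoc.ctx, if_pos hc] at hc1 hc2
    have := n2 hc1 hc2
    rw [incr_ne _ (by omega), incr_ne _ (by omega)]
    exact h.pre hc i hi hi'
  have hbound := ModelLoc.incr_le_bound (ModelLoc.incr_le_bound h.bound (by rw [h1]; exact b1))
    (i := l.2.2.2.1) (by rw [h2']; exact b2)
  have hrem := (ModelLoc.remaining_incr (k := incr L.k l.2.1) (i := l.2.2.2.1) (by omega)
    (by rw [h2']; exact b2)).trans (ModelLoc.remaining_incr (k := L.k) (i := l.2.1) (by omega)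
    (by rw [h1]; exact b1))
  have hlen := h.len
  have hlow := h.low
  generalize hk' : incr (incr L.k l.2.1) l.2.2.2.1 = k' at *
  have e2 : k' 13 - 2 = L.k 13 - 2 := by omega
  have hr : ({ L with k := k' } : ModelLoc).expr (k' 13) = L.expr (L.k 13) := by
    show L.expr (k' 13) = _
    rw [ModelLoc.expr, ModelLoc.expr, e2]
  obtain ⟨rec, hq, hx⟩ := h.quant
  refine ⟨?_, ⟨hlinks, hbound, hpre, ?_, fun hc => ?_, h.data,
    rec, ?_, fun h3 h4 => ?_⟩, ?_⟩
  · show (if k' 14 < 2 then preCtx else modelCtx) = _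
    rw [e14]
    rfl
  · show _ = k' 13 - 2
    rw [e2, hlen]
  · exact hlow (by change k' 13 ≤ 1 at hc; omega)
  · show ModelQuant _ _ _ _ _ (flags modelThr k') _ _
    rw [hflags]
    exact hq.with_counters _ _
  · change 2 ≤ k' 13 at h3
    change k' 13 ≤ 4 at h4
    show ModelExpr _ _ _ (k' 13 - 2) (ModelLoc.expr { L with k := k' } (k' 13))
    rw [hr, e2]
    by_cases hc : 2 ≤ L.k 13
    · exact hx hc (by omega)
    · have e0 : L.k 13 - 2 = 0 := by omega
      have hf := model_flags_true hlinks hpre h3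
      rw [ModelLoc.expr, hlow (by omega), e0, Option.getD_none]
      rw [hflags] at hf
      exact hq.modelExpr_count (hf 7 (by omega)) (hf 8 (by omega)) (by omega)
  · rw [ModelLoc.rank, ModelLoc.rank, hr]
    exact Nat.add_lt_add_right hrem _

theorem eval (h : ModelInv own₀ env₀ ψ α L S) (hk : 2 ≤ L.k 13) (hk' : L.k 13 ≤ 4) {S' : Store}
    {e' : Expr} (H : EStep (fun _ => true) S (L.expr (L.k 13)) S' e') {L' : ModelLoc}
    (hL : L' = { L with e := some e' }) :
    ModelInv own₀ env₀ ψ α L' S' ∧ L'.rank < L.rank := by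
  subst hL
  obtain ⟨rec, hq, hx⟩ := h.quant
  obtain ⟨rec', h1, h2, h3⟩ := hq.eStep (h.flags_true hk 7 (by omega)) (h.flags_true hk 8 (by omega))
    (hx hk hk') H
  refine ⟨⟨h.links, h.bound, h.pre, h.len, fun h4 => ?_, fun q h4 => ?_, rec',
    h1.with_counters _ _, fun _ _ => h2⟩, ?_⟩
  · exact absurd h4 (by show ¬ L.k 13 ≤ 1; omega)
  · cases h4
    obtain ⟨v, g1, g2, -⟩ := ModelQuant.modelExpr_vals h2
    cases g1
    cases g2
  · exact Nat.add_lt_add_left h3 _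

end ModelInv

/-- What has not yet happened when the photons pass a beam splitter. -/
theorem stage_gate {k : ℕ → ℕ} (h : Links modelLinks k) {x i : ℕ} (hx2 : 2 ≤ x) (hx : x < 7)
    (hthr : modelThr[x]? = some (i, 3)) (hk : k i = 2) : k 13 ≤ 1 ∧ (k 11 ≤ 2 ∨ k 12 ≤ 2) ∧
      (∀ y < 7, x < y → flags modelThr k y = true → Apart x y) ∧
      ∀ s < 2, flags modelThr k (7 + s) = true → Apart x s := by
  have hi : i = 2 * x - 2 := by
    interval_cases x <;> simp [modelThr] at hthr <;> omega
  have key : k 13 ≤ 1 ∧ (k 11 ≤ 2 ∨ k 12 ≤ 2) ∧ (x = 2 → k 6 = 0 ∧ k 8 = 0 ∧ k 10 = 0 ∧ k 12 = 0) ∧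
      (x = 3 → k 11 = 0) ∧ (x = 4 → k 10 = 0 ∧ k 11 ≤ 1 ∧ k 12 = 0) ∧
      (x = 5 → k 10 ≤ 1 ∧ k 12 = 0) ∧ (x = 6 → k 12 = 0) := by
    subst hi
    interval_cases x
    · have := stage_two h hk.le
      omega
    · have := stage_four h hk.le
      omega
    · have := stage_six h hk.le
      omega
    · have := stage_eight h hk.le
      omega
    · have := stage_ten h hk.le
      omega
  obtain ⟨g1, g2, g3, g4, g5, g6, g7⟩ := key
  refine ⟨g1, g2, fun y hy hxy hb => ?_, fun s hs hb => ?_⟩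
  · have c : y = 3 ∧ 3 ≤ k 4 ∨ y = 4 ∧ 3 ≤ k 6 ∨ y = 5 ∧ 3 ≤ k 8 ∨ y = 6 ∧ 3 ≤ k 10 := by
      interval_cases y
      · omega
      · omega
      · omega
      · exact .inl ⟨rfl, of_decide_eq_true hb⟩
      · exact .inr (.inl ⟨rfl, of_decide_eq_true hb⟩)
      · exact .inr (.inr (.inl ⟨rfl, of_decide_eq_true hb⟩))
      · exact .inr (.inr (.inr ⟨rfl, of_decide_eq_true hb⟩))
    have d : x = 2 ∧ y = 3 ∨ x = 3 ∨ x = 4 ∧ y = 5 := by omega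
    interval_cases x <;> interval_cases y <;> first | decide | omega
  · have c : s = 0 ∧ 3 ≤ k 11 ∨ s = 1 ∧ 3 ≤ k 12 := by
      interval_cases s
      · exact .inl ⟨rfl, of_decide_eq_true hb⟩
      · exact .inr ⟨rfl, of_decide_eq_true hb⟩
    have d : s = 0 ∧ (x = 2 ∨ x = 5 ∨ x = 6) ∨ s = 1 ∧ x = 3 := by omega
    interval_cases x <;> interval_cases s <;> first | decide | omega

namespace ModelInv

variable {own₀ : Finset QName} {env₀ : List QName} {ψ : State} {α : Hist} {L : ModelLoc} {S : Store}

theorem tau_splitter (h : ModelInv own₀ env₀ ψ α L S) {p : Ports} {i x : ℕ} {c d e f : Chan}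
    {S' : Store} {X : Proc} (hT : ModelLoc.thread p L i = bsTh c d e f (reflectivity x)
      (L.nm (opticalPair x).1) (L.nm (opticalPair x).2)) (hi : i < 15) (hi' : 2 ≤ i ∧ i ≤ 10)
    (hx2 : 2 ≤ x) (hx : x < 7) (hthr : modelThr[x]? = some (i, 3)) (h3 : (i, 4) ∉ modelThr)
    (hb : 3 < ModelLoc.bound i)
    (hl : ∀ l ∈ modelLinks, (l.2.1 = i → l.2.2.1 ≠ 2 ∧ l.2.2.1 ≠ 3) ∧
      (l.2.2.2.1 = i → l.2.2.2.2 ≠ 2 ∧ l.2.2.2.2 ≠ 3))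
    (K : Tau S (L.thread p i (L.k i)) S' X) :
    ∃ L', L.ctx.fill (Function.update (fun i => L.thread p i (L.k i)) i X) = L'.proc p ∧
      ModelInv own₀ env₀ ψ α L' S' ∧ L'.rank < L.rank := by
  have hj : ∀ j < 15, j ≠ i → L.thread p j (L.k j) =
      ModelLoc.thread p { L with k := incr L.k i } j (incr L.k i j) := by
    intro j _ hj
    rw [incr_ne _ hj]
    rfl
  have h14 : incr L.k i 14 = L.k 14 := incr_ne _ (by omega)
  rw [hT] at K
  rcases bsTh_tau_iff.1 K with ⟨hk, -, rfl, rfl⟩ | ⟨hk, rfl, rfl⟩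
  · obtain ⟨g1, g2, g3, g4⟩ := stage_gate h.links hx2 hx hthr hk
    refine ⟨{ L with k := incr L.k i }, ModelLoc.fill_eq_proc h14 ?_ hj, h.gate hi hk hx hx2 hthr
      (by omega) (fun l hl' => ⟨fun e => ((hl l hl').1 e).1, fun e => ((hl l hl').2 e).1⟩) hi' g1 g2
      g3 g4 rfl⟩
    show _ = L.thread p i (incr L.k i i)
    rw [hT, incr_same, hk]
  · refine ⟨{ L with k := incr L.k i }, ModelLoc.fill_eq_proc h14 ?_ hj, h.skip hi hk h3 hb
      (fun l hl' => ⟨fun e => ((hl l hl').1 e).2, fun e => ((hl l hl').2 e).2⟩) hi' rfl⟩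
    show _ = L.thread p i (incr L.k i i)
    rw [hT, incr_same, hk]

theorem nm_ne (h : ModelInv own₀ env₀ ψ α L S) {s : ℕ} (hs : s < 2)
    (hk : 2 ≤ L.k (11 + s)) : L.nm (2 * s) ≠ L.nm (2 * s + 1) := by
  obtain ⟨rec, hq, -⟩ := h.quant
  have hf : flags modelThr L.k s = true := by
    interval_cases s
    · have hk : 2 ≤ L.k 11 := hk
      have g := of_eleven h.links hk
      have := two_lt_of_four h.links (by omega)
      simp [flags, modelThr]
      omega
    · have hk : 2 ≤ L.k 12 := hk
      have g := of_twelve h.links hk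
      have g' := of_ten h.links (by omega)
      have g'' := of_six h.links (by omega)
      have := two_lt_of_two h.links (by omega)
      simp [flags, modelThr]
      omega
  intro hc
  have := hq.names.inj _ _ (by interval_cases s <;> simp [ModelLoc.Created, hf])
    (by interval_cases s <;> simp [ModelLoc.Created, hf]) hc
  omega

theorem ctx_create (p : Ports) (hk : L.k 14 = 1) (hpre : ∀ i, 2 ≤ i → i ≤ 10 → L.k i = 0) (n : ℕ) :
    preCtx.fill (Function.update (fun i => L.thread p i (L.k i)) 14
      (network (mode (L.nm 4)) (mode n))) =
    ModelLoc.proc p { L with nm := Function.update L.nm 5 n, k := incr L.k 14 } := by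
  have e : ModelLoc.ctx { L with nm := Function.update L.nm 5 n, k := incr L.k 14 } = modelCtx := by
    refine if_neg ?_
    show ¬ incr L.k 14 14 < 2
    rw [incr_same]
    omega
  have g : ∀ i, 2 ≤ i → i ≤ 10 → incr L.k 14 i = 0 := fun i h1 h2 => by
    rw [incr_ne _ (by omega), hpre i h1 h2]
  rw [ModelLoc.proc, e]
  simp only [modelCtx, preCtx, outerCtx, Ctx.run, Ctx.fill, g 2 (by omega) (by omega),
    g 3 (by omega) (by omega), g 4 (by omega) (by omega), g 5 (by omega) (by omega),
    g 6 (by omega) (by omega), g 7 (by omega) (by omega), g 8 (by omega) (by omega),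
    g 9 (by omega) (by omega), g 10 (by omega) le_rfl]
  rfl

theorem tau (h : ModelInv own₀ env₀ ψ α L S) (hψ : IsState (own₀ ∪ env₀.toFinset) ψ) {p : Ports}
    {S' : Store} {P' : Proc} (H : Tau S (L.proc p) S' P') :
    ∃ L', P' = ModelLoc.proc p L' ∧ ModelInv own₀ env₀ ψ α L' S' ∧ L'.rank < L.rank := by
  rcases (h.wired p).tau_inv (by decide) H with ⟨i, X, hi, K, rfl⟩ | ⟨rfl, l, hl, c1, c2, h1, h2, rfl⟩
  · have hi15 := ModelLoc.lt_of_mem_holes hi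
    interval_cases i
    · obtain ⟨hk, m, n, -, hm, hn, hmn, rfl, rfl⟩ := polTh_tau_iff.1 K
      obtain ⟨g4, g6, g10, g11, g12, g13⟩ := stage_of_le_one h.links hk.le
      refine ⟨_, ?_, h.split_a hk hm hn hmn rfl⟩
      refine ModelLoc.fill_eq_proc rfl ?_ fun j hj hji => ?_
      · simp only [incr_same, hk]; rfl
      · interval_cases j <;> first
          | exact absurd rfl hji
          | rfl
          | exact bsTh_congr (.inl g4) (.inl (by omega))
          | exact bsTh_congr (.inr rfl) (.inl g6)
          | exact detTh_congr (.inl g11) (.inl (by omega)) (.inr rfl)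
    · obtain ⟨hk, m, n, -, hm, hn, hmn, rfl, rfl⟩ := polTh_tau_iff.1 K
      obtain ⟨g2, g6, g8, g10, g11, g12, g13⟩ := stage_of_le_one' h.links hk.le
      refine ⟨_, ?_, h.split_b hk hm hn hmn rfl⟩
      refine ModelLoc.fill_eq_proc rfl ?_ fun j hj hji => ?_
      · simp only [incr_same, hk]; rfl
      · interval_cases j <;> first
          | exact absurd rfl hji
          | rfl
          | exact bsTh_congr (.inl g2) (.inl (by omega))
          | exact bsTh_congr (.inl g6) (.inl (by omega))
          | exact bsTh_congr (.inl g8) (.inl (by omega))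
          | exact bsTh_congr (.inl g10) (.inl (by omega))
          | exact detTh_congr (.inl g12) (.inl (by omega)) (.inr rfl)
    · exact h.tau_splitter (x := 2) rfl (by decide) (by decide) (by decide) (by decide) rfl
        (by decide) (by decide) (by decide) K
    · exact absurd K not_tau_vacTh
    · exact h.tau_splitter (x := 3) rfl (by decide) (by decide) (by decide) (by decide) rfl
        (by decide) (by decide) (by decide) K
    · exact absurd K not_tau_dumpTh
    · exact h.tau_splitter (x := 4) rfl (by decide) (by decide) (by decide) (by decide) rfl
        (by decide) (by decide) (by decide) K
    · exact absurd K not_tau_vacTh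
    · exact h.tau_splitter (x := 5) rfl (by decide) (by decide) (by decide) (by decide) rfl
        (by decide) (by decide) (by decide) K
    · exact absurd K not_tau_dumpTh
    · exact h.tau_splitter (x := 6) rfl (by decide) (by decide) (by decide) (by decide) rfl
        (by decide) (by decide) (by decide) K
    · obtain ⟨hk, rfl, rfl⟩ := (detTh_tau fun hk => h.nm_ne (s := 0) (by omega) hk.ge).1 K
      have hk : L.k 11 = 2 := hk
      have g := stage_eleven h.links (by omega)
      refine ⟨_, ?_, h.detect hψ (s := 0) (by omega) hk (by omega) rfl⟩
      refine ModelLoc.fill_eq_proc rfl ?_ fun j hj hji => ?_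
      · simp only [Nat.add_zero, incr_same, hk]; rfl
      · interval_cases j <;> first
          | exact absurd rfl hji
          | rfl
          | exact countTh_congr (.inl g)
    · obtain ⟨hk, rfl, rfl⟩ := (detTh_tau fun hk => h.nm_ne (s := 1) (by omega) hk.ge).1 K
      have hk : L.k 12 = 2 := hk
      have g := stage_twelve h.links (by omega)
      refine ⟨_, ?_, h.detect hψ (s := 1) (by omega) hk (by omega) rfl⟩
      refine ModelLoc.fill_eq_proc rfl ?_ fun j hj hji => ?_
      · simp only [Nat.reduceAdd, incr_same, hk]; rfl
      · interval_cases j <;> first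
          | exact absurd rfl hji
          | rfl
          | exact countTh_congr ((Nat.le_one_iff_eq_zero_or_eq_one.1 g).imp_right fun h => ⟨rfl, h⟩)
    · obtain ⟨hk, hk', e', He, rfl⟩ := countTh_tau_iff.1 K
      refine ⟨_, ?_, h.eval hk hk' He rfl⟩
      refine ModelLoc.fill_eq_proc rfl ?_ fun j hj hji => ?_
      · rfl
      · interval_cases j <;> first
          | exact absurd rfl hji
          | rfl
    · obtain ⟨n, hn, rfl, hc⟩ := preTh_tau_iff.1 K
      have hk : L.k 14 < 2 := by omega
      have hpre := h.pre hk
      have hctx : L.ctx = preCtx := if_pos hk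
      rw [hctx]
      rcases hc with ⟨hk0, rfl⟩ | ⟨hk1, rfl⟩
      · have g := h.create hk hn (L' := { L with nm := Function.update L.nm 4 n, k := incr L.k 14 })
          (by rw [hk0])
        refine ⟨_, ?_, g⟩
        have e : ModelLoc.ctx { L with nm := Function.update L.nm 4 n, k := incr L.k 14 } =
            preCtx := by
          refine if_pos ?_
          show incr L.k 14 14 < 2
          rw [incr_same]
          omega
        rw [ModelLoc.proc, e]
        refine Ctx.fill_update_eq ?_ fun j hj hji => ?_
        · simp only [incr_same, hk0]; rfl
        · have hj' : j = 0 ∨ j = 1 ∨ j = 14 ∨ j = 11 ∨ j = 12 ∨ j = 13 :=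
            (by decide : ∀ j ∈ preCtx.holes, j = 0 ∨ j = 1 ∨ j = 14 ∨ j = 11 ∨ j = 12 ∨ j = 13) j hj
          obtain rfl | rfl | rfl | rfl | rfl | rfl := hj' <;> first
            | exact absurd rfl hji
            | rfl
      · have g := h.create hk hn (L' := { L with nm := Function.update L.nm 5 n, k := incr L.k 14 })
          (by rw [hk1])
        exact ⟨_, ctx_create p hk1 hpre n, g⟩
  · obtain ⟨g1, g2, g3⟩ := h.communicate hl c1 c2 h1 h2 rfl
    refine ⟨_, ?_, g2, g3⟩
    rw [ModelLoc.proc, g1]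
    rfl

theorem progress (h : ModelInv own₀ env₀ ψ α L S) (p : Ports) (ha : α.qa.isSome = true)
    (hb : α.qb.isSome = true) (hlt : α.outs.length < 3) :
    (∃ S' P', Tau S (L.proc p) S' P') ∨
      2 ≤ L.k 13 ∧ L.k 13 ≤ 4 ∧ ∃ v, L.expr (L.k 13) = .vals [v] := by
  have hlen := h.len
  have b := h.bound
  obtain ⟨rec, hq, hx⟩ := h.quant
  have k0 : 1 ≤ L.k 0 := by
    rw [hq.qa_eq] at ha
    by_contra hc
    have : flags modelThr L.k 11 = false := by simp [flags, modelThr]; omega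
    simp [this] at ha
  have k1 : 1 ≤ L.k 1 := by
    rw [hq.qb_eq] at hb
    by_contra hc
    have : flags modelThr L.k 12 = false := by simp [flags, modelThr]; omega
    simp [this] at hb
  have hqa : α.qa = some L.qa := by
    rw [hq.qa_eq, show flags modelThr L.k 11 = true by simp [flags, modelThr]; omega]; rfl
  have hqb : α.qb = some L.qb := by
    rw [hq.qb_eq, show flags modelThr L.k 12 = true by simp [flags, modelThr]; omega]; rfl
  obtain ⟨N, hN⟩ := S.exists_fresh
  by_contra hno
  push Not at hno
  obtain ⟨hno, hres⟩ := hno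
  have loc : ∀ i ∈ L.ctx.holes, ∀ S' X, ¬ Tau S (L.thread p i (L.k i)) S' X := fun i hi S' X H =>
    hno S' _ (Ctx.tau_fill (f := fun i => L.thread p i (L.k i)) (h.wired p).holes hi H)
  have outer : ∀ i ∈ [0, 1, 11, 12, 13], i ∈ L.ctx.holes :=
    L.ctx_cases (P := fun C => ∀ i ∈ [0, 1, 11, 12, 13], i ∈ C.holes) (by decide) (by decide)
  have c14 : L.k 14 = 2 := by
    by_contra hc
    have hk : L.k 14 < 2 := by have := b 14 (by omega); change _ ≤ 2 at this; omega
    have hctx : L.ctx = preCtx := if_pos hk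
    have n14 : ∀ S' X, ¬ Tau S (preTh (L.nm 4) (L.k 14)) S' X := loc 14 (by rw [hctx]; decide)
    obtain hk | hk : L.k 14 = 0 ∨ L.k 14 = 1 := by omega
    · exact n14 _ _ (preTh_tau_iff.2 ⟨N, (hN _ le_rfl).2, rfl, .inl ⟨hk, rfl⟩⟩)
    · exact n14 _ _ (preTh_tau_iff.2 ⟨N, (hN _ le_rfl).2, rfl, .inr ⟨hk, rfl⟩⟩)
  have hctx : L.ctx = modelCtx := if_neg (by omega)
  have c0 : L.k 0 ≠ 1 := fun c => loc 0 (outer _ (by decide)) _ _ (polTh_tau_iff.2 ⟨c, N, N + 1,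
      hq.names.own_a _ hqa (by simp [flags, modelThr]; omega), (hN _ (by omega)).2,
      (hN _ (by omega)).2, by omega, rfl, rfl⟩)
  have c1 : L.k 1 ≠ 1 := fun c => loc 1 (outer _ (by decide)) _ _ (polTh_tau_iff.2 ⟨c, N, N + 1,
      hq.names.own_b _ hqb (by simp [flags, modelThr]; omega), (hN _ (by omega)).2,
      (hN _ (by omega)).2, by omega, rfl, rfl⟩)
  have bs : ∀ i x, (∃ c d e f, ModelLoc.thread p L i = bsTh c d e f (reflectivity x)
      (L.nm (opticalPair x).1) (L.nm (opticalPair x).2)) → i ∈ modelCtx.holes → 2 ≤ x → x < 7 →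
      modelThr[x]? = some (i, 3) → L.k i ≠ 2 ∧ L.k i ≠ 3 := by
    rintro i x ⟨c, d, e, f, hT⟩ hi hx2 hx hthr
    have n : ∀ S' X, ¬ Tau S (L.thread p i (L.k i)) S' X := loc i (by rw [hctx]; exact hi)
    rw [hT] at n
    refine ⟨fun hk => n _ _ (bsTh_tau_iff.2 (.inl ⟨hk, ?_, rfl, rfl⟩)),
      fun hk => n _ _ (bsTh_tau_iff.2 (.inr ⟨hk, rfl, rfl⟩))⟩
    have hl : ∀ l ∈ modelLinks, (l.2.1 = i → l.2.2.1 ≠ 2) ∧ (l.2.2.2.1 = i → l.2.2.2.2 ≠ 2) := by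
      have hi : i = 2 * x - 2 := by interval_cases x <;> simp [modelThr] at hthr <;> omega
      subst hi
      interval_cases x <;> decide
    have hs := model_sound (h.links.step (i := i) (by rw [hk]; exact hl)) (fun hc => by
      have : L.k 14 ≤ incr L.k i 14 := by
        by_cases h14 : 14 = i
        · rw [h14, incr_same]
          omega
        · rw [incr_ne _ h14]
      omega) x hx
    rw [flags_incr (x := x) (by decide) hk hthr] at hs
    obtain ⟨s1, s2⟩ := hs (Function.update_self _ _ _)
    simp only [ModelLoc.Created, Function.update_of_ne (show 0 ≠ x by omega),
      Function.update_of_ne (show 1 ≠ x by omega), Function.update_of_ne (show 9 ≠ x by omega),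
      Function.update_of_ne (show 10 ≠ x by omega)] at s1 s2
    intro hc
    have := hq.names.inj _ _ s1 s2 hc
    interval_cases x <;> simp [opticalPair] at this
  have com : ∀ c i m j n, (c, i, m, j, n) ∈ modelLinks → m ≤ L.k i → n ≤ L.k j →
      m < L.k i ∧ n < L.k j := by
    intro c i m j n hl hm hn
    have hiff := h.links _ hl
    by_contra hc
    obtain ⟨S', P', H⟩ : ∃ S' P', Tau S (L.proc p) S' P' :=
      ⟨S, (h.wired p).tau_com hl
        (by rw [hctx]; exact (by decide : ∀ l ∈ modelLinks, l.2.1 ∈ modelCtx.holes) _ hl)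
        (by rw [hctx]; exact (by decide : ∀ l ∈ modelLinks, l.2.2.2.1 ∈ modelCtx.holes) _ hl)
        (by simp only at *; omega) (by simp only at *; omega)⟩
    exact hno _ _ H
  have c2 := bs 2 2 ⟨_, _, _, _, rfl⟩ (by decide) (by decide) (by decide) rfl
  have c4 := bs 4 3 ⟨_, _, _, _, rfl⟩ (by decide) (by decide) (by decide) rfl
  have c6 := bs 6 4 ⟨_, _, _, _, rfl⟩ (by decide) (by decide) (by decide) rfl
  have c8 := bs 8 5 ⟨_, _, _, _, rfl⟩ (by decide) (by decide) (by decide) rfl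
  have c10 := bs 10 6 ⟨_, _, _, _, rfl⟩ (by decide) (by decide) (by decide) rfl
  have c11 : L.k 11 ≠ 2 := fun c => loc 11 (outer _ (by decide)) _ _
    ((detTh_tau fun hk => h.nm_ne (s := 0) (by omega) hk.ge).2 ⟨c, rfl, rfl⟩)
  have c12 : L.k 12 ≠ 2 := fun c => loc 12 (outer _ (by decide)) _ _
    ((detTh_tau fun hk => h.nm_ne (s := 1) (by omega) hk.ge).2 ⟨c, rfl, rfl⟩)
  have l0 := com 0 0 2 4 0 (by decide) (by omega) (by omega)
  have l6 := com 6 3 0 4 1 (by decide) (by omega) (by omega)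
  have l8 := com 8 4 4 11 0 (by decide) (by omega) (by omega)
  have l2 := com 2 1 2 2 0 (by decide) (by omega) (by omega)
  have l3 := com 3 1 3 2 1 (by decide) (by omega) (by omega)
  have l4 := com 4 2 4 6 0 (by decide) (by omega) (by omega)
  have l5 := com 5 2 5 8 0 (by decide) (by omega) (by omega)
  have l11 := com 11 7 0 8 1 (by decide) (by omega) (by omega)
  have l1 := com 1 0 3 6 1 (by decide) (by omega) (by omega)
  have l10 := com 10 6 4 10 0 (by decide) (by omega) (by omega)
  have l9 := com 9 6 5 11 1 (by decide) (by omega) (by omega)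
  have l12 := com 12 8 4 10 1 (by decide) (by omega) (by omega)
  have l14 := com 14 10 4 12 0 (by decide) (by omega) (by omega)
  have l15 := com 15 10 5 12 1 (by decide) (by omega) (by omega)
  have l16 := com 16 11 3 13 0 (by decide) (by omega) (by omega)
  have l17 := com 17 12 3 13 1 (by decide) (by omega) (by omega)
  rcases (hx (by omega) (by omega)).1.progress with ⟨v, hv, -⟩ | hv
  · exact hres (by omega) (by omega) v hv
  · obtain ⟨S', e', He⟩ := hv (fun _ => true) S
    exact loc 13 (outer _ (by decide)) _ _ (countTh_tau_iff.2 ⟨by omega, by omega, e', He, rfl⟩)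

end ModelInv

/-- The configurations that the model reaches with a history. -/
def ModelGood (p : Ports) (own₀ : Finset QName) (env₀ : List QName) (ψ : State) (t : Config)
    (α : Hist) : Prop :=
  ∃ L S, t = .mix S (ModelLoc.proc p L) ∧ ModelInv own₀ env₀ ψ α L S

namespace ModelInv

variable {own₀ : Finset QName} {env₀ : List QName} {ψ : State} {α : Hist} {L : ModelLoc} {S : Store}

theorem qa_eq_none_iff (h : ModelInv own₀ env₀ ψ α L S) : α.qa = none ↔ L.k 0 = 0 := by
  obtain ⟨rec, hq, -⟩ := h.quant
  rw [hq.qa_eq, show flags modelThr L.k 11 = decide (1 ≤ L.k 0) from rfl]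
  simp

theorem qb_eq_none_iff (h : ModelInv own₀ env₀ ψ α L S) : α.qb = none ↔ L.k 1 = 0 := by
  obtain ⟨rec, hq, -⟩ := h.quant
  rw [hq.qb_eq, show flags modelThr L.k 12 = decide (1 ≤ L.k 1) from rfl]
  simp

theorem env_eq (h : ModelInv own₀ env₀ ψ α L S) : S.env = α.env env₀ := by
  obtain ⟨rec, hq, -⟩ := h.quant
  exact hq.names.env_eq

theorem receive_a (h : ModelInv own₀ env₀ ψ α L S) (hk : L.k 0 = 0) {n : ℕ} (hn : .qb n ∈ S.env)
    {L' : ModelLoc} (hL : L' = { L with qa := n, k := incr L.k 0 }) :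
    ModelInv own₀ env₀ ψ { α with qa := some n } L' (S.receive [.qb n]) := by
  subst hL
  have g := stage_of_le_one h.links (by omega)
  refine (h.step (α' := { α with qa := some n }) (L' := { L with qa := n, k := incr L.k 0 }) (i := 0) (by omega) hk (by omega) rfl rfl (by decide) (by decide)
    (fun _ => .inl (by omega)) rfl fun hp rec hq _ => ⟨rec, ?_, fun h2 => by omega⟩).1
  show ModelQuant _ _ _ _ _ (flags modelThr (incr L.k 0)) _ _
  rw [flags_incr (x := 11) (by decide) hk rfl]
  exact (hq.receive_a (by simp [flags, modelThr]; omega) (by simp [flags, modelThr]; omega)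
    hn).with_counters _ _

theorem receive_b (h : ModelInv own₀ env₀ ψ α L S) (hk : L.k 1 = 0) {n : ℕ} (hn : .qb n ∈ S.env)
    {L' : ModelLoc} (hL : L' = { L with qb := n, k := incr L.k 1 }) :
    ModelInv own₀ env₀ ψ { α with qb := some n } L' (S.receive [.qb n]) := by
  subst hL
  have g := stage_of_le_one' h.links (by omega)
  refine (h.step (α' := { α with qb := some n }) (L' := { L with qb := n, k := incr L.k 1 }) (i := 1) (by omega) hk (by omega) rfl rfl (by decide) (by decide)
    (fun _ => .inl (by omega)) rfl fun hp rec hq _ => ⟨rec, ?_, fun h2 => by omega⟩).1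
  show ModelQuant _ _ _ _ _ (flags modelThr (incr L.k 1)) _ _
  rw [flags_incr (x := 12) (by decide) hk rfl]
  exact (hq.receive_b (by simp [flags, modelThr]; omega) (by simp [flags, modelThr]; omega)
    hn).with_counters _ _

theorem fill_receive_a (p : Ports) (hk : L.k 0 = 0) (n : ℕ) :
    L.ctx.fill (Function.update (fun i => L.thread p i (L.k i)) 0
      (polTh (.pub p.a) ch.c ch.d n (L.nm 0) (L.nm 1) 1)) =
      ModelLoc.proc p { L with qa := n, k := incr L.k 0 } := by
  refine ModelLoc.fill_eq_proc rfl ?_ fun j hj hji => ?_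
  · simp only [incr_same, hk]
    rfl
  · interval_cases j <;> first
      | exact absurd rfl hji
      | rfl

theorem fill_receive_b (p : Ports) (hk : L.k 1 = 0) (n : ℕ) :
    L.ctx.fill (Function.update (fun i => L.thread p i (L.k i)) 1
      (polTh (.pub p.b) ch.e ch.f n (L.nm 2) (L.nm 3) 1)) =
      ModelLoc.proc p { L with qb := n, k := incr L.k 1 } := by
  refine ModelLoc.fill_eq_proc rfl ?_ fun j hj hji => ?_
  · simp only [incr_same, hk]
    rfl
  · interval_cases j <;> first
      | exact absurd rfl hji
      | rfl

theorem output (h : ModelInv own₀ env₀ ψ α L S) (hψ : IsState (own₀ ∪ env₀.toFinset) ψ)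
    (hk : 2 ≤ L.k 13) (hk' : L.k 13 ≤ 4) {vs : List Val} (he : L.expr (L.k 13) = .vals vs) :
    S.outProb vs = α.nextProb ψ ∧ ∀ w, 0 < α.nextProb ψ w →
      (S.outBranch vs w).rhoE = α.nextRho env₀ ψ w ∧
      ModelInv own₀ env₀ ψ (α.next ψ w) { L with e := none, k := incr L.k 13 }
        (S.outBranch vs w) := by
  have hlen := h.len
  have hft := h.flags_true hk
  obtain ⟨rec, hq, hx⟩ := h.quant
  have hx := hx hk hk'
  rw [he, ← hlen] at hx
  obtain ⟨v, rfl, hv, hval⟩ := ModelQuant.modelExpr_vals hx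
  obtain ⟨g1, g2⟩ := hq.out hψ h.sound hft (by omega) hv hval
  refine ⟨g1, fun w hw => ⟨(g2 w hw).1, ?_⟩⟩
  have hq' := (g2 w hw).2
  refine ⟨h.links.step ?_, ModelLoc.incr_le_bound h.bound (by change L.k 13 < 5; omega), ?_, ?_,
    fun _ => rfl, by simp, rec, ?_, fun h5 h7 => ?_⟩
  · have : ∀ n, 2 ≤ n → n ≤ 4 → ∀ l ∈ modelLinks,
        (l.2.1 = 13 → l.2.2.1 ≠ n) ∧ (l.2.2.2.1 = 13 → l.2.2.2.2 ≠ n) := by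
      intro n h1 h2
      interval_cases n <;> decide
    exact this _ hk hk'
  · intro hc i hi hi'
    show incr L.k 13 i = 0
    rw [incr_ne _ (by omega)]
    exact h.pre hc i hi hi'
  · show (α.outs ++ [w]).length = L.k 13 + 1 - 2
    rw [List.length_append, hlen, List.length_singleton]
    omega
  · show ModelQuant _ _ _ _ _ (flags modelThr (incr L.k 13)) _ _
    rw [flags_incr_of_notMem rfl ?_]
    · exact hq'.with_counters _ _
    · intro hc
      simp [modelThr] at hc
  · exact hq'.modelExpr_count (j := L.k 13 + 1 - 2) (hft 7 (by omega)) (hft 8 (by omega)) (by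
      change L.k 13 + 1 ≤ 4 at h7
      omega)

end ModelInv

theorem ModelLoc.vis_pub (L : ModelLoc) {i : ℕ} (hi : i ∈ [0, 1, 13]) (n : ℕ) :
    i ∈ L.ctx.holes ∧ L.ctx.vis i (.pub n) = true := by
  refine L.ctx_cases (P := fun C => i ∈ C.holes ∧ C.vis i (.pub n) = true) ?_ ?_
  all_goals
    simp only [List.mem_cons, List.not_mem_nil, or_false] at hi
    obtain rfl | rfl | rfl := hi
    all_goals simp [preCtx, modelCtx, outerCtx, Ctx.vis, Ctx.holes]

theorem ModelLoc.pIn_pub {p : Ports} {L : ModelLoc} {i q : ℕ} {vs X} (hi : i < 15)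
    (H : PIn (L.thread p i (L.k i)) (.pub q) vs X) : i = 0 ∨ i = 1 := by
  interval_cases i <;> first
    | exact .inl rfl
    | exact .inr rfl
    | exact absurd H not_pIn_vacTh
    | exact absurd H not_pIn_preTh
    | cases (dumpTh_in H).2.1
    | exact (bsTh_in H).elim (fun h => nomatch h.2.1) fun h => nomatch h.2.1
    | exact (detTh_in H).elim (fun h => nomatch h.2.1) fun h => nomatch h.2.1
    | exact (countTh_in H).elim (fun h => nomatch h.2.1) fun h => nomatch h.2.1

theorem ModelLoc.pOut_pub {p : Ports} {L : ModelLoc} {i q : ℕ} {vs X} (hi : i < 15)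
    (H : POut (L.thread p i (L.k i)) (.pub q) vs X) : i = 13 := by
  interval_cases i <;> first
    | rfl
    | exact absurd H not_pOut_dumpTh
    | exact absurd H not_pOut_preTh
    | cases (vacTh_out_iff.1 H).2.1
    | cases (detTh_out_iff.1 H).2.1
    | exact (bsTh_out_iff.1 H).elim (fun h => nomatch h.2.1) fun h => nomatch h.2.1
    | exact (polTh_out_iff.1 H).elim (fun h => nomatch h.2.1) fun h => nomatch h.2.1

theorem model_behaves (p : Ports) {own₀ : Finset QName} {env₀ : List QName} {ψ : State}
    (hψ : IsState (own₀ ∪ env₀.toFinset) ψ) :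
    Behaves env₀ ψ p.a p.b p.result (ModelGood p own₀ env₀ ψ) where
  mix := by
    rintro t α ⟨L, S, rfl, -⟩
    exact ⟨_, _, rfl⟩
  tau := by
    rintro t α t' ⟨L, S, rfl, h⟩ H
    cases H with
    | tau H =>
      obtain ⟨L', rfl, h', -⟩ := h.tau hψ H
      exact ⟨L', _, rfl, h'⟩
  inp := by
    rintro t α c vs t' ⟨L, S, rfl, h⟩ H
    cases H with
    | inp H h1 h2 h3 =>
      obtain ⟨i, X, q, hi, hc, K, rfl⟩ := (h.wired p).pIn_inv H
      subst hc
      obtain rfl | rfl := ModelLoc.pIn_pub (ModelLoc.lt_of_mem_holes hi) K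
      · obtain ⟨hk, hc, n, rfl, rfl⟩ := polTh_in_iff.1 K
        have hn : .qb n ∈ S.env := h3 _ (by simp [namesOf])
        refine ⟨n, rfl, h.env_eq ▸ hn, .inl ⟨hc, h.qa_eq_none_iff.2 hk, _, _, ?_,
          h.receive_a hk hn rfl⟩⟩
        rw [← ModelInv.fill_receive_a p hk]
        rfl
      · obtain ⟨hk, hc, n, rfl, rfl⟩ := polTh_in_iff.1 K
        have hn : .qb n ∈ S.env := h3 _ (by simp [namesOf])
        refine ⟨n, rfl, h.env_eq ▸ hn, .inr ⟨hc, h.qb_eq_none_iff.2 hk, _, _, ?_,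
          h.receive_b hk hn rfl⟩⟩
        rw [← ModelInv.fill_receive_b p hk]
        rfl
  receive_a := by
    rintro t α n ⟨L, S, rfl, h⟩ h1 h2
    have hk := h.qa_eq_none_iff.1 h1
    have hn : .qb n ∈ S.env := by rw [h.env_eq]; exact h2
    refine ⟨_, .inp (Ctx.pIn_fill (h.wired p).holes (L.vis_pub (i := 0) (by decide) _).2
      (f := fun i => L.thread p i (L.k i)) (i := 0) (polTh_in_iff.2 ⟨hk, rfl, n, rfl, rfl⟩))
      (by simp [Val.IsClosed]) (by simp [namesOf]) (by simpa [namesOf] using hn),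
      _, _, ?_, h.receive_a hk hn rfl⟩
    rw [← ModelInv.fill_receive_a p hk]
    rfl
  receive_b := by
    rintro t α n ⟨L, S, rfl, h⟩ h1 h2
    have hk := h.qb_eq_none_iff.1 h1
    have hn : .qb n ∈ S.env := by rw [h.env_eq]; exact h2
    refine ⟨_, .inp (Ctx.pIn_fill (h.wired p).holes (L.vis_pub (i := 1) (by decide) _).2
      (f := fun i => L.thread p i (L.k i)) (i := 1) (polTh_in_iff.2 ⟨hk, rfl, n, rfl, rfl⟩))
      (by simp [Val.IsClosed]) (by simp [namesOf]) (by simpa [namesOf] using hn),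
      _, _, ?_, h.receive_b hk hn rfl⟩
    rw [← ModelInv.fill_receive_b p hk]
    rfl
  out := by
    rintro t α c V X q S' P' ⟨L, S, rfl, h⟩ H
    cases H with
    | out H h1 h2 =>
      obtain ⟨i, X, q, hi, hc, K, rfl⟩ := (h.wired p).pOut_inv H
      subst hc
      obtain rfl := ModelLoc.pOut_pub (ModelLoc.lt_of_mem_holes hi) K
      obtain ⟨hk, hk', hc, he, rfl⟩ := countTh_out_iff.1 K
      change 2 ≤ L.k 13 at hk
      change L.k 13 ≤ 4 at hk'
      obtain ⟨g1, g2⟩ := h.output hψ hk hk' he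
      obtain ⟨o1, o2⟩ := of_thirteen h.links hk
      have hlen := h.len
      have s0 : 1 < L.k 0 := by
        by_contra hc
        have := (stage_of_le_one h.links (by omega)).2.2.2.1
        omega
      have s1 : 1 < L.k 1 := by
        by_contra hc
        have := (stage_of_le_one' h.links (by omega)).2.2.2.2.2.1
        omega
      refine ⟨?_, ?_, by omega, ?_, g1, by rw [g1], fun w hw => ?_⟩
      · rw [Option.isSome_iff_ne_none, ne_eq, h.qa_eq_none_iff]
        omega
      · rw [Option.isSome_iff_ne_none, ne_eq, h.qb_eq_none_iff]
        omega
      · rw [hc, hlen]; rfl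
      · rw [g1] at hw
        refine ⟨(g2 w hw).1, _, _, ?_, (g2 w hw).2⟩
        congr 1
        refine ModelLoc.fill_eq_proc rfl ?_ fun j hj hji => ?_
        · simp only [incr_same]
          rfl
        · interval_cases j <;> first
            | exact absurd rfl hji
            | rfl
  send := by
    rintro t α ⟨L, S, rfl, h⟩ ha hb hlt
    induction hr : L.rank using Nat.strong_induction_on generalizing L S with
    | _ r ih =>
      rcases h.progress p ha hb hlt with ⟨S', P', H⟩ | ⟨hk, hk', v, hv⟩
      · obtain ⟨L', rfl, h', hlt'⟩ := h.tau hψ H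
        obtain ⟨t', c, V, X, q, S'', P'', hw, H'⟩ := ih L'.rank (hr ▸ hlt') L' S' h' rfl
        exact ⟨t', c, V, X, q, S'', P'', .head (.tau H) hw, H'⟩
      · obtain ⟨rec, hq, hx⟩ := h.quant
        have hx := hx hk hk'
        rw [hv] at hx
        obtain ⟨v', hv', hc, -⟩ := ModelQuant.modelExpr_vals hx
        obtain rfl : v = v' := by simpa using hv'
        refine ⟨_, _, _, _, _, _, _, .refl, .out (Ctx.pOut_fill (h.wired p).holes
          (f := fun i => L.thread p i (L.k i)) (i := 13) (c := p.result (L.k 13 - 2)) ?_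
          (countTh_out_iff.2 ⟨hk, hk', rfl, hv, rfl⟩)) ?_ ?_⟩
        · obtain c | c | c : L.k 13 - 2 = 0 ∨ L.k 13 - 2 = 1 ∨ L.k 13 - 2 = 2 := by omega
          all_goals rw [c]; exact (L.vis_pub (by decide) _).2
        · rw [classical_namesOf hc]; exact List.nodup_nil
        · rw [classical_namesOf hc]; simp

theorem model_initial (a b o₁ c o₂ : ℕ) (own₀ : Finset QName) (env₀ : List QName) (ψ : State)
    (κ : ℕ → ℕ) (θ : ℕ → Val) :
    ModelGood ⟨κ a, κ b, κ o₁, κ c, κ o₂⟩ own₀ env₀ ψ (.mix (.pure own₀ env₀ ψ)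
      (((Model₁ (.pub a) (.pub b) (.pub o₁) (.pub c) (.pub o₂)).rename κ).subst θ))
      ⟨none, none, [], 1⟩ := by
  refine ⟨⟨fun _ => 0, 0, 0, fun _ => 0, none, fun _ => 0⟩, .pure own₀ env₀ ψ, ?_, ?_⟩
  · rfl
  · refine ⟨by simp [Links, modelLinks], by simp, by simp, rfl, fun _ => rfl, by simp,
      fun _ => [], ?_, by simp⟩
    show ModelQuant _ _ _ _ _ (flags modelThr fun _ => 0) _ _
    rw [flags_zero (by decide)]
    exact {
      names := Names.pure own₀ env₀ ψ _ (by simp [ModelLoc.Created])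
      qa_eq := rfl
      qb_eq := rfl
      pos := one_pos
      prob_nil := fun _ => rfl
      rep := by
        rw [observed_of_nil rfl rfl]
        exact Store.rep_pure _ _ _
      normed := by simp
      rec_congr := fun _ _ _ => rfl
      slot := by simp }

end CQP

theorem mainTheorem3 (a b out₁ cnt out₂ : ℕ) :
    CQP.FullBisimilar
      (CQP.Model₁ (.pub a) (.pub b) (.pub out₁) (.pub cnt) (.pub out₂))
      (CQP.Specification₁ (.pub a) (.pub b) (.pub out₁) (.pub cnt) (.pub out₂)) := by
  intro κ θ hθ own env ψ hn he hψ
  exact ((CQP.model_behaves _ hψ).or (CQP.spec_behaves _ hψ)).bisimilar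
    (.inl (CQP.model_initial a b out₁ cnt out₂ _ _ _ κ θ))
    (.inr (CQP.spec_initial a b out₁ cnt out₂ _ _ _ κ θ))
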